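/- A homeomorphism $\psi$ of a surface $S$ is called pseudo-Anosov if it preserves a pair $(\mathcal F^s,\mu^s)$, $(\mathcal F^u,\mu^u)$ of transverse singular measured foliations (with finitely many singularities, each a $k$-prong singularity of both foliations for some $k\ge 3$) and there is $\lambda>1$ such that $\mu^s(\psi(\alpha))=\lambda^{-1}\mu^s(\alpha)$ for every arc $\alpha$ transverse to $\mathcal F^s$ and $\mu^u(\psi(\beta))=\lambda\mu^u(\beta)$ for every arc $\beta$ transverse to $\mathcal F^u$. A compressible pseudo-Anosov surface in a 3-manifold $M$ is a two-sided surface $\Sigma\subseteq M$ whose inclusion is not injective on fundamental groups, such that some homeomorphism $f\colon M\to M$ satisfies $f(\Sigma)=\Sigma$ and restricts to a pseudo-Anosov map of $\Sigma$. (1) Let $\Sigma\subset S^3=\mathbb R^3\cup\{\infty\}$ be the standard genus-2 Heegaard surface, that is, the frontier of the standard genus-2 handlebody $P\times[0,1]\subset\mathbb R^3$, where $P$ is the planar rectangle $[0,5]\times[0,3]$ with the two open squares $(1,2)\times(1,2)$ and $(3,4)\times(1,2)$ removed. Then $\Sigma$ is a closed orientable surface of genus 2 and is a compressible pseudo-Anosov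 surface in $S^3$; moreover, the homeomorphism $f$ of $S^3$ with $f(\Sigma)=\Sigma$ and $f|_\Sigma$ pseudo-Anosov can be chosen to be the identity on a round closed ball of positive radius disjoint from $\Sigma$. (2) Every non-empty 3-manifold (Hausdorff; compact or not, orientable or not, with or without boundary) contains a compressible pseudo-Anosov surface that is a closed orientable surface of genus 2. -/

import Mathlib

open scoped Manifold Topology

/-! ### Singular transverse measured foliations and pseudo-Anosov homeomorphisms -/

/-- A pair `(𝓕ˢ, μˢ)`, `(𝓕ᵘ, μᵘ)` of transverse singular measured foliations on a surface `S`.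

Away from the finite singular set it is given by charts `(x, y)`, in which the leaves of `𝓕ˢ` are
the curves `y = const` with transverse measure `|dy|`, and the leaves of `𝓕ᵘ` are the curves
`x = const` with transverse measure `|dx|`.  So a change of charts is locally of the form
`(x, y) ↦ (± x + a, ± y + b)`.

At a singular point both foliations have a `k`-prong singularity, `k ≥ 3`: there is a
complex coordinate `z` centred at the point in which they are the standard ones, that is, the
charts are locally the branches of `z ^ (k / 2) = x + i y`, up to signs and translations. -/
structure TransverseMeasuredFoliations (S : Type*) [TopologicalSpace S] where
  /-- the singular points -/
  sing : Set S
  finite_sing : sing.Finite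
  /-- the charts `(x, y)` -/
  charts : Set (OpenPartialHomeomorph S (ℝ × ℝ))
  iUnion_source : ⋃ φ ∈ charts, φ.source = singᶜ
  compat : ∀ φ ∈ charts, ∀ φ' ∈ charts, ∀ p ∈ φ.source ∩ φ'.source,
    ∃ ε δ a b : ℝ, (ε = 1 ∨ ε = -1) ∧ (δ = 1 ∨ δ = -1) ∧
      ∀ᶠ q in 𝓝 p, φ' q = (ε * (φ q).1 + a, δ * (φ q).2 + b)
  prong : ∀ p ∈ sing, ∃ k : ℕ, 3 ≤ k ∧ ∃ z : OpenPartialHomeomorph S ℂ,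
    p ∈ z.source ∧ z p = 0 ∧
    ∀ φ ∈ charts, ∀ q ∈ φ.source ∩ z.source,
      ∃ ε δ a b : ℝ, (ε = 1 ∨ ε = -1) ∧ (δ = 1 ∨ δ = -1) ∧
        ∀ᶠ w in 𝓝 q, (⟨ε * (φ w).1 + a, δ * (φ w).2 + b⟩ : ℂ) ^ 2 = z w ^ k

namespace TransverseMeasuredFoliations

variable {S : Type*} [TopologicalSpace S]

/- Below, `π` selects one of the two foliations through its transverse coordinate:
`π = Prod.snd` (the coordinate `y`) for `𝓕ˢ`, and `π = Prod.fst` (the coordinate `x`) for `𝓕ᵘ`. -/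

/-- The regular points `p` and `q` lie on the same leaf: they are joined by a path of regular
points along which the transverse coordinate is locally constant. -/
def SameLeaf (F : TransverseMeasuredFoliations S) (π : ℝ × ℝ → ℝ) (p q : S) : Prop :=
  ∃ γ : Path p q, (∀ t, γ t ∉ F.sing) ∧
    ∀ t, ∀ φ ∈ F.charts, γ t ∈ φ.source → ∀ᶠ s in 𝓝 t, π (φ (γ s)) = π (φ (γ t))

/-- `γ` is an arc of regular points transverse to the foliation: it crosses the leaves strictly
monotonically, i.e. the transverse coordinate along it is locally injective. -/
def IsTransverseArc (F : TransverseMeasuredFoliations S) (π : ℝ × ℝ → ℝ)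
    (γ : C(unitInterval, S)) : Prop :=
  Function.Injective γ ∧ (∀ t, γ t ∉ F.sing) ∧
    ∀ t, ∀ φ ∈ F.charts, γ t ∈ φ.source → ∃ U ∈ 𝓝 t, Set.InjOn (fun s => π (φ (γ s))) U

/-- `γ` is a transverse arc of transverse measure `m`.  The transverse coordinates along the arc,
which are only defined locally and up to sign and an additive constant, are put together to
one function `g` on the arc; then `m = |g 1 - g 0|`. -/
def HasTransverseMeasure (F : TransverseMeasuredFoliations S) (π : ℝ × ℝ → ℝ)
    (γ : C(unitInterval, S)) (m : ℝ) : Prop :=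
  F.IsTransverseArc π γ ∧ ∃ g : unitInterval → ℝ, Continuous g ∧
    (∀ t, ∀ φ ∈ F.charts, γ t ∈ φ.source → ∃ ε c : ℝ, (ε = 1 ∨ ε = -1) ∧
      ∀ᶠ s in 𝓝 t, π (φ (γ s)) = ε * g s + c) ∧
    m = |g 1 - g 0|

/-- `ψ` maps singular points to singular points and leaves onto leaves. -/
def IsPreservedBy (F : TransverseMeasuredFoliations S) (π : ℝ × ℝ → ℝ) (ψ : S ≃ₜ S) : Prop :=
  ψ '' F.sing = F.sing ∧
    ∀ p ∉ F.sing, ∀ q ∉ F.sing, F.SameLeaf π (ψ p) (ψ q) ↔ F.SameLeaf π p q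

end TransverseMeasuredFoliations

/-- `ψ` preserves a pair of transverse singular measured foliations, multiplying the
measure of arcs transverse to `𝓕ˢ` by `l⁻¹` and that of arcs transverse to `𝓕ᵘ` by `l`, for
some `l > 1`. -/
def IsPseudoAnosov {S : Type*} [TopologicalSpace S] (ψ : S ≃ₜ S) : Prop :=
  ∃ (F : TransverseMeasuredFoliations S) (l : ℝ), 1 < l ∧
    F.IsPreservedBy Prod.snd ψ ∧ F.IsPreservedBy Prod.fst ψ ∧
    (∀ (α : C(unitInterval, S)) (m : ℝ), F.HasTransverseMeasure Prod.snd α m →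
      F.HasTransverseMeasure Prod.snd ((ψ : C(S, S)).comp α) (l⁻¹ * m)) ∧
    (∀ (β : C(unitInterval, S)) (m : ℝ), F.HasTransverseMeasure Prod.fst β m →
      F.HasTransverseMeasure Prod.fst ((ψ : C(S, S)).comp β) (l * m))

/-! ### The standard genus 2 surface -/

/-- The standard genus 2 handlebody in `ℝ³`: the product of the unit interval with the rectangle
`[0,5] × [0,3]` from which two disjoint open square holes are removed. -/
def stdGenusTwoHandlebody : Set (EuclideanSpace ℝ (Fin 3)) :=
  {x | x 0 ∈ Set.Icc 0 5 ∧ x 1 ∈ Set.Icc 0 3 ∧ x 2 ∈ Set.Icc 0 1 ∧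
    ¬ (x 0 ∈ Set.Ioo 1 2 ∧ x 1 ∈ Set.Ioo 1 2) ∧ ¬ (x 0 ∈ Set.Ioo 3 4 ∧ x 1 ∈ Set.Ioo 1 2)}

/-- The standard genus 2 surface in `ℝ³`. -/
def stdGenusTwoSurface : Set (EuclideanSpace ℝ (Fin 3)) :=
  frontier stdGenusTwoHandlebody

/-- The unit sphere in `ℝ⁴`. -/
abbrev ThreeSphere : Type :=
  Metric.sphere (0 : EuclideanSpace ℝ (Fin 4)) 1

/-- The standard genus 2 Heegaard surface of `S³`: the points of `S³` other than the
pole `(0, 0, 0, 1)` whose stereographic projection from that pole lies on the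
standard genus 2 surface of `ℝ³`. -/
def stdGenusTwoHeegaardSurface : Set ThreeSphere :=
  {p | p.1 3 ≠ 1 ∧
    (!₂[p.1 0 / (1 - p.1 3), p.1 1 / (1 - p.1 3), p.1 2 / (1 - p.1 3)] :
      EuclideanSpace ℝ (Fin 3)) ∈ stdGenusTwoSurface}

/-- `S` is a closed orientable surface of genus 2. -/
def IsGenusTwoSurface (S : Type*) [TopologicalSpace S] : Prop :=
  Nonempty (S ≃ₜ stdGenusTwoSurface)

/-! ### Surfaces in 3-manifolds -/

section Surfaces

variable {M : Type*} [TopologicalSpace M]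

/-- The surface `Sg ⊆ M` is two-sided: it has an open neighbourhood that is a product
`Sg × ℝ` in which `Sg` is the slice `Sg × {0}`. -/
def IsTwoSided (Sg : Set M) : Prop :=
  ∃ c : Sg × ℝ → M, Topology.IsOpenEmbedding c ∧ ∀ x : Sg, c (x, 0) = x

/-- The inclusion of `Sg` in `M` is injective on fundamental groups. -/
def IsPiOneInjective (Sg : Set M) : Prop :=
  ∀ x : Sg, Function.Injective
    (FundamentalGroup.map (⟨Subtype.val, continuous_subtype_val⟩ : C(Sg, M)) x)

/-- `f` maps `Sg` onto itself and restricts to a pseudo-Anosov map of `Sg`. -/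
def RestrictsToPseudoAnosov (f : M ≃ₜ M) (Sg : Set M) : Prop :=
  f '' Sg = Sg ∧ ∃ ψ : Sg ≃ₜ Sg, (∀ x : Sg, (ψ x : M) = f x) ∧ IsPseudoAnosov ψ

/-- `Sg` is a compressible pseudo-Anosov surface in `M`, as shown by the homeomorphism `f`. -/
def IsCompressiblePseudoAnosovVia (f : M ≃ₜ M) (Sg : Set M) : Prop :=
  IsTwoSided Sg ∧ ¬ IsPiOneInjective Sg ∧ RestrictsToPseudoAnosov f Sg

end Surfaces

/-! The surface is obtained as a double branched cover of a flat sphere, and its pseudo-Anosov map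
as the lift of a hyperbolic matrix that extends over all of `ℝ³`.

The sphere is the boundary of the octahedron `norm1 ≤ 1`. The map `dev` identifies it with the
quotient of the plane by the group generated by `-1` and the lattice of the `(2a, 2b)` with `a + b`
even. The integer points lie over the six vertices. Those with even coordinate sum give the four
cone points of angle `π`, namely `(0, ±1, 0)` and `(0, 0, ±1)`, while `(±1, 0, 0)` are regular. In
the double cover branched over all six vertices, which has genus 2, the cone points become regular
and `(±1, 0, 0)` get angle `4π`: they become 4-prong singularities of every linear foliation.

The shear `(x, y) ↦ (x + 4y, y)` descends to the sphere and extends to the octahedron and to its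
exterior as `twist`, which is the identity far away. The antipodal map lifts to `(x, y) ↦ (y + 2,
x)`, so conjugation by it gives a shear in the other direction. The composite `quotHomeo` acts by
the matrix with rows `(17, 4)` and `(4, 1)`, whose eigenvalues are `9 ± 4√5`. A polygonal line
`axisPt` passes through the six vertices, is symmetric under `v ↦ -v`, and runs only through points
fixed by the twist; hence `quotHomeo` fixes it pointwise. The line is a graph over the linear
function `height`, so `straighten` turns it into the axis of `ℝ × ℂ`. The covering `(t, z) ↦ (t,
z²)` is then the double cover branched along the line, and `exists_lift_of_compactSupport` lifts the
homeomorphism with compact support. The charts of the foliations are local lifts along `dev`,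
composed with the eigencoordinates `diagonalize`; the lift is affine in them.

That this cover is standardly embedded is shown slice by slice (`exists_homeomorph_standard`). Each
slice `height = t` of the octahedron becomes a disc with centre `ρ(t) ≥ 0` and radius `R(t)`, the
line being at `0`; its double cover is `|w² - ρ(t)| ≤ R(t)`. The standard handlebody, a thickened
rectangle with two holes, is brought to the same form.

For compressibility, a loop around a hole has winding number one about the vertical line through
that hole, so it is essential in the surface, but it is null-homotopic in `ℝ³`. As all supports are
compact, the whole picture is carried along any open embedding of `ℝ³`: inverse stereographic
projection for `S³`, a ball in the interior of a chart for other manifolds. -/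

namespace GenusTwo

/-! ### A criterion for being pseudo-Anosov -/

namespace Foliation

variable {S : Type*} [TopologicalSpace S]

/-- In the charts of `F`, the map `ψ` is affine with linear part `κ` up to sign,
for the transverse coordinate `π`. -/
def ScalesBy (F : TransverseMeasuredFoliations S) (π : ℝ × ℝ → ℝ) (ψ : S ≃ₜ S) (κ : ℝ) : Prop :=
  ∀ φ ∈ F.charts, ∀ φ' ∈ F.charts, ∀ q ∈ φ.source, ψ q ∈ φ'.source →
    ∃ ε a : ℝ, (ε = 1 ∨ ε = -1) ∧ ∀ᶠ w in 𝓝 q, π (φ' (ψ w)) = ε * κ * π (φ w) + a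

theorem exists_chart (F : TransverseMeasuredFoliations S) {p : S} (hp : p ∉ F.sing) :
    ∃ φ ∈ F.charts, p ∈ φ.source := by
  have h : p ∈ ⋃ φ ∈ F.charts, φ.source := by rw [F.iUnion_source]; exact hp
  simpa using h

theorem ScalesBy.symm {F : TransverseMeasuredFoliations S} {π : ℝ × ℝ → ℝ} {ψ : S ≃ₜ S} {κ : ℝ}
    (hκ : κ ≠ 0) (h : ScalesBy F π ψ κ) : ScalesBy F π ψ.symm κ⁻¹ := by
  intro φ hφ φ' hφ' q hq hq'
  obtain ⟨ε, a, hε, he⟩ := h φ' hφ' φ hφ (ψ.symm q) hq' (by simpa using hq)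
  have he' := ψ.symm.continuous.continuousAt.eventually he
  refine ⟨ε, -(ε * κ⁻¹ * a), hε, ?_⟩
  filter_upwards [he'] with w hw
  rw [ψ.apply_symm_apply] at hw
  rw [hw]
  rcases hε with rfl | rfl <;> field_simp <;> ring

theorem notMem_sing {F : TransverseMeasuredFoliations S} {ψ : S ≃ₜ S}
    (hs : ψ '' F.sing = F.sing) {p : S} : ψ p ∉ F.sing ↔ p ∉ F.sing := by
  conv_lhs => rw [← hs]
  simp

theorem ScalesBy.sameLeaf {F : TransverseMeasuredFoliations S} {π : ℝ × ℝ → ℝ} {ψ : S ≃ₜ S}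
    {κ : ℝ} (hs : ψ '' F.sing = F.sing) (h : ScalesBy F π ψ κ) {p q : S}
    (hpq : F.SameLeaf π p q) : F.SameLeaf π (ψ p) (ψ q) := by
  obtain ⟨γ, hγ, hl⟩ := hpq
  refine ⟨γ.map ψ.continuous, fun t => ?_, fun t φ' hφ' ht => ?_⟩
  · simpa using (notMem_sing hs).2 (hγ t)
  · simp only [Path.map_coe, Function.comp_apply] at ht ⊢
    obtain ⟨φ, hφ, hp⟩ := exists_chart F (hγ t)
    obtain ⟨ε, a, -, he⟩ := h φ hφ φ' hφ' _ hp ht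
    have h0 := he.self_of_nhds
    filter_upwards [γ.continuous.continuousAt.eventually he, hl t φ hφ hp] with s h1 h2
    rw [h1, h2, h0]

theorem ScalesBy.isPreservedBy {F : TransverseMeasuredFoliations S} {π : ℝ × ℝ → ℝ} {ψ : S ≃ₜ S}
    {κ : ℝ} (hκ : κ ≠ 0) (hs : ψ '' F.sing = F.sing) (h : ScalesBy F π ψ κ) :
    F.IsPreservedBy π ψ := by
  refine ⟨hs, fun p _ q _ => ⟨fun H => ?_, h.sameLeaf hs⟩⟩
  have hs' : ψ.symm '' F.sing = F.sing := by
    conv_lhs => rw [← hs]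
    rw [Set.image_image]; simp
  simpa using (h.symm hκ).sameLeaf hs' H

/-- If `g` glues the transverse coordinates along `γ`, then `κ * g` glues those along `ψ ∘ γ`: the
signs and constants in the affine form of `ψ` are just the indeterminacy a glued coordinate is
allowed to have. -/
theorem ScalesBy.hasTransverseMeasure {F : TransverseMeasuredFoliations S} {π : ℝ × ℝ → ℝ}
    {ψ : S ≃ₜ S} {κ : ℝ} (hκ : 0 < κ) (hs : ψ '' F.sing = F.sing) (h : ScalesBy F π ψ κ)
    (γ : C(unitInterval, S)) (m : ℝ) (hm : F.HasTransverseMeasure π γ m) :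
    F.HasTransverseMeasure π ((ψ : C(S, S)).comp γ) (κ * m) := by
  obtain ⟨⟨hinj, hreg, hloc⟩, g, hg, hgl, rfl⟩ := hm
  refine ⟨⟨?_, fun t => ?_, fun t φ' hφ' ht => ?_⟩, fun t => κ * g t, by fun_prop,
    fun t φ' hφ' ht => ?_, ?_⟩
  · exact ψ.injective.comp hinj
  · exact (notMem_sing hs).2 (hreg t)
  · obtain ⟨φ, hφ, hp⟩ := exists_chart F (hreg t)
    obtain ⟨ε, a, hε, he⟩ := h φ hφ φ' hφ' _ hp ht
    obtain ⟨U, hU, hUi⟩ := hloc t φ hφ hp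
    refine ⟨_, Filter.inter_mem hU (γ.continuous.continuousAt.eventually he), ?_⟩
    rintro s ⟨hs1, hs2⟩ s' ⟨hs1', hs2'⟩ hss
    refine hUi hs1 hs1' ?_
    simp only [ContinuousMap.comp_apply, ContinuousMap.coe_coe] at hss
    simp only [Set.mem_ofPred_eq] at hs2 hs2'
    have h3 : ε * κ * π (φ (γ s)) = ε * κ * π (φ (γ s')) := by
      have := hs2.symm.trans (hss.trans hs2')
      linarith
    refine mul_left_cancel₀ ?_ h3
    rcases hε with rfl | rfl <;> simp [hκ.ne']
  · obtain ⟨φ, hφ, hp⟩ := exists_chart F (hreg t)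
    obtain ⟨ε, a, hε, he⟩ := h φ hφ φ' hφ' _ hp ht
    obtain ⟨ε', c, hε', hc⟩ := hgl t φ hφ hp
    refine ⟨ε * ε', ε * κ * c + a, ?_, ?_⟩
    · rcases hε with rfl | rfl <;> rcases hε' with rfl | rfl <;> simp
    · filter_upwards [γ.continuous.continuousAt.eventually he, hc] with s h1 h2
      simp only [ContinuousMap.comp_apply, ContinuousMap.coe_coe]
      rw [h1, h2]; ring
  · rw [← mul_sub, abs_mul, abs_of_pos hκ]

/-- `ψ` preserves the singular foliations of some `F`, and is affine in its charts. -/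
def IsAffinePseudoAnosov (ψ : S ≃ₜ S) : Prop :=
  ∃ (F : TransverseMeasuredFoliations S) (l : ℝ), 1 < l ∧ ψ '' F.sing = F.sing ∧
    ScalesBy F Prod.fst ψ l ∧ ScalesBy F Prod.snd ψ l⁻¹

theorem IsAffinePseudoAnosov.isPseudoAnosov {ψ : S ≃ₜ S} (h : IsAffinePseudoAnosov ψ) :
    IsPseudoAnosov ψ := by
  obtain ⟨F, l, hl, hs, h1, h2⟩ := h
  have hl0 : 0 < l := by linarith
  exact ⟨F, l, hl, h2.isPreservedBy (by positivity) hs, h1.isPreservedBy hl0.ne' hs,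
    h2.hasTransverseMeasure (by positivity) hs, h1.hasTransverseMeasure hl0 hs⟩

variable {S' : Type*} [TopologicalSpace S']

/-- Transport of foliations along a homeomorphism. -/
def transport (F : TransverseMeasuredFoliations S) (e : S ≃ₜ S') :
    TransverseMeasuredFoliations S' where
  sing := e '' F.sing
  finite_sing := F.finite_sing.image e
  charts := (fun φ => e.symm.toOpenPartialHomeomorph.trans φ) '' F.charts
  iUnion_source := by
    ext p
    have h := congrArg (fun s => e.symm p ∈ s) F.iUnion_source
    simp only [Set.mem_iUnion, Set.mem_compl_iff, eq_iff_iff] at h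
    simp only [Set.biUnion_image, Set.mem_iUnion, Set.mem_compl_iff]
    have h2 : p ∈ e '' F.sing ↔ e.symm p ∈ F.sing := by
      constructor
      · rintro ⟨x, hx, rfl⟩; simpa using hx
      · intro hx; exact ⟨_, hx, by simp⟩
    rw [h2, ← h]
    simp
  compat := by
    rintro _ ⟨φ, hφ, rfl⟩ _ ⟨φ', hφ', rfl⟩ p hp
    obtain ⟨ε, δ, a, b, hε, hδ, he⟩ := F.compat φ hφ φ' hφ' (e.symm p) (by simpa using hp)
    exact ⟨ε, δ, a, b, hε, hδ, by
      simpa using e.symm.continuous.continuousAt.eventually he⟩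
  prong := by
    rintro _ ⟨p, hp, rfl⟩
    obtain ⟨k, hk, z, hz, hz0, hzc⟩ := F.prong p hp
    refine ⟨k, hk, e.symm.toOpenPartialHomeomorph.trans z, by simpa using hz, by simpa using hz0, ?_⟩
    rintro _ ⟨φ, hφ, rfl⟩ q hq
    obtain ⟨ε, δ, a, b, hε, hδ, he⟩ := hzc φ hφ (e.symm q) (by simpa using hq)
    exact ⟨ε, δ, a, b, hε, hδ, by
      simpa using e.symm.continuous.continuousAt.eventually he⟩

/-- Being affine in charts is a statement about the atlas alone, and the atlas moves along `e`. This
is why the affine condition, and not `IsPseudoAnosov` itself, is carried through the constructions.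
-/
theorem IsAffinePseudoAnosov.conj {ψ : S ≃ₜ S} (h : IsAffinePseudoAnosov ψ) (e : S ≃ₜ S')
    (ψ' : S' ≃ₜ S') (hψ : ∀ x, ψ' (e x) = e (ψ x)) : IsAffinePseudoAnosov ψ' := by
  obtain ⟨F, l, hl, hs, h1, h2⟩ := h
  have hψ' : ∀ x, e.symm (ψ' x) = ψ (e.symm x) := fun x => by
    rw [e.symm_apply_eq, ← hψ, e.apply_symm_apply]
  have key : ∀ (π : ℝ × ℝ → ℝ) (κ : ℝ), ScalesBy F π ψ κ → ScalesBy (transport F e) π ψ' κ := by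
    rintro π κ H _ ⟨φ, hφ, rfl⟩ _ ⟨φ', hφ', rfl⟩ q hq hq'
    obtain ⟨ε, a, hε, he⟩ := H φ hφ φ' hφ' (e.symm q) (by simpa using hq)
      (by simpa [hψ'] using hq')
    exact ⟨ε, a, hε, by simpa [hψ'] using e.symm.continuous.continuousAt.eventually he⟩
  refine ⟨transport F e, l, hl, ?_, key _ _ h1, key _ _ h2⟩
  change ψ' '' (e '' F.sing) = e '' F.sing
  conv_rhs => rw [← hs]
  rw [Set.image_image, Set.image_image]
  simp [hψ]

end Foliation


/-! ### Fibrewise homeomorphisms -/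

section Fibre

variable {X : Type*} [TopologicalSpace X]

/-- By monotonicity, `a < g x y` means `Φ x a < y`, which is an open condition on `(x, y)`. This
makes the fibrewise inverse continuous without any compactness. -/
theorem exists_fibreHomeo (Φ : X → ℝ → ℝ) (hc : Continuous fun p : X × ℝ => Φ p.1 p.2)
    (hm : ∀ x, StrictMono (Φ x)) (hs : ∀ x, Function.Surjective (Φ x)) :
    ∃ e : X × ℝ ≃ₜ X × ℝ, ∀ p, e p = (p.1, Φ p.1 p.2) := by
  choose g hg using hs
  have hg' : ∀ x s, g x (Φ x s) = s := fun x s => (hm x).injective (hg x _)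
  have hcg : Continuous fun p : X × ℝ => g p.1 p.2 := by
    rw [continuous_iff_continuousAt]
    rintro ⟨x, y⟩
    refine tendsto_order.2 ⟨fun a ha => ?_, fun a ha => ?_⟩
    · have h1 : Φ x a < y := by
        have := hm x ha
        rwa [hg] at this
      have h2 : ∀ᶠ p : X × ℝ in 𝓝 (x, y), Φ p.1 a < p.2 :=
        (hc.comp (continuous_fst.prodMk continuous_const)).continuousAt.eventually_lt
          continuous_snd.continuousAt h1
      filter_upwards [h2] with p hp
      rw [← (hm p.1).lt_iff_lt, hg]; exact hp
    · have h1 : y < Φ x a := by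
        have := hm x ha
        rwa [hg] at this
      have h2 : ∀ᶠ p : X × ℝ in 𝓝 (x, y), p.2 < Φ p.1 a :=
        continuous_snd.continuousAt.eventually_lt
          (hc.comp (continuous_fst.prodMk continuous_const)).continuousAt h1
      filter_upwards [h2] with p hp
      rw [← (hm p.1).lt_iff_lt, hg]; exact hp
  exact ⟨{ toFun := fun p => (p.1, Φ p.1 p.2)
           invFun := fun p => (p.1, g p.1 p.2)
           left_inv := fun p => by simp [hg']
           right_inv := fun p => by simp [hg]
           continuous_toFun := continuous_fst.prodMk hc
           continuous_invFun := continuous_fst.prodMk hcg }, fun p => rfl⟩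

theorem surjective_of_sub_bounded {φ : ℝ → ℝ} (hc : Continuous φ) {C : ℝ}
    (h : ∀ s, |φ s - s| ≤ C) : Function.Surjective φ := by
  apply hc.surjective
  · refine Filter.tendsto_atTop_mono (f := fun s => s - C) (fun s => ?_)
      (Filter.tendsto_atTop_add_const_right _ _ Filter.tendsto_id)
    have := (abs_le.1 (h s)).1; linarith
  · refine Filter.tendsto_atBot_mono (f := fun s => s + C) (fun s => ?_)
      (Filter.tendsto_atBot_add_const_right _ _ Filter.tendsto_id)
    have := (abs_le.1 (h s)).2; linarith

/-- A fibrewise increasing homeomorphism of `X × ℝ`. -/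
structure IsFibreMap (Φ : X → ℝ → ℝ) : Prop where
  continuous : Continuous fun p : X × ℝ => Φ p.1 p.2
  strictMono : ∀ x, StrictMono (Φ x)
  surjective : ∀ x, Function.Surjective (Φ x)

theorem IsFibreMap.comp {Φ Ψ : X → ℝ → ℝ} (h : IsFibreMap Φ) (h' : IsFibreMap Ψ) :
    IsFibreMap fun x s => Φ x (Ψ x s) where
  continuous := h.continuous.comp (continuous_fst.prodMk h'.continuous)
  strictMono x := (h.strictMono x).comp (h'.strictMono x)
  surjective x := (h.surjective x).comp (h'.surjective x)

/-- Any continuous family of intervals can be stretched to any other one. -/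
theorem exists_stretch {m L m' L' : X → ℝ} (hm : Continuous m) (hL : Continuous L)
    (hm' : Continuous m') (hL' : Continuous L') (h0 : ∀ x, 0 ≤ L x) (h0' : ∀ x, 0 ≤ L' x)
    (h : ∀ x, L x = 0 ↔ L' x = 0) :
    ∃ Φ : X → ℝ → ℝ, IsFibreMap Φ ∧ (∀ x s, s ≤ m x → Φ x s = s - m x + m' x) ∧
      ∀ x s, m x + L x ≤ s → Φ x s = s - (m x + L x) + (m' x + L' x) := by
  -- Translate by `m' - m`, remove the part of the interval that lies below `s`, and put back the
  -- same proportion of an interval of length `L'`. Where `L` vanishes so does `L'`, so the quotient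
  -- by zero is harmless, and the last term stays continuous because it is bounded by `L'`.
  set Φ : X → ℝ → ℝ := fun x s => m' x + (s - m x) - max 0 (min (s - m x) (L x)) +
    L' x * max 0 (min ((s - m x) / L x) 1) with hΦ
  have hc : Continuous fun p : X × ℝ => Φ p.1 p.2 := by
    have h1 : Continuous fun p : X × ℝ => L' p.1 * max 0 (min ((p.2 - m p.1) / L p.1) 1) := by
      rw [continuous_iff_continuousAt]
      rintro ⟨x, s⟩
      by_cases hx : L x = 0
      · have hx' := (h x).1 hx
        have hz : L' x * max 0 (min ((s - m x) / L x) 1) = 0 := by rw [hx', zero_mul]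
        unfold ContinuousAt
        simp only [hz]
        have hl : Filter.Tendsto (fun p : X × ℝ => L' p.1) (𝓝 (x, s)) (𝓝 0) := by
          rw [← hx']; exact (hL'.comp continuous_fst).continuousAt
        refine squeeze_zero (fun p => mul_nonneg (h0' _) (le_max_left _ _)) (fun p => ?_) hl
        refine mul_le_of_le_one_right (h0' _) (max_le zero_le_one (min_le_right _ _))
      · have : ContinuousAt (fun p : X × ℝ => (p.2 - m p.1) / L p.1) (x, s) :=
          ContinuousAt.div (by fun_prop) (by fun_prop) hx
        exact ContinuousAt.mul (by fun_prop) (ContinuousAt.sup continuousAt_const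
          (ContinuousAt.inf this continuousAt_const))
    simp only [hΦ]
    exact Continuous.add (by fun_prop) h1
  have hmono : ∀ x, StrictMono (Φ x) := by
    intro x s t hst
    simp only [hΦ]
    rcases (h0 x).eq_or_lt with hx | hx
    · rw [← hx, (h x).1 hx.symm]
      have : ∀ s, max 0 (min (s - m x) 0) = 0 := fun s => max_eq_left (min_le_right _ _)
      simp only [this]; linarith
    · have hx' : 0 < L' x := (h0' x).lt_of_ne fun H => hx.ne' ((h x).2 H.symm)
      have hd : (s - m x) / L x < (t - m x) / L x := by gcongr
      have e : ∀ s, L x * ((s - m x) / L x) = s - m x := fun s => by field_simp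
      have mono : max 0 (min ((s - m x) / L x) 1) ≤ max 0 (min ((t - m x) / L x) 1) := by gcongr
      have m2 := mul_le_mul_of_nonneg_left mono hx'.le
      rcases le_or_gt (t - m x) 0 with ht | ht
      · rw [max_eq_left (a := 0) (b := min (s - m x) _) (min_le_iff.2 (Or.inl (by linarith))),
          max_eq_left (a := 0) (b := min (t - m x) _) (min_le_iff.2 (Or.inl (by linarith)))]
        linarith
      rcases le_or_gt (L x) (s - m x) with hs | hs
      · rw [min_eq_right (a := s - m x) hs, min_eq_right (a := t - m x) (by linarith)]
        linarith
      have key : max 0 (min ((s - m x) / L x) 1) < max 0 (min ((t - m x) / L x) 1) := by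
        have ha : 0 < (t - m x) / L x := by positivity
        have hb : (s - m x) / L x < 1 := by rw [div_lt_one hx]; exact hs
        rw [min_eq_left hb.le, max_lt_iff]
        constructor
        · exact lt_max_of_lt_right (lt_min ha one_pos)
        · exact lt_max_of_lt_right (lt_min hd hb)
      have k2 := mul_lt_mul_of_pos_left key hx'
      have l1 : max 0 (min (t - m x) (L x)) - max 0 (min (s - m x) (L x)) ≤ t - s := by
        rcases max_cases 0 (min (t - m x) (L x)) with ⟨h1, h2⟩ | ⟨h1, h2⟩ <;>
        rcases max_cases 0 (min (s - m x) (L x)) with ⟨h3, h4⟩ | ⟨h3, h4⟩ <;>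
        rcases min_cases (t - m x) (L x) with ⟨h5, h6⟩ | ⟨h5, h6⟩ <;>
        rcases min_cases (s - m x) (L x) with ⟨h7, h8⟩ | ⟨h7, h8⟩ <;> linarith
      linarith
  refine ⟨Φ, ⟨hc, hmono, fun x => ?_⟩, fun x s hs => ?_, fun x s hs => ?_⟩
  · refine surjective_of_sub_bounded (C := |m' x - m x| + L x + L' x)
      (hc.comp (continuous_const.prodMk continuous_id)) fun s => ?_
    have a1 : max 0 (min (s - m x) (L x)) ≤ L x := max_le (h0 x) (min_le_right _ _)
    have a2 : 0 ≤ max 0 (min (s - m x) (L x)) := le_max_left _ _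
    have b1 : L' x * max 0 (min ((s - m x) / L x) 1) ≤ L' x :=
      mul_le_of_le_one_right (h0' _) (max_le zero_le_one (min_le_right _ _))
    have b2 : 0 ≤ L' x * max 0 (min ((s - m x) / L x) 1) :=
      mul_nonneg (h0' _) (le_max_left _ _)
    have c1 := le_abs_self (m' x - m x)
    have c2 := neg_abs_le (m' x - m x)
    have := h0 x
    have := h0' x
    simp only [hΦ]
    rw [abs_le]; constructor <;> linarith
  · have e1 : max 0 (min (s - m x) (L x)) = 0 :=
      max_eq_left (min_le_iff.2 (Or.inl (by linarith)))
    have e2 : max 0 (min ((s - m x) / L x) 1) = 0 :=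
      max_eq_left (min_le_iff.2 (Or.inl (div_nonpos_of_nonpos_of_nonneg (by linarith) (h0 x))))
    simp only [hΦ, e1, e2]; ring
  · have e1 : max 0 (min (s - m x) (L x)) = L x := by
      rw [min_eq_right (by linarith), max_eq_right (h0 x)]
    have e2 : L' x * max 0 (min ((s - m x) / L x) 1) = L' x := by
      rcases (h0 x).eq_or_lt with hx | hx
      · rw [(h x).1 hx.symm, zero_mul]
      · rw [min_eq_right (by rw [le_div_iff₀ hx]; linarith), max_eq_right zero_le_one, mul_one]
    simp only [hΦ, e1, e2]; ring

/-- Fibrewise maps taking four knots to four knots. -/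
theorem exists_fourKnots {k₀ k₁ k₂ k₃ l₀ l₁ l₂ l₃ : X → ℝ} (hk₀ : Continuous k₀)
    (hk₁ : Continuous k₁) (hk₂ : Continuous k₂) (hk₃ : Continuous k₃) (hl₀ : Continuous l₀)
    (hl₁ : Continuous l₁) (hl₂ : Continuous l₂) (hl₃ : Continuous l₃)
    (h1 : ∀ x, k₀ x ≤ k₁ x ∧ l₀ x ≤ l₁ x ∧ (k₀ x = k₁ x ↔ l₀ x = l₁ x))
    (h2 : ∀ x, k₁ x ≤ k₂ x ∧ l₁ x ≤ l₂ x ∧ (k₁ x = k₂ x ↔ l₁ x = l₂ x))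
    (h3 : ∀ x, k₂ x ≤ k₃ x ∧ l₂ x ≤ l₃ x ∧ (k₂ x = k₃ x ↔ l₂ x = l₃ x)) :
    ∃ Φ : X → ℝ → ℝ, IsFibreMap Φ ∧ (∀ x, Φ x (k₀ x) = l₀ x) ∧ (∀ x, Φ x (k₁ x) = l₁ x) ∧
      (∀ x, Φ x (k₂ x) = l₂ x) ∧ ∀ x, Φ x (k₃ x) = l₃ x := by
  -- The three gaps are adjusted one after the other from the left. When its turn comes, a gap
  -- already starts at its final position, and what is to its right has only been translated.
  obtain ⟨Φ₁, f1, a1, b1⟩ := exists_stretch hk₀ (hk₁.sub hk₀) hl₀ (hl₁.sub hl₀)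
    (fun x => sub_nonneg.2 (h1 x).1) (fun x => sub_nonneg.2 (h1 x).2.1)
    (fun x => by rw [Pi.sub_apply, Pi.sub_apply, sub_eq_zero, sub_eq_zero, eq_comm, (h1 x).2.2, eq_comm])
  obtain ⟨Φ₂, f2, a2, b2⟩ := exists_stretch hl₁ (hk₂.sub hk₁) hl₁ (hl₂.sub hl₁)
    (fun x => sub_nonneg.2 (h2 x).1) (fun x => sub_nonneg.2 (h2 x).2.1)
    (fun x => by rw [Pi.sub_apply, Pi.sub_apply, sub_eq_zero, sub_eq_zero, eq_comm, (h2 x).2.2, eq_comm])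
  obtain ⟨Φ₃, f3, a3, b3⟩ := exists_stretch hl₂ (hk₃.sub hk₂) hl₂ (hl₃.sub hl₂)
    (fun x => sub_nonneg.2 (h3 x).1) (fun x => sub_nonneg.2 (h3 x).2.1)
    (fun x => by rw [Pi.sub_apply, Pi.sub_apply, sub_eq_zero, sub_eq_zero, eq_comm, (h3 x).2.2, eq_comm])
  simp only [Pi.sub_apply] at b1 b2 b3
  have hh1 := fun x => (h1 x).1
  have hh2 := fun x => (h2 x).1
  have hh3 := fun x => (h3 x).1
  have hl1 := fun x => (h1 x).2.1
  have hl2 := fun x => (h2 x).2.1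
  refine ⟨_, f3.comp (f2.comp f1), fun x => ?_, fun x => ?_, fun x => ?_, fun x => ?_⟩
  all_goals
    have := hh1 x
    have := hh2 x
    have := hh3 x
    have := hl1 x
    have := hl2 x
  · rw [a1 x _ (by linarith), a2 x _ (by linarith), a3 x _ (by linarith)]; ring
  · rw [b1 x _ (by linarith), a2 x _ (by linarith), a3 x _ (by linarith)]; ring
  · rw [b1 x _ (by linarith), b2 x _ (by linarith), a3 x _ (by linarith)]; ring
  · rw [b1 x _ (by linarith), b2 x _ (by linarith), b3 x _ (by linarith)]; ring

/-- Two pancakes of positive thickness over the same set are equivalent. -/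
theorem exists_pancake {β β' : X → ℝ} (hβ : Continuous β) (hβ' : Continuous β')
    (h0 : ∀ x, 0 ≤ β x ↔ 0 ≤ β' x) (h1 : ∀ x, 0 < β x ↔ 0 < β' x) :
    ∃ e : X × ℝ ≃ₜ X × ℝ, (∀ p, (e p).1 = p.1) ∧
      ∀ p, |(e p).2| ≤ β' p.1 ↔ |p.2| ≤ β p.1 := by
  -- The fibre interval `[-β, β]` is stretched to `[-β', β']`, with negative thickness replaced by
  -- `0`. Over points of negative thickness both pancakes are empty, so nothing is required there.
  obtain ⟨Φ, f, a, b⟩ := exists_stretch (m := fun x => - max (β x) 0)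
    (L := fun x => 2 * max (β x) 0) (m' := fun x => - max (β' x) 0)
    (L' := fun x => 2 * max (β' x) 0) (by fun_prop) (by fun_prop) (by fun_prop) (by fun_prop)
    (fun x => by positivity) (fun x => by positivity) (fun x => by simp [← not_lt, h1])
  obtain ⟨e, he⟩ := exists_fibreHomeo Φ f.continuous f.strictMono f.surjective
  refine ⟨e, fun p => by rw [he], fun p => ?_⟩
  rw [he]
  rcases lt_or_ge (β p.1) 0 with hp | hp
  · have hp' : β' p.1 < 0 := not_le.1 fun H => hp.not_ge ((h0 _).2 H)
    exact ⟨fun H => absurd (abs_nonneg _) (not_le.2 (H.trans_lt hp')),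
      fun H => absurd (abs_nonneg _) (not_le.2 (H.trans_lt hp))⟩
  · have hp' := (h0 _).1 hp
    have e1 := a p.1 (- β p.1) (by simp [hp])
    have e2 := b p.1 (β p.1) (by simp [hp]; linarith)
    simp only [max_eq_left hp, max_eq_left hp'] at e1 e2
    ring_nf at e1 e2
    rw [abs_le, abs_le, ← e1, (f.strictMono p.1).le_iff_le]
    conv_lhs => rw [← e2]
    rw [(f.strictMono p.1).le_iff_le]

end Fibre

/-! ### Radial rescaling between families of gauges -/

section Radial

variable {X E : Type*} [TopologicalSpace X] [NormedAddCommGroup E] [NormedSpace ℝ E]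

/-- A continuous family of gauges: positively homogeneous functions comparable to the norm. -/
structure IsGauge (G : X → E → ℝ) : Prop where
  continuous : Continuous fun p : X × E => G p.1 p.2
  hom : ∀ x (r : ℝ) w, 0 ≤ r → G x (r • w) = r * G x w
  lower : ∃ c, 0 < c ∧ ∀ x w, c * ‖w‖ ≤ G x w
  upper : ∃ C, ∀ x w, G x w ≤ C * ‖w‖

theorem IsGauge.pos {G : X → E → ℝ} (h : IsGauge G) (x : X) {w : E} (hw : w ≠ 0) : 0 < G x w := by
  obtain ⟨c, hc, H⟩ := h.lower
  exact lt_of_lt_of_le (mul_pos hc (norm_pos_iff.2 hw)) (H x w)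

theorem IsGauge.zero {G : X → E → ℝ} (h : IsGauge G) (x : X) : G x 0 = 0 := by
  simpa using h.hom x 0 0 le_rfl

/-- The ratio of the gauges need not have a limit at the origin, but it is bounded there by `C / c`,
so its product with the vector tends to `0`. -/
theorem IsGauge.continuous_rescale {G G' : X → E → ℝ} (h : IsGauge G) (h' : IsGauge G') :
    Continuous fun p : X × E => (p.1, (G p.1 p.2 / G' p.1 p.2) • p.2) := by
  refine continuous_fst.prodMk ?_
  rw [continuous_iff_continuousAt]
  rintro ⟨x, w⟩
  by_cases hw : w = 0
  · subst hw
    obtain ⟨c, hc, H⟩ := h'.lower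
    obtain ⟨C, H'⟩ := h.upper
    have : Filter.Tendsto (fun p : X × E => (G p.1 p.2 / G' p.1 p.2) • p.2) (𝓝 (x, 0)) (𝓝 0) := by
      have hl : Filter.Tendsto (fun p : X × E => C / c * ‖p.2‖) (𝓝 (x, 0)) (𝓝 0) := by
        have : Continuous fun p : X × E => C / c * ‖p.2‖ := by fun_prop
        simpa using this.tendsto (x, 0)
      refine squeeze_zero_norm (fun p => ?_) hl
      by_cases hp : p.2 = 0
      · simp [hp]
      · have h1 := h.pos p.1 hp
        have h2 := h'.pos p.1 hp
        rw [norm_smul, Real.norm_of_nonneg (by positivity)]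
        have h3 := H p.1 p.2
        have h4 := H' p.1 p.2
        have hn : 0 < ‖p.2‖ := norm_pos_iff.2 hp
        have hC : 0 < C := by
          by_contra hC
          nlinarith
        gcongr ?_ * _
        rw [div_le_div_iff₀ h2 hc]
        calc G p.1 p.2 * c ≤ (C * ‖p.2‖) * c := by gcongr
          _ = C * (c * ‖p.2‖) := by ring
          _ ≤ C * G' p.1 p.2 := by gcongr
    simpa [ContinuousAt] using this
  · exact ((h.continuous.continuousAt).div h'.continuous.continuousAt (h'.pos x hw).ne').smul
      continuous_snd.continuousAt

/-- Radial rescaling between two families of gauges. -/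
theorem exists_rescale {G G' : X → E → ℝ} (h : IsGauge G) (h' : IsGauge G') :
    ∃ e : X × E ≃ₜ X × E, (∀ p, e p = (p.1, (G p.1 p.2 / G' p.1 p.2) • p.2)) ∧
      ∀ p, G' p.1 (e p).2 = G p.1 p.2 := by
  have key : ∀ {G G' : X → E → ℝ}, IsGauge G → IsGauge G' → ∀ x w,
      G' x ((G x w / G' x w) • w) = G x w := by
    intro G G' h h' x w
    by_cases hw : w = 0
    · subst hw; simp [h.zero, h'.zero]
    · rw [h'.hom _ _ _ (div_nonneg (h.pos x hw).le (h'.pos x hw).le),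
        div_mul_cancel₀ _ (h'.pos x hw).ne']
  have inv : ∀ {G G' : X → E → ℝ}, IsGauge G → IsGauge G' → ∀ x w,
      (G' x ((G x w / G' x w) • w) / G x ((G x w / G' x w) • w)) • ((G x w / G' x w) • w) = w := by
    intro G G' h h' x w
    by_cases hw : w = 0
    · subst hw; simp
    · have h1 := h.pos x hw
      have h2 := h'.pos x hw
      rw [key h h', h.hom _ _ _ (by positivity), smul_smul]
      have : G x w / (G x w / G' x w * G x w) * (G x w / G' x w) = 1 := by field_simp
      rw [this, one_smul]
  refine ⟨{ toFun := fun p => (p.1, (G p.1 p.2 / G' p.1 p.2) • p.2)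
            invFun := fun p => (p.1, (G' p.1 p.2 / G p.1 p.2) • p.2)
            left_inv := fun p => Prod.ext rfl (inv h h' _ _)
            right_inv := fun p => Prod.ext rfl (inv h' h _ _)
            continuous_toFun := h.continuous_rescale h'
            continuous_invFun := h'.continuous_rescale h }, fun p => rfl, fun p => key h h' _ _⟩

end Radial


/-! ### Lifting homeomorphisms to the double cover branched along an axis -/

/-- The double branched covering `(t, z) ↦ (t, z ^ 2)`. -/
def dbl (p : ℝ × ℂ) : ℝ × ℂ := (p.1, p.2 ^ 2)

theorem continuous_dbl : Continuous dbl := by unfold dbl; fun_prop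

theorem isOpenQuotientMap_dbl : IsOpenQuotientMap dbl :=
  IsOpenQuotientMap.id.prodMap (Complex.isOpenQuotientMap_pow 2)

/-- `k` is a logarithm of the rotation of `g` about the axis. -/
structure IsLogOf (g : ℝ × ℂ ≃ₜ ℝ × ℂ) (k : ℝ × ℂ → ℂ) : Prop where
  axis : ∀ p, (g p).2 = 0 ↔ p.2 = 0
  cont : ∀ p, p.2 ≠ 0 → ContinuousAt k p
  eq : ∀ p, p.2 ≠ 0 → (g p).2 = p.2 * Complex.exp (k p)

/-- The lift of `g` determined by the logarithm `k`. -/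
noncomputable def liftMap (g : ℝ × ℂ ≃ₜ ℝ × ℂ) (k : ℝ × ℂ → ℂ) (p : ℝ × ℂ) : ℝ × ℂ :=
  ((g (dbl p)).1, p.2 * Complex.exp (k (dbl p) / 2))

theorem IsLogOf.dbl_liftMap {g : ℝ × ℂ ≃ₜ ℝ × ℂ} {k : ℝ × ℂ → ℂ} (h : IsLogOf g k) (p : ℝ × ℂ) :
    dbl (liftMap g k p) = g (dbl p) := by
  have e : Complex.exp (k (dbl p) / 2) ^ 2 = Complex.exp (k (dbl p)) := by
    rw [← Complex.exp_nat_mul]; congr 1; push_cast; ring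
  by_cases hp : p.2 = 0
  · have h2 : (g (dbl p)).2 = 0 := (h.axis _).2 (by simp [dbl, hp])
    refine Prod.ext rfl ?_
    rw [h2]; simp [dbl, liftMap, hp]
  · have h2 := h.eq (dbl p) (by simp [dbl, hp])
    refine Prod.ext rfl ?_
    rw [h2]
    simp only [dbl, liftMap] at e ⊢
    rw [mul_pow, e]

/-- The logarithm is uncontrolled at the axis, but the modulus of the second coordinate of the lift
is the square root of that of `g (dbl q)`, which tends to `0` there. -/
theorem IsLogOf.continuous_liftMap {g : ℝ × ℂ ≃ₜ ℝ × ℂ} {k : ℝ × ℂ → ℂ} (h : IsLogOf g k) :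
    Continuous (liftMap g k) := by
  refine (continuous_fst.comp (g.continuous.comp continuous_dbl)).prodMk ?_
  rw [continuous_iff_continuousAt]
  intro p
  by_cases hp : p.2 = 0
  · have h0 : (g (dbl p)).2 = 0 := (h.axis _).2 (by simp [dbl, hp])
    have h1 : Filter.Tendsto (fun q => Real.sqrt ‖(g (dbl q)).2‖) (𝓝 p) (𝓝 0) := by
      have : Continuous fun q => Real.sqrt ‖(g (dbl q)).2‖ :=
        (continuous_snd.comp (g.continuous.comp continuous_dbl)).norm.sqrt
      simpa [h0] using this.tendsto p
    have : Filter.Tendsto (fun q : ℝ × ℂ => q.2 * Complex.exp (k (dbl q) / 2)) (𝓝 p) (𝓝 0) := by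
      refine squeeze_zero_norm (fun q => le_of_eq ?_) h1
      rw [← h.dbl_liftMap q]
      simp [dbl, liftMap]
    simpa [ContinuousAt, hp] using this
  · have hk : ContinuousAt (fun q => k (dbl q)) p :=
      ContinuousAt.comp (f := dbl) (h.cont (dbl p) (by simp [dbl, hp])) continuous_dbl.continuousAt
    exact continuous_snd.continuousAt.mul (hk.div_const 2).cexp

theorem IsLogOf.symm {g : ℝ × ℂ ≃ₜ ℝ × ℂ} {k : ℝ × ℂ → ℂ} (h : IsLogOf g k) :
    IsLogOf g.symm (fun p => - k (g.symm p)) where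
  axis p := by rw [← h.axis, g.apply_symm_apply]
  cont p hp := by
    refine (ContinuousAt.comp (f := g.symm) (h.cont (g.symm p) fun H => hp ?_)
      g.symm.continuous.continuousAt).neg
    rwa [← h.axis, g.apply_symm_apply] at H
  eq p hp := by
    have h1 : (g.symm p).2 ≠ 0 := fun H => hp (by rwa [← h.axis, g.apply_symm_apply] at H)
    have h2 := h.eq _ h1
    rw [g.apply_symm_apply] at h2
    rw [h2, mul_assoc, ← Complex.exp_add]; simp

theorem IsLogOf.liftMap_symm_liftMap {g : ℝ × ℂ ≃ₜ ℝ × ℂ} {k : ℝ × ℂ → ℂ} (h : IsLogOf g k)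
    (p : ℝ × ℂ) : liftMap g.symm (fun p => - k (g.symm p)) (liftMap g k p) = p := by
  have h1 := h.dbl_liftMap p
  rw [liftMap]
  simp only [h1, g.symm_apply_apply]
  refine Prod.ext (by simp [dbl]) ?_
  change p.2 * Complex.exp (k (dbl p) / 2) * _ = _
  rw [mul_assoc, ← Complex.exp_add]
  simp [neg_div]

/-- The lift of `g` as a homeomorphism. -/
noncomputable def IsLogOf.lift {g : ℝ × ℂ ≃ₜ ℝ × ℂ} {k : ℝ × ℂ → ℂ} (h : IsLogOf g k) :
    ℝ × ℂ ≃ₜ ℝ × ℂ where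
  toFun := liftMap g k
  invFun := liftMap g.symm fun p => - k (g.symm p)
  left_inv := h.liftMap_symm_liftMap
  right_inv p := by simpa using h.symm.liftMap_symm_liftMap p
  continuous_toFun := h.continuous_liftMap
  continuous_invFun := h.symm.continuous_liftMap

/-- The quotient `(g p).2 / p.2` maps `ℝ × (ℂ ∖ 0)` to `ℂ ∖ 0`. The product is contracted onto the
slice `t = T`, where the slit plane hypothesis supplies a logarithm, and this logarithm is continued
by lifting the contraction through the covering `exp`. -/
theorem exists_isLogOf (g : ℝ × ℂ ≃ₜ ℝ × ℂ) (hax : ∀ p, (g p).2 = 0 ↔ p.2 = 0) (T : ℝ) {ω : ℂ}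
    (hω : ω ≠ 0) (hT : ∀ w : ℂ, w ≠ 0 → (g (T, w)).2 / (ω * w) ∈ Complex.slitPlane) :
    ∃ k, IsLogOf g k ∧
      ∀ w, w ≠ 0 → k (T, w) = Complex.log ((g (T, w)).2 / (ω * w)) + Complex.log ω := by
  let H : C(unitInterval × (ℝ × {w : ℂ // w ≠ 0}), {w : ℂ // w ≠ 0}) :=
    ⟨fun x => ⟨(g (T + x.1 * (x.2.1 - T), x.2.2)).2 / x.2.2.1,
      div_ne_zero (fun h => x.2.2.2 ((hax _).1 h)) x.2.2.2⟩, by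
      refine Continuous.subtype_mk (Continuous.div ?_ (by fun_prop) fun x => x.2.2.2) _
      exact continuous_snd.comp (g.continuous.comp (by fun_prop))⟩
  let f : C(ℝ × {w : ℂ // w ≠ 0}, ℂ) :=
    ⟨fun a => Complex.log ((g (T, a.2)).2 / (ω * a.2)) + Complex.log ω, by
      refine Continuous.add (Continuous.clog (Continuous.div ?_ (by fun_prop)
        fun x => mul_ne_zero hω x.2.2) fun x => hT _ x.2.2) continuous_const
      exact continuous_snd.comp (g.continuous.comp (by fun_prop))⟩
  have H0 : ∀ a : ℝ × {w : ℂ // w ≠ 0}, H (0, a) = ⟨Complex.exp (f a), Complex.exp_ne_zero _⟩ := by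
    intro a
    refine Subtype.ext ?_
    change (g (T + (0 : ℝ) * (a.1 - T), a.2)).2 / a.2.1 = Complex.exp (Complex.log _ + Complex.log ω)
    rw [zero_mul, add_zero, Complex.exp_add, Complex.exp_log (Complex.slitPlane_ne_zero (hT _ a.2.2)),
      Complex.exp_log hω]
    have := a.2.2
    field_simp
  let K := Complex.isCoveringMap_exp.liftHomotopy H f H0
  have hK : ∀ x, Complex.exp (K x) = (H x).1 := fun x =>
    congrArg Subtype.val (congrFun (Complex.isCoveringMap_exp.liftHomotopy_lifts H f H0) x)
  have hK0 : ∀ a, K (0, a) = f a := Complex.isCoveringMap_exp.liftHomotopy_zero H f H0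
  classical
  refine ⟨fun p => if h : p.2 ≠ 0 then K (1, (p.1, ⟨p.2, h⟩)) else 0, ⟨hax, ?_, ?_⟩, ?_⟩
  · intro p hp
    have hU : {q : ℝ × ℂ | q.2 ≠ 0} ∈ 𝓝 p :=
      (isOpen_ne.preimage continuous_snd).mem_nhds hp
    refine ContinuousOn.continuousAt (s := {q : ℝ × ℂ | q.2 ≠ 0}) ?_ hU
    rw [continuousOn_iff_continuous_domRestrict]
    have : Continuous fun q : {q : ℝ × ℂ | q.2 ≠ 0} => K (1, (q.1.1, ⟨q.1.2, q.2⟩)) := by fun_prop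
    convert this using 2 with q
    have hq : q.1.2 ≠ 0 := q.2
    simp [hq]
  · intro p hp
    rw [dif_pos hp, hK]
    simp only [H, ContinuousMap.coe_mk, Set.Icc.coe_one, one_mul, add_sub_cancel]
    field_simp
  · intro w hw
    simp only
    rw [dif_pos hw]
    -- The contraction is stationary on the slice `t = T`, so the lifted path is constant there.
    have : K (1, (T, ⟨w, hw⟩)) = K (0, (T, ⟨w, hw⟩)) := by
      have hc : Continuous fun τ : unitInterval => K (τ, (T, ⟨w, hw⟩)) := by fun_prop
      refine congrFun (Complex.isCoveringMap_exp.eq_of_comp_eq hc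
        (continuous_const (y := K (0, (T, ⟨w, hw⟩)))) ?_ 0 rfl) 1
      funext τ
      refine Subtype.ext ?_
      simp only [Function.comp_apply, hK]
      simp [H]
    rw [this, hK0]
    rfl

/-- The complement of a large box, off the axis, is connected. -/
theorem isPreconnected_outside (W : ℝ) (hW : 0 ≤ W) :
    IsPreconnected {p : ℝ × ℂ | p.2 ≠ 0 ∧ W < ‖p‖} := by
  have hrank : 1 < Module.rank ℝ ℂ := by
    rw [Complex.rank_real_complex]; norm_num
  have hC : IsPreconnected {w : ℂ | W < ‖w‖} := by
    have := ((isPreconnected_Ioi (a := W)).prod (isPreconnected_sphere hrank (0 : ℂ) 1)).image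
      (fun q : ℝ × ℂ => q.1 • q.2) (by fun_prop)
    convert this using 1
    ext w
    simp only [Set.mem_ofPred_eq, Set.mem_image, Set.mem_prod, Set.mem_Ioi, mem_sphere_zero_iff_norm,
      Prod.exists]
    constructor
    · intro h
      have h0 : ‖w‖ ≠ 0 := by linarith
      refine ⟨‖w‖, ‖w‖⁻¹ • w, ⟨h, ?_⟩, ?_⟩
      · rw [norm_smul, norm_inv, norm_norm, inv_mul_cancel₀ h0]
      · rw [smul_smul, mul_inv_cancel₀ h0, one_smul]
    · rintro ⟨r, u, ⟨hr, hu⟩, rfl⟩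
      rw [norm_smul, hu, mul_one, Real.norm_of_nonneg (by linarith)]; exact hr
  have h0 : IsPreconnected ({0}ᶜ : Set ℂ) :=
    (isConnected_compl_singleton_of_one_lt_rank hrank 0).isPreconnected
  -- The set is the union of three products: `‖w‖ > W`, and the two ends `t > W` and `t < -W` with
  -- `w ≠ 0`. The first meets each end.
  have h1 := (isPreconnected_univ (α := ℝ)).prod hC
  have h2 := (isPreconnected_Ioi (a := W)).prod h0
  have h3 := (isPreconnected_Iio (a := -W)).prod h0
  have hw : W < ‖((W + 1 : ℝ) : ℂ)‖ := by
    rw [Complex.norm_real, Real.norm_of_nonneg (by linarith)]; linarith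
  have hw0 : ((W + 1 : ℝ) : ℂ) ≠ 0 := by
    intro h; rw [h, norm_zero] at hw; linarith
  have h12 := IsPreconnected.union ((W + 1 : ℝ), ((W + 1 : ℝ) : ℂ))
    (Set.mk_mem_prod (Set.mem_univ _) hw)
    (Set.mk_mem_prod (by rw [Set.mem_Ioi]; linarith) hw0) h1 h2
  have h123 := IsPreconnected.union ((-(W + 1) : ℝ), ((W + 1 : ℝ) : ℂ))
    (Or.inl (Set.mk_mem_prod (Set.mem_univ _) hw))
    (Set.mk_mem_prod (by rw [Set.mem_Iio]; linarith) hw0) h12 h3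
  convert h123 using 1
  ext ⟨t, w⟩
  have e : W < ‖w‖ → w ≠ 0 := by rintro h rfl; rw [norm_zero] at h; linarith
  simp only [Set.mem_ofPred_eq, Set.mem_union, Set.mem_prod, Set.mem_univ, true_and, Set.mem_Ioi,
    Set.mem_Iio, Set.mem_compl_iff, Set.mem_singleton_iff, Prod.norm_def, lt_max_iff, Real.norm_eq_abs,
    lt_abs]
  constructor
  · rintro ⟨h, (h' | h') | h'⟩
    · exact Or.inl (Or.inr ⟨h', h⟩)
    · exact Or.inr ⟨by linarith, h⟩
    · exact Or.inl (Or.inl h')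
  · rintro ((h | h) | h)
    · exact ⟨e h, Or.inr h⟩
    · exact ⟨h.2, Or.inl (Or.inl h.1)⟩
    · exact ⟨h.2, Or.inl (Or.inr (by linarith [h.1]))⟩

/-- A compactly supported homeomorphism fixing the axis lifts to one with compact support. -/
theorem exists_lift_of_compactSupport (g : ℝ × ℂ ≃ₜ ℝ × ℂ) (hax : ∀ p : ℝ × ℂ, p.2 = 0 → g p = p)
    {W : ℝ} (hW : 0 ≤ W) (hg : ∀ p, W < ‖p‖ → g p = p) :
    ∃ G : ℝ × ℂ ≃ₜ ℝ × ℂ, (∀ p, dbl (G p) = g (dbl p)) ∧ (∀ p : ℝ × ℂ, p.2 = 0 → G p = p) ∧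
      ∀ p, W < ‖dbl p‖ → G p = p := by
  have hax' : ∀ p, (g p).2 = 0 ↔ p.2 = 0 := by
    refine fun p => ⟨fun h => ?_, fun h => by rw [hax p h]; exact h⟩
    have := hax _ h
    rw [g.injective.eq_iff] at this
    rwa [this] at h
  have hn : ∀ w : ℂ, W < ‖((W + 1 : ℝ), w)‖ := fun w =>
    lt_of_lt_of_le (by rw [Real.norm_of_nonneg (by linarith)]; linarith) (norm_fst_le ((W + 1 : ℝ), w))
  obtain ⟨k, hk, hk0⟩ := exists_isLogOf g hax' (W + 1) one_ne_zero (fun w hw => by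
    rw [hg _ (hn w), one_mul, div_self hw]; exact Complex.one_mem_slitPlane)
  -- Outside the support both `k` and `0` are logarithms of `1`; they agree at one point of a
  -- connected set, hence on all of it.
  have hko : Set.EqOn k (fun _ => 0) {p : ℝ × ℂ | p.2 ≠ 0 ∧ W < ‖p‖} := by
    refine Complex.isCoveringMap_exp.eqOn_of_comp_eqOn (isPreconnected_outside W hW)
      (fun p hp => (hk.cont p hp.1).continuousWithinAt) continuousOn_const ?_
      (a := ((W + 1 : ℝ), (1 : ℂ))) ⟨by simp, hn 1⟩ ?_
    · rintro p ⟨hp, hp'⟩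
      refine Subtype.ext ?_
      have h1 := hk.eq p hp
      rw [hg p hp'] at h1
      simp only [Function.comp_apply, Complex.exp_zero]
      exact mul_left_cancel₀ hp (by rw [← h1, mul_one])
    · rw [hk0 1 one_ne_zero, hg _ (hn 1)]; simp
  refine ⟨hk.lift, hk.dbl_liftMap, fun p hp => ?_, fun p hp => ?_⟩
  · change liftMap g k p = p
    have h1 : dbl p = p := by simp [dbl, Prod.ext_iff, hp]
    refine Prod.ext ?_ (by simp [liftMap, hp])
    simp only [liftMap]
    rw [h1, hax p hp]
  · change liftMap g k p = p
    unfold liftMap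
    rw [hg _ hp]
    refine Prod.ext rfl ?_
    by_cases h : p.2 = 0
    · simp [h]
    · simp only
      rw [hko ⟨by simp [dbl, h], hp⟩]; simp


/-! ### The flat structure on the octahedron -/

/-- The sawtooth function with slopes `±1` and period `4`, equal to the identity on `[-1, 1]`. -/
noncomputable def saw (x : ℝ) : ℝ := 2 / Real.pi * Real.arcsin (Real.sin (Real.pi * x / 2))

@[fun_prop]
theorem continuous_saw : Continuous saw := by unfold saw; fun_prop

theorem saw_of_mem {x : ℝ} (h1 : -1 ≤ x) (h2 : x ≤ 1) : saw x = x := by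
  have := Real.pi_pos
  rw [saw, Real.arcsin_sin (by nlinarith) (by nlinarith)]
  field_simp

theorem saw_add_two (x : ℝ) : saw (x + 2) = - saw x := by
  rw [saw, saw, show Real.pi * (x + 2) / 2 = Real.pi * x / 2 + Real.pi by ring, Real.sin_add_pi,
    Real.arcsin_neg]; ring

theorem saw_neg (x : ℝ) : saw (-x) = - saw x := by
  rw [saw, saw, show Real.pi * (-x) / 2 = - (Real.pi * x / 2) by ring, Real.sin_neg,
    Real.arcsin_neg]; ring

theorem saw_two_sub (x : ℝ) : saw (2 - x) = saw x := by
  rw [show 2 - x = -x + 2 by ring, saw_add_two, saw_neg, neg_neg]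

theorem saw_add_four_mul (x : ℝ) (n : ℤ) : saw (x + 4 * n) = saw x := by
  rw [saw, saw, show Real.pi * (x + 4 * n) / 2 = Real.pi * x / 2 + n * (2 * Real.pi) by ring,
    Real.sin_add_int_mul_two_pi]

/-- The shifted sawtooth function. -/
noncomputable def csaw (x : ℝ) : ℝ := saw (x + 1)

@[fun_prop]
theorem continuous_csaw : Continuous csaw := by unfold csaw; fun_prop

theorem csaw_add_two (x : ℝ) : csaw (x + 2) = - csaw x := by
  rw [csaw, csaw, ← saw_add_two]; ring_nf

theorem csaw_neg (x : ℝ) : csaw (-x) = csaw x := by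
  rw [csaw, csaw, ← saw_two_sub]; ring_nf

theorem csaw_two_sub (x : ℝ) : csaw (2 - x) = - csaw x := by
  rw [show 2 - x = -x + 2 by ring, csaw_add_two, csaw_neg]

theorem csaw_add_four_mul (x : ℝ) (n : ℤ) : csaw (x + 4 * n) = csaw x := by
  rw [csaw, csaw, ← saw_add_four_mul (x + 1) n]; ring_nf

theorem csaw_add_one (x : ℝ) : csaw (x + 1) = - saw x := by
  rw [csaw, ← saw_add_two]; ring_nf

theorem csaw_sub_one (x : ℝ) : csaw (x - 1) = saw x := by
  rw [csaw]; ring_nf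

theorem saw_sub_one (x : ℝ) : saw (x - 1) = - csaw x := by
  rw [csaw, eq_neg_iff_add_eq_zero, show x + 1 = x - 1 + 2 by ring, saw_add_two]; ring

theorem csaw_of_mem {x : ℝ} (h1 : -1 ≤ x) (h2 : x ≤ 1) : csaw x = 1 - |x| := by
  rcases le_total 0 x with h | h
  · rw [csaw, ← saw_two_sub, saw_of_mem (by linarith) (by linarith), abs_of_nonneg h]; ring
  · rw [csaw, saw_of_mem (by linarith) (by linarith), abs_of_nonpos h]; ring

/-- Every real number is at distance at most `1` from an even integer. -/
theorem exists_near_even (x : ℝ) : ∃ (k : ℤ) (r : ℝ), -1 ≤ r ∧ r ≤ 1 ∧ x = r + 2 * k := by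
  refine ⟨round (x / 2), x - 2 * round (x / 2), ?_, ?_, by ring⟩ <;>
  · have := abs_le.1 (abs_sub_round (x / 2)); linarith [this.1, this.2]

theorem saw_add_two_mul (x : ℝ) (k : ℤ) :
    (saw (x + 2 * k) = saw x ∧ csaw (x + 2 * k) = csaw x) ∨
      (saw (x + 2 * k) = - saw x ∧ csaw (x + 2 * k) = - csaw x) := by
  rcases Int.even_or_odd' k with ⟨n, rfl | rfl⟩
  · left
    rw [← saw_add_four_mul x n, ← csaw_add_four_mul x n]; push_cast; constructor <;> ring_nf
  · right
    rw [← saw_add_two, ← csaw_add_two, ← saw_add_four_mul (x + 2) n, ← csaw_add_four_mul (x + 2) n]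
    push_cast; constructor <;> ring_nf

theorem abs_csaw (x : ℝ) : |csaw x| = 1 - |saw x| := by
  obtain ⟨k, r, h1, h2, rfl⟩ := exists_near_even x
  have hr : |r| ≤ 1 := abs_le.2 ⟨h1, h2⟩
  rcases saw_add_two_mul r k with ⟨e1, e2⟩ | ⟨e1, e2⟩ <;>
  · rw [e1, e2, saw_of_mem h1 h2, csaw_of_mem h1 h2]
    simp only [abs_neg, abs_of_nonneg (sub_nonneg.2 hr)]

theorem abs_saw_le (x : ℝ) : |saw x| ≤ 1 := by
  have := abs_nonneg (csaw x)
  rw [abs_csaw] at this; linarith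

/-- The two sawtooth values determine the sine and the cosine of `πx / 2`, hence `x` modulo `4`. -/
theorem exists_of_saw_eq {x x' : ℝ} (hs : saw x = saw x') (hc : csaw x = csaw x') :
    ∃ n : ℤ, x' = x + 4 * n := by
  have hπ := Real.pi_pos
  have h1 : ∀ {a b : ℝ}, saw a = saw b → Real.sin (Real.pi * a / 2) = Real.sin (Real.pi * b / 2) := by
    intro a b h
    have : Real.arcsin (Real.sin (Real.pi * a / 2)) = Real.arcsin (Real.sin (Real.pi * b / 2)) :=
      mul_left_cancel₀ (by positivity) h
    rw [← Real.sin_arcsin (Real.neg_one_le_sin (Real.pi * a / 2)) (Real.sin_le_one _), this,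
      Real.sin_arcsin (Real.neg_one_le_sin _) (Real.sin_le_one _)]
  have h2 : ∀ a : ℝ, Real.sin (Real.pi * (a + 1) / 2) = Real.cos (Real.pi * a / 2) := by
    intro a
    rw [← Real.sin_add_pi_div_two]; ring_nf
  have hs' := h1 hs
  have hc' := h1 hc
  rw [h2, h2] at hc'
  obtain ⟨n, hn⟩ := Real.Angle.angle_eq_iff_two_pi_dvd_sub.1 (Real.Angle.cos_sin_inj hc' hs')
  refine ⟨-n, ?_⟩
  push_cast
  have : Real.pi * (x - x' - 4 * n) = 0 := by linear_combination 2 * hn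
  rcases mul_eq_zero.1 this with h | h
  · exact absurd h hπ.ne'
  · linarith

/-- The signed minimum of absolute values. -/
noncomputable def smin (a b : ℝ) : ℝ := (|a + b| - |a - b|) / 2

theorem abs_smin (a b : ℝ) : |smin a b| = min |a| |b| := by
  unfold smin; simp only [abs_eq_max_neg, max_def, min_def]; split_ifs <;> linarith

theorem smin_neg_left (a b : ℝ) : smin (-a) b = - smin a b := by
  unfold smin
  rw [show -a + b = -(a - b) by ring, show -a - b = - (a + b) by ring, abs_neg, abs_neg]; ring

theorem smin_comm (a b : ℝ) : smin a b = smin b a := by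
  unfold smin; rw [add_comm, abs_sub_comm]

theorem smin_neg_right (a b : ℝ) : smin a (-b) = - smin a b := by
  rw [smin_comm, smin_neg_left, smin_comm]

theorem smin_zero_left (a : ℝ) : smin 0 a = 0 := by simp [smin]

theorem smin_of_nonneg {a b : ℝ} (ha : 0 ≤ a) (hb : 0 ≤ b) : smin a b = min a b := by
  unfold smin; simp only [abs_eq_max_neg, max_def, min_def]; split_ifs <;> linarith

/-- Given the moduli, `smin` remembers the sign of the product `a * b`. The pair is thus known up to
a common sign, and if one entry vanishes the choice of its sign is free anyway. -/
theorem smin_injective {a a' b b' : ℝ} (ha : |a| = |a'|) (hb : |b| = |b'|)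
    (h : smin a b = smin a' b') : (a' = a ∧ b' = b) ∨ (a' = -a ∧ b' = -b) := by
  have key : smin a b = - smin a b → a = 0 ∨ b = 0 := by
    intro h
    have h0 : |smin a b| = 0 := by rw [abs_eq_zero]; linarith
    rw [abs_smin] at h0
    rcases min_choice |a| |b| with h' | h' <;> rw [h'] at h0
    · exact Or.inl (abs_eq_zero.1 h0)
    · exact Or.inr (abs_eq_zero.1 h0)
  rcases abs_eq_abs.1 ha with h1 | h1 <;> rcases abs_eq_abs.1 hb with h2 | h2 <;> subst h1 <;>
    subst h2
  · simp
  · rw [smin_neg_right] at h key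
    rcases key (by linarith) with h | h
    · right; simp [h]
    · left; simp [neg_eq_zero.1 h]
  · rw [smin_neg_left] at h key
    rcases key (by linarith) with h | h
    · left; simp [neg_eq_zero.1 h]
    · right; simp [h]
  · simp

/-- The developing map of the flat structure on the boundary of the octahedron. -/
noncomputable def dev (p : ℝ × ℝ) : ℝ × ℝ × ℝ :=
  (|saw p.1| - |saw p.2|, smin (csaw p.1) (csaw p.2), smin (saw p.1) (saw p.2))

@[fun_prop]
theorem continuous_dev : Continuous dev := by unfold dev smin; fun_prop

/-- The `ℓ¹`-norm. -/
def norm1 (v : ℝ × ℝ × ℝ) : ℝ := |v.1| + |v.2.1| + |v.2.2|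

@[fun_prop]
theorem continuous_norm1 : Continuous norm1 := by unfold norm1; fun_prop

/-- With `a = |saw x|` and `b = |saw y|` this is `|a - b| + (1 - max a b) + min a b = 1`. -/
theorem norm1_dev (p : ℝ × ℝ) : norm1 (dev p) = 1 := by
  simp only [norm1, dev, abs_smin, abs_csaw]
  simp only [abs_eq_max_neg, max_def, min_def]; split_ifs <;> linarith

theorem dev_neg (p : ℝ × ℝ) : dev (-p) = dev p := by
  simp [dev, saw_neg, csaw_neg, smin_neg_left, smin_neg_right]

theorem dev_add_lattice (x y : ℝ) {a b : ℤ} (h : Even (a + b)) :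
    dev (x + 2 * a, y + 2 * b) = dev (x, y) := by
  obtain ⟨n, hn⟩ := h
  have e1 : ∀ (x y : ℝ) (n : ℤ), dev (x + 4 * n, y) = dev (x, y) := by
    intro x y n; simp [dev, saw_add_four_mul, csaw_add_four_mul]
  have hx : x + 2 * a = x - 2 * b + 4 * n := by
    have : (a : ℝ) + b = n + n := by exact_mod_cast hn
    linarith
  rw [hx, e1]
  rcases Int.even_or_odd' b with ⟨k, rfl | rfl⟩
  · have := saw_add_four_mul x (-k)
    have h1 := saw_add_four_mul y k
    have h2 := csaw_add_four_mul x (-k)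
    have h3 := csaw_add_four_mul y k
    push_cast at *
    simp only [dev, show x - 2 * (2 * (k : ℝ)) = x + 4 * -k by ring,
      show y + 2 * (2 * (k : ℝ)) = y + 4 * k by ring, *]
  · have h1 := saw_add_four_mul (x + 2) (-k - 1)
    have h2 := saw_add_four_mul (y + 2) k
    have h3 := csaw_add_four_mul (x + 2) (-k - 1)
    have h4 := csaw_add_four_mul (y + 2) k
    push_cast at *
    rw [saw_add_two] at h1 h2
    rw [csaw_add_two] at h3 h4
    simp only [dev, show x - 2 * (2 * (k : ℝ) + 1) = x + 2 + 4 * (-k - 1) by ring,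
      show y + 2 * (2 * (k : ℝ) + 1) = y + 2 + 4 * k by ring, h1, h2, h3, h4, abs_neg,
      smin_neg_left, smin_neg_right, neg_neg]

/-- Two points have the same image iff they differ by the group generated by `-1` and
a lattice. -/
theorem dev_eq_dev_iff {x y x' y' : ℝ} : dev (x, y) = dev (x', y') ↔
    ∃ (ε : ℝ) (a b : ℤ), (ε = 1 ∨ ε = -1) ∧ Even (a + b) ∧ x' = ε * x + 2 * a ∧
      y' = ε * y + 2 * b := by
  constructor
  · intro h
    have hX := congrArg (fun v => v.1) h
    have hY := congrArg (fun v => v.2.1) h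
    have hZ := congrArg (fun v => v.2.2) h
    simp only [dev] at hX hY hZ
    have hZ' := congrArg abs hZ
    rw [abs_smin, abs_smin] at hZ'
    have h1 : |saw x| = |saw x'| ∧ |saw y| = |saw y'| := by
      rcases min_cases |saw x| |saw y| with ⟨h1, h2⟩ | ⟨h1, h2⟩ <;>
      rcases min_cases |saw x'| |saw y'| with ⟨h3, h4⟩ | ⟨h3, h4⟩ <;>
      constructor <;> linarith
    have h2 := smin_injective h1.1 h1.2 hZ
    have h3 := smin_injective (by rw [abs_csaw, abs_csaw, h1.1]) (by rw [abs_csaw, abs_csaw, h1.2]) hY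
    -- Up to translations by `4` in either variable, the four sign patterns of the sawtooth pairs
    -- are the identity, `(2 - x, 2 - y)`, `(-x, -y)` and `(x + 2, y + 2)`.
    rcases h2 with ⟨a1, a2⟩ | ⟨a1, a2⟩ <;> rcases h3 with ⟨b1, b2⟩ | ⟨b1, b2⟩
    · obtain ⟨n, hn⟩ := exists_of_saw_eq a1.symm b1.symm
      obtain ⟨k, hk⟩ := exists_of_saw_eq a2.symm b2.symm
      exact ⟨1, 2 * n, 2 * k, Or.inl rfl, ⟨n + k, by ring⟩, by rw [hn]; push_cast; ring,
        by rw [hk]; push_cast; ring⟩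
    · rw [← saw_two_sub x] at a1
      rw [← saw_two_sub y] at a2
      rw [← csaw_two_sub] at b1 b2
      obtain ⟨n, hn⟩ := exists_of_saw_eq a1.symm b1.symm
      obtain ⟨k, hk⟩ := exists_of_saw_eq a2.symm b2.symm
      exact ⟨-1, 2 * n + 1, 2 * k + 1, Or.inr rfl, ⟨n + k + 1, by ring⟩,
        by rw [hn]; push_cast; ring, by rw [hk]; push_cast; ring⟩
    · rw [← saw_neg] at a1 a2
      rw [← csaw_neg x] at b1
      rw [← csaw_neg y] at b2
      obtain ⟨n, hn⟩ := exists_of_saw_eq a1.symm b1.symm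
      obtain ⟨k, hk⟩ := exists_of_saw_eq a2.symm b2.symm
      exact ⟨-1, 2 * n, 2 * k, Or.inr rfl, ⟨n + k, by ring⟩,
        by rw [hn]; push_cast; ring, by rw [hk]; push_cast; ring⟩
    · rw [← saw_add_two] at a1 a2
      rw [← csaw_add_two] at b1 b2
      obtain ⟨n, hn⟩ := exists_of_saw_eq a1.symm b1.symm
      obtain ⟨k, hk⟩ := exists_of_saw_eq a2.symm b2.symm
      exact ⟨1, 2 * n + 1, 2 * k + 1, Or.inl rfl, ⟨n + k + 1, by ring⟩,
        by rw [hn]; push_cast; ring, by rw [hk]; push_cast; ring⟩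
  · rintro ⟨ε, a, b, rfl | rfl, hab, rfl, rfl⟩
    · rw [dev_add_lattice _ _ hab]; simp
    · rw [dev_add_lattice _ _ hab, ← dev_neg]; simp

/-- The antipodal map lifts to the plane with linear part the exchange of the coordinates.
Conjugation by it turns shears along `x` into shears along `y`. -/
theorem neg_dev (x y : ℝ) : - dev (x, y) = dev (y + 2, x) := by
  simp only [dev, saw_add_two, csaw_add_two, smin_neg_left, abs_neg, smin_comm (csaw y),
    smin_comm (saw y), Prod.neg_mk, neg_sub]

/-- The symmetry exchanging the two sides. -/
def swapSides (v : ℝ × ℝ × ℝ) : ℝ × ℝ × ℝ := (-v.1, -v.2.2, -v.2.1)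

theorem swapSides_dev (x y : ℝ) : swapSides (dev (x, y)) = dev (x + 1, y - 1) := by
  simp only [dev, swapSides, csaw_add_one, csaw_sub_one, saw_sub_one, smin_neg_left, smin_neg_right,
    abs_neg, abs_csaw]
  rw [show saw (x + 1) = csaw x from rfl, abs_csaw]
  ext1 <;> simp


/-! ### The twist of the octahedron -/

/-- Coordinates on the octahedron: `y` is the slice, `g` the distance from the core of the slice,
and `x` the angle. -/
noncomputable def slice (x g y : ℝ) : ℝ × ℝ × ℝ :=
  (|(1 - g) * (-5 / 6) + g * saw x| - y, g * smin (csaw x) (1 - y),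
    smin ((1 - g) * (-5 / 6) + g * saw x) y)

/-- For fixed `y`, the slice is the image of the disc of the pairs `(u, Y)` with `|Y| ≤ min (1 -
|u|) (1 - y)`, where `u` is a signed version of `|Z| + max X 0`. The parameter `g` is the factor of
a homothety towards the core `(-5/6, 0)`; at `g = 1` the boundary is reached, with `u = saw x`. The
value `-5/6` is matched to the bends of the branch line. -/
theorem slice_one {x y : ℝ} (h0 : 0 ≤ y) (h1 : y ≤ 1) : slice x 1 y = dev (x, y) := by
  simp only [slice, dev, saw_of_mem (show -1 ≤ y by linarith) h1,
    csaw_of_mem (show -1 ≤ y by linarith) h1, abs_of_nonneg h0]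
  norm_num

theorem slice_add_four_mul (x g y : ℝ) (n : ℤ) : slice (x + 4 * n) g y = slice x g y := by
  simp only [slice, saw_add_four_mul, csaw_add_four_mul]

theorem slice_zero (x x' y : ℝ) : slice x 0 y = slice x' 0 y := by
  simp [slice]

theorem abs_core_le (x : ℝ) {g : ℝ} (h0 : 0 ≤ g) (h1 : g ≤ 1) :
    |(1 - g) * (-5 / 6) + g * saw x| ≤ 1 - g * (1 - |saw x|) ∧
      g * (1 - |saw x|) ≤ 1 - |(1 - g) * (-5 / 6) + g * saw x| := by
  have h2 := neg_abs_le (saw x)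
  have h3 := le_abs_self (saw x)
  constructor
  · rw [abs_le]; constructor <;> nlinarith
  · rw [le_sub_comm, abs_le]; constructor <;> nlinarith

theorem norm1_slice_le (x : ℝ) {g y : ℝ} (hg0 : 0 ≤ g) (hg1 : g ≤ 1) (h0 : 0 ≤ y) (h1 : y ≤ 1) :
    norm1 (slice x g y) ≤ 1 := by
  obtain ⟨h2, h3⟩ := abs_core_le x hg0 hg1
  simp only [norm1, slice, abs_smin, abs_mul, abs_csaw, abs_of_nonneg hg0,
    abs_of_nonneg (sub_nonneg.2 h1), abs_of_nonneg h0]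
  set u := |(1 - g) * (-5 / 6) + g * saw x|
  have h4 : g * min (1 - |saw x|) (1 - y) ≤ 1 - u :=
    (mul_le_mul_of_nonneg_left (min_le_left _ _) hg0).trans h3
  have h5 : g * min (1 - |saw x|) (1 - y) ≤ 1 - y :=
    (mul_le_mul_of_nonneg_left (min_le_right _ _) hg0).trans (by nlinarith)
  rcases abs_cases (u - y) with ⟨h, _⟩ | ⟨h, _⟩ <;> rw [h] <;>
  rcases min_cases u y with ⟨h', _⟩ | ⟨h', _⟩ <;> rw [h'] <;> linarith

/-- This inverts the formulas `X = |u| - y` and `Z = smin u y`: the modulus of `u` and the slice `y`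
are read off from `X` and `Z`. -/
theorem smin_abs_eq {u y : ℝ} (hy : 0 ≤ y) :
    |u| = |smin u y| + max (|u| - y) 0 ∧ y = |smin u y| + max (-(|u| - y)) 0 := by
  rw [abs_smin, abs_of_nonneg hy]
  constructor <;> simp only [max_def, min_def] <;> split_ifs <;> linarith

theorem exists_smin_eq (X Z : ℝ) : ∃ u, |u| = |Z| + max X 0 ∧
    smin u (|Z| + max (-X) 0) = Z := by
  have h1 : 0 ≤ max X 0 := le_max_right _ _
  have h2 : 0 ≤ max (-X) 0 := le_max_right _ _
  have h3 := abs_nonneg Z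
  have hmin : min (|Z| + max X 0) (|Z| + max (-X) 0) = |Z| := by
    simp only [max_def, min_def]; split_ifs <;> linarith
  rcases le_total 0 Z with h | h
  · refine ⟨|Z| + max X 0, abs_of_nonneg (by linarith), ?_⟩
    rw [smin_of_nonneg (by linarith) (by linarith), hmin, abs_of_nonneg h]
  · refine ⟨-(|Z| + max X 0), by rw [abs_neg, abs_of_nonneg (by linarith)], ?_⟩
    rw [smin_neg_left, smin_of_nonneg (by linarith) (by linarith), hmin, abs_of_nonpos h, neg_neg]

/-- `X` and `Z` give `u` and the slice `y`. It then remains to find the homothetic copy of the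
boundary of the slice on which `(u, Y)` lies. -/
theorem exists_slice {v : ℝ × ℝ × ℝ} (hv : norm1 v ≤ 1) : ∃ x g y, 0 ≤ g ∧ g ≤ 1 ∧ 0 ≤ y ∧ y ≤ 1 ∧
    slice x g y = v ∧ (norm1 v = 1 → g = 1) := by
  obtain ⟨X, Y, Z⟩ := v
  simp only [norm1] at hv
  obtain ⟨u, hu, hZ⟩ := exists_smin_eq X Z
  set y := |Z| + max (-X) 0 with hy
  have hZ0 := abs_nonneg Z
  have hY0 := abs_nonneg Y
  have hX0 : max X 0 = (|X| + X) / 2 := by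
    simp only [abs_eq_max_neg, max_def]; split_ifs <;> linarith
  have hX1 : max (-X) 0 = (|X| - X) / 2 := by
    simp only [abs_eq_max_neg, max_def]; split_ifs <;> linarith
  have hXa := abs_nonneg X
  have hXb := neg_abs_le X
  have hXc := le_abs_self X
  rw [hX0] at hu
  rw [hX1] at hy
  have hy0 : 0 ≤ y := by linarith
  have hy1 : |Y| ≤ 1 - y := by linarith
  have hu1 : |Y| ≤ 1 - |u| := by linarith
  have hua := neg_abs_le u
  have hub := le_abs_self u
  have hX : |u| - y = X := by linarith
  have build : ∀ s g, 0 ≤ g → g ≤ 1 → |s| ≤ 1 → (1 - g) * (-5 / 6) + g * s = u →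
      g * min (1 - |s|) (1 - y) = |Y| → ∃ x, slice x g y = (X, Y, Z) := by
    intro s g hg0 hg1 hs h1 h2
    have hs' := abs_le.1 hs
    have hc : 0 ≤ 1 - |s| := by linarith
    have hc' : 0 ≤ 1 - y := by linarith
    rcases le_total 0 Y with h | h
    · refine ⟨s, ?_⟩
      simp only [slice, saw_of_mem hs'.1 hs'.2, csaw_of_mem hs'.1 hs'.2, h1, hX, hZ,
        smin_of_nonneg hc hc', h2, abs_of_nonneg h]
    · refine ⟨2 - s, ?_⟩
      simp only [slice, saw_two_sub, csaw_two_sub, saw_of_mem hs'.1 hs'.2,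
        csaw_of_mem hs'.1 hs'.2, h1, hX, hZ, smin_neg_left, smin_of_nonneg hc hc', mul_neg, h2,
        abs_of_nonpos h, neg_neg]
  -- The top slice is a segment with `Y = 0`; all its points already occur for `g = 1`.
  by_cases hy2 : y = 1
  · have hY : |Y| = 0 := by linarith
    obtain ⟨x, hx⟩ := build u 1 zero_le_one le_rfl (by linarith) (by ring)
      (by rw [hy2, hY, sub_self, min_eq_right (by linarith), mul_zero])
    exact ⟨x, 1, y, by norm_num, le_rfl, hy0, by linarith, hx, fun _ => rfl⟩
  have hy3 : 0 < 1 - y := lt_of_le_of_ne (by linarith) fun h => hy2 (by linarith)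
  -- The least admissible factor. With `g * s = u + 5/6 * (1 - g)`, the three terms say `|Y| ≤ g *
  -- (1 - y)`, `|Y| ≤ g * (1 - s)` and `|Y| ≤ g * (1 + s)`; the one attaining the maximum is an
  -- equality, so the point lies on the boundary of the copy.
  set g := max (|Y| / (1 - y)) (max ((|Y| + u + 5 / 6) * (6 / 11)) ((|Y| - u - 5 / 6) * 6)) with hg
  have g1 : |Y| / (1 - y) ≤ g := le_max_left _ _
  have g2 : (|Y| + u + 5 / 6) * (6 / 11) ≤ g := (le_max_left _ _).trans (le_max_right _ _)
  have g3 : (|Y| - u - 5 / 6) * 6 ≤ g := (le_max_right _ _).trans (le_max_right _ _)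
  have g4 : g = |Y| / (1 - y) ∨ g = (|Y| + u + 5 / 6) * (6 / 11) ∨ g = (|Y| - u - 5 / 6) * 6 := by
    rcases max_choice (|Y| / (1 - y)) (max ((|Y| + u + 5 / 6) * (6 / 11)) ((|Y| - u - 5 / 6) * 6))
      with h | h
    · exact Or.inl h
    · rcases max_choice ((|Y| + u + 5 / 6) * (6 / 11)) ((|Y| - u - 5 / 6) * 6) with h' | h'
      · exact Or.inr (Or.inl (h.trans h'))
      · exact Or.inr (Or.inr (h.trans h'))
  have hg0 : 0 ≤ g := le_trans (by positivity) g1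
  have g1' : |Y| ≤ g * (1 - y) := by rwa [div_le_iff₀ hy3] at g1
  have hg1 : g ≤ 1 := by
    refine max_le ?_ (max_le ?_ ?_)
    · rw [div_le_one hy3]; exact hy1
    · linarith
    · linarith
  have hgY : norm1 (X, Y, Z) = 1 → g = 1 := by
    intro h
    simp only [norm1] at h
    refine le_antisymm hg1 ?_
    rcases le_total 0 X with h' | h'
    · rw [abs_of_nonneg h'] at h hu hX1
      rcases abs_cases u with ⟨h'', _⟩ | ⟨h'', _⟩ <;> linarith
    · have : |Y| = 1 - y := by rw [abs_of_nonpos h'] at h hy; linarith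
      rw [this, div_self hy3.ne'] at g1; exact g1
  rcases hg0.eq_or_lt with h | h
  · have hY : |Y| = 0 := by nlinarith
    obtain ⟨x, hx⟩ := build 0 0 le_rfl zero_le_one (by simp) (by linarith) (by rw [hY, zero_mul])
    rw [h] at hx
    exact ⟨x, g, y, hg0, hg1, hy0, by linarith, hx, hgY⟩
  · set s := (u - (1 - g) * (-5 / 6)) / g with hs
    have hgs : g * s = u - (1 - g) * (-5 / 6) := by rw [hs]; field_simp
    have e1 : |Y| ≤ g * (1 - s) := by linarith
    have e2 : |Y| ≤ g * (1 + s) := by linarith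
    have e3 : |Y| ≤ g * (1 - |s|) := by
      rcases abs_cases s with ⟨h', _⟩ | ⟨h', _⟩ <;> rw [h'] <;> linarith
    have hs1 : |s| ≤ 1 := by
      by_contra H
      nlinarith
    obtain ⟨x, hx⟩ := build s g hg0 hg1 hs1 (by linarith) (by
      refine le_antisymm ?_ ?_
      · rcases g4 with h' | h' | h'
        · refine (mul_le_mul_of_nonneg_left (min_le_right _ _) hg0).trans (le_of_eq ?_)
          rw [h', div_mul_cancel₀ _ hy3.ne']
        · refine (mul_le_mul_of_nonneg_left (min_le_left _ _) hg0).trans ?_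
          have : g * (1 - |s|) ≤ g * (1 - s) := by
            have := le_abs_self s
            gcongr
          linarith
        · refine (mul_le_mul_of_nonneg_left (min_le_left _ _) hg0).trans ?_
          have : g * (1 - |s|) ≤ g * (1 + s) := by
            have := neg_abs_le s
            apply mul_le_mul_of_nonneg_left _ hg0
            linarith
          linarith
      · rcases min_choice (1 - |s|) (1 - y) with h' | h' <;> rw [h'] <;> assumption)
    exact ⟨x, g, y, hg0, hg1, hy0, by linarith, hx, hgY⟩

/-- The amount of twisting. -/
noncomputable def twistAmount (g y : ℝ) : ℝ := max 0 (min (1 / 2 + (y - 1 / 2) / g ^ 2) 1)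

theorem twistAmount_one {y : ℝ} (h0 : 0 ≤ y) (h1 : y ≤ 1) : twistAmount 1 y = y := by
  unfold twistAmount; norm_num [h0, h1]

/-- All the twisting takes place for `|y - 1/2| < g² / 2`. This zone is the whole slab at `g = 1`
and is pinched to the point `y = 1/2` at the core, where a curve can pass from the untwisted side to
the fully twisted one through fixed points only. -/
theorem twistAmount_eq_zero {g y : ℝ} (hg : 0 < g) (h : y ≤ (1 - g ^ 2) / 2) :
    twistAmount g y = 0 := by
  unfold twistAmount
  refine max_eq_left ((min_le_left _ _).trans ?_)
  have : (y - 1 / 2) / g ^ 2 ≤ -1 / 2 := by rw [div_le_iff₀ (by positivity)]; linarith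
  linarith

theorem twistAmount_eq_one {g y : ℝ} (hg : 0 < g) (h : 1 - y ≤ (1 - g ^ 2) / 2) :
    twistAmount g y = 1 := by
  unfold twistAmount
  have : 1 / 2 ≤ (y - 1 / 2) / g ^ 2 := by rw [le_div_iff₀ (by positivity)]; linarith
  rw [min_eq_right (by linarith), max_eq_right zero_le_one]

/-- The twist, in the coordinates `x, g, y`. -/
noncomputable def sliceTwist (τ : ℤ) (q : ℝ × ℝ × ℝ) : ℝ × ℝ × ℝ :=
  slice (q.1 + 4 * (τ * twistAmount q.2.1 q.2.2)) q.2.1 q.2.2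

/-- The twist amount is discontinuous at the pinching point, but the angle enters `slice` only
through bounded functions multiplied by `g`. -/
theorem continuousOn_sliceTwist (τ : ℤ) : Continuous (sliceTwist τ) := by
  have key : ∀ φ : ℝ × ℝ → ℝ, Continuous φ → (∃ C, ∀ p, |φ p| ≤ C) →
      Continuous fun q : ℝ × ℝ × ℝ =>
        q.2.1 * φ (q.1 + 4 * (τ * twistAmount q.2.1 q.2.2), q.2.2) := by
    rintro φ hφ ⟨C, hC⟩
    rw [continuous_iff_continuousAt]
    rintro ⟨x, g, y⟩
    by_cases hg : g = 0
    · subst hg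
      have hl : Filter.Tendsto (fun q : ℝ × ℝ × ℝ => |q.2.1| * C) (𝓝 (x, 0, y)) (𝓝 0) := by
        have : Continuous fun q : ℝ × ℝ × ℝ => |q.2.1| * C := by fun_prop
        simpa using this.tendsto (x, 0, y)
      have : Filter.Tendsto (fun q : ℝ × ℝ × ℝ =>
          q.2.1 * φ (q.1 + 4 * (τ * twistAmount q.2.1 q.2.2), q.2.2)) (𝓝 (x, 0, y)) (𝓝 0) := by
        refine squeeze_zero_norm (fun q => ?_) hl
        rw [Real.norm_eq_abs, abs_mul]
        exact mul_le_mul_of_nonneg_left (hC _) (abs_nonneg _)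
      simpa [ContinuousAt] using this
    · have h1 : ContinuousAt (fun q : ℝ × ℝ × ℝ => twistAmount q.2.1 q.2.2) (x, g, y) := by
        unfold twistAmount
        refine ContinuousAt.sup continuousAt_const (ContinuousAt.inf ?_ continuousAt_const)
        exact continuousAt_const.add (ContinuousAt.div (by fun_prop) (by fun_prop) (by simpa))
      refine ContinuousAt.mul (by fun_prop) (ContinuousAt.comp (g := φ) hφ.continuousAt ?_)
      fun_prop
  have k1 := key (fun p => saw p.1) (by fun_prop) ⟨1, fun p => abs_saw_le _⟩
  have k2 := key (fun p => smin (csaw p.1) (1 - p.2)) (by unfold smin; fun_prop)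
    ⟨1, fun p => by
      rw [abs_smin]
      exact (min_le_left _ _).trans (by rw [abs_csaw]; linarith [abs_nonneg (saw p.1)])⟩
  simp only at k1 k2
  unfold sliceTwist slice
  refine Continuous.prodMk ?_ (Continuous.prodMk k2 ?_)
  · fun_prop
  · unfold smin; fun_prop

theorem sliceTwist_zero (q : ℝ × ℝ × ℝ) : sliceTwist 0 q = slice q.1 q.2.1 q.2.2 := by
  simp [sliceTwist]

/-- On the bottom slice `u` and `-u` give the same point, and a rotation would not respect this
folding. There the twist amount is zero; on the top slice it is one, a full turn. -/
theorem sliceTwist_bot (τ : ℤ) (x : ℝ) {g : ℝ} (h0 : 0 ≤ g) (h1 : g ≤ 1) :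
    sliceTwist τ (x, g, 0) = slice x g 0 := by
  rcases h0.eq_or_lt with rfl | h
  · exact slice_zero _ _ _
  · simp [sliceTwist, twistAmount_eq_zero h (show (0 : ℝ) ≤ (1 - g ^ 2) / 2 by nlinarith)]

theorem sliceTwist_top (τ : ℤ) (x : ℝ) {g : ℝ} (h0 : 0 ≤ g) (h1 : g ≤ 1) :
    sliceTwist τ (x, g, 1) = slice x g 1 := by
  rcases h0.eq_or_lt with rfl | h
  · exact slice_zero _ _ _
  · rw [sliceTwist]
    simp only [twistAmount_eq_one h (show (1 : ℝ) - 1 ≤ (1 - g ^ 2) / 2 by nlinarith), mul_one]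
    exact slice_add_four_mul _ _ _ _

/-- Well-definedness of the twist. The bottom and top slices are fixed; in between, the point
determines `u`, `Y` and `y`, then `g` because a larger homothetic copy surrounds a smaller one, and
finally the angle modulo `4` unless `g = 0`. -/
theorem sliceTwist_congr (τ : ℤ) {x g y x' g' y' : ℝ} (hg0 : 0 ≤ g) (hg1 : g ≤ 1) (hg0' : 0 ≤ g')
    (hg1' : g' ≤ 1) (h0 : 0 ≤ y) (h1 : y ≤ 1) (h0' : 0 ≤ y') (h : slice x g y = slice x' g' y') :
    sliceTwist τ (x, g, y) = sliceTwist τ (x', g', y') := by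
  have hX := congrArg (fun v => v.1) h
  have hY := congrArg (fun v => v.2.1) h
  have hZ := congrArg (fun v => v.2.2) h
  simp only [slice] at hX hY hZ
  have hy := (smin_abs_eq (u := (1 - g) * (-5 / 6) + g * saw x) h0).2
  have hu := (smin_abs_eq (u := (1 - g) * (-5 / 6) + g * saw x) h0).1
  have hy' := (smin_abs_eq (u := (1 - g') * (-5 / 6) + g' * saw x') h0').2
  have hu' := (smin_abs_eq (u := (1 - g') * (-5 / 6) + g' * saw x') h0').1
  rw [hX, hZ] at hy hu
  obtain rfl : y = y' := hy.trans hy'.symm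
  rcases h0.eq_or_lt with rfl | h0
  · rw [sliceTwist_bot _ _ hg0 hg1, sliceTwist_bot _ _ hg0' hg1', h]
  rcases h1.eq_or_lt with rfl | h1
  · rw [sliceTwist_top _ _ hg0 hg1, sliceTwist_top _ _ hg0' hg1', h]
  have hus := smin_injective (hu.trans hu'.symm) rfl hZ
  replace hus : (1 - g') * (-5 / 6) + g' * saw x' = (1 - g) * (-5 / 6) + g * saw x := by
    rcases hus with h | h
    · exact h.1
    · linarith [h.2]
  have hYa := congrArg abs hY
  rw [abs_mul, abs_mul, abs_smin, abs_smin, abs_csaw, abs_csaw, abs_of_nonneg hg0,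
    abs_of_nonneg hg0', abs_of_pos (sub_pos.2 h1)] at hYa
  -- On a vertical line `u = const`, the height of the homothetic copy increases strictly with the
  -- factor, because the core lies strictly inside the slice.
  have hmono : ∀ {x g x' g' : ℝ}, 0 ≤ g → g < g' →
      (1 - g') * (-5 / 6) + g' * saw x' = (1 - g) * (-5 / 6) + g * saw x →
      g * min (1 - |saw x|) (1 - y) < g' * min (1 - |saw x'|) (1 - y) := by
    intro x g x' g' hg hlt he
    have hg' : 0 < g' := hg.trans_lt hlt
    rw [mul_min_of_nonneg _ _ hg, mul_min_of_nonneg _ _ hg'.le]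
    refine lt_min ((min_le_left _ _).trans_lt ?_) ((min_le_right _ _).trans_lt ?_)
    · have e1 : g * |saw x| = |g * saw x| := by rw [abs_mul, abs_of_nonneg hg]
      have e2 : g' * |saw x'| = |g' * saw x'| := by rw [abs_mul, abs_of_nonneg hg'.le]
      rw [mul_sub, mul_sub, e1, e2]
      rcases abs_cases (g * saw x) with ⟨h, _⟩ | ⟨h, _⟩ <;>
        rcases abs_cases (g' * saw x') with ⟨h', _⟩ | ⟨h', _⟩ <;> rw [h, h'] <;> linarith
    · nlinarith
  obtain rfl : g = g' := by
    rcases lt_trichotomy g g' with hlt | heq | hlt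
    · exact absurd hYa (hmono hg0 hlt hus).ne
    · exact heq
    · exact absurd hYa (hmono hg0' hlt hus.symm).ne'
  rcases hg0.eq_or_lt with rfl | hg
  · exact slice_zero _ _ _
  have hs : saw x = saw x' := mul_left_cancel₀ hg.ne' (by linarith)
  have hc : csaw x = csaw x' := by
    have := smin_injective (by rw [abs_csaw, abs_csaw, hs]) rfl (mul_left_cancel₀ hg.ne' hY)
    rcases this with h | h
    · exact h.1.symm
    · linarith [h.2]
  obtain ⟨n, rfl⟩ := exists_of_saw_eq hs hc
  simp only [sliceTwist]
  rw [add_right_comm, slice_add_four_mul]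

/-- The twist of the octahedron. -/
noncomputable def twistIn (τ : ℤ) (v : ℝ × ℝ × ℝ) : ℝ × ℝ × ℝ :=
  open Classical in
  if h : norm1 v ≤ 1 then
    sliceTwist τ ((exists_slice h).choose, (exists_slice h).choose_spec.choose,
      (exists_slice h).choose_spec.choose_spec.choose)
  else v

theorem twistIn_slice (τ : ℤ) (x : ℝ) {g y : ℝ} (hg0 : 0 ≤ g) (hg1 : g ≤ 1) (h0 : 0 ≤ y)
    (h1 : y ≤ 1) : twistIn τ (slice x g y) = sliceTwist τ (x, g, y) := by
  have h := norm1_slice_le x hg0 hg1 h0 h1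
  rw [twistIn, dif_pos h]
  obtain ⟨a1, a2, a3, a4, a5, -⟩ := (exists_slice h).choose_spec.choose_spec.choose_spec
  exact sliceTwist_congr τ a1 a2 hg0 hg1 a3 a4 h0 a5

theorem sliceTwist_eq (τ : ℤ) (x g y : ℝ) :
    sliceTwist τ (x, g, y) = slice (x + 4 * (τ * twistAmount g y)) g y := rfl

theorem twistIn_zero {v : ℝ × ℝ × ℝ} (hv : norm1 v ≤ 1) : twistIn 0 v = v := by
  obtain ⟨x, g, y, hg0, hg1, h0, h1, rfl, -⟩ := exists_slice hv
  rw [twistIn_slice _ _ hg0 hg1 h0 h1, sliceTwist_zero]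

theorem norm1_twistIn_le (τ : ℤ) {v : ℝ × ℝ × ℝ} (hv : norm1 v ≤ 1) : norm1 (twistIn τ v) ≤ 1 := by
  obtain ⟨x, g, y, hg0, hg1, h0, h1, rfl, -⟩ := exists_slice hv
  rw [twistIn_slice _ _ hg0 hg1 h0 h1]
  exact norm1_slice_le _ hg0 hg1 h0 h1

theorem twistIn_twistIn (τ τ' : ℤ) {v : ℝ × ℝ × ℝ} (hv : norm1 v ≤ 1) :
    twistIn τ (twistIn τ' v) = twistIn (τ + τ') v := by
  obtain ⟨x, g, y, hg0, hg1, h0, h1, rfl, -⟩ := exists_slice hv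
  rw [twistIn_slice _ _ hg0 hg1 h0 h1, twistIn_slice _ _ hg0 hg1 h0 h1, sliceTwist_eq,
    twistIn_slice _ _ hg0 hg1 h0 h1, sliceTwist_eq, sliceTwist_eq]
  congr 1; push_cast; ring

theorem twistIn_dev (τ : ℤ) (x : ℝ) {y : ℝ} (h0 : 0 ≤ y) (h1 : y ≤ 1) :
    twistIn τ (dev (x, y)) = dev (x + 4 * (τ * y), y) := by
  rw [← slice_one h0 h1, twistIn_slice _ _ zero_le_one le_rfl h0 h1, sliceTwist_eq,
    twistAmount_one h0 h1, slice_one h0 h1]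

/-- The developing map is onto, already on a strip. -/
theorem exists_dev_eq {v : ℝ × ℝ × ℝ} (hv : norm1 v = 1) :
    ∃ x y, 0 ≤ y ∧ y ≤ 1 ∧ dev (x, y) = v := by
  obtain ⟨x, g, y, -, -, h0, h1, h, hg⟩ := exists_slice hv.le
  obtain rfl := hg hv
  exact ⟨x, y, h0, h1, by rw [← slice_one h0 h1, h]⟩

theorem norm1_twistIn_eq_one (τ : ℤ) {v : ℝ × ℝ × ℝ} (hv : norm1 v = 1) :
    norm1 (twistIn τ v) = 1 := by
  obtain ⟨x, y, h0, h1, rfl⟩ := exists_dev_eq hv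
  rw [twistIn_dev _ _ h0 h1, norm1_dev]

/-- Near the centre `y ≤ 1/20` and `g ≤ 3/5`, which is outside the twisting zone. After inversion
this is what makes the twist trivial near infinity. -/
theorem twistIn_of_small (τ : ℤ) {v : ℝ × ℝ × ℝ} (hv : norm1 v ≤ 1 / 20) : twistIn τ v = v := by
  obtain ⟨x, g, y, hg0, hg1, h0, h1, rfl, -⟩ := exists_slice (hv.trans (by norm_num))
  rw [twistIn_slice _ _ hg0 hg1 h0 h1]
  rcases hg0.eq_or_lt with rfl | hg
  · exact slice_zero _ _ _
  simp only [norm1, slice, abs_mul, abs_of_nonneg hg0] at hv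
  rw [abs_smin, abs_csaw, abs_of_nonneg (sub_nonneg.2 h1)] at hv
  set u := (1 - g) * (-5 / 6) + g * saw x with hu
  have a1 := abs_nonneg (|u| - y)
  have a2 := abs_nonneg (smin u y)
  obtain ⟨b1, b2⟩ := smin_abs_eq (u := u) h0
  have b3 : max (|u| - y) 0 ≤ |(|u| - y)| := max_le (le_abs_self _) a1
  have b4 : max (-(|u| - y)) 0 ≤ |(|u| - y)| := max_le (neg_le_abs _) a1
  have a3 : 0 ≤ g * min (1 - |saw x|) (1 - y) :=
    mul_nonneg hg0 (le_min (sub_nonneg.2 (abs_saw_le x)) (by linarith))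
  have hy : y ≤ 1 / 20 := by linarith
  have hu' : |u| ≤ 1 / 20 := by linarith
  have hu1 := abs_le.1 hu'
  have hg6 : g ≤ 3 / 5 := by
    by_contra H
    push Not at H
    have e1 : 1 / 10 < g * (1 - |saw x|) := by
      rw [mul_sub, ← abs_of_nonneg hg0, ← abs_mul, abs_of_nonneg hg0]
      rcases abs_cases (g * saw x) with ⟨h, _⟩ | ⟨h, _⟩ <;> rw [h] <;> linarith
    have e2 : 1 / 10 < g * (1 - y) := by nlinarith
    have : 1 / 10 < g * min (1 - |saw x|) (1 - y) := by
      rcases min_choice (1 - |saw x|) (1 - y) with h' | h' <;> rw [h'] <;> assumption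
    linarith
  rw [sliceTwist_eq, twistAmount_eq_zero hg (by nlinarith)]
  simp

theorem twistIn_eq_zero (τ : ℤ) {v : ℝ × ℝ × ℝ} (hv : norm1 v ≤ 1) : twistIn τ v = 0 ↔ v = 0 := by
  have h0 : ∀ τ, twistIn τ 0 = 0 := fun τ => twistIn_of_small τ (by simp [norm1])
  refine ⟨fun h => ?_, fun h => by rw [h, h0]⟩
  have := congrArg (twistIn (-τ)) h
  rwa [twistIn_twistIn _ _ hv, neg_add_cancel, twistIn_zero hv, h0] at this

/-- A continuous map from a compact set to a Hausdorff space is closed onto its image, hence a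
quotient map: continuity can be tested upstairs. -/
theorem continuousOn_image_of_isCompact {α β γ : Type*} [TopologicalSpace α] [TopologicalSpace β]
    [T2Space β] [TopologicalSpace γ] {K : Set α} (hK : IsCompact K) {φ : α → β} (hφ : Continuous φ)
    {f : β → γ} (hf : ContinuousOn (f ∘ φ) K) : ContinuousOn f (φ '' K) := by
  rw [continuousOn_iff_isClosed]
  intro C hC
  obtain ⟨D, hD, hDK⟩ := (continuousOn_iff_isClosed.1 hf) C hC
  refine ⟨φ '' (D ∩ K), ((hK.inter_left hD).image hφ).isClosed, ?_⟩
  rw [← hDK]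
  ext b
  constructor
  · rintro ⟨h1, a, ha, rfl⟩
    exact ⟨⟨a, ⟨h1, ha⟩, rfl⟩, a, ha, rfl⟩
  · rintro ⟨⟨a, ⟨h1, ha⟩, rfl⟩, -⟩
    exact ⟨h1, a, ha, rfl⟩

theorem continuous_slice : Continuous fun q : ℝ × ℝ × ℝ => slice q.1 q.2.1 q.2.2 := by
  unfold slice smin; fun_prop

theorem continuousOn_twistIn (τ : ℤ) : ContinuousOn (twistIn τ) {v | norm1 v ≤ 1} := by
  have hK : IsCompact (Set.Icc (0 : ℝ) 4 ×ˢ Set.Icc (0 : ℝ) 1 ×ˢ Set.Icc (0 : ℝ) 1) :=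
    isCompact_Icc.prod (isCompact_Icc.prod isCompact_Icc)
  refine (continuousOn_image_of_isCompact hK continuous_slice (f := twistIn τ) ?_).mono ?_
  · refine (continuousOn_sliceTwist τ).continuousOn.congr ?_
    rintro ⟨x, g, y⟩ ⟨-, hg, hy⟩
    exact twistIn_slice τ x hg.1 hg.2 hy.1 hy.2
  · intro v hv
    obtain ⟨x, g, y, hg0, hg1, h0, h1, rfl, -⟩ := exists_slice hv
    refine ⟨(x + 4 * (-⌊x / 4⌋ : ℤ), g, y), ⟨⟨?_, ?_⟩, ⟨hg0, hg1⟩, h0, h1⟩,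
      slice_add_four_mul _ _ _ _⟩
    · have := Int.floor_le (x / 4); push_cast; linarith
    · have := Int.lt_floor_add_one (x / 4); push_cast; linarith

/-! ### The twist of the whole space -/

/-- An involution exchanging the inside and the outside of the octahedron. -/
noncomputable def inversion1 (v : ℝ × ℝ × ℝ) : ℝ × ℝ × ℝ := (norm1 v ^ 2)⁻¹ • swapSides v

theorem norm1_nonneg (v : ℝ × ℝ × ℝ) : 0 ≤ norm1 v := by unfold norm1; positivity

theorem norm1_smul (r : ℝ) (v : ℝ × ℝ × ℝ) : norm1 (r • v) = |r| * norm1 v := by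
  simp only [norm1, Prod.smul_fst, Prod.smul_snd, smul_eq_mul, abs_mul]; ring

theorem norm1_neg (v : ℝ × ℝ × ℝ) : norm1 (-v) = norm1 v := by simp [norm1]

theorem norm1_eq_zero {v : ℝ × ℝ × ℝ} : norm1 v = 0 ↔ v = 0 := by
  refine ⟨fun h => ?_, fun h => by simp [h, norm1]⟩
  unfold norm1 at h
  have h1 := abs_nonneg v.1
  have h2 := abs_nonneg v.2.1
  have h3 := abs_nonneg v.2.2
  ext
  · exact abs_eq_zero.1 (by linarith)
  · exact abs_eq_zero.1 (by linarith)
  · exact abs_eq_zero.1 (by linarith)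

theorem norm1_swapSides (v : ℝ × ℝ × ℝ) : norm1 (swapSides v) = norm1 v := by
  simp [norm1, swapSides]; ring

theorem norm1_inversion1 (v : ℝ × ℝ × ℝ) : norm1 (inversion1 v) = (norm1 v)⁻¹ := by
  rw [inversion1, norm1_smul, norm1_swapSides, abs_inv, abs_of_nonneg (by positivity)]
  by_cases h : norm1 v = 0
  · simp [h]
  · field_simp

theorem swapSides_smul (r : ℝ) (v : ℝ × ℝ × ℝ) : swapSides (r • v) = r • swapSides v := by
  simp [swapSides]

theorem swapSides_swapSides (v : ℝ × ℝ × ℝ) : swapSides (swapSides v) = v := by simp [swapSides]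

theorem inversion1_inversion1 {v : ℝ × ℝ × ℝ} (hv : v ≠ 0) : inversion1 (inversion1 v) = v := by
  have h : norm1 v ≠ 0 := fun h => hv (norm1_eq_zero.1 h)
  conv_lhs => rw [inversion1]
  rw [norm1_inversion1, inversion1, swapSides_smul, swapSides_swapSides, smul_smul]
  have : (((norm1 v)⁻¹ ^ 2)⁻¹ * (norm1 v ^ 2)⁻¹) = 1 := by field_simp
  rw [this, one_smul]

theorem inversion1_of_norm1_eq_one {v : ℝ × ℝ × ℝ} (hv : norm1 v = 1) :
    inversion1 v = swapSides v := by simp [inversion1, hv]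

theorem inversion1_ne_zero {v : ℝ × ℝ × ℝ} (hv : v ≠ 0) : inversion1 v ≠ 0 := by
  rw [Ne, ← norm1_eq_zero, norm1_inversion1, inv_eq_zero, norm1_eq_zero]; exact hv

/-- The twist of the whole space. -/
noncomputable def twist (τ : ℤ) (v : ℝ × ℝ × ℝ) : ℝ × ℝ × ℝ :=
  open Classical in
  if norm1 v ≤ 1 then twistIn τ v else inversion1 (twistIn τ (inversion1 v))

theorem twist_of_le (τ : ℤ) {v : ℝ × ℝ × ℝ} (hv : norm1 v ≤ 1) : twist τ v = twistIn τ v :=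
  if_pos hv

/-- The inner twist and its conjugate by the exchange of sides agree on the octahedron boundary: the
exchange maps `y` to `1 - y` up to the group, and the resulting shears differ by the translation
`4τ` of the lattice. So the two halves of `twist` fit together. -/
theorem twistIn_swapSides_dev (τ : ℤ) (x : ℝ) {y : ℝ} (h0 : 0 ≤ y) (h1 : y ≤ 1) :
    swapSides (twistIn τ (swapSides (dev (x, y)))) = dev (x + 4 * (τ * y), y) := by
  rw [swapSides_dev, ← dev_neg, Prod.neg_mk, twistIn_dev _ _ (by linarith) (by linarith),
    swapSides_dev, dev_eq_dev_iff]
  exact ⟨-1, 2 * τ, 0, Or.inr rfl, by simp, by push_cast; ring, by push_cast; ring⟩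

theorem twist_of_ge (τ : ℤ) {v : ℝ × ℝ × ℝ} (hv : 1 ≤ norm1 v) :
    twist τ v = inversion1 (twistIn τ (inversion1 v)) := by
  rcases hv.eq_or_lt with h | h
  · rw [twist_of_le _ h.symm.le]
    obtain ⟨x, y, h0, h1, rfl⟩ := exists_dev_eq h.symm
    rw [inversion1_of_norm1_eq_one h.symm, inversion1_of_norm1_eq_one, twistIn_swapSides_dev _ _ h0 h1,
      twistIn_dev _ _ h0 h1]
    exact norm1_twistIn_eq_one _ (by rw [norm1_swapSides, ← h])
  · exact if_neg (not_le.2 h)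

/-- The group moves every `y` into `[0, 1]`, where the formula is `twistIn_dev`; it holds everywhere
because the shear by `4τ` normalises the group. -/
theorem twist_dev (τ : ℤ) (x y : ℝ) : twist τ (dev (x, y)) = dev (x + 4 * (τ * y), y) := by
  rw [twist_of_le _ (norm1_dev _).le]
  obtain ⟨k, r, h1, h2, rfl⟩ := exists_near_even y
  have e1 : dev (x, r + 2 * k) = dev (x - 2 * k, r) := by
    rw [dev_eq_dev_iff]
    exact ⟨1, -k, -k, Or.inl rfl, ⟨-k, rfl⟩, by push_cast; ring, by push_cast; ring⟩
  rw [e1]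
  rcases le_total 0 r with h | h
  · rw [twistIn_dev _ _ h h2, dev_eq_dev_iff]
    exact ⟨1, k + 4 * (τ * k), k, Or.inl rfl, ⟨k + 2 * (τ * k), by ring⟩, by push_cast; ring,
      by ring⟩
  · rw [← dev_neg, Prod.neg_mk, twistIn_dev _ _ (by linarith) (by linarith), dev_eq_dev_iff]
    exact ⟨-1, k + 4 * (τ * k), k, Or.inr rfl, ⟨k + 2 * (τ * k), by ring⟩, by push_cast; ring,
      by ring⟩

theorem inversion1_facts {v : ℝ × ℝ × ℝ} (hv : 1 ≤ norm1 v) :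
    v ≠ 0 ∧ inversion1 v ≠ 0 ∧ norm1 (inversion1 v) ≤ 1 := by
  have h : v ≠ 0 := by
    rw [Ne, ← norm1_eq_zero]; linarith
  exact ⟨h, inversion1_ne_zero h, by rw [norm1_inversion1]; exact inv_le_one_of_one_le₀ hv⟩

theorem one_le_norm1_twist (τ : ℤ) {v : ℝ × ℝ × ℝ} (hv : 1 ≤ norm1 v) : 1 ≤ norm1 (twist τ v) := by
  obtain ⟨h1, h2, h3⟩ := inversion1_facts hv
  rw [twist_of_ge _ hv, norm1_inversion1]
  refine (one_le_inv₀ ?_).2 (norm1_twistIn_le τ h3)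
  refine lt_of_le_of_ne (norm1_nonneg _) fun h => h2 ?_
  rwa [eq_comm, norm1_eq_zero, twistIn_eq_zero _ h3] at h

theorem twist_twist (τ τ' : ℤ) (v : ℝ × ℝ × ℝ) : twist τ (twist τ' v) = twist (τ + τ') v := by
  rcases le_total (norm1 v) 1 with hv | hv
  · rw [twist_of_le _ hv, twist_of_le _ hv, twist_of_le _ (norm1_twistIn_le _ hv),
      twistIn_twistIn _ _ hv]
  · obtain ⟨h1, h2, h3⟩ := inversion1_facts hv
    rw [twist_of_ge _ (one_le_norm1_twist _ hv), twist_of_ge _ hv, twist_of_ge _ hv,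
      inversion1_inversion1, twistIn_twistIn _ _ h3]
    rwa [Ne, twistIn_eq_zero _ h3]

theorem twist_zero (v : ℝ × ℝ × ℝ) : twist 0 v = v := by
  rcases le_total (norm1 v) 1 with hv | hv
  · rw [twist_of_le _ hv, twistIn_zero hv]
  · obtain ⟨h1, h2, h3⟩ := inversion1_facts hv
    rw [twist_of_ge _ hv, twistIn_zero h3, inversion1_inversion1 h1]

theorem continuousOn_inversion1 : ContinuousOn inversion1 {0}ᶜ := by
  unfold inversion1
  refine ContinuousOn.smul (ContinuousOn.inv₀ (continuous_norm1.pow 2).continuousOn fun v hv => ?_) ?_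
  · exact pow_ne_zero 2 fun h => hv (norm1_eq_zero.1 h)
  · unfold swapSides; fun_prop

theorem continuous_twist (τ : ℤ) : Continuous (twist τ) := by
  have h1 : ContinuousOn (twist τ) {v | norm1 v ≤ 1} :=
    (continuousOn_twistIn τ).congr fun v hv => twist_of_le τ hv
  have h2 : ContinuousOn (twist τ) {v | 1 ≤ norm1 v} := by
    refine ContinuousOn.congr (f := fun v => inversion1 (twistIn τ (inversion1 v))) ?_
      fun v hv => twist_of_ge τ hv
    refine continuousOn_inversion1.comp (t := {0}ᶜ) ((continuousOn_twistIn τ).comp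
      (t := {v | norm1 v ≤ 1}) (continuousOn_inversion1.mono fun v hv => (inversion1_facts hv).1)
      fun v hv => (inversion1_facts hv).2.2) fun v hv => ?_
    have h := inversion1_facts hv
    exact fun H => h.2.1 ((twistIn_eq_zero τ h.2.2).1 H)
  rw [← continuousOn_univ]
  refine (h1.union_of_isClosed h2 (isClosed_le continuous_norm1 continuous_const)
    (isClosed_le continuous_const continuous_norm1)).mono fun v _ => (le_total (norm1 v) 1 : norm1 v ≤ 1 ∨ 1 ≤ norm1 v)

theorem twist_of_large (τ : ℤ) {v : ℝ × ℝ × ℝ} (hv : 20 ≤ norm1 v) : twist τ v = v := by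
  have hv1 : 1 ≤ norm1 v := by linarith
  rw [twist_of_ge _ hv1, twistIn_of_small, inversion1_inversion1 (inversion1_facts hv1).1]
  rw [norm1_inversion1, one_div]
  exact inv_anti₀ (by norm_num) hv

/-- The twist as a homeomorphism. -/
noncomputable def twistHomeo (τ : ℤ) : (ℝ × ℝ × ℝ) ≃ₜ (ℝ × ℝ × ℝ) where
  toFun := twist τ
  invFun := twist (-τ)
  left_inv v := by rw [twist_twist, neg_add_cancel, twist_zero]
  right_inv v := by rw [twist_twist, add_neg_cancel, twist_zero]
  continuous_toFun := continuous_twist τ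
  continuous_invFun := continuous_twist (-τ)

/-- The hyperbolic homeomorphism of the quotient. -/
noncomputable def quotHomeo : (ℝ × ℝ × ℝ) ≃ₜ (ℝ × ℝ × ℝ) :=
  ((Homeomorph.neg _).trans (twistHomeo 1)).trans ((Homeomorph.neg _).trans (twistHomeo 1))

theorem quotHomeo_apply (v : ℝ × ℝ × ℝ) : quotHomeo v = twist 1 (-(twist 1 (-v))) := rfl

/-- Shear, exchange of coordinates, shear, exchange: the matrices multiply to `(17, 4; 4, 1)`, and
the translations that remain lie in the lattice. -/
theorem quotHomeo_dev (x y : ℝ) :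
    quotHomeo (dev (x, y)) = dev (17 * x + 4 * y, 4 * x + y) := by
  rw [quotHomeo_apply, neg_dev, twist_dev, neg_dev, twist_dev, dev_eq_dev_iff]
  exact ⟨1, -5, -1, Or.inl rfl, ⟨-3, rfl⟩, by push_cast; ring, by push_cast; ring⟩

theorem quotHomeo_of_large {v : ℝ × ℝ × ℝ} (hv : 20 ≤ norm1 v) : quotHomeo v = v := by
  rw [quotHomeo_apply, twist_of_large 1 (v := -v) (by rwa [norm1_neg]), neg_neg,
    twist_of_large _ hv]


/-! ### The branch line -/

/-- Truncation to the interval `[a, b]`. -/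
noncomputable def ramp (a b t : ℝ) : ℝ := max a (min b t)

@[fun_prop]
theorem continuous_ramp (a b : ℝ) : Continuous (ramp a b) := by unfold ramp; fun_prop

theorem ramp_of_le {a b t : ℝ} (h : t ≤ a) : ramp a b t = a :=
  max_eq_left ((min_le_right _ _).trans h)

theorem ramp_of_ge {a b t : ℝ} (hab : a ≤ b) (h : b ≤ t) : ramp a b t = b := by
  rw [ramp, min_eq_left h, max_eq_right hab]

theorem ramp_of_mem {a b t : ℝ} (h1 : a ≤ t) (h2 : t ≤ b) : ramp a b t = t := by
  rw [ramp, min_eq_right h2, max_eq_right h1]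

theorem ramp_neg {a b : ℝ} (hab : a ≤ b) (t : ℝ) : ramp (-b) (-a) (-t) = - ramp a b t := by
  rcases le_total t a with h | h
  · rw [ramp_of_le h, ramp_of_ge (by linarith) (by linarith)]
  rcases le_total b t with h' | h'
  · rw [ramp_of_ge hab h', ramp_of_le (by linarith)]
  · rw [ramp_of_mem h h', ramp_of_mem (by linarith) (by linarith)]

/-- First coordinate of the branch line. -/
noncomputable def axisX (t : ℝ) : ℝ :=
  -1 / 16 * ramp (-16) (-(32 / 3)) t - 1 / 4 * ramp (-(32 / 3)) (-8) t +
    13 / 50 * ramp (-8) (-6) t + 4 / 25 * ramp (-6) (-3) t + 4 / 25 * ramp 3 6 t +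
    13 / 50 * ramp 6 8 t - 1 / 4 * ramp 8 (32 / 3) t - 1 / 16 * ramp (32 / 3) 16 t

/-- Second coordinate of the branch line. -/
noncomputable def axisY (t : ℝ) : ℝ :=
  9 / 25 * ramp (-8) (-6) t + 7 / 75 * ramp (-6) (-3) t - 1 / 3 * ramp (-3) 3 t +
    7 / 75 * ramp 3 6 t + 9 / 25 * ramp 6 8 t

@[fun_prop]
theorem continuous_axisX : Continuous axisX := by unfold axisX; fun_prop

@[fun_prop]
theorem continuous_axisY : Continuous axisY := by unfold axisY; fun_prop

theorem axisX_neg (t : ℝ) : axisX (-t) = - axisX t := by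
  have h1 := ramp_neg (show (3 : ℝ) ≤ 6 by norm_num) t
  have h2 := ramp_neg (show (6 : ℝ) ≤ 8 by norm_num) t
  have h3 := ramp_neg (show (8 : ℝ) ≤ 32 / 3 by norm_num) t
  have h4 := ramp_neg (show (32 / 3 : ℝ) ≤ 16 by norm_num) t
  have h5 := ramp_neg (show (3 : ℝ) ≤ 6 by norm_num) (-t)
  have h6 := ramp_neg (show (6 : ℝ) ≤ 8 by norm_num) (-t)
  have h7 := ramp_neg (show (8 : ℝ) ≤ 32 / 3 by norm_num) (-t)
  have h8 := ramp_neg (show (32 / 3 : ℝ) ≤ 16 by norm_num) (-t)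
  rw [neg_neg] at h5 h6 h7 h8
  unfold axisX
  rw [h1, h2, h3, h4, h5, h6, h7, h8]; ring

theorem axisY_neg (t : ℝ) : axisY (-t) = - axisY t := by
  have h1 := ramp_neg (show (3 : ℝ) ≤ 6 by norm_num) t
  have h2 := ramp_neg (show (6 : ℝ) ≤ 8 by norm_num) t
  have h3 := ramp_neg (show (-3 : ℝ) ≤ 3 by norm_num) t
  have h5 := ramp_neg (show (3 : ℝ) ≤ 6 by norm_num) (-t)
  have h6 := ramp_neg (show (6 : ℝ) ≤ 8 by norm_num) (-t)
  rw [neg_neg] at h3 h5 h6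
  unfold axisY
  rw [h1, h2, h3, h5, h6]; ring

/-- The curve is affine between its breakpoints. At `t = ∓3, ∓8, ∓16` it is at the vertices `±(0, 1,
0)`, `∓(1, 0, 0)`, `±(0, 0, 1)`. The other breakpoints are bends: `(-12/25, 18/25, 0)` of norm `6/5`
at `t = -6` and `(-1/3, 0, 1/2)` of norm `5/6` at `t = -32/3`, with their antipodes. -/
theorem axis_piece₀ {t : ℝ} (h : t ≤ -16) : axisX t = 0 ∧ axisY t = 0 := by
  constructor
  · rw [axisX]
    repeat rw [ramp_of_le (by linarith)]
    norm_num
  · rw [axisY]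
    repeat rw [ramp_of_le (by linarith)]
    norm_num

theorem axis_piece₁ {t : ℝ} (h : -16 ≤ t) (h' : t ≤ -(32 / 3)) :
    axisX t = -(t + 16) / 16 ∧ axisY t = 0 := by
  constructor
  · rw [axisX, ramp_of_mem h h']
    repeat rw [ramp_of_le (by linarith)]
    ring
  · rw [axisY]
    repeat rw [ramp_of_le (by linarith)]
    norm_num

theorem axis_piece₂ {t : ℝ} (h : -(32 / 3) ≤ t) (h' : t ≤ -8) :
    axisX t = -3 - t / 4 ∧ axisY t = 0 := by
  constructor
  · rw [axisX, ramp_of_ge (by norm_num) h, ramp_of_mem h h']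
    repeat rw [ramp_of_le (by linarith)]
    ring
  · rw [axisY]
    repeat rw [ramp_of_le (by linarith)]
    norm_num

theorem axis_piece₃ {t : ℝ} (h : -8 ≤ t) (h' : t ≤ -6) :
    axisX t = -1 + 13 / 50 * (t + 8) ∧ axisY t = 9 / 25 * (t + 8) := by
  constructor
  · rw [axisX, ramp_of_ge (b := -(32 / 3)) (by norm_num) (by linarith),
      ramp_of_ge (b := -8) (by norm_num) h, ramp_of_mem h h']
    repeat rw [ramp_of_le (by linarith)]
    ring
  · rw [axisY, ramp_of_mem h h']
    repeat rw [ramp_of_le (by linarith)]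
    ring

theorem axis_piece₄ {t : ℝ} (h : -6 ≤ t) (h' : t ≤ -3) :
    axisX t = -12 / 25 + 4 / 25 * (t + 6) ∧ axisY t = 18 / 25 + 7 / 75 * (t + 6) := by
  constructor
  · rw [axisX, ramp_of_ge (b := -(32 / 3)) (by norm_num) (by linarith),
      ramp_of_ge (b := -8) (by norm_num) (by linarith), ramp_of_ge (b := -6) (by norm_num) h,
      ramp_of_mem h h']
    repeat rw [ramp_of_le (by linarith)]
    ring
  · rw [axisY, ramp_of_ge (b := -6) (by norm_num) h, ramp_of_mem h h']
    repeat rw [ramp_of_le (by linarith)]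
    ring

theorem axis_piece₅ {t : ℝ} (h : -3 ≤ t) (h' : t ≤ 3) : axisX t = 0 ∧ axisY t = -t / 3 := by
  constructor
  · rw [axisX, ramp_of_ge (b := -(32 / 3)) (by norm_num) (by linarith),
      ramp_of_ge (b := -8) (by norm_num) (by linarith),
      ramp_of_ge (b := -6) (by norm_num) (by linarith), ramp_of_ge (b := -3) (by norm_num) h]
    repeat rw [ramp_of_le (by linarith)]
    norm_num
  · rw [axisY, ramp_of_ge (b := -6) (by norm_num) (by linarith),
      ramp_of_ge (b := -3) (by norm_num) h, ramp_of_mem h h']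
    repeat rw [ramp_of_le (by linarith)]
    ring

/-- The branch line. -/
noncomputable def axisPt (t : ℝ) : ℝ × ℝ × ℝ :=
  (axisX t, axisY t, (8 * axisX t - 3 * axisY t - t) / 16)

theorem axisPt_neg (t : ℝ) : axisPt (-t) = - axisPt t := by
  simp only [axisPt, axisX_neg, axisY_neg, Prod.neg_mk]
  ext <;> simp only
  ring

/-- The `ℓ¹`-norm along the branch line. -/
theorem norm1_axisPt_of_nonpos {t : ℝ} (h : t ≤ 0) :
    (t ≤ -16 ∧ norm1 (axisPt t) = -t / 16) ∨
    (-16 ≤ t ∧ t ≤ -(32 / 3) ∧ norm1 (axisPt t) = 1 / 2 - t / 32) ∨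
    (-(32 / 3) ≤ t ∧ t ≤ -8 ∧ norm1 (axisPt t) = (24 + t) / 16) ∨
    (-8 ≤ t ∧ t ≤ -6 ∧ norm1 (axisPt t) = 1 + (t + 8) / 10) ∨
    (-6 ≤ t ∧ t ≤ -3 ∧ norm1 (axisPt t) = 4 / 5 - t / 15) ∨
    (-3 ≤ t ∧ norm1 (axisPt t) = -t / 3) := by
  rcases le_total t (-16) with h1 | h1
  · left
    obtain ⟨hx, hy⟩ := axis_piece₀ h1
    refine ⟨h1, ?_⟩
    simp only [norm1, axisPt, hx, hy]
    rw [abs_zero, abs_of_nonneg (by linarith)]; ring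
  rcases le_total t (-(32 / 3)) with h2 | h2
  · right; left
    obtain ⟨hx, hy⟩ := axis_piece₁ h1 h2
    refine ⟨h1, h2, ?_⟩
    simp only [norm1, axisPt, hx, hy]
    rw [abs_zero, abs_of_nonpos (by linarith), abs_of_nonneg (by linarith)]; ring
  rcases le_total t (-8) with h3 | h3
  · right; right; left
    obtain ⟨hx, hy⟩ := axis_piece₂ h2 h3
    refine ⟨h2, h3, ?_⟩
    simp only [norm1, axisPt, hx, hy]
    rw [abs_zero, abs_of_nonpos (by linarith), abs_of_nonneg (by linarith)]; ring
  rcases le_total t (-6) with h4 | h4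
  · right; right; right; left
    obtain ⟨hx, hy⟩ := axis_piece₃ h3 h4
    refine ⟨h3, h4, ?_⟩
    simp only [norm1, axisPt, hx, hy]
    rw [abs_of_nonpos (by linarith), abs_of_nonneg (by linarith),
      show (8 * (-1 + 13 / 50 * (t + 8)) - 3 * (9 / 25 * (t + 8)) - t) / 16 = 0 by ring, abs_zero]
    ring
  rcases le_total t (-3) with h5 | h5
  · right; right; right; right; left
    obtain ⟨hx, hy⟩ := axis_piece₄ h4 h5
    refine ⟨h4, h5, ?_⟩
    simp only [norm1, axisPt, hx, hy]
    rw [abs_of_nonpos (by linarith), abs_of_nonneg (by linarith),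
      show (8 * (-12 / 25 + 4 / 25 * (t + 6)) - 3 * (18 / 25 + 7 / 75 * (t + 6)) - t) / 16 = 0 by
        ring, abs_zero]
    ring
  · right; right; right; right; right
    obtain ⟨hx, hy⟩ := axis_piece₅ h5 (by linarith)
    refine ⟨h5, ?_⟩
    simp only [norm1, axisPt, hx, hy]
    rw [abs_zero, abs_of_nonneg (by linarith), show (8 * 0 - 3 * (-t / 3) - t) / 16 = 0 by ring,
      abs_zero]
    ring

theorem norm1_axisPt_abs (t : ℝ) : norm1 (axisPt t) = norm1 (axisPt (-|t|)) := by
  rcases abs_cases t with ⟨h, _⟩ | ⟨h, _⟩ <;> rw [h]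
  · rw [axisPt_neg, norm1_neg]
  · rw [neg_neg]

/-- Exactly three arcs of the line lie inside the octahedron: a central one through the origin and
two others, each joining a vertex `±(1, 0, 0)` to a vertex `∓(0, 0, 1)`. -/
theorem norm1_axisPt_lt_one {t : ℝ} :
    norm1 (axisPt t) < 1 ↔ |t| < 3 ∨ (8 < |t| ∧ |t| < 16) := by
  rw [norm1_axisPt_abs]
  have h0 := abs_nonneg t
  set r := |t|
  rcases norm1_axisPt_of_nonpos (t := -r) (by linarith) with h | h | h | h | h | h
  · rw [h.2]; grind
  · rw [h.2.2]; grind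
  · rw [h.2.2]; grind
  · rw [h.2.2]; grind
  · rw [h.2.2]; grind
  · rw [h.2]; grind

theorem norm1_axisPt_eq_one {t : ℝ} :
    norm1 (axisPt t) = 1 ↔ |t| = 3 ∨ |t| = 8 ∨ |t| = 16 := by
  rw [norm1_axisPt_abs]
  have h0 := abs_nonneg t
  set r := |t|
  rcases norm1_axisPt_of_nonpos (t := -r) (by linarith) with h | h | h | h | h | h
  · rw [h.2]; grind
  · rw [h.2.2]; grind
  · rw [h.2.2]; grind
  · rw [h.2.2]; grind
  · rw [h.2.2]; grind
  · rw [h.2]; grind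

/-! The twist fixes the branch line. -/

theorem twistIn_of_bot {v : ℝ × ℝ × ℝ} (hv : norm1 v ≤ 1) (hX : 0 ≤ v.1) (hZ : v.2.2 = 0) :
    twistIn 1 v = v := by
  obtain ⟨x, g, y, hg0, hg1, h0, h1, rfl, -⟩ := exists_slice hv
  have h := (smin_abs_eq (u := (1 - g) * (-5 / 6) + g * saw x) h0).2
  simp only [slice] at hX hZ
  rw [hZ, max_eq_right (by linarith), abs_zero, add_zero] at h
  subst h
  rw [twistIn_slice _ _ hg0 hg1 h0 h1, sliceTwist_bot _ _ hg0 hg1]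

theorem twistIn_of_amount_zero {x g y : ℝ} (hg0 : 0 ≤ g) (hg1 : g ≤ 1) (h0 : 0 ≤ y)
    (h1 : y ≤ 1) (h : y ≤ (1 - g ^ 2) / 2) : twistIn 1 (slice x g y) = slice x g y := by
  rw [twistIn_slice _ _ hg0 hg1 h0 h1, sliceTwist_eq]
  rcases hg0.eq_or_lt with rfl | hg
  · exact slice_zero _ _ _
  · rw [twistAmount_eq_zero hg h]; simp

theorem twistIn_of_amount_one {x g y : ℝ} (hg0 : 0 ≤ g) (hg1 : g ≤ 1) (h0 : 0 ≤ y)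
    (h1 : y ≤ 1) (h : 1 - y ≤ (1 - g ^ 2) / 2) : twistIn 1 (slice x g y) = slice x g y := by
  rw [twistIn_slice _ _ hg0 hg1 h0 h1, sliceTwist_eq]
  rcases hg0.eq_or_lt with rfl | hg
  · exact slice_zero _ _ _
  · rw [twistAmount_eq_one hg h, mul_one]; exact slice_add_four_mul _ _ _ _

theorem saw_one : saw 1 = 1 := saw_of_mem (by norm_num) le_rfl
theorem saw_neg_one : saw (-1) = -1 := saw_of_mem le_rfl (by norm_num)
theorem csaw_one : csaw 1 = 0 := by rw [csaw_of_mem (by norm_num) le_rfl]; norm_num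
theorem csaw_neg_one : csaw (-1) = 0 := by rw [csaw_of_mem le_rfl (by norm_num)]; norm_num

/-- Points of the half plane `x = 1`. -/
theorem slice_at_one {X Z : ℝ} (hX : X ≤ 0) (hZ : 0 ≤ Z) :
    slice 1 ((6 * Z + 5) / 11) (Z - X) = (X, 0, Z) := by
  have e : (1 - (6 * Z + 5) / 11) * (-5 / 6) + (6 * Z + 5) / 11 * saw 1 = Z := by
    rw [saw_one]; ring
  simp only [slice, e, csaw_one, smin_zero_left]
  rw [smin_of_nonneg hZ (by linarith), min_eq_left (by linarith), abs_of_nonneg hZ]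
  simp

/-- Points of the half plane `x = -1`. -/
theorem slice_at_neg_one {X Z : ℝ} (hX : 0 ≤ X) (hZ : Z ≤ 0) :
    slice (-1) (6 * (X - Z) - 5) (-Z) = (X, 0, Z) := by
  have e : (1 - (6 * (X - Z) - 5)) * (-5 / 6) + (6 * (X - Z) - 5) * saw (-1) = -(X - Z) := by
    rw [saw_neg_one]; ring
  simp only [slice, e, csaw_neg_one, smin_zero_left]
  rw [smin_neg_left, smin_of_nonneg (by linarith) (by linarith), min_eq_right (by linarith), abs_neg,
    abs_of_nonneg (by linarith)]
  simp

theorem twistIn_at_one {X Z : ℝ} (hX : X ≤ 0) (hZ : 0 ≤ Z) (h1 : Z - X ≤ 1)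
    (h : 1 - (Z - X) ≤ (1 - ((6 * Z + 5) / 11) ^ 2) / 2) : twistIn 1 (X, 0, Z) = (X, 0, Z) := by
  rw [← slice_at_one hX hZ]
  exact twistIn_of_amount_one (by positivity) (by linarith) (by linarith) h1 h

theorem twistIn_at_neg_one {X Z : ℝ} (hX : 0 ≤ X) (hZ : Z ≤ 0) (h0 : 5 / 6 ≤ X - Z)
    (h1 : X - Z ≤ 1) (h : -Z ≤ (1 - (6 * (X - Z) - 5) ^ 2) / 2 ∨
      1 + Z ≤ (1 - (6 * (X - Z) - 5) ^ 2) / 2) : twistIn 1 (X, 0, Z) = (X, 0, Z) := by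
  rw [← slice_at_neg_one hX hZ]
  rcases h with h | h
  · exact twistIn_of_amount_zero (by linarith) (by linarith) (by linarith) (by linarith) h
  · exact twistIn_of_amount_one (by linarith) (by linarith) (by linarith) (by linarith) (by linarith)

theorem twist_of_inversion1 {v : ℝ × ℝ × ℝ} (hv : 1 ≤ norm1 v)
    (h : twistIn 1 (inversion1 v) = inversion1 v) : twist 1 v = v := by
  rw [twist_of_ge _ hv, h, inversion1_inversion1 (inversion1_facts hv).1]

/-- The inversion carries this quarter plane to the half plane `x = -1` of the slice coordinates,
with `g = 6 / n - 5`. The two alternatives are the zones of twist amount zero and one. -/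
theorem twist_outside_neg_one {X Y n : ℝ} (hX : X ≤ 0) (hY : 0 ≤ Y) (hn : Y - X = n) (h1 : 1 ≤ n)
    (h2 : n ≤ 6 / 5) (h : Y ≤ 6 * (n - 1) * (3 - 2 * n) ∨ n ^ 2 - Y ≤ 6 * (n - 1) * (3 - 2 * n)) :
    twist 1 (X, Y, 0) = (X, Y, 0) := by
  have hN : norm1 (X, Y, (0 : ℝ)) = n := by
    simp only [norm1, abs_of_nonpos hX, abs_of_nonneg hY, abs_zero]; linarith
  have hn0 : 0 < n := by linarith
  refine twist_of_inversion1 (by rw [hN]; exact h1) ?_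
  have e : inversion1 (X, Y, 0) = (-X / n ^ 2, 0, -Y / n ^ 2) := by
    rw [inversion1, hN]; simp [swapSides, div_eq_inv_mul]
  have e2 : -X / n ^ 2 - -Y / n ^ 2 = 1 / n := by rw [← sub_div, show -X - -Y = n by linarith]; field_simp
  rw [e]
  have e3 : (1 - (6 * (1 / n) - 5) ^ 2) / 2 = 6 * (n - 1) * (3 - 2 * n) / n ^ 2 := by
    field_simp; ring
  refine twistIn_at_neg_one (div_nonneg (by linarith) (by positivity))
    (div_nonpos_of_nonpos_of_nonneg (by linarith) (by positivity)) ?_ ?_ ?_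
  · rw [e2, div_le_div_iff₀ (by norm_num) hn0]; linarith
  · rw [e2, div_le_one hn0]; exact h1
  · rw [e2, e3, neg_div, neg_neg]
    refine h.imp (fun h => by gcongr) fun h => ?_
    rw [← sub_eq_add_neg, one_sub_div (by positivity)]
    gcongr

theorem twist_outside_one {X Y m : ℝ} (hX : 0 ≤ X) (hY : Y ≤ 0) (hn : (X - Y) * m = 1)
    (hm0 : 0 < m) (hm1 : m ≤ 1)
    (h : 1 - m ≤ (1 - ((6 * (-Y * m ^ 2) + 5) / 11) ^ 2) / 2) :
    twist 1 (X, Y, 0) = (X, Y, 0) := by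
  have hN : norm1 (X, Y, (0 : ℝ)) = X - Y := by
    simp only [norm1, abs_of_nonneg hX, abs_of_nonpos hY, abs_zero]; ring
  have hn0 : X - Y = m⁻¹ := eq_inv_of_mul_eq_one_left hn
  have e : inversion1 (X, Y, 0) = (-X * m ^ 2, 0, -Y * m ^ 2) := by
    rw [inversion1, hN, hn0]; simp [swapSides, mul_comm]
  have e2 : -Y * m ^ 2 - -X * m ^ 2 = m := by linear_combination m * hn
  refine twist_of_inversion1 (by rw [hN, hn0]; exact (one_le_inv₀ hm0).2 hm1) ?_
  rw [e]
  refine twistIn_at_one (by nlinarith) (by nlinarith [sq_nonneg m]) ?_ ?_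
  · rw [e2]; exact hm1
  · rw [e2]; exact h

/-- The central arc, and the ray beyond the last vertex after inversion, lie on the bottom slice.
The arc inside from `(0, 0, 1)` to `(-1, 0, 0)` stays in the half plane `x = 1`, where the twist is
a full turn. The outer arc, inverted, crosses from amount zero to amount one; it does so at its bend
`t = -6`, which lands on the core at `y = 1/2`. -/
theorem twist_axisPt_of_nonpos {t : ℝ} (h : t ≤ 0) : twist 1 (axisPt t) = axisPt t := by
  have hN := norm1_axisPt_of_nonpos h
  rcases le_total t (-16) with h1 | h1
  · obtain ⟨hx, hy⟩ := axis_piece₀ h1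
    have hN1 : 1 ≤ norm1 (axisPt t) := by grind
    refine twist_of_inversion1 hN1 (twistIn_of_bot (inversion1_facts hN1).2.2 ?_ ?_)
    · simp [inversion1, swapSides, axisPt, hx]
    · simp [inversion1, swapSides, axisPt, hy]
  rcases le_total t (-8) with h3 | h3
  · rcases le_total t (-(32 / 3)) with h2 | h2
    · obtain ⟨hx, hy⟩ := axis_piece₁ h1 h2
      rw [twist_of_le _ (by grind)]
      simp only [axisPt, hx, hy]
      refine twistIn_at_one (by linarith) (by linarith) (by linarith) ?_
      nlinarith
    · obtain ⟨hx, hy⟩ := axis_piece₂ h2 h3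
      rw [twist_of_le _ (by grind)]
      simp only [axisPt, hx, hy]
      refine twistIn_at_one (by linarith) (by linarith) (by linarith) ?_
      nlinarith
  rcases le_total t (-6) with h4 | h4
  · obtain ⟨hx, hy⟩ := axis_piece₃ h3 h4
    have e : axisPt t = (-1 + 13 / 50 * (t + 8), 9 / 25 * (t + 8), 0) := by
      simp only [axisPt, hx, hy]; ext <;> simp only; ring
    rw [e]
    refine twist_outside_neg_one (n := 1 + (t + 8) / 10) (by linarith) (by linarith) (by ring)
      (by linarith) (by linarith) (Or.inl ?_)
    nlinarith
  rcases le_total t (-3) with h5 | h5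
  · obtain ⟨hx, hy⟩ := axis_piece₄ h4 h5
    have e : axisPt t = (-12 / 25 + 4 / 25 * (t + 6), 18 / 25 + 7 / 75 * (t + 6), 0) := by
      simp only [axisPt, hx, hy]; ext <;> simp only; ring
    rw [e]
    refine twist_outside_neg_one (n := 4 / 5 - t / 15) (by linarith) (by linarith) (by ring)
      (by linarith) (by linarith) (Or.inr ?_)
    nlinarith
  · obtain ⟨hx, hy⟩ := axis_piece₅ h5 (by linarith)
    have hN1 : norm1 (axisPt t) ≤ 1 := by grind
    rw [twist_of_le _ hN1]
    refine twistIn_of_bot hN1 ?_ ?_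
    · simp [axisPt, hx]
    · simp only [axisPt, hx, hy]; ring

/-- By the symmetry of the line this is the case `t ≥ 0`. The roles are exchanged: now the inner arc
crosses the pinching point, at its bend `t = -32/3`, and the inverted outer arc stays in the zone of
full twist. -/
theorem twist_neg_axisPt_of_nonpos {t : ℝ} (h : t ≤ 0) : twist 1 (-axisPt t) = -axisPt t := by
  have hN := norm1_axisPt_of_nonpos h
  rw [← norm1_neg] at hN
  rcases le_total t (-16) with h1 | h1
  · obtain ⟨hx, hy⟩ := axis_piece₀ h1
    have hN1 : 1 ≤ norm1 (-axisPt t) := by grind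
    refine twist_of_inversion1 hN1 (twistIn_of_bot (inversion1_facts hN1).2.2 ?_ ?_)
    · simp [inversion1, swapSides, axisPt, hx]
    · simp [inversion1, swapSides, axisPt, hy]
  rcases le_total t (-8) with h3 | h3
  · rcases le_total t (-(32 / 3)) with h2 | h2
    · obtain ⟨hx, hy⟩ := axis_piece₁ h1 h2
      rw [twist_of_le _ (by grind)]
      simp only [axisPt, hx, hy, Prod.neg_mk, neg_zero]
      refine twistIn_at_neg_one (by linarith) (by linarith) (by linarith) (by linarith) (Or.inr ?_)
      nlinarith
    · obtain ⟨hx, hy⟩ := axis_piece₂ h2 h3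
      rw [twist_of_le _ (by grind)]
      simp only [axisPt, hx, hy, Prod.neg_mk, neg_zero]
      refine twistIn_at_neg_one (by linarith) (by linarith) (by linarith) (by linarith) (Or.inl ?_)
      nlinarith
  rcases le_total t (-6) with h4 | h4
  · obtain ⟨hx, hy⟩ := axis_piece₃ h3 h4
    have e : -axisPt t = (1 - 13 / 50 * (t + 8), -(9 / 25 * (t + 8)), 0) := by
      simp only [axisPt, hx, hy, Prod.neg_mk]; ext <;> simp only <;> ring
    rw [e]
    set m := (1 + (t + 8) / 10)⁻¹ with hm
    have hmn : (1 + (t + 8) / 10) * m = 1 := mul_inv_cancel₀ (by linarith)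
    have hm1 : m ≤ 1 := inv_le_one_of_one_le₀ (by linarith)
    have hm0 : 5 / 6 ≤ m := by
      rw [hm, le_inv_comm₀ (by norm_num) (by linarith)]; norm_num; linarith
    refine twist_outside_one (m := m) (by linarith) (by linarith) (by linear_combination hmn)
      (by linarith) hm1 ?_
    have hu : - -(9 / 25 * (t + 8)) * m ^ 2 = 18 / 5 * (m - m ^ 2) := by
      linear_combination 18 / 5 * m * hmn
    rw [hu]
    have g1 : (6 * (18 / 5 * (m - m ^ 2)) + 5) / 11 ≤ 8 / 11 := by nlinarith
    have g0 : 0 ≤ (6 * (18 / 5 * (m - m ^ 2)) + 5) / 11 := by nlinarith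
    nlinarith
  rcases le_total t (-3) with h5 | h5
  · obtain ⟨hx, hy⟩ := axis_piece₄ h4 h5
    have e : -axisPt t = (12 / 25 - 4 / 25 * (t + 6), -(18 / 25 + 7 / 75 * (t + 6)), 0) := by
      simp only [axisPt, hx, hy, Prod.neg_mk]; ext <;> simp only <;> ring
    rw [e]
    set m := (4 / 5 - t / 15)⁻¹ with hm
    have hmn : (4 / 5 - t / 15) * m = 1 := mul_inv_cancel₀ (by linarith)
    have hm1 : m ≤ 1 := inv_le_one_of_one_le₀ (by linarith)
    have hm0 : 5 / 6 ≤ m := by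
      rw [hm, le_inv_comm₀ (by norm_num) (by linarith)]; norm_num; linarith
    refine twist_outside_one (m := m) (by linarith) (by linarith) (by linear_combination hmn)
      (by linarith) hm1 ?_
    have hu : - -(18 / 25 + 7 / 75 * (t + 6)) * m ^ 2 = 12 / 5 * m ^ 2 - 7 / 5 * m := by
      linear_combination -7 / 5 * m * hmn
    rw [hu]
    have g1 : (6 * (12 / 5 * m ^ 2 - 7 / 5 * m) + 5) / 11 ≤ (18 * m - 7) / 11 := by nlinarith
    have g0 : 0 ≤ (6 * (12 / 5 * m ^ 2 - 7 / 5 * m) + 5) / 11 := by nlinarith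
    have g2 := mul_self_le_mul_self g0 g1
    nlinarith
  · obtain ⟨hx, hy⟩ := axis_piece₅ h5 (by linarith)
    have hN1 : norm1 (-axisPt t) ≤ 1 := by grind
    rw [twist_of_le _ hN1]
    refine twistIn_of_bot hN1 ?_ ?_
    · simp [axisPt, hx]
    · simp only [axisPt, hx, hy, Prod.neg_mk]; ring

theorem twist_axisPt (t : ℝ) : twist 1 (axisPt t) = axisPt t := by
  rcases le_total t 0 with h | h
  · exact twist_axisPt_of_nonpos h
  · have := twist_neg_axisPt_of_nonpos (t := -t) (by linarith)
    rwa [axisPt_neg, neg_neg] at this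

theorem quotHomeo_axisPt (t : ℝ) : quotHomeo (axisPt t) = axisPt t := by
  rw [quotHomeo_apply, ← axisPt_neg, twist_axisPt, ← axisPt_neg, neg_neg, twist_axisPt]

/-! ### Straightening the branch line -/

/-- The branch line, projected. -/
noncomputable def axisC (t : ℝ) : ℂ := axisX t + axisY t * Complex.I

@[fun_prop]
theorem continuous_axisC : Continuous axisC := by unfold axisC; fun_prop

theorem axisC_re (t : ℝ) : (axisC t).re = axisX t := by simp [axisC]
theorem axisC_im (t : ℝ) : (axisC t).im = axisY t := by simp [axisC]

/-- The height function. -/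
def height (v : ℝ × ℝ × ℝ) : ℝ := 8 * v.1 - 3 * v.2.1 - 16 * v.2.2

/-- The homeomorphism that makes the branch line the axis of `ℝ × ℂ`. -/
noncomputable def straighten : (ℝ × ℝ × ℝ) ≃ₜ (ℝ × ℂ) where
  toFun v := (height v, v.1 + v.2.1 * Complex.I - axisC (height v))
  invFun p := ((p.2 + axisC p.1).re, (p.2 + axisC p.1).im,
    (8 * (p.2 + axisC p.1).re - 3 * (p.2 + axisC p.1).im - p.1) / 16)
  left_inv v := by
    simp [height]
  right_inv p := by
    have h : height ((p.2 + axisC p.1).re, (p.2 + axisC p.1).im,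
      (8 * (p.2 + axisC p.1).re - 3 * (p.2 + axisC p.1).im - p.1) / 16) = p.1 := by
      simp only [height]; ring
    refine Prod.ext h ?_
    simp only [h, Complex.re_add_im]
    ring
  continuous_toFun := by unfold height; fun_prop
  continuous_invFun := by
    refine Continuous.prodMk ?_ (Continuous.prodMk ?_ ?_)
    · exact Complex.continuous_re.comp (by fun_prop)
    · exact Complex.continuous_im.comp (by fun_prop)
    · have h1 : Continuous fun p : ℝ × ℂ => (p.2 + axisC p.1).re :=
        Complex.continuous_re.comp (by fun_prop)
      have h2 : Continuous fun p : ℝ × ℂ => (p.2 + axisC p.1).im :=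
        Complex.continuous_im.comp (by fun_prop)
      fun_prop

theorem straighten_fst (v : ℝ × ℝ × ℝ) : (straighten v).1 = height v := rfl
theorem straighten_snd (v : ℝ × ℝ × ℝ) :
    (straighten v).2 = v.1 + v.2.1 * Complex.I - axisC (height v) := rfl

theorem straighten_symm_axis (t : ℝ) : straighten.symm (t, 0) = axisPt t := by
  change ((0 + axisC t).re, (0 + axisC t).im, (8 * (0 + axisC t).re - 3 * (0 + axisC t).im - t) / 16)
    = axisPt t
  rw [zero_add, axisC_re, axisC_im, axisPt]

theorem straighten_axisPt (t : ℝ) : straighten (axisPt t) = (t, 0) := by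
  rw [← straighten_symm_axis, Homeomorph.apply_symm_apply]

theorem abs_ramp_le {a b : ℝ} (hab : a ≤ b) (t : ℝ) : |ramp a b t| ≤ max |a| |b| := by
  rw [ramp, abs_le]
  have h1 := neg_abs_le a
  have h2 := le_abs_self b
  have h3 := le_max_left |a| |b|
  have h4 := le_max_right |a| |b|
  constructor
  · exact (by linarith : _ ≤ a).trans (le_max_left _ _)
  · exact max_le (by linarith) ((min_le_left _ _).trans (by linarith))

theorem norm_axisC_le (t : ℝ) : ‖axisC t‖ ≤ 100 := by
  have h : |axisX t| + |axisY t| ≤ 100 := by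
    have key : ∀ a b : ℝ, a ≤ b → max |a| |b| ≤ 16 → |ramp a b t| ≤ 16 :=
      fun a b h h' => (abs_ramp_le h t).trans h'
    have b1 := abs_le.1 (key (-16) (-(32 / 3)) (by norm_num) (by norm_num [abs_of_pos]))
    have b2 := abs_le.1 (key (-(32 / 3)) (-8) (by norm_num) (by norm_num [abs_of_pos]))
    have b3 := abs_le.1 (key (-8) (-6) (by norm_num) (by norm_num [abs_of_pos]))
    have b4 := abs_le.1 (key (-6) (-3) (by norm_num) (by norm_num [abs_of_pos]))
    have b5 := abs_le.1 (key 3 6 (by norm_num) (by norm_num [abs_of_pos]))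
    have b6 := abs_le.1 (key 6 8 (by norm_num) (by norm_num [abs_of_pos]))
    have b7 := abs_le.1 (key 8 (32 / 3) (by norm_num) (by norm_num [abs_of_pos]))
    have b8 := abs_le.1 (key (32 / 3) 16 (by norm_num) (by norm_num [abs_of_pos]))
    have b9 := abs_le.1 (key (-3) 3 (by norm_num) (by norm_num [abs_of_pos]))
    have hx : |axisX t| ≤ 50 := by
      rw [axisX, abs_le]; constructor <;> linarith
    have hy : |axisY t| ≤ 50 := by
      rw [axisY, abs_le]; constructor <;> linarith
    linarith
  have := Complex.norm_le_abs_re_add_abs_im (axisC t)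
  rw [axisC_re, axisC_im] at this
  linarith

theorem norm_straighten_le {v : ℝ × ℝ × ℝ} (hv : norm1 v ≤ 20) : ‖straighten v‖ ≤ 400 := by
  obtain ⟨X, Y, Z⟩ := v
  simp only [norm1] at hv
  have h1 := abs_nonneg X
  have h2 := abs_nonneg Y
  have h3 := abs_nonneg Z
  have h4 := abs_le.1 (le_refl |X|)
  have h5 := abs_le.1 (le_refl |Y|)
  have h6 := abs_le.1 (le_refl |Z|)
  rw [Prod.norm_def]
  refine max_le ?_ ?_
  · rw [straighten_fst, Real.norm_eq_abs, height, abs_le]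
    constructor <;> simp only <;> linarith
  · rw [straighten_snd]
    refine (norm_sub_le _ _).trans ?_
    have := norm_axisC_le (height (X, Y, Z))
    have h7 : ‖(X : ℂ) + Y * Complex.I‖ ≤ |X| + |Y| := by
      refine (norm_add_le _ _).trans (le_of_eq ?_)
      simp
    linarith

/-- The hyperbolic homeomorphism in the straightened coordinates. -/
noncomputable def straightHomeo : (ℝ × ℂ) ≃ₜ (ℝ × ℂ) :=
  (straighten.symm.trans quotHomeo).trans straighten

theorem straightHomeo_apply (p : ℝ × ℂ) :
    straightHomeo p = straighten (quotHomeo (straighten.symm p)) := rfl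

theorem straightHomeo_axis (p : ℝ × ℂ) (hp : p.2 = 0) : straightHomeo p = p := by
  obtain ⟨t, w⟩ := p
  simp only at hp
  subst hp
  rw [straightHomeo_apply, straighten_symm_axis, quotHomeo_axisPt, straighten_axisPt]

theorem straightHomeo_of_large {p : ℝ × ℂ} (hp : 400 < ‖p‖) : straightHomeo p = p := by
  rw [straightHomeo_apply, quotHomeo_of_large, Homeomorph.apply_symm_apply]
  by_contra H
  have := norm_straighten_le (v := straighten.symm p) (by linarith)
  rw [Homeomorph.apply_symm_apply] at this
  linarith


/-! ### Local structure of the developing map -/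

theorem isClosed_evenLattice : IsClosed {p : ℝ × ℝ | ∃ a b : ℤ, p = (2 * (a : ℝ), 2 * (b : ℝ))} := by
  have h := (Int.isClosedEmbedding_coe_real.prodMap Int.isClosedEmbedding_coe_real).isClosed_range
  have h2 : Continuous fun p : ℝ × ℝ => ((p.1 / 2, p.2 / 2) : ℝ × ℝ) := by fun_prop
  convert h.preimage h2 using 1
  ext ⟨x, y⟩
  constructor
  · rintro ⟨a, b, h⟩
    simp only [Prod.mk.injEq] at h
    exact ⟨(a, b), by simp [h.1, h.2]⟩
  · rintro ⟨⟨a, b⟩, h⟩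
    simp only [Prod.map_apply, Prod.mk.injEq] at h
    exact ⟨a, b, by ext <;> simp only <;> linarith⟩

theorem evenLattice_eq_zero {a b : ℤ} (h : ‖((2 * (a : ℝ), 2 * (b : ℝ)) : ℝ × ℝ)‖ < 1) :
    a = 0 ∧ b = 0 := by
  rw [Prod.norm_def, max_lt_iff, Real.norm_eq_abs, Real.norm_eq_abs, abs_lt, abs_lt] at h
  simp only at h
  obtain ⟨⟨h1, h2⟩, h3, h4⟩ := h
  have : (-1 : ℝ) < a ∧ (a : ℝ) < 1 ∧ (-1 : ℝ) < b ∧ (b : ℝ) < 1 :=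
    ⟨by linarith, by linarith, by linarith, by linarith⟩
  norm_cast at this
  omega

/-- The integer points, which contain all branch points of `dev`. -/
def IsIntegral (p : ℝ × ℝ) : Prop := ∃ a b : ℤ, p = ((a : ℝ), (b : ℝ))

/-- Two lifts differ by an element of the group, which is locally constant. A change of sign would
put the sum `v + ε • u` into the lattice arbitrarily near `q`, hence at `q`, making `u q` integral.
With the sign fixed, discreteness of the lattice fixes the translation. -/
theorem eventually_eq_of_dev_eq {S : Type*} [TopologicalSpace S] {u v : S → ℝ × ℝ} {q : S}
    (hu : ContinuousAt u q) (hv : ContinuousAt v q) (h : ∀ᶠ w in 𝓝 q, dev (u w) = dev (v w))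
    (hq : ¬ IsIntegral (u q)) :
    ∃ (ε : ℝ) (a b : ℤ), (ε = 1 ∨ ε = -1) ∧
      ∀ᶠ w in 𝓝 q, v w = ε • u w + (2 * (a : ℝ), 2 * (b : ℝ)) := by
  obtain ⟨ε, a, b, hε, -, h1, h2⟩ := dev_eq_dev_iff.1 h.self_of_nhds
  have e1 : v q = ε • u q + (2 * (a : ℝ), 2 * (b : ℝ)) := Prod.ext h1 h2
  refine ⟨ε, a, b, hε, ?_⟩
  have c1 : ContinuousAt (fun w => v w - ε • u w - (2 * (a : ℝ), 2 * (b : ℝ))) q := by fun_prop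
  have c2 : ContinuousAt (fun w => v w + ε • u w) q := by fun_prop
  have n1 : ∀ᶠ w in 𝓝 q, ‖v w - ε • u w - (2 * (a : ℝ), 2 * (b : ℝ))‖ < 1 :=
    c1.norm.eventually_lt continuousAt_const (by rw [e1]; simp)
  have n2 : ∀ᶠ w in 𝓝 q, v w + ε • u w ∈
      {p : ℝ × ℝ | ∃ a b : ℤ, p = (2 * (a : ℝ), 2 * (b : ℝ))}ᶜ := by
    refine c2.eventually (isClosed_evenLattice.isOpen_compl.mem_nhds ?_)
    rintro ⟨a', b', h'⟩
    simp only [e1] at h'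
    have h3 := congrArg Prod.fst h'
    have h4 := congrArg Prod.snd h'
    simp only [Prod.fst_add, Prod.snd_add, Prod.smul_fst, Prod.smul_snd, smul_eq_mul] at h3 h4
    rcases hε with rfl | rfl
    · exact hq ⟨a' - a, b' - b, by ext <;> push_cast <;> linarith⟩
    · exact hq ⟨a - a', b - b', by ext <;> push_cast <;> linarith⟩
  filter_upwards [h, n1, n2] with w hw h3 h4
  obtain ⟨ε', a', b', hε', -, h5, h6⟩ := dev_eq_dev_iff.1 hw
  have e2 : v w = ε' • u w + (2 * (a' : ℝ), 2 * (b' : ℝ)) := Prod.ext h5 h6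
  have : ε' = ε ∨ ε' = -ε := by
    rcases hε with rfl | rfl <;> rcases hε' with rfl | rfl <;> norm_num
  rcases this with rfl | rfl
  · rw [e2] at h3
    have h7 := evenLattice_eq_zero (a := a' - a) (b := b' - b) (by
      convert h3 using 2; ext <;> simp <;> ring)
    rw [e2, show a' = a by omega, show b' = b by omega]
  · exact absurd ⟨a', b', by rw [e2, neg_smul]; simp⟩ h4

theorem eventually_isIntegral_imp_eq {S : Type*} [TopologicalSpace S] {u : S → ℝ × ℝ} {q : S}
    (hu : ContinuousAt u q) : ∀ᶠ w in 𝓝 q, IsIntegral (u w) → u w = u q := by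
  have cl : ∀ᶠ w in 𝓝 q, 2 • u w ∈ {p : ℝ × ℝ | ∃ a b : ℤ, p = (2 * (a : ℝ), 2 * (b : ℝ))} →
      2 • u q ∈ {p : ℝ × ℝ | ∃ a b : ℤ, p = (2 * (a : ℝ), 2 * (b : ℝ))} := by
    by_cases h : 2 • u q ∈ {p : ℝ × ℝ | ∃ a b : ℤ, p = (2 * (a : ℝ), 2 * (b : ℝ))}
    · exact Filter.Eventually.of_forall fun _ _ => h
    · have : ContinuousAt (fun w => 2 • u w) q := by fun_prop
      filter_upwards [this.eventually (isClosed_evenLattice.isOpen_compl.mem_nhds h)] with w hw hw'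
      exact absurd hw' hw
  have n1 : ∀ᶠ w in 𝓝 q, ‖2 • u w - 2 • u q‖ < 1 :=
    (ContinuousAt.norm (by fun_prop)).eventually_lt continuousAt_const (by simp)
  filter_upwards [cl, n1] with w h1 h2
  rintro ⟨a, b, h⟩
  obtain ⟨a', b', h'⟩ := h1 ⟨a, b, by rw [h]; simp⟩
  rw [h, h'] at h2
  have h3 := evenLattice_eq_zero (a := a - a') (b := b - b') (by
    convert h2 using 2; ext <;> simp <;> ring)
  rw [h, show a = a' by omega, show b = b' by omega]
  have h5 := congrArg Prod.fst h'
  have h6 := congrArg Prod.snd h'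
  simp at h5 h6
  ext <;> simp [h5, h6]

theorem isPreconnected_punctured_ball {E : Type*} [NormedAddCommGroup E] [NormedSpace ℝ E]
    (hrank : 1 < Module.rank ℝ E) (c : E) (r : ℝ) : IsPreconnected (Metric.ball c r \ {c}) := by
  have := ((isPreconnected_Ioo (a := 0) (b := r)).prod
    (isPreconnected_sphere hrank (0 : E) 1)).image (fun q : ℝ × E => c + q.1 • q.2) (by fun_prop)
  convert this using 1
  ext w
  simp only [Set.mem_sdiff, Metric.mem_ball, Set.mem_singleton_iff, Set.mem_image, Set.mem_prod,
    Set.mem_Ioo, mem_sphere_zero_iff_norm, Prod.exists]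
  constructor
  · rintro ⟨h, h'⟩
    have h0 : ‖w - c‖ ≠ 0 := norm_ne_zero_iff.2 (sub_ne_zero.2 h')
    refine ⟨‖w - c‖, ‖w - c‖⁻¹ • (w - c),
      ⟨⟨(norm_nonneg _).lt_of_ne' h0, by rwa [← dist_eq_norm]⟩, ?_⟩, ?_⟩
    · rw [norm_smul, norm_inv, norm_norm, inv_mul_cancel₀ h0]
    · rw [smul_smul, mul_inv_cancel₀ h0, one_smul]; abel
  · rintro ⟨s, u, ⟨⟨hs, hs'⟩, hu⟩, rfl⟩
    constructor
    · rw [dist_eq_norm, add_sub_cancel_left, norm_smul, hu, mul_one, Real.norm_of_nonneg hs.le]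
      exact hs'
    · rw [add_eq_left, ← norm_eq_zero, norm_smul, hu, mul_one, Real.norm_of_nonneg hs.le]
      exact hs.ne'

/-- Two lifts of the same map differ locally by a translation and a sign. -/
theorem eventually_eq_of_dev_eq_of_chart {S : Type*} [TopologicalSpace S]
    (φ : OpenPartialHomeomorph S (ℝ × ℝ)) {u v : S → ℝ × ℝ} {q : S} (hq : q ∈ φ.source)
    (hu : ∀ᶠ w in 𝓝 q, ContinuousAt u w) (hv : ∀ᶠ w in 𝓝 q, ContinuousAt v w)
    (h : ∀ᶠ w in 𝓝 q, dev (u w) = dev (v w)) (hi : ∀ᶠ w in 𝓝 q, IsIntegral (u w) → w = q) :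
    ∃ (ε : ℝ) (b : ℝ × ℝ), (ε = 1 ∨ ε = -1) ∧ ∀ᶠ w in 𝓝 q, v w = ε • u w + b := by
  have hall := (hu.and (hv.and (h.and hi))).and (φ.open_source.mem_nhds hq)
  have hall' : ∀ᶠ x in 𝓝 (φ q), x ∈ φ.target ∧ ContinuousAt u (φ.symm x) ∧
      ContinuousAt v (φ.symm x) ∧ dev (u (φ.symm x)) = dev (v (φ.symm x)) ∧
      (IsIntegral (u (φ.symm x)) → φ.symm x = q) := by
    have := (φ.continuousAt_symm (φ.map_source hq)).tendsto
    rw [φ.left_inv hq] at this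
    filter_upwards [this.eventually hall, φ.open_target.mem_nhds (φ.map_source hq)] with x hx hx'
    exact ⟨hx', hx.1.1, hx.1.2.1, hx.1.2.2.1, hx.1.2.2.2⟩
  obtain ⟨r, hr, hball⟩ := Metric.eventually_nhds_iff_ball.1 hall'
  set B := Metric.ball (φ q) r \ {φ q} with hB
  have hrank : 1 < Module.rank ℝ (ℝ × ℝ) := by
    rw [rank_prod', Module.rank_self]; norm_num
  have hBc : IsPreconnected B := isPreconnected_punctured_ball hrank _ _
  have hBo : IsOpen B := Metric.isOpen_ball.sdiff isClosed_singleton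
  set u' := fun x => u (φ.symm x) with hu'
  set v' := fun x => v (φ.symm x) with hv'
  have cu : ∀ x ∈ Metric.ball (φ q) r, ContinuousAt u' x := fun x hx =>
    ContinuousAt.comp (f := φ.symm) (hball x hx).2.1 (φ.continuousAt_symm (hball x hx).1)
  have cv : ∀ x ∈ Metric.ball (φ q) r, ContinuousAt v' x := fun x hx =>
    ContinuousAt.comp (f := φ.symm) (hball x hx).2.2.1 (φ.continuousAt_symm (hball x hx).1)
  have hni : ∀ x ∈ B, ¬ IsIntegral (u' x) := by
    rintro x ⟨hx, hx'⟩ H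
    have := (hball x hx).2.2.2.2 H
    apply hx'
    rw [Set.mem_singleton_iff, ← this, φ.right_inv (hball x hx).1]
  have hloc : ∀ x ∈ B, ∃ (ε : ℝ) (a b : ℤ), (ε = 1 ∨ ε = -1) ∧
      ∀ᶠ w in 𝓝 x, v' w = ε • u' w + (2 * (a : ℝ), 2 * (b : ℝ)) := fun x hx =>
    eventually_eq_of_dev_eq (cu x hx.1) (cv x hx.1)
      (by filter_upwards [hBo.mem_nhds hx] with y hy using (hball y hy.1).2.2.2.1) (hni x hx)
  have : Filter.NeBot (𝓝[≠] (φ q)) := Module.punctured_nhds_neBot ℝ (ℝ × ℝ) (φ q)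
  have hBn : B ∈ 𝓝[≠] (φ q) := by
    rw [hB, Set.sdiff_eq]
    exact Filter.inter_mem (mem_nhdsWithin_of_mem_nhds (Metric.ball_mem_nhds _ hr))
      self_mem_nhdsWithin
  obtain ⟨x₀, hx₀⟩ := Filter.nonempty_of_mem hBn
  obtain ⟨ε, a, b, hε, he⟩ := hloc x₀ hx₀
  -- The set where the two lifts differ by this particular group element is open, and so is its
  -- complement, in the connected punctured ball. The centre then follows by continuity.
  have hsub : B ⊆ {x ∈ B | v' x = ε • u' x + (2 * (a : ℝ), 2 * (b : ℝ))} := by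
    refine IsPreconnected.subset_left_of_subset_union
      (v := {x ∈ B | v' x ≠ ε • u' x + (2 * (a : ℝ), 2 * (b : ℝ))}) ?_ ?_ ?_ ?_
      ⟨x₀, hx₀, hx₀, he.self_of_nhds⟩ hBc
    · rw [isOpen_iff_mem_nhds]
      rintro x ⟨hx, hxe⟩
      obtain ⟨ε', a', b', hε', he'⟩ := hloc x hx
      have h1 := he'.self_of_nhds
      rw [hxe] at h1
      have h3 := congrArg Prod.fst h1
      have h4 := congrArg Prod.snd h1
      simp only [Prod.fst_add, Prod.snd_add, Prod.smul_fst, Prod.smul_snd, smul_eq_mul] at h3 h4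
      have : ε' = ε ∨ ε' = -ε := by
        rcases hε with rfl | rfl <;> rcases hε' with rfl | rfl <;> norm_num
      rcases this with rfl | rfl
      · have e1 : (a : ℝ) = a' := by linarith
        have e2 : (b : ℝ) = b' := by linarith
        filter_upwards [he', hBo.mem_nhds hx] with y hy hy'
        exact ⟨hy', by rw [hy, e1, e2]⟩
      · exfalso
        rcases hε with rfl | rfl
        · exact hni x hx ⟨a' - a, b' - b, by ext <;> push_cast <;> linarith⟩
        · exact hni x hx ⟨a - a', b - b', by ext <;> push_cast <;> linarith⟩
    · rw [isOpen_iff_mem_nhds]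
      rintro x ⟨hx, hxe⟩
      have c := cu x hx.1
      have c3 := (cv x hx.1).sub (ContinuousAt.add (c.const_smul ε)
        (continuousAt_const (y := (2 * (a : ℝ), 2 * (b : ℝ)))))
      filter_upwards [c3.eventually_ne (sub_ne_zero.2 hxe), hBo.mem_nhds hx] with y h1 h2
      exact ⟨h2, sub_ne_zero.1 h1⟩
    · rw [Set.disjoint_left]
      rintro x ⟨-, h1⟩ ⟨-, h2⟩
      exact h2 h1
    · intro x hx
      by_cases h : v' x = ε • u' x + (2 * (a : ℝ), 2 * (b : ℝ))
      · exact Or.inl ⟨hx, h⟩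
      · exact Or.inr ⟨hx, h⟩
  have hcen : v' (φ q) = ε • u' (φ q) + (2 * (a : ℝ), 2 * (b : ℝ)) := by
    have c1 := (cv _ (Metric.mem_ball_self hr)).tendsto.mono_left (nhdsWithin_le_nhds (s := {φ q}ᶜ))
    have c2 := (((cu _ (Metric.mem_ball_self hr)).const_smul ε).add
      (continuousAt_const (y := (2 * (a : ℝ), 2 * (b : ℝ))))).tendsto.mono_left
      (nhdsWithin_le_nhds (s := {φ q}ᶜ))
    refine tendsto_nhds_unique_of_eventuallyEq c1 c2 ?_
    filter_upwards [hBn] with y hy using (hsub hy).2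
  refine ⟨ε, (2 * (a : ℝ), 2 * (b : ℝ)), hε, ?_⟩
  filter_upwards [(φ.continuousAt hq).eventually (Metric.ball_mem_nhds _ hr),
    φ.open_source.mem_nhds hq] with w h1 h2
  have h3 : v' (φ w) = ε • u' (φ w) + (2 * (a : ℝ), 2 * (b : ℝ)) := by
    by_cases h : φ w = φ q
    · rw [h, hcen]
    · exact (hsub ⟨h1, h⟩).2
  simpa only [hu', hv', φ.left_inv h2] using h3

/-- The developing map is open, as a map to the boundary of the octahedron. -/
theorem dev_nhds {p : ℝ × ℝ} {N : Set (ℝ × ℝ)} (hN : N ∈ 𝓝 p) :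
    ∃ V ∈ 𝓝 (dev p), ∀ v ∈ V, norm1 v = 1 → ∃ p' ∈ N, dev p' = v := by
  set sat : Set (ℝ × ℝ) := {ν | ∃ ν' ∈ interior N, dev ν' = dev ν} with hsat
  have hopen : IsOpen sat := by
    rw [isOpen_iff_mem_nhds]
    rintro ν ⟨ν', hν', h⟩
    obtain ⟨ε, a, b, hε, hab, h1, h2⟩ := dev_eq_dev_iff.1 h.symm
    have c : ContinuousAt (fun w : ℝ × ℝ => ((ε * w.1 + 2 * a, ε * w.2 + 2 * b) : ℝ × ℝ)) ν := by
      fun_prop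
    have e : (ε * ν.1 + 2 * a, ε * ν.2 + 2 * b) = ν' := Prod.ext h1.symm h2.symm
    filter_upwards [c.eventually (isOpen_interior.mem_nhds (by simpa only [e] using hν'))] with w hw
    exact ⟨_, hw, (dev_eq_dev_iff.2 ⟨ε, a, b, hε, hab, rfl, rfl⟩).symm⟩
  -- The saturation of a neighbourhood is open, and its complement in a compact set of
  -- representatives has compact image. The complement of this image is the required neighbourhood.
  have hK : IsCompact ((Set.Icc (0 : ℝ) 4 ×ˢ Set.Icc (0 : ℝ) 1) \ sat) := by
    rw [Set.sdiff_eq]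
    exact (isCompact_Icc.prod isCompact_Icc).inter_right hopen.isClosed_compl
  refine ⟨(dev '' ((Set.Icc (0 : ℝ) 4 ×ˢ Set.Icc (0 : ℝ) 1) \ sat))ᶜ,
    (hK.image continuous_dev).isClosed.isOpen_compl.mem_nhds ?_, ?_⟩
  · rintro ⟨ν, ⟨-, hν⟩, h⟩
    exact hν ⟨p, mem_interior_iff_mem_nhds.2 hN, h.symm⟩
  · intro v hv hv1
    obtain ⟨x, y, h0, h1, rfl⟩ := exists_dev_eq hv1
    set n := ⌊x / 4⌋
    have e : dev (x - 4 * n, y) = dev (x, y) := by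
      rw [dev_eq_dev_iff]
      exact ⟨1, 2 * n, 0, Or.inl rfl, by simp, by push_cast; ring, by simp⟩
    by_contra H
    refine hv ⟨(x - 4 * n, y), ⟨⟨⟨?_, ?_⟩, h0, h1⟩, ?_⟩, e⟩
    · have := Int.floor_le (x / 4); simp only; linarith
    · have := Int.lt_floor_add_one (x / 4); simp only; linarith
    · rintro ⟨ν', h2, h3⟩
      exact H ⟨ν', interior_subset h2, h3.trans e⟩

/-! ### The surface and its charts -/

/-- The projection to the quotient. -/
noncomputable def proj (p : ℝ × ℂ) : ℝ × ℝ × ℝ := straighten.symm (dbl p)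

@[fun_prop]
theorem continuous_proj : Continuous proj := straighten.symm.continuous.comp continuous_dbl

/-- The surface, as the double branched cover of the boundary of the octahedron. -/
def surf : Set (ℝ × ℂ) := {p | norm1 (proj p) = 1}

theorem straighten_proj (p : ℝ × ℂ) : straighten (proj p) = dbl p :=
  straighten.apply_symm_apply _

theorem proj_eq_of {p : ℝ × ℂ} {v : ℝ × ℝ × ℝ} (h1 : p.1 = height v)
    (h2 : p.2 ^ 2 = (straighten v).2) : proj p = v := by
  rw [proj, Homeomorph.symm_apply_eq]
  exact Prod.ext h1 h2

/-- A parametrisation `E` of the octahedron boundary and a square root `ζ` of the straightened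
coordinate give a parametrisation of the double cover. For openness, a nearby point of the surface
projects into the image of `E`, and only the sign of the square root is in question. -/
theorem exists_chart_of {U : Set ℂ} (hU : IsOpen U) (hne : U.Nonempty) {E : ℂ → ℝ × ℝ × ℝ}
    {ζ : ℂ → ℂ} (hE : Continuous E) (hE1 : ∀ z, norm1 (E z) = 1)
    (hEo : ∀ z ∈ U, ∀ N ∈ 𝓝 z, ∃ V ∈ 𝓝 (E z), ∀ v ∈ V, norm1 v = 1 → ∃ z' ∈ N, E z' = v)
    (hζ : ContinuousOn ζ U) (hζ2 : ∀ z ∈ U, ζ z ^ 2 = (straighten (E z)).2)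
    (hinj : ∀ z ∈ U, ∀ z' ∈ U, E z = E z' → ζ z = ζ z' → z = z')
    (hbr : ∀ z ∈ U, ζ z ≠ 0 ∨
      (z = 0 ∧ ∀ z' ∈ U, -z' ∈ U ∧ E (-z') = E z' ∧ ζ (-z') = - ζ z')) :
    ∃ e : OpenPartialHomeomorph surf ℂ, e.target = U ∧
      (∀ z ∈ U, (e.symm z : ℝ × ℂ) = (height (E z), ζ z)) ∧
      (∀ q ∈ e.source, proj q = E (e q)) ∧ ∀ q : surf, ∀ z ∈ U, q.1 = (height (E z), ζ z) →
        q ∈ e.source ∧ e q = z := by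
  have hpr : ∀ z ∈ U, proj (height (E z), ζ z) = E z := fun z hz => proj_eq_of rfl (hζ2 z hz)
  let χ : U → surf := fun z => ⟨(height (E z), ζ z), by
    rw [surf, Set.mem_ofPred_eq, hpr z z.2, hE1]⟩
  have hχc : Continuous χ := by
    refine Continuous.subtype_mk (Continuous.prodMk ?_ ?_) _
    · unfold height; fun_prop
    · exact continuousOn_iff_continuous_domRestrict.1 hζ
  have hχi : Function.Injective χ := by
    intro z z' h
    have h1 : ((height (E z), ζ z) : ℝ × ℂ) = (height (E z'), ζ z') := congrArg Subtype.val h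
    refine Subtype.ext (hinj z z.2 z' z'.2 ?_ (congrArg Prod.snd h1))
    rw [← hpr z z.2, h1, hpr z' z'.2]
  have hχo : IsOpenMap χ := by
    rw [isOpenMap_iff_nhds_le]
    rintro ⟨z, hz⟩ M hM
    obtain ⟨N₀, hN₀, hN₀M⟩ := mem_nhds_subtype _ _ _ |>.1 (Filter.mem_map.1 hM)
    have hN : N₀ ∩ U ∈ 𝓝 z := Filter.inter_mem hN₀ (hU.mem_nhds hz)
    have hsub : ∀ z' (h : z' ∈ N₀ ∩ U), χ ⟨z', h.2⟩ ∈ M := fun z' h =>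
      hN₀M (show (⟨z', h.2⟩ : U) ∈ Subtype.val ⁻¹' N₀ from h.1)
    have cp : ContinuousAt (fun s : surf => proj s) (χ ⟨z, hz⟩) := by fun_prop
    have hp0 : proj (χ ⟨z, hz⟩) = E z := hpr z hz
    have hlift : ∀ (s : surf) (z' : ℂ), z' ∈ U → E z' = proj s →
        s.1.1 = height (E z') ∧ (s.1.2 = ζ z' ∨ s.1.2 = - ζ z') := by
      intro s z' hz' h
      have h1 := straighten_proj s
      rw [← h] at h1
      refine ⟨(congrArg Prod.fst h1).symm, ?_⟩
      rw [← sq_eq_sq_iff_eq_or_eq_neg, hζ2 z' hz', h1]; rfl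
    rcases hbr z hz with h0 | ⟨rfl, h0⟩
    -- Away from the branch point the two square roots are far apart, so a point near `χ z` has the
    -- right sign.
    · have hpos : 0 < ‖ζ z‖ := norm_pos_iff.2 h0
      have hN1 : {z' | z' ∈ N₀ ∩ U ∧ ‖ζ z' - ζ z‖ < ‖ζ z‖ / 2} ∈ 𝓝 z := by
        have c : ContinuousAt ζ z := hζ.continuousAt (hU.mem_nhds hz)
        have : ∀ᶠ z' in 𝓝 z, ‖ζ z' - ζ z‖ < ‖ζ z‖ / 2 :=
          (ContinuousAt.norm (by fun_prop)).eventually_lt continuousAt_const (by simpa using h0)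
        exact Filter.Eventually.and hN this
      obtain ⟨V, hV, hVE⟩ := hEo z hz _ hN1
      have cs : ContinuousAt (fun s : surf => ‖s.1.2 - ζ z‖) (χ ⟨z, hz⟩) := by fun_prop
      have hs : ∀ᶠ s : surf in 𝓝 (χ ⟨z, hz⟩), ‖s.1.2 - ζ z‖ < ‖ζ z‖ / 2 :=
        cs.eventually_lt continuousAt_const (by simpa [χ] using h0)
      filter_upwards [cp.preimage_mem_nhds (by simp only [hp0]; exact hV), hs] with s hs1 hs2
      obtain ⟨z', ⟨hz', hz'2⟩, hEz'⟩ := hVE _ hs1 s.2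
      obtain ⟨e1, e2 | e2⟩ := hlift s z' hz'.2 hEz'
      · have : s = χ ⟨z', hz'.2⟩ := Subtype.ext (Prod.ext e1 e2)
        rw [this]; exact hsub z' hz'
      · exfalso
        rw [e2] at hs2
        have : ‖(2 : ℂ) * ζ z‖ ≤ ‖ζ z' - ζ z‖ + ‖-ζ z' - ζ z‖ := by
          rw [show (2 : ℂ) * ζ z = -((ζ z' - ζ z) + (-ζ z' - ζ z)) by ring, norm_neg]
          exact norm_add_le _ _
        rw [norm_mul, Complex.norm_ofNat] at this
        linarith
    -- At the branch point the wrong sign is corrected by replacing `z'` with `-z'`.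
    · have hN1 : {z' | z' ∈ N₀ ∩ U ∧ -z' ∈ N₀ ∩ U} ∈ 𝓝 (0 : ℂ) := by
        have : Filter.Tendsto (fun z : ℂ => -z) (𝓝 0) (𝓝 0) := by
          simpa using (continuous_neg (G := ℂ)).tendsto 0
        exact Filter.Eventually.and hN (this.eventually hN)
      obtain ⟨V, hV, hVE⟩ := hEo 0 hz _ hN1
      filter_upwards [cp.preimage_mem_nhds (by simp only [hp0]; exact hV)] with s hs1
      obtain ⟨z', ⟨hz', hz'2⟩, hEz'⟩ := hVE _ hs1 s.2
      obtain ⟨e1, e2 | e2⟩ := hlift s z' hz'.2 hEz'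
      · have : s = χ ⟨z', hz'.2⟩ := Subtype.ext (Prod.ext e1 e2)
        rw [this]; exact hsub z' hz'
      · obtain ⟨-, h1, h2⟩ := h0 z' hz'.2
        have : s = χ ⟨-z', hz'2.2⟩ := Subtype.ext (Prod.ext (by rw [e1, ← h1]) (by rw [e2, ← h2]))
        rw [this]; exact hsub _ hz'2
  have hemb : Topology.IsOpenEmbedding χ :=
    Topology.IsOpenEmbedding.of_continuous_injective_isOpenMap hχc hχi hχo
  have : Nonempty U := hne.to_subtype
  let e1 := hemb.toOpenPartialHomeomorph χ
  let e2 := hU.isOpenEmbedding_subtypeVal.toOpenPartialHomeomorph (Subtype.val : U → ℂ)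
  have he1 : ∀ z, e1.symm (χ z) = z := fun z => e1.left_inv (by simp [e1])
  have he2 : ∀ z : U, e2.symm z = z := fun z => e2.left_inv (by simp [e2])
  have key : ∀ z (hz : z ∈ U), χ ⟨z, hz⟩ ∈ (e1.symm.trans e2).source ∧
      (e1.symm.trans e2) (χ ⟨z, hz⟩) = z := by
    intro z hz
    constructor
    · simp [e1, e2]
    · simp only [OpenPartialHomeomorph.coe_trans, Function.comp_apply, he1]; rfl
  have ht : (e1.symm.trans e2).target = U := by
    ext z; simp [e1, e2]
  have hsymm : ∀ z (hz : z ∈ U), (e1.symm.trans e2).symm z = χ ⟨z, hz⟩ := by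
    intro z hz
    have := (e1.symm.trans e2).left_inv (key z hz).1
    rwa [(key z hz).2] at this
  refine ⟨e1.symm.trans e2, ht, fun z hz => by rw [hsymm z hz], fun q hq => ?_, fun q z hz h => ?_⟩
  · have h1 := (e1.symm.trans e2).left_inv hq
    have h2 : (e1.symm.trans e2) q ∈ U := ht.subset ((e1.symm.trans e2).map_source hq)
    rw [hsymm _ h2] at h1
    rw [← hpr _ h2]
    exact congrArg (fun s : surf => proj s) h1.symm
  · have : q = χ ⟨z, hz⟩ := Subtype.ext h
    rw [this]; exact key z hz


/-! ### Odd square roots -/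

/-- The hypothesis says that `f` does not point in the direction opposite to `g`: the real numbers
in it are the real and imaginary parts of `f` times the conjugate of `g`. -/
theorem div_mem_slitPlane {f g : ℂ} (hg : g ≠ 0)
    (h : 0 < f.re * g.re + f.im * g.im ∨ f.im * g.re - f.re * g.im ≠ 0) :
    f / g ∈ Complex.slitPlane := by
  have hn : 0 < Complex.normSq g := Complex.normSq_pos.2 hg
  rw [Complex.mem_slitPlane_iff, Complex.div_re, Complex.div_im, ← add_div, ← sub_div]
  refine h.imp (fun h => div_pos h hn) fun h => div_ne_zero h hn.ne'

/-- `f` and `g` have an even logarithmic quotient in a punctured disc. -/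
def LogRel (r : ℝ) (f g : ℂ → ℂ) : Prop :=
  ∃ k : ℂ → ℂ, ContinuousOn k {z | z ≠ 0 ∧ ‖z‖ < r} ∧ (∀ z, k (-z) = k z) ∧
    ∀ z, z ≠ 0 → ‖z‖ < r → f z = g z * Complex.exp (k z)

theorem LogRel.trans {r : ℝ} {f g h : ℂ → ℂ} (h1 : LogRel r f g) (h2 : LogRel r g h) :
    LogRel r f h := by
  obtain ⟨k, hk, hk', hf⟩ := h1
  obtain ⟨l, hl, hl', hg⟩ := h2
  exact ⟨fun z => l z + k z, hl.add hk, fun z => by simp only [hk', hl'], fun z h0 hr => by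
    rw [hf z h0 hr, hg z h0 hr, Complex.exp_add, mul_assoc]⟩

theorem LogRel.of_slitPlane {r : ℝ} {f g : ℂ → ℂ} (hf : Continuous f) (hg : Continuous g)
    (hf' : ∀ z, f (-z) = f z) (hg' : ∀ z, g (-z) = g z)
    (h0 : ∀ z, z ≠ 0 → ‖z‖ < r → g z ≠ 0)
    (h : ∀ z, z ≠ 0 → ‖z‖ < r → 0 < (f z).re * (g z).re + (f z).im * (g z).im ∨
      (f z).im * (g z).re - (f z).re * (g z).im ≠ 0) : LogRel r f g := by
  have hs : ∀ z, z ≠ 0 → ‖z‖ < r → f z / g z ∈ Complex.slitPlane := fun z hz hr =>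
    div_mem_slitPlane (h0 z hz hr) (h z hz hr)
  refine ⟨fun z => Complex.log (f z / g z), ?_, fun z => by simp only [hf', hg'], fun z hz hr => ?_⟩
  · exact (hf.continuousOn.div hg.continuousOn fun z hz => h0 z hz.1 hz.2).clog
      fun z hz => hs z hz.1 hz.2
  · rw [Complex.exp_log (Complex.slitPlane_ne_zero (hs z hz hr)), mul_div_cancel₀ _ (h0 z hz hr)]

/-- The root is `ω * conj z * exp (k z / 2)`; it is odd because `k` is even. Its modulus is the
square root of that of `W`, which gives continuity at the origin. -/
theorem LogRel.exists_odd_sqrt {r : ℝ} {W : ℂ → ℂ} (hW : Continuous W) (hW0 : W 0 = 0) {ω : ℂ}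
    (hω : ω ≠ 0) (h : LogRel r W fun z => (ω * (starRingEnd ℂ) z) ^ 2) :
    ∃ ζ : ℂ → ℂ, ContinuousOn ζ (Metric.ball 0 r) ∧ (∀ z, ζ (-z) = - ζ z) ∧
      (∀ z ∈ Metric.ball 0 r, ζ z ^ 2 = W z) ∧ ∀ z, z ≠ 0 → ζ z ≠ 0 := by
  obtain ⟨k, hk, hk', hf⟩ := h
  have hsq : ∀ z ∈ Metric.ball (0 : ℂ) r,
      (ω * (starRingEnd ℂ) z * Complex.exp (k z / 2)) ^ 2 = W z := by
    intro z hz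
    by_cases h0 : z = 0
    · simp [h0, hW0]
    · rw [hf z h0 (by simpa using hz), mul_pow _ (Complex.exp _), ← Complex.exp_nat_mul]
      congr 2; push_cast; ring
  refine ⟨fun z => ω * (starRingEnd ℂ) z * Complex.exp (k z / 2), fun z hz => ?_, fun z => ?_, hsq,
    fun z hz => ?_⟩
  · by_cases h0 : z = 0
    · subst h0
      have hl : Filter.Tendsto (fun z => Real.sqrt ‖W z‖) (𝓝[Metric.ball 0 r] 0) (𝓝 0) := by
        have : Continuous fun z => Real.sqrt ‖W z‖ := hW.norm.sqrt
        simpa [hW0] using (this.tendsto 0).mono_left (nhdsWithin_le_nhds (s := Metric.ball 0 r))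
      have : Filter.Tendsto (fun z => ω * (starRingEnd ℂ) z * Complex.exp (k z / 2))
          (𝓝[Metric.ball 0 r] 0) (𝓝 0) := by
        refine squeeze_zero_norm' ?_ hl
        filter_upwards [self_mem_nhdsWithin] with z hz
        rw [← hsq z hz, norm_pow, Real.sqrt_sq (norm_nonneg _)]
      simpa [ContinuousWithinAt] using this
    · have hz' : ‖z‖ < r := by simpa using hz
      have hU : IsOpen {z : ℂ | z ≠ 0 ∧ ‖z‖ < r} :=
        isOpen_ne.inter (isOpen_lt continuous_norm continuous_const)
      have c : ContinuousAt k z := hk.continuousAt (hU.mem_nhds ⟨h0, hz'⟩)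
      have c2 : ContinuousAt (fun z => ω * (starRingEnd ℂ) z) z :=
        (continuous_const.mul Complex.continuous_conj).continuousAt
      exact (c2.mul (c.div_const 2).cexp).continuousWithinAt
  · simp [hk']
  · exact mul_ne_zero (mul_ne_zero hω (by simpa using hz)) (Complex.exp_ne_zero _)

/-! ### Charts at the branch points -/

theorem dev_comp_nhds {g : ℂ → ℝ × ℝ} (hg : IsOpenMap g) (z : ℂ) {N : Set ℂ} (hN : N ∈ 𝓝 z) :
    ∃ V ∈ 𝓝 (dev (g z)), ∀ v ∈ V, norm1 v = 1 → ∃ z' ∈ N, dev (g z') = v := by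
  obtain ⟨V, hV, h⟩ := dev_nhds (hg.image_mem_nhds hN)
  refine ⟨V, hV, fun v hv h1 => ?_⟩
  obtain ⟨_, ⟨z', hz', rfl⟩, h2⟩ := h v hv h1
  exact ⟨z', hz', h2⟩

/-- The homeomorphism of the complex plane and the real plane taking `0` to `c`. -/
noncomputable def planeAt (c : ℝ × ℝ) : ℂ ≃ₜ ℝ × ℝ :=
  Complex.equivRealProdCLM.toHomeomorph.trans (Homeomorph.addLeft c)

theorem planeAt_apply (c : ℝ × ℝ) (z : ℂ) : planeAt c z = (c.1 + z.re, c.2 + z.im) := rfl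

theorem dev_injective_near {a b : ℤ} {x y x' y' : ℝ} (hx : |x| < 1 / 2) (hy : |y| < 1 / 2)
    (hx' : |x'| < 1 / 2) (hy' : |y'| < 1 / 2)
    (h : dev (a + x, b + y) = dev (a + x', b + y')) :
    (x' = x ∧ y' = y) ∨ (x' = -x ∧ y' = -y ∧ Even (a + b)) := by
  obtain ⟨ε, m, n, hε, hmn, h1, h2⟩ := dev_eq_dev_iff.1 h
  rw [abs_lt] at hx hy hx' hy'
  rcases hε with rfl | rfl
  · have : (-1 : ℝ) < m ∧ (m : ℝ) < 1 ∧ (-1 : ℝ) < n ∧ (n : ℝ) < 1 :=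
      ⟨by linarith, by linarith, by linarith, by linarith⟩
    norm_cast at this
    obtain rfl : m = 0 := by omega
    obtain rfl : n = 0 := by omega
    left
    push_cast at h1 h2
    constructor <;> linarith
  · have : (-1 : ℝ) < m - a ∧ (m - a : ℝ) < 1 ∧ (-1 : ℝ) < n - b ∧ (n - b : ℝ) < 1 :=
      ⟨by linarith, by linarith, by linarith, by linarith⟩
    norm_cast at this
    obtain rfl : m = a := by omega
    obtain rfl : n = b := by omega
    right
    exact ⟨by linarith, by linarith, hmn⟩

/-- The even coordinate of the base becomes an honest coordinate of the double cover through the odd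
square root. At a cone point `g` is an affine coordinate, already even for `dev`; at a regular
vertex it is its composition with squaring. -/
theorem exists_branched_chart {r : ℝ} (hr : 0 < r) {g : ℂ → ℝ × ℝ} (hg : Continuous g)
    (hgo : IsOpenMap g) (heven : ∀ z, dev (g (-z)) = dev (g z))
    (hinj : ∀ z z', ‖z‖ < r → ‖z'‖ < r → dev (g z) = dev (g z') → z' = z ∨ z' = -z)
    (h0 : (straighten (dev (g 0))).2 = 0) {ω : ℂ} (hω : ω ≠ 0)
    (hl : LogRel r (fun z => (straighten (dev (g z))).2) fun z => (ω * (starRingEnd ℂ) z) ^ 2) :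
    ∃ e : OpenPartialHomeomorph surf ℂ, (∀ q ∈ e.source, ‖e q‖ < r) ∧
      (∀ q ∈ e.source, dev (g (e q)) = proj q) ∧
      ∀ q : surf, q.1 = (height (dev (g 0)), 0) → q ∈ e.source ∧ e q = 0 := by
  have hc : Continuous fun z => dev (g z) := continuous_dev.comp hg
  obtain ⟨ζ, hζ, hodd, hsq, hne⟩ := hl.exists_odd_sqrt
    (continuous_snd.comp (straighten.continuous.comp hc)) h0 hω
  have h00 : ζ 0 = 0 := by
    have := hsq 0 (Metric.mem_ball_self hr)
    simp only [Function.comp_apply, h0] at this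
    exact pow_eq_zero_iff (two_ne_zero) |>.1 this
  obtain ⟨e, he1, -, he3, he4⟩ := exists_chart_of Metric.isOpen_ball ⟨0, Metric.mem_ball_self hr⟩
    hc (fun z => norm1_dev _) (fun z _ N hN => dev_comp_nhds hgo z hN) hζ hsq
    (fun z hz z' hz' h h' => by
      rcases hinj z z' (by simpa using hz) (by simpa using hz') h with h2 | h2
      · exact h2.symm
      · rw [h2, hodd] at h'
        have : z = 0 := by
          by_contra H
          exact hne z H (self_eq_neg.1 h')
        rw [h2, this, neg_zero])
    (fun z hz => by
      by_cases hz0 : z = 0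
      · exact Or.inr ⟨hz0, fun z' hz' => ⟨by simpa using hz', heven z', hodd z'⟩⟩
      · exact Or.inl (hne z hz0))
  refine ⟨e, fun q hq => ?_, fun q hq => (he3 q hq).symm, fun q hq => ?_⟩
  · have : e q ∈ Metric.ball (0 : ℂ) r := he1.subset (e.map_source hq)
    simpa using this
  · exact he4 q 0 (Metric.mem_ball_self hr) (by rw [h00]; exact hq)

theorem straighten_snd_re (v : ℝ × ℝ × ℝ) : (straighten v).2.re = v.1 - axisX (height v) := by
  simp [straighten_snd, axisC_re]

theorem straighten_snd_im (v : ℝ × ℝ × ℝ) : (straighten v).2.im = v.2.1 - axisY (height v) := by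
  simp [straighten_snd, axisC_im]

theorem smin_mul_mul (a b : ℝ) : smin a b * (a * b) = smin a b ^ 2 * (|a + b| + |a - b|) / 2 := by
  have h1 := sq_abs (a + b)
  have h2 := sq_abs (a - b)
  have : a * b = (|a + b| - |a - b|) * (|a + b| + |a - b|) / 4 := by nlinarith
  rw [this, smin]; ring

/-- The pair `(|x| - |y|, smin x y)` is a piecewise linear version of `(x² - y², 2xy)`. The last
inequality says that it makes an acute angle with the square of `x + iy`, so both wind equally about
the origin. -/
theorem corner_facts (x y : ℝ) : max |x| |y| = |(|x| - |y|)| + |smin x y| ∧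
    (|x| - |y| = 0 → smin x y = 0 → x = 0 ∧ y = 0) ∧
    0 ≤ (|x| - |y|) * (x ^ 2 - y ^ 2) ∧ 0 ≤ smin x y * (x * y) ∧
    (¬ (x = 0 ∧ y = 0) → 0 < (|x| - |y|) * (x ^ 2 - y ^ 2) + 2 * (smin x y * (x * y))) := by
  have e1 : (|x| - |y|) * (x ^ 2 - y ^ 2) = (|x| - |y|) ^ 2 * (|x| + |y|) := by
    rw [← sq_abs x, ← sq_abs y]; ring
  have h1 : |x| - |y| = 0 → smin x y = 0 → x = 0 ∧ y = 0 := by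
    intro h h'
    have h2 : min |x| |y| = 0 := by rw [← abs_smin, h', abs_zero]
    have h3 : |x| = 0 := by
      rw [min_eq_left (by linarith)] at h2; exact h2
    exact ⟨abs_eq_zero.1 h3, abs_eq_zero.1 (by linarith)⟩
  have h2 : 0 ≤ (|x| - |y|) * (x ^ 2 - y ^ 2) := by rw [e1]; positivity
  have h3 : 0 ≤ smin x y * (x * y) := by rw [smin_mul_mul]; positivity
  refine ⟨?_, h1, h2, h3, fun h => ?_⟩
  · rw [abs_smin]
    simp only [abs_eq_max_neg, max_def, min_def]; split_ifs <;> linarith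
  · by_contra H
    have h4 : (|x| - |y|) ^ 2 * (|x| + |y|) = 0 := by rw [← e1]; linarith
    have h5 : smin x y ^ 2 * (|x + y| + |x - y|) = 0 := by
      have := smin_mul_mul x y
      linarith
    apply h
    rcases mul_eq_zero.1 h4 with h6 | h6
    · rcases mul_eq_zero.1 h5 with h7 | h7
      · exact h1 (pow_eq_zero_iff two_ne_zero |>.1 h6) (pow_eq_zero_iff two_ne_zero |>.1 h7)
      · have := abs_nonneg (x + y)
        have := abs_nonneg (x - y)
        have a1 := abs_eq_zero.1 (show |x + y| = 0 by linarith)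
        have a2 := abs_eq_zero.1 (show |x - y| = 0 by linarith)
        constructor <;> linarith
    · have := abs_nonneg x
      have := abs_nonneg y
      exact ⟨abs_eq_zero.1 (by linarith), abs_eq_zero.1 (by linarith)⟩

theorem complex_ne_zero_iff (z : ℂ) : z ≠ 0 ↔ ¬ (z.re = 0 ∧ z.im = 0) := by
  rw [Ne, Complex.ext_iff]; rfl

theorem abs_re_im_lt {z : ℂ} {r : ℝ} (h : ‖z‖ < r) : |z.re| < r ∧ |z.im| < r :=
  ⟨(Complex.abs_re_le_norm z).trans_lt h, (Complex.abs_im_le_norm z).trans_lt h⟩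

theorem dev_near_origin {x y : ℝ} (hx : |x| < 1 / 10) (hy : |y| < 1 / 10) :
    dev (x, y) = (|x| - |y|, 1 - |(|x| - |y|)| - |smin x y|, smin x y) := by
  have hx1 := abs_lt.1 hx
  have hy1 := abs_lt.1 hy
  have h := (corner_facts x y).1
  simp only [dev]
  rw [saw_of_mem (by linarith) (by linarith), saw_of_mem (by linarith) (by linarith),
    csaw_of_mem (by linarith) (by linarith), csaw_of_mem (by linarith) (by linarith),
    smin_of_nonneg (by linarith) (by linarith)]
  have : min (1 - |x|) (1 - |y|) = 1 - max |x| |y| := by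
    rcases le_total |x| |y| with h | h
    · rw [max_eq_right h, min_eq_right (by linarith)]
    · rw [max_eq_left h, min_eq_left (by linarith)]
  rw [this, h]; ext <;> simp only
  ring

theorem continuous_smin_re_im : Continuous fun z : ℂ => smin z.re z.im := by
  have := Complex.continuous_re
  have := Complex.continuous_im
  unfold smin; fun_prop

theorem planeAt_neg_dev (a b : ℤ) (h : Even (a + b)) (z : ℂ) :
    dev (planeAt (a, b) (-z)) = dev (planeAt (a, b) z) := by
  rw [planeAt_apply, planeAt_apply, dev_eq_dev_iff]
  exact ⟨-1, a, b, Or.inr rfl, h, by simp; ring, by simp; ring⟩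

theorem planeAt_injective_near (a b : ℤ) {z z' : ℂ} (hz : ‖z‖ < 1 / 10) (hz' : ‖z'‖ < 1 / 10)
    (h : dev (planeAt (a, b) z) = dev (planeAt (a, b) z')) : z' = z ∨ z' = -z := by
  have h1 := abs_re_im_lt hz
  have h2 := abs_re_im_lt hz'
  rw [planeAt_apply, planeAt_apply] at h
  rcases dev_injective_near (by linarith) (by linarith) (by linarith) (by linarith) h with h | h
  · exact Or.inl (Complex.ext h.1 h.2)
  · exact Or.inr (Complex.ext h.1 h.2.1)

theorem conj_sq_facts (z : ℂ) : ((starRingEnd ℂ) z ^ 2).re = z.re ^ 2 - z.im ^ 2 ∧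
    ((starRingEnd ℂ) z ^ 2).im = -2 * (z.re * z.im) := by
  rw [sq]; simp only [Complex.mul_re, Complex.mul_im, Complex.conj_re, Complex.conj_im]
  constructor <;> ring

/-- The chart at the branch point over `(0, 1, 0)`. -/
theorem exists_chart_at_A : ∃ e : OpenPartialHomeomorph surf ℂ,
    (∀ q ∈ e.source, dev (planeAt (0, 0) (e q)) = proj q) ∧
      ∀ q : surf, q.1 = (-3, 0) → q ∈ e.source := by
  have hd : ∀ z : ℂ, ‖z‖ < 1 / 10 → dev (planeAt (0, 0) z) =
      (|z.re| - |z.im|, 1 - |(|z.re| - |z.im|)| - |smin z.re z.im|, smin z.re z.im) := by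
    intro z hz
    have h := abs_re_im_lt hz
    rw [planeAt_apply, zero_add, zero_add, dev_near_origin h.1 h.2]
  have d0 : dev (planeAt (0, 0) 0) = (0, 1, 0) := by rw [hd 0 (by norm_num)]; simp [smin]
  have cR := Complex.continuous_re
  have cI := Complex.continuous_im
  have cS := continuous_smin_re_im
  have hdc : Continuous fun z => dev (planeAt (0, 0) z) := continuous_dev.comp (planeAt _).continuous
  have heven : ∀ z, dev (planeAt (0, 0) (-z)) = dev (planeAt (0, 0) z) := by
    have := planeAt_neg_dev 0 0 (by simp); simpa using this
  -- The intermediate function `lin` is the straightened coordinate as it would be if the inner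
  -- piece of the branch line were prolonged beyond the vertex. The function `base` is simpler, and
  -- still winds like the square of the conjugate of `z`.
  set lin : ℂ → ℂ := fun z => ((|z.re| - |z.im| : ℝ) : ℂ) +
    ((8 * (|z.re| - |z.im|) - 16 * smin z.re z.im) / 3 : ℝ) * Complex.I with hlin
  set base : ℂ → ℂ := fun z => ((|z.re| - |z.im| : ℝ) : ℂ) + (- smin z.re z.im : ℝ) * Complex.I
    with hbase
  have lre : ∀ z, (lin z).re = |z.re| - |z.im| := by simp [hlin]
  have lim : ∀ z, (lin z).im = (8 * (|z.re| - |z.im|) - 16 * smin z.re z.im) / 3 := fun z => by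
    simp only [hlin, Complex.add_im, Complex.mul_im, Complex.ofReal_re, Complex.ofReal_im,
      Complex.I_re, Complex.I_im]; ring
  have bre : ∀ z, (base z).re = |z.re| - |z.im| := by simp [hbase]
  have bim : ∀ z, (base z).im = - smin z.re z.im := by simp [hbase]
  have l1 : LogRel (1 / 10) (fun z => (straighten (dev (planeAt (0, 0) z))).2) lin := by
    refine LogRel.of_slitPlane (continuous_snd.comp (straighten.continuous.comp hdc))
      (by simp only [hlin]; fun_prop) (fun z => by rw [heven])
      (fun z => by simp [hlin, smin_neg_left, smin_neg_right]) (fun z hz hr h => ?_)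
      fun z hz hr => ?_
    · obtain ⟨-, h1, -⟩ := corner_facts z.re z.im
      have e1 := congrArg Complex.re h
      have e2 := congrArg Complex.im h
      rw [lre] at e1
      rw [lim, e1] at e2
      simp only [Complex.zero_re, Complex.zero_im] at e1 e2
      exact (complex_ne_zero_iff z).1 hz (h1 e1 (by linarith))
    · obtain ⟨-, h1, -⟩ := corner_facts z.re z.im
      have hb := abs_re_im_lt hr
      rw [straighten_snd_re, straighten_snd_im, lre, lim, hd z hr]
      have hsm : |smin z.re z.im| < 1 / 10 := by
        rw [abs_smin]; exact (min_le_left _ _).trans_lt hb.1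
      have hX : |(|z.re| - |z.im|)| < 1 / 10 := by
        rw [abs_lt]
        have := abs_nonneg z.re
        have := abs_nonneg z.im
        constructor <;> linarith
      have hz' := (complex_ne_zero_iff z).1 hz
      set X := |z.re| - |z.im|
      set Z := smin z.re z.im
      simp only [height]
      have hX1 := abs_lt.1 hX
      have hZ1 := abs_lt.1 hsm
      have hX0 := abs_nonneg X
      have hZ0 := abs_nonneg Z
      rcases le_or_gt 0 (8 * X + 3 * (|X| + |Z|) - 16 * Z) with hδ | hδ
      · obtain ⟨e1, e2⟩ := axis_piece₅ (t := 8 * X - 3 * (1 - |X| - |Z|) - 16 * Z) (by linarith)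
          (by linarith)
        rw [e1, e2]
        left
        have hne : ¬ (X = 0 ∧ Z = 0) := fun h => hz' (h1 h.1 h.2)
        have e3 : 1 - |X| - |Z| - -(8 * X - 3 * (1 - |X| - |Z|) - 16 * Z) / 3
          = (8 * X - 16 * Z) / 3 := by ring
        rw [e3, sub_zero]
        by_cases hX' : X = 0
        · have hZ' : Z ≠ 0 := fun h => hne ⟨hX', h⟩
          rw [hX']; have := sq_pos_of_ne_zero hZ'; nlinarith
        · have := sq_pos_of_ne_zero hX'; nlinarith [sq_nonneg ((8 * X - 16 * Z) / 3)]
      · obtain ⟨e1, e2⟩ := axis_piece₄ (t := 8 * X - 3 * (1 - |X| - |Z|) - 16 * Z) (by linarith)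
          (by linarith)
        rw [e1, e2]
        by_cases hZ' : Z = 0
        · left
          rw [hZ'] at hδ ⊢
          simp only [abs_zero] at hδ ⊢
          have hXneg : X < 0 := by
            rcases lt_trichotomy X 0 with h | h | h
            · exact h
            · exact absurd (h1 h hZ') hz'
            · rw [abs_of_pos h] at hδ; linarith
          rw [abs_of_neg hXneg]
          nlinarith
        · right
          -- On the outer side of the bend this cross product of the true coordinate with `lin` is
          -- nonzero unless `Z = 0`. In that remaining case the two values make an acute angle.
          have e3 : (1 - |X| - |Z| - (18 / 25 + 7 / 75 * (8 * X - 3 * (1 - |X| - |Z|) - 16 * Z + 6))) *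
              X - (X - (-12 / 25 + 4 / 25 * (8 * X - 3 * (1 - |X| - |Z|) - 16 * Z + 6))) *
              ((8 * X - 16 * Z) / 3) = -(64 / 75) * (8 * X + 3 * (|X| + |Z|) - 16 * Z) * Z := by ring
          rw [e3]
          exact mul_ne_zero (mul_ne_zero (by norm_num) hδ.ne) hZ'
  have l2 : LogRel (1 / 10) lin base := by
    refine LogRel.of_slitPlane (by simp only [hlin]; fun_prop) (by simp only [hbase]; fun_prop)
      (fun z => by simp [hlin, smin_neg_left, smin_neg_right])
      (fun z => by simp [hbase, smin_neg_left, smin_neg_right]) (fun z hz hr h => ?_)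
      fun z hz hr => ?_
    all_goals
      obtain ⟨-, h1, -⟩ := corner_facts z.re z.im
    · have e1 := congrArg Complex.re h
      have e2 := congrArg Complex.im h
      rw [bre] at e1
      rw [bim] at e2
      simp only [Complex.zero_re, Complex.zero_im] at e1 e2
      exact (complex_ne_zero_iff z).1 hz (h1 e1 (by linarith))
    · left
      rw [lre, lim, bre, bim]
      have hne := mt (fun h : (|z.re| - |z.im| = 0 ∧ smin z.re z.im = 0) => h1 h.1 h.2)
        ((complex_ne_zero_iff z).1 hz)
      set X := |z.re| - |z.im|
      set Z := smin z.re z.im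
      by_cases hX' : X = 0
      · have hZ' : Z ≠ 0 := fun h => hne ⟨hX', h⟩
        rw [hX']; have := sq_pos_of_ne_zero hZ'; nlinarith
      · have := sq_pos_of_ne_zero hX'; nlinarith [sq_nonneg (X - 4 * Z)]
  have l3 : LogRel (1 / 10) base fun z => (1 * (starRingEnd ℂ) z) ^ 2 := by
    refine LogRel.of_slitPlane (by simp only [hbase]; fun_prop)
      ((continuous_const.mul Complex.continuous_conj).pow 2)
      (fun z => by simp [hbase, smin_neg_left, smin_neg_right]) (fun z => by simp)
      (fun z hz hr => by simpa using hz) fun z hz hr => Or.inl ?_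
    obtain ⟨-, -, -, -, h⟩ := corner_facts z.re z.im
    rw [one_mul, (conj_sq_facts z).1, (conj_sq_facts z).2, bre, bim]
    have := h ((complex_ne_zero_iff z).1 hz)
    linarith
  obtain ⟨e, -, he2, he3⟩ := exists_branched_chart (by norm_num : (0 : ℝ) < 1 / 10)
    (planeAt (0, 0)).continuous (planeAt (0, 0)).isOpenMap heven
    (fun z z' hz hz' h => planeAt_injective_near 0 0 hz hz' (by simpa using h))
    (by
      obtain ⟨e1, e2⟩ := axis_piece₅ (t := -3) (by norm_num) (by norm_num)
      rw [d0, straighten_snd]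
      simp [height, axisC, e1, e2])
    one_ne_zero ((l1.trans l2).trans l3)
  refine ⟨e, he2, fun q hq => (he3 q ?_).1⟩
  rw [hq, d0]; simp [height]


theorem dev_near_D {x y : ℝ} (hx : |x| < 1 / 10) (hy : |y| < 1 / 10) :
    dev (1 + x, 1 + y) = (|y| - |x|, smin x y, 1 - |(|x| - |y|)| - |smin x y|) := by
  have hx1 := abs_lt.1 hx
  have hy1 := abs_lt.1 hy
  have h := congrArg (fun v => v.2.1) (dev_near_origin hx hy)
  simp only [dev] at h
  simp only [dev, add_comm (1 : ℝ), csaw_add_one]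
  rw [show saw (x + 1) = csaw x from rfl, show saw (y + 1) = csaw y from rfl, h, abs_csaw, abs_csaw,
    saw_of_mem (by linarith) (by linarith), saw_of_mem (by linarith) (by linarith), smin_neg_left,
    smin_neg_right]
  ext <;> simp

/-- The chart at the branch point over `(0, 0, 1)`. -/
theorem exists_chart_at_D : ∃ e : OpenPartialHomeomorph surf ℂ,
    (∀ q ∈ e.source, dev (planeAt (1, 1) (e q)) = proj q) ∧
      ∀ q : surf, q.1 = (-16, 0) → q ∈ e.source := by
  have hd : ∀ z : ℂ, ‖z‖ < 1 / 10 → dev (planeAt (1, 1) z) =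
      (|z.im| - |z.re|, smin z.re z.im, 1 - |(|z.re| - |z.im|)| - |smin z.re z.im|) := by
    intro z hz
    have h := abs_re_im_lt hz
    rw [planeAt_apply, dev_near_D h.1 h.2]
  have d0 : dev (planeAt (1, 1) 0) = (0, 0, 1) := by rw [hd 0 (by norm_num)]; simp [smin]
  have cR := Complex.continuous_re
  have cI := Complex.continuous_im
  have cS := continuous_smin_re_im
  have hdc : Continuous fun z => dev (planeAt (1, 1) z) := continuous_dev.comp (planeAt _).continuous
  have heven : ∀ z, dev (planeAt (1, 1) (-z)) = dev (planeAt (1, 1) z) := by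
    have := planeAt_neg_dev 1 1 (by decide); simpa using this
  set base : ℂ → ℂ := fun z => ((|z.im| - |z.re| : ℝ) : ℂ) + (smin z.re z.im : ℝ) * Complex.I
    with hbase
  have bre : ∀ z, (base z).re = |z.im| - |z.re| := by simp [hbase]
  have bim : ∀ z, (base z).im = smin z.re z.im := by simp [hbase]
  have l1 : LogRel (1 / 10) (fun z => (straighten (dev (planeAt (1, 1) z))).2) base := by
    refine LogRel.of_slitPlane (continuous_snd.comp (straighten.continuous.comp hdc))
      (by simp only [hbase]; fun_prop) (fun z => by rw [heven])
      (fun z => by simp [hbase, smin_neg_left, smin_neg_right]) (fun z hz hr h => ?_)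
      fun z hz hr => ?_
    · obtain ⟨-, h1, -⟩ := corner_facts z.re z.im
      have e1 := congrArg Complex.re h
      have e2 := congrArg Complex.im h
      rw [bre] at e1
      rw [bim] at e2
      simp only [Complex.zero_re, Complex.zero_im] at e1 e2
      exact (complex_ne_zero_iff z).1 hz (h1 (by linarith) e2)
    · obtain ⟨-, h1, -⟩ := corner_facts z.re z.im
      have hb := abs_re_im_lt hr
      rw [straighten_snd_re, straighten_snd_im, bre, bim, hd z hr, abs_sub_comm]
      have hsm : |smin z.re z.im| < 1 / 10 := by
        rw [abs_smin]; exact (min_le_left _ _).trans_lt hb.1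
      have hX : |(|z.im| - |z.re|)| < 1 / 10 := by
        rw [abs_lt]
        have := abs_nonneg z.re
        have := abs_nonneg z.im
        constructor <;> linarith
      have hne := mt (fun h : (|z.im| - |z.re| = 0 ∧ smin z.re z.im = 0) => h1 (by linarith) h.2)
        ((complex_ne_zero_iff z).1 hz)
      set X := |z.im| - |z.re|
      set Y := smin z.re z.im
      simp only [height]
      have hX1 := abs_lt.1 hX
      have hY1 := abs_lt.1 hsm
      have hX0 := neg_abs_le X
      have hY0 := le_abs_self Y
      have hX2 := abs_nonneg X
      have hY2 := abs_nonneg Y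
      -- The vertex `(0, 0, 1)` is the lowest point of the octahedron for `height`, so only the
      -- inner piece of the line is met here.
      obtain ⟨e1, e2⟩ := axis_piece₁ (t := 8 * X - 3 * Y - 16 * (1 - |X| - |Y|)) (by linarith)
          (by linarith)
      rw [e1, e2]
      by_cases hY : Y = 0
      · left
        have hX' : X ≠ 0 := fun h => hne ⟨h, hY⟩
        have := sq_pos_of_ne_zero hX'
        have h3 := sq_abs X
        rw [hY]
        simp only [abs_zero]
        rcases abs_cases X with ⟨h, _⟩ | ⟨h, _⟩ <;> rw [h] <;> nlinarith
      · right
        have := abs_pos.2 hY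
        have e3 : (Y - 0) * X - (X - -(8 * X - 3 * Y - 16 * (1 - |X| - |Y|) + 16) / 16) * Y =
          -((8 * X - 3 * Y + 16 * |X| + 16 * |Y|) / 16) * Y := by ring
        rw [e3]
        have hp : 0 < (8 * X - 3 * Y + 16 * |X| + 16 * |Y|) / 16 := by linarith
        exact mul_ne_zero (neg_ne_zero.2 hp.ne') hY
  have l3 : LogRel (1 / 10) base fun z => (Complex.I * (starRingEnd ℂ) z) ^ 2 := by
    refine LogRel.of_slitPlane (by simp only [hbase]; fun_prop)
      ((continuous_const.mul Complex.continuous_conj).pow 2)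
      (fun z => by simp [hbase, smin_neg_left, smin_neg_right]) (fun z => by simp)
      (fun z hz hr => by simpa using hz) fun z hz hr => Or.inl ?_
    obtain ⟨-, -, -, -, h⟩ := corner_facts z.re z.im
    rw [mul_pow, Complex.I_sq, neg_one_mul, Complex.neg_re, Complex.neg_im, (conj_sq_facts z).1,
      (conj_sq_facts z).2, bre, bim]
    have := h ((complex_ne_zero_iff z).1 hz)
    linarith
  obtain ⟨e, -, he2, he3⟩ := exists_branched_chart (by norm_num : (0 : ℝ) < 1 / 10)
    (planeAt (1, 1)).continuous (planeAt (1, 1)).isOpenMap heven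
    (fun z z' hz hz' h => planeAt_injective_near 1 1 hz hz' (by simpa using h))
    (by
      obtain ⟨e1, e2⟩ := axis_piece₀ (t := -16) le_rfl
      rw [d0, straighten_snd]
      simp [height, axisC, e1, e2])
    Complex.I_ne_zero (l1.trans l3)
  refine ⟨e, he2, fun q hq => (he3 q ?_).1⟩
  rw [hq, d0]; simp [height]

theorem smin_of_abs_le {a b : ℝ} (h : |a| ≤ b) : smin a b = a := by
  have := abs_le.1 h
  rw [smin, abs_of_nonneg (by linarith), abs_of_nonpos (by linarith)]; ring

theorem dev_near_C {x y : ℝ} (hx : |x| < 1 / 10) (hy : |y| < 1 / 10) :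
    dev (1 + x, y) = (1 - |x| - |y|, -x, y) := by
  have hx1 := abs_lt.1 hx
  have hy1 := abs_lt.1 hy
  simp only [dev, add_comm (1 : ℝ), csaw_add_one]
  rw [show saw (x + 1) = csaw x from rfl, abs_csaw,
    saw_of_mem (by linarith) (by linarith), saw_of_mem (by linarith) (by linarith),
    csaw_of_mem (by linarith) (by linarith), csaw_of_mem (by linarith) (by linarith),
    smin_neg_left, smin_of_abs_le (by linarith), smin_comm, smin_of_abs_le (by linarith)]

/-- The coordinates of the projection near the vertex `(1, 0, 0)`. -/
theorem straighten_near_C {x y : ℝ} (hx : |x| < 1 / 100) (hy : |y| < 1 / 100) :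
    (0 ≤ -8 * |x| - 8 * |y| + 3 * x - 16 * y ∧
      (straighten (dev (1 + x, y))).2.re = -3 * |x| - 3 * |y| + 3 / 4 * x - 4 * y ∧
      (straighten (dev (1 + x, y))).2.im = -x) ∨
    (-8 * |x| - 8 * |y| + 3 * x - 16 * y < 0 ∧
      (straighten (dev (1 + x, y))).2.re =
        -|x| - |y| - 13 / 50 * (-8 * |x| - 8 * |y| + 3 * x - 16 * y) ∧
      (straighten (dev (1 + x, y))).2.im = -x - 9 / 25 * (-8 * |x| - 8 * |y| + 3 * x - 16 * y)) := by
  have hx1 := abs_lt.1 hx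
  have hy1 := abs_lt.1 hy
  rw [straighten_snd_re, straighten_snd_im, dev_near_C (by linarith) (by linarith)]
  have hx2 := abs_nonneg x
  have hy2 := abs_nonneg y
  simp only [height]
  set t := 8 * (1 - |x| - |y|) - 3 * -x - 16 * y with ht
  have hX := axisX_neg (-t)
  have hY := axisY_neg (-t)
  rw [neg_neg] at hX hY
  rcases le_or_gt 0 (-8 * |x| - 8 * |y| + 3 * x - 16 * y) with h | h
  · obtain ⟨e1, e2⟩ := axis_piece₂ (t := -t) (by linarith) (by linarith)
    left
    rw [hX, hY, e1, e2]
    refine ⟨h, by rw [ht]; ring, by ring⟩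
  · obtain ⟨e1, e2⟩ := axis_piece₃ (t := -t) (by linarith) (by linarith)
    right
    rw [hX, hY, e1, e2]
    refine ⟨h, by rw [ht]; ring, by rw [ht]; ring⟩

theorem sheared_ne_zero {x y : ℝ} (hx : |x| < 1 / 100) (hy : |y| < 1 / 100) (h : ¬ (x = 0 ∧ y = 0)) :
    (straighten (dev (1 + x, y))).2 ≠ 0 := by
  intro H
  have h1 := congrArg Complex.re H
  have h2 := congrArg Complex.im H
  simp only [Complex.zero_re, Complex.zero_im] at h1 h2
  have hx2 := abs_nonneg x
  have hy2 := abs_nonneg y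
  apply h
  rcases straighten_near_C hx hy with ⟨h0, e1, e2⟩ | ⟨h0, e1, e2⟩
  · rw [e1] at h1
    rw [e2] at h2
    have hx0 : x = 0 := by linarith
    subst hx0
    refine ⟨rfl, ?_⟩
    rw [abs_zero] at h1
    rcases abs_cases y with ⟨h, _⟩ | ⟨h, _⟩ <;> rw [h] at h1 <;> linarith
  · rw [e1] at h1
    rw [e2] at h2
    have := le_abs_self x
    have h3 : 18 * (|x| + |y|) = 13 * x := by linarith
    exact ⟨abs_eq_zero.1 (by linarith), abs_eq_zero.1 (by linarith)⟩

/-- The sheared coordinate never points opposite to `(-y, -x)`. -/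
theorem sheared_direction {x y f₁ f₂ : ℝ} (h : ¬ (x = 0 ∧ y = 0))
    (hf : (0 ≤ -8 * |x| - 8 * |y| + 3 * x - 16 * y ∧
      f₁ = 18 * (-3 * |x| - 3 * |y| + 3 / 4 * x - 4 * y) + 13 * x ∧ f₂ = -x) ∨
    (-8 * |x| - 8 * |y| + 3 * x - 16 * y < 0 ∧ f₁ = -18 * (|x| + |y|) + 13 * x ∧
      f₂ = -x - 9 / 25 * (-8 * |x| - 8 * |y| + 3 * x - 16 * y))) :
    0 < f₁ * -y + f₂ * -x ∨ f₂ * -y - f₁ * -x ≠ 0 := by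
  by_contra H
  push Not at H
  obtain ⟨hR, hI⟩ := H
  have hx2 := abs_nonneg x
  have hy2 := abs_nonneg y
  rcases hf with ⟨h0, e1, e2⟩ | ⟨h0, e1, e2⟩
  · have h3 : x * (y + f₁) = 0 := by rw [e2] at hI; linarith
    rcases mul_eq_zero.1 h3 with hx | hx
    · subst hx
      have hy : y ≠ 0 := fun h' => h ⟨rfl, h'⟩
      have := sq_pos_of_ne_zero hy
      rw [e1, abs_zero] at hR
      rcases abs_cases y with ⟨h, _⟩ | ⟨h, _⟩ <;> rw [h] at hR <;> nlinarith
    · have hf : f₁ = -y := by linarith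
      rw [hf, e2] at hR
      have h4 : x ^ 2 + y ^ 2 ≤ 0 := by nlinarith
      apply h
      constructor <;> nlinarith [sq_nonneg x, sq_nonneg y]
  · have hxle := le_abs_self x
    have hf1 : f₁ < 0 := by
      rw [e1]
      rcases (add_nonneg hx2 hy2).eq_or_lt with h' | h'
      · exact absurd ⟨abs_eq_zero.1 (by linarith), abs_eq_zero.1 (by linarith)⟩ h
      · linarith
    have hI' : x * f₁ = y * f₂ := by linarith
    have h5 : y * (f₁ ^ 2 + f₂ ^ 2) ≤ 0 := by
      have e3 : y * (f₁ ^ 2 + f₂ ^ 2) = f₁ * (f₁ * y + f₂ * x) := by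
        linear_combination (-f₂) * hI'
      rw [e3]
      exact mul_nonpos_of_nonpos_of_nonneg hf1.le (by linarith)
    have hy0 : y ≤ 0 := by
      by_contra hy
      push Not at hy
      have := sq_pos_of_ne_zero hf1.ne
      nlinarith [sq_nonneg f₂]
    rcases hy0.eq_or_lt with hy | hy
    · subst hy
      rw [zero_mul] at hI'
      rcases mul_eq_zero.1 hI' with h' | h'
      · exact h ⟨h', rfl⟩
      · exact hf1.ne h'
    · rw [abs_of_neg hy] at e1 e2 h0
      rcases le_or_gt 0 x with hx | hx
      · rw [abs_of_nonneg hx] at e1 e2 h0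
        rw [e1, e2] at hI'
        nlinarith [mul_nonneg hx (neg_nonneg.2 hy.le), sq_nonneg x, mul_pos_of_neg_of_neg hy hy]
      · have hf2 : 0 < f₂ := by rw [e2]; linarith
        have h6 : 0 < x * f₁ := mul_pos_of_neg_of_neg hx hf1
        have h7 : y * f₂ < 0 := mul_neg_of_neg_of_pos hy hf2
        linarith

/-- The chart at the singular point over `(1, 0, 0)`. -/
theorem exists_chart_at_C : ∃ e : OpenPartialHomeomorph surf ℂ,
    (∀ q ∈ e.source, ‖e q‖ < 1 / 10) ∧
    (∀ q ∈ e.source, dev (planeAt (1, 0) (e q ^ 2)) = proj q) ∧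
      ∀ q : surf, q.1 = (8, 0) → q ∈ e.source ∧ e q = 0 := by
  have hb : ∀ z : ℂ, ‖z‖ < 1 / 10 → |(z ^ 2).re| < 1 / 100 ∧ |(z ^ 2).im| < 1 / 100 := by
    intro z hz
    refine abs_re_im_lt ?_
    rw [norm_pow]; nlinarith [norm_nonneg z]
  have hpl : ∀ z, planeAt (1, 0) (z ^ 2) = (1 + (z ^ 2).re, (z ^ 2).im) := fun z => by
    rw [planeAt_apply, zero_add]
  have d0 : dev (planeAt (1, 0) (0 ^ 2)) = (1, 0, 0) := by
    rw [hpl, dev_near_C (by norm_num) (by norm_num)]; simp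
  have hc : Continuous fun z : ℂ => planeAt (1, 0) (z ^ 2) :=
    (planeAt _).continuous.comp (continuous_pow 2)
  set W : ℂ → ℂ := fun z => (straighten (dev (planeAt (1, 0) (z ^ 2)))).2 with hW
  have hWc : Continuous W := continuous_snd.comp (straighten.continuous.comp (continuous_dev.comp hc))
  have hWe : ∀ z, W (-z) = W z := fun z => by simp only [hW, neg_sq]
  -- The outer piece of the line has direction `(13, 18)` in the projection, so `18 * re - 13 * im`
  -- is unaffected by moving along it. The shear thus removes the bend from the first coordinate on
  -- that side.
  set TW : ℂ → ℂ := fun z => ((18 * (W z).re - 13 * (W z).im : ℝ) : ℂ) + (W z).im * Complex.I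
    with hTW
  have hTWc : Continuous TW := by
    have cR := Complex.continuous_re.comp hWc
    have cI := Complex.continuous_im.comp hWc
    simp only [Function.comp_def] at cR cI
    simp only [hTW]; fun_prop
  have tre : ∀ z, (TW z).re = 18 * (W z).re - 13 * (W z).im := by simp [hTW]
  have tim : ∀ z, (TW z).im = (W z).im := by simp [hTW]
  have hz2 : ∀ z : ℂ, z ≠ 0 → ¬ ((z ^ 2).re = 0 ∧ (z ^ 2).im = 0) := fun z hz =>
    (complex_ne_zero_iff _).1 (pow_ne_zero 2 hz)
  have hW0 : ∀ z : ℂ, z ≠ 0 → ‖z‖ < 1 / 10 → W z ≠ 0 := fun z hz hr => by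
    simp only [hW, hpl]
    exact sheared_ne_zero (hb z hr).1 (hb z hr).2 (hz2 z hz)
  -- Writing `z ^ 2 = x + iy`, the comparison vector `(-y, -x)` is `-i` times the conjugate of `z ^
  -- 2`; this choice of `ω` makes it `(ω * conj z) ^ 2`.
  obtain ⟨ω, hω⟩ : ∃ ω : ℂ, ω ^ 2 = -Complex.I := (Complex.isOpenQuotientMap_pow 2).surjective _
  have l1 : LogRel (1 / 10) W TW := by
    refine LogRel.of_slitPlane hWc hTWc hWe (fun z => by simp only [hTW, hWe])
      (fun z hz hr h => hW0 z hz hr ?_) fun z hz hr => ?_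
    · have e1 := congrArg Complex.re h
      have e2 := congrArg Complex.im h
      rw [tre] at e1
      rw [tim] at e2
      simp only [Complex.zero_re, Complex.zero_im] at e1 e2
      rw [e2] at e1
      exact Complex.ext (by simp only [Complex.zero_re]; linarith) e2
    · have h := (complex_ne_zero_iff _).1 (hW0 z hz hr)
      rw [tre, tim]
      set a := (W z).re
      set b := (W z).im
      by_contra H
      push Not at H
      obtain ⟨hR, hI⟩ := H
      have h3 : b * (17 * a - 13 * b) = 0 := by linarith
      apply h
      rcases mul_eq_zero.1 h3 with hb | hb
      · rw [hb] at hR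
        exact ⟨by nlinarith, hb⟩
      · have : a ^ 2 + b ^ 2 ≤ 0 := by nlinarith
        constructor <;> nlinarith [sq_nonneg a, sq_nonneg b]
  have l2 : LogRel (1 / 10) TW fun z => (ω * (starRingEnd ℂ) z) ^ 2 := by
    refine LogRel.of_slitPlane hTWc ((continuous_const.mul Complex.continuous_conj).pow 2)
      (fun z => by simp only [hTW, hWe]) (fun z => by simp)
      (fun z hz hr => ?_) fun z hz hr => ?_
    · refine pow_ne_zero 2 (mul_ne_zero ?_ (by simpa using hz))
      rintro rfl
      simp at hω
    · have e : (ω * (starRingEnd ℂ) z) ^ 2 = -Complex.I * (starRingEnd ℂ) (z ^ 2) := by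
        rw [mul_pow, hω, map_pow]
      have ere : ((ω * (starRingEnd ℂ) z) ^ 2).re = -(z ^ 2).im := by
        rw [e]
        simp only [Complex.mul_re, Complex.neg_re, Complex.neg_im, Complex.I_re, Complex.I_im,
          Complex.conj_re, Complex.conj_im]
        ring
      have eim : ((ω * (starRingEnd ℂ) z) ^ 2).im = -(z ^ 2).re := by
        rw [e]
        simp only [Complex.mul_im, Complex.neg_re, Complex.neg_im, Complex.I_re, Complex.I_im,
          Complex.conj_re, Complex.conj_im]
        ring
      rw [ere, eim, tre, tim]
      refine sheared_direction (hz2 z hz) ?_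
      simp only [hW, hpl]
      refine (straighten_near_C (hb z hr).1 (hb z hr).2).imp ?_ ?_
      · rintro ⟨h0, e1, e2⟩
        exact ⟨h0, by rw [e1, e2]; ring, e2⟩
      · rintro ⟨h0, e1, e2⟩
        exact ⟨h0, by rw [e1, e2]; ring, e2⟩
  obtain ⟨e, he1, he2, he3⟩ := exists_branched_chart (by norm_num : (0 : ℝ) < 1 / 10)
    hc ((planeAt (1, 0)).isOpenMap.comp (Complex.isOpenQuotientMap_pow 2).isOpenMap)
    (fun z => by rw [neg_sq])
    (fun z z' hz hz' h => by
      rw [hpl, hpl] at h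
      have h1 := hb z hz
      have h2 := hb z' hz'
      rcases dev_injective_near (a := 1) (b := 0) (x := (z ^ 2).re) (y := (z ^ 2).im)
        (x' := (z' ^ 2).re) (y' := (z' ^ 2).im) (by linarith)
        (by linarith) (by linarith) (by linarith) (by simpa using h) with h | h
      · exact sq_eq_sq_iff_eq_or_eq_neg.1 (Complex.ext h.1 h.2)
      · exact absurd h.2.2 (by decide))
    (by
      obtain ⟨e1, e2⟩ := axis_piece₂ (t := -8) (by norm_num) le_rfl
      have e3 := axisX_neg 8
      have e4 := axisY_neg 8
      rw [e1] at e3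
      rw [e2] at e4
      rw [d0, straighten_snd]
      have e5 : axisX 8 = 1 := by linarith
      have e6 : axisY 8 = 0 := by linarith
      simp [height, axisC, e5, e6])
    (show ω ≠ 0 by rintro rfl; simp at hω) (l1.trans l2)
  refine ⟨e, he1, he2, fun q hq => he3 q ?_⟩
  rw [hq, d0]; simp [height]


/-! ### The regular charts -/

theorem straighten_neg (v : ℝ × ℝ × ℝ) : straighten (-v) = - straighten v := by
  have h : height (-v) = - height v := by simp only [height, Prod.fst_neg, Prod.snd_neg]; ring
  refine Prod.ext (by rw [Prod.fst_neg, straighten_fst, straighten_fst, h]) (Complex.ext ?_ ?_)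
  · rw [Prod.snd_neg, Complex.neg_re, straighten_snd_re, straighten_snd_re, h, axisX_neg,
      Prod.fst_neg]; ring
  · rw [Prod.snd_neg, Complex.neg_im, straighten_snd_im, straighten_snd_im, h, axisY_neg,
      Prod.snd_neg, Prod.fst_neg]; ring

/-- The lift of the antipodal map. -/
noncomputable def antipode : (ℝ × ℂ) ≃ₜ (ℝ × ℂ) :=
  (Homeomorph.neg ℝ).prodCongr (Homeomorph.mulLeft₀ Complex.I Complex.I_ne_zero)

theorem antipode_apply (p : ℝ × ℂ) : antipode p = (-p.1, Complex.I * p.2) := rfl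

theorem proj_antipode (p : ℝ × ℂ) : proj (antipode p) = - proj p := by
  rw [proj, Homeomorph.symm_apply_eq, straighten_neg, straighten_proj, antipode_apply]
  refine Prod.ext rfl ?_
  simp only [dbl, Prod.snd_neg, mul_pow, Complex.I_sq, neg_one_mul]

noncomputable def antipodeSurf : surf ≃ₜ surf :=
  antipode.subtype fun p => by
    change norm1 (proj p) = 1 ↔ norm1 (proj (antipode p)) = 1
    rw [proj_antipode, norm1_neg]

theorem antipodeSurf_coe (q : surf) : (antipodeSurf q : ℝ × ℂ) = antipode q := rfl

/-- The lift of the antipodal map to the plane. -/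
def antipodePlane : ℝ × ℝ ≃ₜ ℝ × ℝ where
  toFun p := (p.2 + 2, p.1)
  invFun p := (p.2, p.1 - 2)
  left_inv p := by simp
  right_inv p := by simp
  continuous_toFun := by fun_prop
  continuous_invFun := by fun_prop

theorem dev_antipodePlane (p : ℝ × ℝ) : dev (antipodePlane p) = - dev p := (neg_dev p.1 p.2).symm

/-- `φ` is a local lift of the projection along the developing map. -/
def IsLift (φ : OpenPartialHomeomorph surf (ℝ × ℝ)) : Prop :=
  ∀ q ∈ φ.source, dev (φ q) = proj q

theorem IsLift.antipode {φ : OpenPartialHomeomorph surf (ℝ × ℝ)} (h : IsLift φ) :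
    IsLift ((antipodeSurf.toOpenPartialHomeomorph.trans φ).transHomeomorph antipodePlane) := by
  intro q hq
  have hq' : antipodeSurf q ∈ φ.source := by simpa using hq
  have := h _ hq'
  simp only [OpenPartialHomeomorph.transHomeomorph_apply, Function.comp_apply,
    OpenPartialHomeomorph.coe_trans, Homeomorph.toOpenPartialHomeomorph_apply, dev_antipodePlane]
  rw [this, antipodeSurf_coe, proj_antipode, neg_neg]

theorem exists_lift_antipode {q : surf} (h : ∃ φ, IsLift φ ∧ antipodeSurf q ∈ φ.source) :
    ∃ φ, IsLift φ ∧ q ∈ φ.source := by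
  obtain ⟨φ, h1, h2⟩ := h
  exact ⟨_, h1.antipode, by simpa using h2⟩

/-- Modulo the lattice every integer point is one of eight, and these lie over the six vertices.
Three vertices are computed directly, the others by the antipodal symmetry. -/
theorem exists_axisPt_of_isIntegral {p : ℝ × ℝ} (h : IsIntegral p) : ∃ t, dev p = axisPt t := by
  obtain ⟨a, b, rfl⟩ := h
  have h0 : dev (0, 0) = axisPt (-3) := by
    have h1 := axis_piece₅ (t := -3) le_rfl (by norm_num)
    rw [dev_near_origin (by norm_num) (by norm_num), axisPt, h1.1, h1.2]
    norm_num [smin]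
  have h1 : dev (1, 0) = axisPt 8 := by
    have h1 := axis_piece₂ (t := -8) (by norm_num) le_rfl
    have h2 := axisX_neg 8
    have h3 := axisY_neg 8
    rw [h1.1] at h2
    rw [h1.2] at h3
    have h4 := dev_near_C (x := 0) (y := 0) (by norm_num) (by norm_num)
    rw [add_zero] at h4
    rw [h4, axisPt, show axisX 8 = 1 by linarith, show axisY 8 = 0 by linarith]
    norm_num
  have h2 : dev (1, 1) = axisPt (-16) := by
    have h1 := axis_piece₀ (t := -16) le_rfl
    have h4 := dev_near_D (x := 0) (y := 0) (by norm_num) (by norm_num)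
    rw [add_zero] at h4
    rw [h4, axisPt, h1.1, h1.2]
    norm_num [smin]
  have hn : ∀ x y : ℝ, (∃ t, dev (x, y) = axisPt t) → ∃ t, dev (y + 2, x) = axisPt t := by
    rintro x y ⟨t, ht⟩
    exact ⟨-t, by rw [← neg_dev, ht, axisPt_neg]⟩
  obtain ⟨m, a₀, ha₀, ha⟩ : ∃ m a₀ : ℤ, (a₀ = 0 ∨ a₀ = 1) ∧ a = a₀ + 2 * m :=
    ⟨a / 2, a % 2, by omega, by omega⟩
  obtain ⟨n, b₀, hb₀, hb⟩ : ∃ m a₀ : ℤ, (a₀ = 0 ∨ a₀ = 1) ∧ b = a₀ + 2 * m :=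
    ⟨b / 2, b % 2, by omega, by omega⟩
  have h3 : ∃ t, dev ((a₀ : ℝ), (b₀ : ℝ)) = axisPt t ∧
      ∃ t, dev ((a₀ : ℝ) + 2, (b₀ : ℝ)) = axisPt t := by
    have e : dev (0, 1) = dev (2, 1) :=
      dev_eq_dev_iff.2 ⟨-1, 1, 1, Or.inr rfl, by decide, by norm_num, by norm_num⟩
    have e' : dev (2, 1) = - dev (1, 0) := by rw [neg_dev]; norm_num
    have e'' : dev (3, 0) = dev (1, 0) :=
      dev_eq_dev_iff.2 ⟨-1, 2, 0, Or.inr rfl, by decide, by norm_num, by norm_num⟩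
    have k0 := hn 0 0 ⟨_, h0⟩
    have k1 := hn 1 1 ⟨_, h2⟩
    rcases ha₀ with rfl | rfl <;> rcases hb₀ with rfl | rfl
    · exact ⟨_, by simpa using h0, by simpa using k0⟩
    · exact ⟨-8, by simpa [e, e', axisPt_neg] using h1, -8, by simpa [e', axisPt_neg] using h1⟩
    · exact ⟨_, by simpa using h1, 8, by norm_num; rw [e'']; exact h1⟩
    · exact ⟨_, by simpa using h2, by norm_num at k1 ⊢; exact k1⟩
  obtain ⟨t, ht, t', ht'⟩ := h3
  rcases Int.even_or_odd (m + n) with h | h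
  · refine ⟨t, ?_⟩
    rw [← ht, eq_comm, dev_eq_dev_iff]
    exact ⟨1, m, n, Or.inl rfl, h, by rw [ha]; push_cast; ring, by rw [hb]; push_cast; ring⟩
  · refine ⟨t', ?_⟩
    rw [← ht', eq_comm, dev_eq_dev_iff]
    exact ⟨1, m - 1, n, Or.inl rfl, by rw [show m - 1 + n = m + n - 1 by ring]; exact h.sub_odd odd_one,
      by rw [ha]; push_cast; ring, by rw [hb]; push_cast; ring⟩

theorem dbl_of_proj_eq_axisPt {p : ℝ × ℂ} {t : ℝ} (h : proj p = axisPt t) : p = (t, 0) := by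
  have h1 := straighten_proj p
  rw [h, straighten_axisPt, dbl, Prod.mk.injEq] at h1
  exact Prod.ext h1.1.symm (pow_eq_zero_iff two_ne_zero |>.1 h1.2.symm)

theorem planeAt_add_planeAt (c : ℝ × ℝ) (z z' : ℂ) :
    dist (planeAt c z + planeAt c z') (2 • c) ≤ ‖z‖ + ‖z'‖ := by
  have h1 := Complex.abs_re_le_norm z
  have h2 := Complex.abs_re_le_norm z'
  have h3 := Complex.abs_im_le_norm z
  have h4 := Complex.abs_im_le_norm z'
  rw [dist_eq_norm, Prod.norm_def, planeAt_apply, planeAt_apply]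
  simp only [Prod.fst_sub, Prod.fst_add, Prod.snd_sub, Prod.snd_add, Prod.smul_fst, Prod.smul_snd,
    Real.norm_eq_abs]
  refine max_le ?_ ?_
  · rw [show c.1 + z.re + (c.1 + z'.re) - 2 • c.1 = z.re + z'.re by rw [two_smul]; ring]
    exact (abs_add_le _ _).trans (add_le_add h1 h2)
  · rw [show c.2 + z.im + (c.2 + z'.im) - 2 • c.2 = z.im + z'.im by rw [two_smul]; ring]
    exact (abs_add_le _ _).trans (add_le_add h3 h4)

/-- Away from the axis a branch of the square root is available near the given value. The plane
parametrises the neighbourhood because integer points lie over the line. -/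
theorem exists_lift_of_ne_zero (q : surf) (hq : q.1.2 ≠ 0) : ∃ φ, IsLift φ ∧ q ∈ φ.source := by
  obtain ⟨x, y, -, -, hxy⟩ := exists_dev_eq q.2
  set ν : ℝ × ℝ := (x, y) with hν
  have hni : ¬ IsIntegral ν := fun h => by
    obtain ⟨t, ht⟩ := exists_axisPt_of_isIntegral h
    rw [hxy] at ht
    exact hq (congrArg Prod.snd (dbl_of_proj_eq_axisPt ht))
  have hlat : (2 • ν) ∈ {p : ℝ × ℝ | ∃ a b : ℤ, p = (2 * (a : ℝ), 2 * (b : ℝ))}ᶜ := by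
    rintro ⟨a, b, h⟩
    have h5 := congrArg Prod.fst h
    have h6 := congrArg Prod.snd h
    simp at h5 h6
    exact hni ⟨a, b, Prod.ext h5 h6⟩
  -- Half this radius excludes half-turns: two points of the small disc identified by a group
  -- element of sign `-1` would have their sum in the lattice, near `2 • ν`.
  obtain ⟨r₁, hr₁, hb₁⟩ := Metric.isOpen_iff.1 isClosed_evenLattice.isOpen_compl _ hlat
  set W : ℂ → ℂ := fun z => (straighten (dev (planeAt ν z))).2 with hW
  have hE : Continuous fun z => dev (planeAt ν z) := continuous_dev.comp (planeAt ν).continuous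
  have hWc : Continuous W := continuous_snd.comp (straighten.continuous.comp hE)
  have hp0 : planeAt ν 0 = ν := by simp [planeAt_apply]
  have hW0 : W 0 = q.1.2 ^ 2 := by
    simp only [hW, hp0, hxy, straighten_proj]; rfl
  have hW0' : W 0 ≠ 0 := by rw [hW0]; exact pow_ne_zero 2 hq
  have hsl : ∀ᶠ z in 𝓝 (0 : ℂ), W z / W 0 ∈ Complex.slitPlane := by
    have : ContinuousAt (fun z => W z / W 0) 0 := by fun_prop
    refine this.eventually (Complex.isOpen_slitPlane.mem_nhds ?_)
    simp [hW0']
  obtain ⟨r₂, hr₂, hb₂⟩ := Metric.eventually_nhds_iff_ball.1 hsl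
  set r := min (1 / 2) (min (r₁ / 2) r₂) with hr
  have hr0 : 0 < r := by positivity
  have hrr : r ≤ 1 / 2 ∧ r ≤ r₁ / 2 ∧ r ≤ r₂ :=
    ⟨min_le_left _ _, (min_le_right _ _).trans (min_le_left _ _),
      (min_le_right _ _).trans (min_le_right _ _)⟩
  have hs : ∀ z ∈ Metric.ball (0 : ℂ) r, W z / W 0 ∈ Complex.slitPlane := fun z hz =>
    hb₂ z (Metric.ball_subset_ball hrr.2.2 hz)
  obtain ⟨e, -, -, he, he'⟩ := exists_chart_of (U := Metric.ball 0 r)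
    (ζ := fun z => q.1.2 * Complex.exp (Complex.log (W z / W 0) / 2)) Metric.isOpen_ball
    ⟨0, Metric.mem_ball_self hr0⟩ hE (fun z => norm1_dev _)
    (fun z _ N hN => dev_comp_nhds (planeAt ν).isOpenMap z hN)
    (continuousOn_const.mul ((((hWc.div_const _).continuousOn.clog hs).div_const 2).cexp))
    (fun z hz => by
      rw [mul_pow, ← Complex.exp_nat_mul, ← hW0]
      rw [show ((2 : ℕ) : ℂ) * (Complex.log (W z / W 0) / 2) = Complex.log (W z / W 0) by
        push_cast; ring, Complex.exp_log (Complex.slitPlane_ne_zero (hs z hz)),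
        mul_div_cancel₀ _ hW0'])
    (fun z hz z' hz' h _ => by
      rw [mem_ball_zero_iff] at hz hz'
      simp only [planeAt_apply] at h
      obtain ⟨ε, a, b, rfl | rfl, -, h1, h2⟩ := dev_eq_dev_iff.1 h
      · have k1 := abs_lt.1 ((Complex.abs_re_le_norm z).trans_lt hz)
        have k2 := abs_lt.1 ((Complex.abs_im_le_norm z).trans_lt hz)
        have k3 := abs_lt.1 ((Complex.abs_re_le_norm z').trans_lt hz')
        have k4 := abs_lt.1 ((Complex.abs_im_le_norm z').trans_lt hz')
        have : (-1 : ℝ) < a ∧ (a : ℝ) < 1 ∧ (-1 : ℝ) < b ∧ (b : ℝ) < 1 :=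
          ⟨by linarith, by linarith, by linarith, by linarith⟩
        norm_cast at this
        obtain rfl : a = 0 := by omega
        obtain rfl : b = 0 := by omega
        push_cast at h1 h2
        exact Complex.ext (by linarith) (by linarith)
      · refine absurd ⟨a, b, ?_⟩ (hb₁ (Metric.mem_ball.2
          ((planeAt_add_planeAt ν z z').trans_lt (by linarith))))
        rw [planeAt_apply, planeAt_apply]
        exact Prod.ext (by simp only [Prod.fst_add]; linarith) (by simp only [Prod.snd_add]; linarith))
    (fun z _ => Or.inl (mul_ne_zero hq (Complex.exp_ne_zero _)))
  refine ⟨e.transHomeomorph (planeAt ν), fun q' hq' => (he q' hq').symm, ?_⟩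
  refine (he' q 0 (Metric.mem_ball_self hr0) ?_).1
  rw [hp0, hxy]
  refine Prod.ext ?_ ?_
  · exact (congrArg Prod.fst (straighten_proj q)).symm
  · simp [hW0']

/-- The singular points. -/
def surfSing : Set surf := {q | q.1 = (8, 0) ∨ q.1 = (-8, 0)}

theorem mem_surfSing_of {q : surf} (h : q.1.2 = 0) (h3 : |q.1.1| ≠ 3) (h16 : |q.1.1| ≠ 16) :
    q ∈ surfSing := by
  have h1 : norm1 (proj q) = 1 := q.2
  have h2 : (q : ℝ × ℂ) = (q.1.1, 0) := Prod.ext rfl h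
  have h4 : proj q = axisPt q.1.1 := by
    rw [h2, proj, ← straighten_symm_axis]; simp [dbl]
  rw [h4, norm1_axisPt_eq_one] at h1
  rcases h1 with h1 | h1 | h1
  · exact absurd h1 h3
  · rcases (abs_eq (by norm_num)).1 h1 with h1 | h1
    · left; rw [h2, h1]
    · right; rw [h2, h1]
  · exact absurd h1 h16

/-- The points over the four cone vertices are regular upstairs, since the angle `π` doubles to
`2π`. Charts at `(0, 1, 0)` and `(0, 0, 1)` suffice, the other two following by `antipodeSurf`. -/
theorem exists_lift (q : surf) (hq : q ∉ surfSing) : ∃ φ, IsLift φ ∧ q ∈ φ.source := by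
  by_cases h0 : q.1.2 = 0
  swap
  · exact exists_lift_of_ne_zero q h0
  have hJ : (antipodeSurf q : ℝ × ℂ) = (-q.1.1, 0) := by
    rw [antipodeSurf_coe, antipode_apply, h0, mul_zero]
  have hq2 : (q : ℝ × ℂ) = (q.1.1, 0) := Prod.ext rfl h0
  obtain ⟨eA, hA, hA'⟩ := exists_chart_at_A
  obtain ⟨eD, hD, hD'⟩ := exists_chart_at_D
  have lA : IsLift (eA.transHomeomorph (planeAt (0, 0))) := hA
  have lD : IsLift (eD.transHomeomorph (planeAt (1, 1))) := hD
  by_cases h3 : |q.1.1| = 3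
  · rcases (abs_eq (by norm_num)).1 h3 with h | h
    · exact exists_lift_antipode ⟨_, lA, hA' _ (by rw [hJ, h])⟩
    · exact ⟨_, lA, hA' _ (by rw [hq2, h])⟩
  · by_cases h16 : |q.1.1| = 16
    · rcases (abs_eq (by norm_num)).1 h16 with h | h
      · exact exists_lift_antipode ⟨_, lD, hD' _ (by rw [hJ, h])⟩
      · exact ⟨_, lD, hD' _ (by rw [hq2, h])⟩
    · exact absurd (mem_surfSing_of h0 h3 h16) hq

theorem exists_singular_chart {p : surf} (hp : p ∈ surfSing) :
    ∃ (e : OpenPartialHomeomorph surf ℂ) (a b : ℤ), p ∈ e.source ∧ e p = 0 ∧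
      (∀ q ∈ e.source, ‖e q‖ < 1 / 10) ∧
      ∀ q ∈ e.source, dev (planeAt ((a : ℝ), (b : ℝ)) (e q ^ 2)) = proj q := by
  obtain ⟨e, h1, h2, h3⟩ := exists_chart_at_C
  rcases hp with hp | hp
  · obtain ⟨h4, h5⟩ := h3 p hp
    exact ⟨e, 1, 0, h4, h5, h1, by simpa using h2⟩
  · obtain ⟨h4, h5⟩ := h3 (antipodeSurf p) (by
      rw [antipodeSurf_coe, antipode_apply, hp]; simp)
    -- The exchange of the two plane coordinates is `w ↦ i * conj w`; on the square root coordinate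
    -- it is induced by `z ↦ s * conj z`.
    obtain ⟨s, hs⟩ : ∃ s : ℂ, s ^ 2 = Complex.I :=
      (Complex.isOpenQuotientMap_pow 2).surjective _
    have hs0 : s ≠ 0 := by
      rintro rfl
      exact Complex.I_ne_zero (by rw [← hs, zero_pow two_ne_zero])
    have hs1 : ‖s‖ = 1 := by
      have := congrArg norm hs
      rw [norm_pow, Complex.norm_I] at this
      exact (pow_eq_one_iff_of_nonneg (norm_nonneg _) two_ne_zero).1 this
    have hval : ∀ q, ((antipodeSurf.toOpenPartialHomeomorph.trans e).transHomeomorph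
        (Complex.conjCLE.toHomeomorph.trans (Homeomorph.mulLeft₀ s hs0))) q =
        s * (starRingEnd ℂ) (e (antipodeSurf q)) := fun q => rfl
    refine ⟨(antipodeSurf.toOpenPartialHomeomorph.trans e).transHomeomorph
        (Complex.conjCLE.toHomeomorph.trans (Homeomorph.mulLeft₀ s hs0)), 2, 1,
        by simpa using h4, ?_, fun q hq => ?_, fun q hq => ?_⟩
    · rw [hval, h5, map_zero, mul_zero]
    · rw [hval, norm_mul, hs1, one_mul, RCLike.norm_conj]
      exact h1 _ (by simpa using hq)
    · have hq' : antipodeSurf q ∈ e.source := by simpa using hq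
      have h6 := h2 _ hq'
      rw [antipodeSurf_coe, proj_antipode] at h6
      rw [hval, mul_pow, hs, ← map_pow, ← neg_neg (proj q), ← h6, planeAt_apply, planeAt_apply, neg_dev]
      congr 1
      refine Prod.ext ?_ ?_ <;>
      simp only [Complex.mul_re, Complex.mul_im, Complex.I_re, Complex.I_im, Complex.conj_re,
        Complex.conj_im] <;> push_cast <;> ring


/-! ### The foliations -/

/-- The slope of the stable direction. -/
noncomputable def slope : ℝ := √5 - 2

theorem slope_sq : slope ^ 2 = 1 - 4 * slope := by
  have : √5 ^ 2 = 5 := Real.sq_sqrt (by norm_num)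
  unfold slope; linarith

theorem slope_pos : 0 < slope := by
  have : (2 : ℝ) < √5 := by rw [Real.lt_sqrt] <;> norm_num
  unfold slope; linarith

/-- The linear map taking the invariant directions to the coordinate directions. -/
noncomputable def diagonalize : ℝ × ℝ ≃ₜ ℝ × ℝ where
  toFun p := (p.1 + slope * p.2, p.2 - slope * p.1)
  invFun p := ((p.1 - slope * p.2) / (1 + slope ^ 2), (p.2 + slope * p.1) / (1 + slope ^ 2))
  left_inv p := by
    have : 1 + slope ^ 2 ≠ 0 := by positivity
    ext <;> field_simp <;> ring
  right_inv p := by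
    have : 1 + slope ^ 2 ≠ 0 := by positivity
    ext <;> field_simp <;> ring
  continuous_toFun := by fun_prop
  continuous_invFun := by fun_prop

theorem diagonalize_apply (p : ℝ × ℝ) :
    diagonalize p = (p.1 + slope * p.2, p.2 - slope * p.1) := rfl

theorem diagonalize_smul_add (ε : ℝ) (u b : ℝ × ℝ) : diagonalize (ε • u + b) =
    (ε * (diagonalize u).1 + (diagonalize b).1, ε * (diagonalize u).2 + (diagonalize b).2) := by
  simp only [diagonalize_apply, Prod.fst_add, Prod.snd_add, Prod.smul_fst, Prod.smul_snd, smul_eq_mul]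
  ext <;> simp only <;> ring

theorem isLift_unique_local {φ : OpenPartialHomeomorph surf (ℝ × ℝ)} {u v : surf → ℝ × ℝ}
    {q : surf} (hφ : q ∈ φ.source) (hu : ∀ᶠ w in 𝓝 q, ContinuousAt u w)
    (hv : ∀ᶠ w in 𝓝 q, ContinuousAt v w) (h : ∀ᶠ w in 𝓝 q, dev (u w) = dev (v w))
    (hi : ∀ᶠ w in 𝓝 q, IsIntegral (u w) → w = q) :
    ∃ (ε : ℝ) (b : ℝ × ℝ), (ε = 1 ∨ ε = -1) ∧ ∀ᶠ w in 𝓝 q, diagonalize (v w) =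
      (ε * (diagonalize (u w)).1 + b.1, ε * (diagonalize (u w)).2 + b.2) := by
  obtain ⟨ε, b, hε, he⟩ := eventually_eq_of_dev_eq_of_chart φ hφ hu hv h hi
  refine ⟨ε, diagonalize b, hε, he.mono fun w hw => ?_⟩
  rw [hw, diagonalize_smul_add]

theorem eventually_continuousAt {S T : Type*} [TopologicalSpace S] [TopologicalSpace T]
    (φ : OpenPartialHomeomorph S T) {q : S} (hq : q ∈ φ.source) :
    ∀ᶠ w in 𝓝 q, ContinuousAt φ w := by
  filter_upwards [φ.open_source.mem_nhds hq] with w hw using φ.continuousAt hw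

theorem eventually_isIntegral_chart {S : Type*} [TopologicalSpace S]
    (φ : OpenPartialHomeomorph S (ℝ × ℝ)) {q : S} (hq : q ∈ φ.source) :
    ∀ᶠ w in 𝓝 q, IsIntegral (φ w) → w = q := by
  filter_upwards [eventually_isIntegral_imp_eq (φ.continuousAt hq), φ.open_source.mem_nhds hq]
    with w h1 h2 h3
  exact φ.injOn h2 hq (h1 h3)

theorem not_isIntegral_planeAt {a b : ℤ} {z : ℂ} (h0 : z ≠ 0) (h1 : ‖z‖ < 1) :
    ¬ IsIntegral (planeAt ((a : ℝ), (b : ℝ)) z) := by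
  rintro ⟨m, n, h⟩
  rw [planeAt_apply, Prod.mk.injEq] at h
  obtain ⟨h2, h3⟩ := h
  have k1 := abs_lt.1 ((Complex.abs_re_le_norm z).trans_lt h1)
  have k2 := abs_lt.1 ((Complex.abs_im_le_norm z).trans_lt h1)
  have : (-1 : ℝ) < m - a ∧ (m - a : ℝ) < 1 ∧ (-1 : ℝ) < n - b ∧ (n - b : ℝ) < 1 :=
    ⟨by linarith, by linarith, by linarith, by linarith⟩
  norm_cast at this
  obtain rfl : m = a := by omega
  obtain rfl : n = b := by omega
  exact h0 (Complex.ext (by simp only [Complex.zero_re]; linarith)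
    (by simp only [Complex.zero_im]; linarith))

theorem finite_surfSing : surfSing.Finite := by
  refine Set.Finite.of_finite_image (f := Subtype.val)
    ((Set.toFinite {((8 : ℝ), (0 : ℂ)), (-8, 0)}).subset ?_) Subtype.val_injective.injOn
  rintro _ ⟨q, hq, rfl⟩
  exact hq

/-- The pair of foliations of the surface. -/
noncomputable def surfFoliations : TransverseMeasuredFoliations surf where
  sing := surfSing
  finite_sing := finite_surfSing
  charts := (fun φ => φ.transHomeomorph diagonalize) '' {φ | IsLift φ ∧ φ.source ⊆ surfSingᶜ}
  iUnion_source := by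
    rw [Set.biUnion_image]
    refine subset_antisymm (Set.iUnion₂_subset fun φ hφ => hφ.2) fun q hq => ?_
    obtain ⟨φ, h1, h2⟩ := exists_lift q hq
    have ho : IsOpen surfSingᶜ := finite_surfSing.isClosed.isOpen_compl
    refine Set.mem_biUnion (x := φ.restrOpen _ ho)
      ⟨fun q hq => h1 q ?_, ?_⟩ ?_
    · rw [OpenPartialHomeomorph.restrOpen_source] at hq; exact hq.1
    · rw [OpenPartialHomeomorph.restrOpen_source]; exact Set.inter_subset_right
    · change q ∈ (φ.restrOpen _ ho).source
      rw [OpenPartialHomeomorph.restrOpen_source]; exact ⟨h2, hq⟩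
  compat := by
    rintro _ ⟨φ, ⟨hφ, -⟩, rfl⟩ _ ⟨φ', ⟨hφ', -⟩, rfl⟩ q ⟨hq, hq'⟩
    replace hq : q ∈ φ.source := hq
    replace hq' : q ∈ φ'.source := hq'
    obtain ⟨ε, b, hε, h⟩ := isLift_unique_local hq (eventually_continuousAt φ hq)
      (eventually_continuousAt φ' hq')
      (by filter_upwards [φ.open_source.mem_nhds hq, φ'.open_source.mem_nhds hq'] with w h1 h2
          rw [hφ w h1, hφ' w h2])
      (eventually_isIntegral_chart φ hq)
    exact ⟨ε, ε, b.1, b.2, hε, hε, h⟩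
  prong := by
    intro p hp
    obtain ⟨e, a, b, h1, h2, h3, h4⟩ := exists_singular_chart hp
    -- As a map of `ℂ`, `diagonalize` is multiplication by `1 - i * slope`. With `σ² = 1 - i *
    -- slope`, the natural coordinate is `(σ * e)²`, whose square is a fourth power: a 4-prong
    -- singularity.
    obtain ⟨σ, hσ⟩ : ∃ s : ℂ, s ^ 2 = ⟨1, -slope⟩ :=
      (Complex.isOpenQuotientMap_pow 2).surjective _
    have hσ0 : σ ≠ 0 := by
      rintro rfl
      have := congrArg Complex.re hσ
      simp at this
    refine ⟨4, by norm_num, e.transHomeomorph (Homeomorph.mulLeft₀ σ hσ0), h1, ?_, ?_⟩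
    · change σ * e p = 0
      rw [h2, mul_zero]
    rintro _ ⟨φ, ⟨hφ, hφs⟩, rfl⟩ q ⟨hq, hq'⟩
    replace hq : q ∈ φ.source := hq
    replace hq' : q ∈ e.source := hq'
    have hN : ∀ᶠ w in 𝓝 q, w ∈ φ.source ∧ w ∈ e.source :=
      Filter.inter_mem (φ.open_source.mem_nhds hq) (e.open_source.mem_nhds hq')
    obtain ⟨ε, c, hε, h⟩ := isLift_unique_local (v := φ)
      (u := fun w => planeAt ((a : ℝ), (b : ℝ)) (e w ^ 2)) hq
      (by filter_upwards [hN] with w hw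
          have := e.continuousAt hw.2
          exact (planeAt _).continuous.continuousAt.comp (this.pow 2))
      (eventually_continuousAt φ hq)
      (by filter_upwards [hN] with w hw
          rw [h4 w hw.2, hφ w hw.1])
      (by filter_upwards [hN] with w hw hw'
          refine absurd hw' (not_isIntegral_planeAt (pow_ne_zero 2 fun h0 => ?_) ?_)
          · have : w = p := e.injOn hw.2 h1 (h0.trans h2.symm)
            rw [this] at hw
            exact hφs hw.1 hp
          · have := h3 w hw.2
            rw [norm_pow]; nlinarith [norm_nonneg (e w)])
    refine ⟨ε, ε, -(ε * c.1 + (diagonalize (a, b)).1), -(ε * c.2 + (diagonalize (a, b)).2), hε, hε,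
      h.mono fun w hw => ?_⟩
    have hw1 : ((diagonalize ∘ φ) w) = _ := hw
    simp only [OpenPartialHomeomorph.transHomeomorph_apply, hw1, Homeomorph.coe_mulLeft₀,
      Function.comp_apply]
    have key : (⟨ε * (ε * (diagonalize (planeAt ((a : ℝ), (b : ℝ)) (e w ^ 2))).1 + c.1) +
        -(ε * c.1 + (diagonalize (a, b)).1),
        ε * (ε * (diagonalize (planeAt ((a : ℝ), (b : ℝ)) (e w ^ 2))).2 + c.2) +
        -(ε * c.2 + (diagonalize (a, b)).2)⟩ : ℂ) = σ ^ 2 * e w ^ 2 := by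
      rw [hσ]
      generalize e w ^ 2 = z
      have hε2 : ε * ε = 1 := by rcases hε with rfl | rfl <;> norm_num
      simp only [diagonalize_apply, planeAt_apply]
      apply Complex.ext
      · simp only [Complex.mul_re]
        linear_combination (a + z.re + slope * (b + z.im)) * hε2
      · simp only [Complex.mul_im]
        linear_combination (b + z.im - slope * (a + z.re)) * hε2
    rw [key]; ring

/-! ### The pseudo-Anosov map -/

/-- The matrix has determinant one, so its inverse `(1, -4; -4, 17)` is integral and supplies
preimages on the octahedron boundary. -/
theorem norm1_quotHomeo_eq_one {v : ℝ × ℝ × ℝ} : norm1 (quotHomeo v) = 1 ↔ norm1 v = 1 := by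
  constructor
  · intro h
    obtain ⟨x, y, -, -, hxy⟩ := exists_dev_eq h
    have : quotHomeo (dev (x - 4 * y, -4 * x + 17 * y)) = quotHomeo v := by
      rw [quotHomeo_dev, ← hxy]; congr 2 <;> ring
    rw [← quotHomeo.injective this, norm1_dev]
  · intro h
    obtain ⟨x, y, -, -, hxy⟩ := exists_dev_eq h
    rw [← hxy, quotHomeo_dev, norm1_dev]

theorem isIntegral_of_hyperbolic {p : ℝ × ℝ} (h : IsIntegral (17 * p.1 + 4 * p.2, 4 * p.1 + p.2)) :
    IsIntegral p := by
  obtain ⟨a, b, h⟩ := h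
  rw [Prod.mk.injEq] at h
  exact ⟨a - 4 * b, -4 * a + 17 * b, Prod.ext (by push_cast; linarith) (by push_cast; linarith)⟩

theorem scalesBy_of_linear {ψ : surf ≃ₜ surf} (hψ : ∀ q : surf, proj (ψ q) = quotHomeo (proj q))
    {π : ℝ × ℝ → ℝ} {κ : ℝ} (h : ∀ (ε : ℝ) (b : ℝ × ℝ), ∃ a, ∀ p : ℝ × ℝ,
      π (ε * (diagonalize (17 * p.1 + 4 * p.2, 4 * p.1 + p.2)).1 + b.1,
        ε * (diagonalize (17 * p.1 + 4 * p.2, 4 * p.1 + p.2)).2 + b.2) =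
        ε * κ * π (diagonalize p) + a) : Foliation.ScalesBy surfFoliations π ψ κ := by
  rintro _ ⟨φ, ⟨hφ, -⟩, rfl⟩ _ ⟨φ', ⟨hφ', -⟩, rfl⟩ q hq hq'
  replace hq : q ∈ φ.source := hq
  replace hq' : ψ q ∈ φ'.source := hq'
  obtain ⟨ε, b, hε, he⟩ := isLift_unique_local (v := fun w => φ' (ψ w))
    (u := fun w => (17 * (φ w).1 + 4 * (φ w).2, 4 * (φ w).1 + (φ w).2)) hq
    (by filter_upwards [eventually_continuousAt φ hq] with w hw; fun_prop)
    (by filter_upwards [ψ.continuous.continuousAt.eventually (eventually_continuousAt φ' hq')]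
          with w hw
        exact hw.comp ψ.continuous.continuousAt)
    (by filter_upwards [φ.open_source.mem_nhds hq,
          ψ.continuous.continuousAt.eventually (φ'.open_source.mem_nhds hq')] with w h1 h2
        rw [hφ' _ h2, hψ, ← hφ _ h1, ← quotHomeo_dev])
    (by filter_upwards [eventually_isIntegral_chart φ hq] with w hw h
        exact hw (isIntegral_of_hyperbolic h))
  obtain ⟨a, ha⟩ := h ε b
  refine ⟨ε, a, hε, he.mono fun w hw => ?_⟩
  change π (diagonalize (φ' (ψ w))) = _
  rw [hw, ha]; rfl

theorem isAffinePseudoAnosov_of_proj {ψ : surf ≃ₜ surf}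
    (hψ : ∀ q : surf, proj (ψ q) = quotHomeo (proj q)) (hs : ∀ q ∈ surfSing, ψ q = q) :
    Foliation.IsAffinePseudoAnosov ψ := by
  have h2 := slope_sq
  have h0 := slope_pos
  -- The two eigenvalues of the matrix; their product is its determinant, one. Both eigenvector
  -- equations reduce to `slope² = 1 - 4 * slope`.
  have hinv : (17 + 4 * slope)⁻¹ = 1 - 4 * slope := by
    refine inv_eq_of_mul_eq_one_right ?_
    linear_combination (-16) * h2
  refine ⟨surfFoliations, 17 + 4 * slope, by linarith, ?_, ?_, ?_⟩
  · change ψ '' surfSing = surfSing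
    refine subset_antisymm ?_ fun q hq => ⟨q, hq, hs q hq⟩
    rintro _ ⟨q, hq, rfl⟩
    rwa [hs q hq]
  · refine scalesBy_of_linear hψ fun ε b => ⟨b.1, fun p => ?_⟩
    simp only [diagonalize_apply]
    linear_combination (-4 * ε * p.2) * h2
  · rw [hinv]
    refine scalesBy_of_linear hψ fun ε b => ⟨b.2, fun p => ?_⟩
    simp only [diagonalize_apply]
    linear_combination (-4 * ε * p.1) * h2

/-- A compactly supported homeomorphism whose restriction to the surface is pseudo-Anosov. -/
theorem exists_homeomorph_surf : ∃ (G : ℝ × ℂ ≃ₜ ℝ × ℂ) (ψ : surf ≃ₜ surf),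
    (∀ q : surf, (ψ q : ℝ × ℂ) = G q) ∧ Foliation.IsAffinePseudoAnosov ψ ∧
      ∀ p, 400 < ‖dbl p‖ → G p = p := by
  obtain ⟨G, h1, h2, h3⟩ := exists_lift_of_compactSupport straightHomeo straightHomeo_axis
    (by norm_num : (0 : ℝ) ≤ 400) fun p hp => straightHomeo_of_large hp
  have hpr : ∀ p, proj (G p) = quotHomeo (proj p) := fun p => by
    rw [proj, h1, straightHomeo_apply, Homeomorph.symm_apply_apply]; rfl
  refine ⟨G, G.subtype fun p => ?_, fun q => rfl, ?_, h3⟩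
  · change norm1 (proj p) = 1 ↔ norm1 (proj (G p)) = 1
    rw [hpr, norm1_quotHomeo_eq_one]
  · refine isAffinePseudoAnosov_of_proj (fun q => hpr q) fun q hq => Subtype.ext (h2 q ?_)
    rcases hq with hq | hq <;> rw [hq]


/-! ### A collar of the standard surface -/

theorem ramp_sub_mem {a b x y : ℝ} (h : x ≤ y) :
    0 ≤ ramp a b y - ramp a b x ∧ ramp a b y - ramp a b x ≤ y - x := by
  simp only [ramp]
  constructor
  · rw [sub_nonneg]; gcongr
  · rcases max_cases a (min b y) with ⟨h1, _⟩ | ⟨h1, _⟩ <;>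
    rcases max_cases a (min b x) with ⟨h2, _⟩ | ⟨h2, _⟩ <;>
    rcases min_cases b y with ⟨h3, _⟩ | ⟨h3, _⟩ <;>
    rcases min_cases b x with ⟨h4, _⟩ | ⟨h4, _⟩ <;> linarith

/-- The zigzag function with value `-1` at `0, 2, 4` and `1` at `1, 3, 5`. -/
noncomputable def zigzag (x : ℝ) : ℝ :=
  -1 + 2 * ramp 0 1 x - 2 * (ramp 1 2 x - 1) + 2 * (ramp 2 3 x - 2) - 2 * (ramp 3 4 x - 3) +
    2 * (ramp 4 5 x - 4)

@[fun_prop]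
theorem continuous_zigzag : Continuous zigzag := by
  have := continuous_ramp
  unfold zigzag; fun_prop

theorem zigzag_even {n : ℝ} (h : n = 0 ∨ n = 2 ∨ n = 4) : zigzag n = -1 := by
  rcases h with rfl | rfl | rfl <;> norm_num [zigzag, ramp]

theorem zigzag_odd {n : ℝ} (h : n = 1 ∨ n = 3 ∨ n = 5) : zigzag n = 1 := by
  rcases h with rfl | rfl | rfl <;> norm_num [zigzag, ramp]

theorem abs_zigzag_le (x : ℝ) : |zigzag x| ≤ 11 := by
  have h := fun a b : ℝ => (⟨le_max_left a (min b x), fun h => max_le h (min_le_left b x)⟩ :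
    a ≤ ramp a b x ∧ (a ≤ b → ramp a b x ≤ b))
  have h0 := h 0 1
  have h1 := h 1 2
  have h2 := h 2 3
  have h3 := h 3 4
  have h4 := h 4 5
  norm_num at h0 h1 h2 h3 h4
  rw [abs_le]
  unfold zigzag
  constructor <;> linarith

/-- The bound `6` times the largest flow parameter `1/8` is less than one, so the flow is strictly
increasing. -/
theorem abs_zigzag_sub_le {x y : ℝ} (h : x ≤ y) : |zigzag y - zigzag x| ≤ 6 * (y - x) := by
  have h0 := ramp_sub_mem (a := 0) (b := 1) h
  have h1 := ramp_sub_mem (a := 1) (b := 2) h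
  have h2 := ramp_sub_mem (a := 2) (b := 3) h
  have h3 := ramp_sub_mem (a := 3) (b := 4) h
  have h4 := ramp_sub_mem (a := 4) (b := 5) h
  rw [abs_le]
  unfold zigzag
  constructor <;> linarith

/-- The flow along the zigzag function. -/
noncomputable def flow (s x : ℝ) : ℝ := x + ramp (-(1 / 8)) (1 / 8) s * zigzag x

theorem abs_ramp_eighth (s : ℝ) : |ramp (-(1 / 8)) (1 / 8) s| ≤ 1 / 8 := by
  rw [abs_le]
  exact ⟨le_max_left _ _, max_le (by norm_num) (min_le_left _ _)⟩

theorem isFibreMap_flow : IsFibreMap flow where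
  continuous := by
    have := continuous_ramp
    unfold flow; fun_prop
  strictMono s x y h := by
    have h1 := abs_zigzag_sub_le h.le
    have h2 : |ramp (-(1 / 8)) (1 / 8) s * (zigzag y - zigzag x)| ≤ 1 / 8 * (6 * (y - x)) := by
      rw [abs_mul]
      exact mul_le_mul (abs_ramp_eighth s) h1 (abs_nonneg _) (by norm_num)
    have := (abs_le.1 h2).1
    rw [mul_sub] at this
    unfold flow; linarith
  surjective s := by
    refine surjective_of_sub_bounded (C := 1 / 8 * 11) (by unfold flow; fun_prop) fun x => ?_
    rw [flow, add_sub_cancel_left, abs_mul]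
    exact mul_le_mul (abs_ramp_eighth s) (abs_zigzag_le x) (abs_nonneg _) (by norm_num)

theorem ramp_eighth {s : ℝ} (hs : |s| ≤ 1 / 8) : ramp (-(1 / 8)) (1 / 8) s = s :=
  ramp_of_mem (abs_le.1 hs).1 (abs_le.1 hs).2

/-- The flow moves the walls `0, 2, 4` by `-s` and, in the companion lemma, the walls `1, 3, 5` by
`s`. These are the directions in which the corresponding face functions of the handlebody grow. -/
theorem sub_flow_le {n s x : ℝ} (hn : n = 0 ∨ n = 2 ∨ n = 4) (hs : |s| ≤ 1 / 8) :
    (n - flow s x ≤ s ↔ n - x ≤ 0) ∧ (n - flow s x < s ↔ n - x < 0) := by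
  have h1 : flow s n = n - s := by rw [flow, ramp_eighth hs, zigzag_even hn]; ring
  have h2 := (isFibreMap_flow.strictMono s).le_iff_le (a := n) (b := x)
  have h3 := (isFibreMap_flow.strictMono s).lt_iff_lt (a := n) (b := x)
  rw [h1] at h2 h3
  rw [sub_nonpos, sub_neg, ← h2, ← h3]
  constructor <;> constructor <;> intro h <;> linarith

theorem flow_sub_le {n s x : ℝ} (hn : n = 1 ∨ n = 3 ∨ n = 5) (hs : |s| ≤ 1 / 8) :
    (flow s x - n ≤ s ↔ x - n ≤ 0) ∧ (flow s x - n < s ↔ x - n < 0) := by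
  have h1 : flow s n = n + s := by rw [flow, ramp_eighth hs, zigzag_odd hn]; ring
  have h2 := (isFibreMap_flow.strictMono s).le_iff_le (a := x) (b := n)
  have h3 := (isFibreMap_flow.strictMono s).lt_iff_lt (a := x) (b := n)
  rw [h1] at h2 h3
  rw [sub_nonpos, sub_neg, ← h2, ← h3]
  constructor <;> constructor <;> intro h <;> linarith

/-! ### The handlebody as a sublevel set, and its levels under the flow -/

/-- A defining function of the rectangle with two holes. -/
def planarFun (p : ℝ × ℝ) : ℝ :=
  max (max (max (0 - p.1) (p.1 - 5)) (max (0 - p.2) (p.2 - 3)))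
    (max (min (min (p.1 - 1) (2 - p.1)) (min (p.2 - 1) (2 - p.2)))
      (min (min (p.1 - 3) (4 - p.1)) (min (p.2 - 1) (2 - p.2))))

@[fun_prop]
theorem continuous_planarFun : Continuous planarFun := by unfold planarFun; fun_prop

/-- The defining function is a lattice polynomial in face functions, each of which is carried from
level `0` to level `s`, so the same holds for the whole. -/
theorem planarFun_flow {s : ℝ} (hs : |s| ≤ 1 / 8) (p : ℝ × ℝ) :
    (planarFun (flow s p.1, flow s p.2) ≤ s ↔ planarFun p ≤ 0) ∧
      (planarFun (flow s p.1, flow s p.2) < s ↔ planarFun p < 0) := by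
  have e0 := fun x => sub_flow_le (x := x) (n := 0) (Or.inl rfl) hs
  have e2 := fun x => sub_flow_le (x := x) (n := 2) (Or.inr (Or.inl rfl)) hs
  have e4 := fun x => sub_flow_le (x := x) (n := 4) (Or.inr (Or.inr rfl)) hs
  have e1 := fun x => flow_sub_le (x := x) (n := 1) (Or.inl rfl) hs
  have e3 := fun x => flow_sub_le (x := x) (n := 3) (Or.inr (Or.inl rfl)) hs
  have e5 := fun x => flow_sub_le (x := x) (n := 5) (Or.inr (Or.inr rfl)) hs
  constructor
  · simp only [planarFun, max_le_iff, min_le_iff, e0, e1, e2, e3, e4, e5]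
  · simp only [planarFun, max_lt_iff, min_lt_iff, e0, e1, e2, e3, e4, e5]

/-- A defining function of the standard handlebody. -/
def solidFun (p : (ℝ × ℝ) × ℝ) : ℝ := max (planarFun p.1) (max (0 - p.2) (p.2 - 1))

@[fun_prop]
theorem continuous_solidFun : Continuous solidFun := by unfold solidFun; fun_prop

theorem solidFun_flow {s : ℝ} (hs : |s| ≤ 1 / 8) (p : (ℝ × ℝ) × ℝ) :
    (solidFun ((flow s p.1.1, flow s p.1.2), flow s p.2) ≤ s ↔ solidFun p ≤ 0) ∧
      (solidFun ((flow s p.1.1, flow s p.1.2), flow s p.2) < s ↔ solidFun p < 0) := by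
  have h0 := sub_flow_le (x := p.2) (n := 0) (Or.inl rfl) hs
  have h1 := flow_sub_le (x := p.2) (n := 1) (Or.inl rfl) hs
  have h2 := planarFun_flow hs p.1
  constructor
  · simp only [solidFun, max_le_iff, h0.1, h1.1, h2.1]
  · simp only [solidFun, max_lt_iff, h0.2, h1.2, h2.2]

theorem solidFun_flow_eq {s : ℝ} (hs : |s| ≤ 1 / 8) (p : (ℝ × ℝ) × ℝ) :
    solidFun ((flow s p.1.1, flow s p.1.2), flow s p.2) = s ↔ solidFun p = 0 := by
  have h := solidFun_flow hs p
  rw [eq_iff_le_not_lt, h.1, h.2, ← eq_iff_le_not_lt]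

theorem flow_zero (x : ℝ) : flow 0 x = x := by
  rw [flow, ramp_eighth (by norm_num)]; ring

/-- Coordinates in `ℝ³`. -/
noncomputable def coords : EuclideanSpace ℝ (Fin 3) ≃ₜ (ℝ × ℝ) × ℝ where
  toFun x := ((x 0, x 1), x 2)
  invFun p := !₂[p.1.1, p.1.2, p.2]
  left_inv x := by
    ext i; fin_cases i <;> simp
  right_inv p := by simp
  continuous_toFun := by fun_prop
  continuous_invFun := by
    refine (PiLp.continuous_toLp 2 _).comp (continuous_pi fun i => ?_)
    fin_cases i <;> simp <;> fun_prop

theorem coords_apply (x : EuclideanSpace ℝ (Fin 3)) : coords x = ((x 0, x 1), x 2) := rfl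

theorem mem_stdGenusTwoHandlebody {x : EuclideanSpace ℝ (Fin 3)} :
    x ∈ stdGenusTwoHandlebody ↔ solidFun (coords x) ≤ 0 := by
  simp only [stdGenusTwoHandlebody, Set.mem_ofPred_eq, solidFun, planarFun, coords_apply, max_le_iff,
    min_le_iff, Set.mem_Icc, Set.mem_Ioo, sub_nonpos, not_and_or, not_lt]
  tauto

/-- The inverse of the flow. -/
theorem exists_flowInv : ∃ g : ℝ → ℝ → ℝ, (Continuous fun p : ℝ × ℝ => g p.1 p.2) ∧
    (∀ s x, g s (flow s x) = x) ∧ ∀ s x, flow s (g s x) = x := by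
  obtain ⟨f, hf⟩ := exists_fibreHomeo flow isFibreMap_flow.continuous isFibreMap_flow.strictMono
    isFibreMap_flow.surjective
  have hf' : ∀ s x, f.symm (s, x) = (s, (f.symm (s, x)).2) := fun s x => by
    refine Prod.ext ?_ rfl
    have := congrArg Prod.fst (hf (f.symm (s, x)))
    rw [f.apply_symm_apply] at this
    exact this.symm
  refine ⟨fun s x => (f.symm (s, x)).2, continuous_snd.comp f.symm.continuous, fun s x => ?_,
    fun s x => ?_⟩
  · have := congrArg Prod.snd (f.symm_apply_apply (s, x))
    rwa [hf] at this
  · have := hf (f.symm (s, x))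
    rw [f.apply_symm_apply, hf'] at this
    exact (congrArg Prod.snd this).symm

/-- All the flow maps together. -/
theorem exists_flowHomeo : ∃ e : ℝ × ((ℝ × ℝ) × ℝ) ≃ₜ ℝ × ((ℝ × ℝ) × ℝ), ∀ p,
    e p = (p.1, (flow p.1 p.2.1.1, flow p.1 p.2.1.2), flow p.1 p.2.2) := by
  obtain ⟨g, hc', hf1, hf2⟩ := exists_flowInv
  have hc := isFibreMap_flow.continuous
  exact ⟨{ toFun := fun p => (p.1, (flow p.1 p.2.1.1, flow p.1 p.2.1.2), flow p.1 p.2.2)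
           invFun := fun p => (p.1, (g p.1 p.2.1.1, g p.1 p.2.1.2), g p.1 p.2.2)
           left_inv := fun p => by simp only [hf1]
           right_inv := fun p => by simp only [hf2]
           continuous_toFun := by
            refine continuous_fst.prodMk (Continuous.prodMk (Continuous.prodMk ?_ ?_) ?_)
            · exact hc.comp (f := fun p : ℝ × ((ℝ × ℝ) × ℝ) => (p.1, p.2.1.1)) (by fun_prop)
            · exact hc.comp (f := fun p : ℝ × ((ℝ × ℝ) × ℝ) => (p.1, p.2.1.2)) (by fun_prop)
            · exact hc.comp (f := fun p : ℝ × ((ℝ × ℝ) × ℝ) => (p.1, p.2.2)) (by fun_prop)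
           continuous_invFun := by
            refine continuous_fst.prodMk (Continuous.prodMk (Continuous.prodMk ?_ ?_) ?_)
            · exact hc'.comp (f := fun p : ℝ × ((ℝ × ℝ) × ℝ) => (p.1, p.2.1.1)) (by fun_prop)
            · exact hc'.comp (f := fun p : ℝ × ((ℝ × ℝ) × ℝ) => (p.1, p.2.1.2)) (by fun_prop)
            · exact hc'.comp (f := fun p : ℝ × ((ℝ × ℝ) × ℝ) => (p.1, p.2.2)) (by fun_prop) },
    fun p => rfl⟩

/-- A frontier point of a sublevel set lies on the level. Conversely, the flow for small positive
time pushes a point of level `0` outside the handlebody. -/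
theorem mem_stdGenusTwoSurface {x : EuclideanSpace ℝ (Fin 3)} :
    x ∈ stdGenusTwoSurface ↔ solidFun (coords x) = 0 := by
  have hset : stdGenusTwoHandlebody = {x | solidFun (coords x) ≤ 0} :=
    Set.ext fun _ => mem_stdGenusTwoHandlebody
  have hc : Continuous fun x => solidFun (coords x) := continuous_solidFun.comp coords.continuous
  constructor
  · intro h
    rw [stdGenusTwoSurface, hset] at h
    exact frontier_le_subset_eq hc continuous_const h
  · intro h
    rw [stdGenusTwoSurface, hset, frontier_eq_closure_inter_closure]
    refine ⟨subset_closure h.le, ?_⟩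
    set γ : ℝ → EuclideanSpace ℝ (Fin 3) := fun s =>
      coords.symm ((flow s (coords x).1.1, flow s (coords x).1.2), flow s (coords x).2) with hγ
    have hcf : ∀ a, Continuous fun s => flow s a := fun a =>
      isFibreMap_flow.continuous.comp (f := fun s : ℝ => (s, a)) (by fun_prop)
    have cγ : Continuous γ := by
      refine coords.symm.continuous.comp (Continuous.prodMk (Continuous.prodMk ?_ ?_) ?_) <;>
      exact hcf _
    have hlim : Filter.Tendsto γ (𝓝[>] 0) (𝓝 x) := by
      have := (cγ.tendsto 0).mono_left (nhdsWithin_le_nhds (s := Set.Ioi 0))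
      simpa only [hγ, flow_zero, Prod.mk.eta, Homeomorph.symm_apply_apply] using this
    refine mem_closure_of_tendsto hlim ?_
    filter_upwards [Ioo_mem_nhdsGT (show (0 : ℝ) < 1 / 8 by norm_num)] with s hs
    have := (solidFun_flow_eq (s := s) (by rw [abs_of_pos hs.1]; exact hs.2.le) (coords x)).2 h
    simp only [Set.mem_compl_iff, Set.mem_ofPred_eq, hγ, coords.apply_symm_apply, this, not_le]
    exact hs.1

/-- The flow identifies the level `0` with every nearby level, so the levels between `-1/8` and
`1/8` form a product; `ℝ` is then mapped homeomorphically to this interval. -/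
theorem isTwoSided_stdGenusTwoSurface : IsTwoSided stdGenusTwoSurface := by
  obtain ⟨e, he⟩ := exists_flowHomeo
  set σ : OpenPartialHomeomorph ℝ ℝ := OpenPartialHomeomorph.univBall (0 : ℝ) (1 / 8) with hσ
  have hσs : σ.source = Set.univ := OpenPartialHomeomorph.univBall_source _ _
  have hσt : σ.target = Metric.ball 0 (1 / 8) :=
    OpenPartialHomeomorph.univBall_target _ (by norm_num)
  have hσ0 : σ 0 = 0 := OpenPartialHomeomorph.univBall_apply_zero _ _
  have hσb : ∀ s, |σ s| < 1 / 8 := fun s => by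
    have := σ.map_source (x := s) (by rw [hσs]; trivial)
    rwa [hσt, mem_ball_zero_iff] at this
  have hσc : Continuous σ := OpenPartialHomeomorph.continuous_univBall _ _
  set d : EuclideanSpace ℝ (Fin 3) → ℝ := fun q => solidFun (coords q) with hd
  have hdc : Continuous d := continuous_solidFun.comp coords.continuous
  set U : Set (EuclideanSpace ℝ (Fin 3)) := {q | |d q| < 1 / 8} with hU
  have hUo : IsOpen U := isOpen_lt hdc.abs continuous_const
  have hUt : ∀ q : U, d q ∈ σ.target := fun q => by
    rw [hσt, mem_ball_zero_iff]; exact q.2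
  have hval : ∀ (x : stdGenusTwoSurface) (s : ℝ),
      d (coords.symm (e (σ s, coords x)).2) = σ s := fun x s => by
    rw [hd]
    simp only [coords.apply_symm_apply, he]
    exact (solidFun_flow_eq (hσb s).le _).2 (mem_stdGenusTwoSurface.1 x.2)
  have hsnd : ∀ s p, e.symm (s, p) = (s, (e.symm (s, p)).2) := fun s p => by
    refine Prod.ext ?_ rfl
    have := congrArg Prod.fst (he (e.symm (s, p)))
    rw [e.apply_symm_apply] at this
    exact this.symm
  have hinv : ∀ q : U, coords.symm (e.symm (d q, coords q)).2 ∈ stdGenusTwoSurface := fun q => by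
    have h1 := congrArg Prod.snd (he (e.symm (d q, coords q)))
    rw [e.apply_symm_apply, hsnd] at h1
    rw [mem_stdGenusTwoSurface, coords.apply_symm_apply, ← solidFun_flow_eq (s := d q) q.2.le]
    exact congrArg solidFun h1.symm
  let k : stdGenusTwoSurface × ℝ ≃ₜ U :=
    { toFun := fun x => ⟨coords.symm (e (σ x.2, coords x.1)).2, by
        rw [hU, Set.mem_ofPred_eq, hval]; exact hσb _⟩
      invFun := fun q => (⟨coords.symm (e.symm (d q, coords q)).2, hinv q⟩, σ.symm (d q))
      left_inv := fun x => by
        refine Prod.ext (Subtype.ext ?_) ?_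
        · have h1 : e (σ x.2, coords x.1) = (σ x.2, (e (σ x.2, coords x.1)).2) :=
            Prod.ext (by rw [he]) rfl
          simp only [hval, coords.apply_symm_apply]
          rw [← h1, e.symm_apply_apply, coords.symm_apply_apply]
        · simp only [hval]
          exact σ.left_inv (by rw [hσs]; trivial)
      right_inv := fun q => by
        refine Subtype.ext ?_
        simp only [σ.right_inv (hUt q), coords.apply_symm_apply]
        rw [← hsnd, e.apply_symm_apply, coords.symm_apply_apply]
      continuous_toFun := by
        refine Continuous.subtype_mk (coords.symm.continuous.comp (continuous_snd.comp
          (e.continuous.comp (Continuous.prodMk (hσc.comp continuous_snd) ?_)))) _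
        exact coords.continuous.comp (continuous_subtype_val.comp continuous_fst)
      continuous_invFun := by
        have h1 : Continuous fun q : U => d q := hdc.comp continuous_subtype_val
        refine Continuous.prodMk (Continuous.subtype_mk (coords.symm.continuous.comp
          (continuous_snd.comp (e.symm.continuous.comp (h1.prodMk
            (coords.continuous.comp continuous_subtype_val))))) _) ?_
        exact σ.continuousOn_symm.comp_continuous h1 hUt }
  refine ⟨fun x => k x, hUo.isOpenEmbedding_subtypeVal.comp k.isOpenEmbedding, fun x => ?_⟩
  change coords.symm (e (σ 0, coords x)).2 = x
  rw [hσ0, he]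
  simp only [flow_zero, Prod.mk.eta, coords.symm_apply_apply]

/-- The standard handlebody is a pancake over the rectangle with two holes. -/
theorem exists_pancake_handlebody : ∃ e : (ℝ × ℝ) × ℝ ≃ₜ (ℝ × ℝ) × ℝ, ∀ p,
    |(e p).2| ≤ min (1 / 2) (-4 * planarFun (e p).1) ↔ solidFun p ≤ 0 := by
  obtain ⟨g, hg, hg1, hg2⟩ := exists_flowInv
  have hc := isFibreMap_flow.continuous
  -- At distance `h` from the middle height the planar region is pushed inwards to the level `-h /
  -- 4`. The vertical walls thus become the graph of the thickness `-4 * planarFun`.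
  refine ⟨{ toFun := fun p =>
              ((flow (-(|p.2 - 1 / 2| / 4)) p.1.1, flow (-(|p.2 - 1 / 2| / 4)) p.1.2), p.2 - 1 / 2)
            invFun := fun p =>
              ((g (-(|p.2| / 4)) p.1.1, g (-(|p.2| / 4)) p.1.2), p.2 + 1 / 2)
            left_inv := fun p => by simp only [hg1, sub_add_cancel]
            right_inv := fun p => by simp only [add_sub_cancel_right, hg2]
            continuous_toFun := by
              refine Continuous.prodMk (Continuous.prodMk ?_ ?_) (by fun_prop)
              · exact hc.comp (f := fun p : (ℝ × ℝ) × ℝ => (-(|p.2 - 1 / 2| / 4), p.1.1))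
                  (by fun_prop)
              · exact hc.comp (f := fun p : (ℝ × ℝ) × ℝ => (-(|p.2 - 1 / 2| / 4), p.1.2))
                  (by fun_prop)
            continuous_invFun := by
              refine Continuous.prodMk (Continuous.prodMk ?_ ?_) (by fun_prop)
              · exact hg.comp (f := fun p : (ℝ × ℝ) × ℝ => (-(|p.2| / 4), p.1.1)) (by fun_prop)
              · exact hg.comp (f := fun p : (ℝ × ℝ) × ℝ => (-(|p.2| / 4), p.1.2)) (by fun_prop) },
    fun p => ?_⟩
  have h1 : |p.2 - 1 / 2| ≤ 1 / 2 ↔ 0 ≤ p.2 ∧ p.2 ≤ 1 := by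
    rw [abs_le]
    constructor <;> rintro ⟨h, h'⟩ <;> constructor <;> linarith
  simp only [solidFun, max_le_iff, sub_nonpos, Homeomorph.homeomorph_mk_coe, Equiv.coe_fn_mk,
    le_min_iff, ← h1]
  rw [and_comm, and_congr_left_iff]
  intro h
  have hs : |(-(|p.2 - 1 / 2| / 4))| ≤ 1 / 8 := by
    rw [abs_neg, abs_of_nonneg (by positivity)]; linarith
  rw [← (planarFun_flow hs p.1).1]
  constructor <;> intro h <;> linarith


/-! ### The rectangle with two holes as a union of intervals -/

/-- Lower end of a slice of the sheared rectangle. -/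
noncomputable def knotLo (u : ℝ) : ℝ := max 0 (3 * ramp 0 6 u - 15)

/-- Upper end of a slice of the sheared rectangle. -/
noncomputable def knotHi (u : ℝ) : ℝ := min 3 (3 * ramp 0 6 u)

/-- The middle lines away from the holes. -/
noncomputable def knotMid (u : ℝ) : ℝ := 3 / 4 * ramp 0 (4 / 3) u - 3 / 2 * (ramp (8 / 3) (10 / 3) u - 8 / 3) +
  3 / 4 * (ramp (14 / 3) 6 u - 14 / 3) - 2

/-- Lower end of a slice of the sheared holes. -/
noncomputable def knotELo (u : ℝ) : ℝ := knotMid u + max 1 (3 * ramp (4 / 3) (8 / 3) u - 6) +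
  max 1 (3 * ramp (10 / 3) (14 / 3) u - 12)

/-- Upper end of a slice of the sheared holes. -/
noncomputable def knotEHi (u : ℝ) : ℝ := knotMid u + min 2 (3 * ramp (4 / 3) (8 / 3) u - 3) +
  min 2 (3 * ramp (10 / 3) (14 / 3) u - 9)

theorem continuous_knots : Continuous knotLo ∧ Continuous knotHi ∧ Continuous knotELo ∧
    Continuous knotEHi := by
  have := continuous_ramp
  unfold knotLo knotHi knotELo knotEHi knotMid
  refine ⟨?_, ?_, ?_, ?_⟩ <;> fun_prop

/-- The region is cut along the lines `x + y / 3 = u`. The slant makes the rectangle shrink to a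
corner at `u = 0` and `u = 6`, makes the holes open and close at corners, and separates their ranges
`(4/3, 8/3)` and `(10/3, 14/3)`. Away from the holes the two middle knots coincide. -/
theorem knots_cases (u : ℝ) :
    (u ≤ 0 ∧ knotLo u = 0 ∧ knotELo u = 0 ∧ knotEHi u = 0 ∧ knotHi u = 0) ∨
    (0 < u ∧ u < 4 / 3 ∧ knotLo u = 0 ∧ knotELo u = 3 / 4 * u ∧ knotEHi u = 3 / 4 * u ∧
      knotHi u = min 3 (3 * u)) ∨
    (4 / 3 ≤ u ∧ u ≤ 8 / 3 ∧ knotLo u = 0 ∧ knotELo u = max 1 (3 * u - 6) ∧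
      knotEHi u = min 2 (3 * u - 3) ∧ knotHi u = 3) ∨
    (8 / 3 < u ∧ u < 10 / 3 ∧ knotLo u = 0 ∧ knotELo u = 6 - 3 / 2 * u ∧
      knotEHi u = 6 - 3 / 2 * u ∧ knotHi u = 3) ∨
    (10 / 3 ≤ u ∧ u ≤ 14 / 3 ∧ knotLo u = 0 ∧ knotELo u = max 1 (3 * u - 12) ∧
      knotEHi u = min 2 (3 * u - 9) ∧ knotHi u = 3) ∨
    (14 / 3 < u ∧ u < 6 ∧ knotLo u = max 0 (3 * u - 15) ∧ knotELo u = 3 / 4 * u - 3 / 2 ∧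
      knotEHi u = 3 / 4 * u - 3 / 2 ∧ knotHi u = 3) ∨
    (6 ≤ u ∧ knotLo u = 3 ∧ knotELo u = 3 ∧ knotEHi u = 3 ∧ knotHi u = 3) := by
  have hi : ∀ {a b : ℝ}, 0 ≤ a ∧ b ≤ 6 → a ≤ u → u ≤ b → knotLo u = max 0 (3 * u - 15) ∧ knotHi u = min 3 (3 * u) := by
    intro a b h h1 h2
    rw [knotLo, knotHi, ramp_of_mem (by linarith) (by linarith)]
    exact ⟨rfl, rfl⟩
  simp only [knotELo, knotEHi, knotMid]
  rcases le_or_gt u 0 with h | h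
  · left
    rw [knotLo, knotHi]
    simp only [ramp_of_le h, ramp_of_le (show u ≤ 4 / 3 by linarith),
      ramp_of_le (show u ≤ 8 / 3 by linarith), ramp_of_le (show u ≤ 10 / 3 by linarith),
      ramp_of_le (show u ≤ 14 / 3 by linarith)]
    norm_num [h]
  right
  rcases lt_or_ge u (4 / 3) with h' | h'
  · left
    obtain ⟨e1, e2⟩ := hi (a := 0) (b := 4 / 3) (by norm_num) h.le h'.le
    rw [e1, e2, ramp_of_mem h.le h'.le, ramp_of_le h'.le, ramp_of_le (show u ≤ 8 / 3 by linarith),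
      ramp_of_le (show u ≤ 10 / 3 by linarith), ramp_of_le (show u ≤ 14 / 3 by linarith),
      max_eq_left (show 3 * u - 15 ≤ 0 by linarith)]
    norm_num [h, h']
    ring
  right
  rcases le_or_gt u (8 / 3) with h2 | h2
  · left
    obtain ⟨e1, e2⟩ := hi (a := 4 / 3) (b := 8 / 3) (by norm_num) h' h2
    rw [e1, e2, ramp_of_ge (by norm_num) h', ramp_of_mem h' h2, ramp_of_le h2,
      ramp_of_le (show u ≤ 10 / 3 by linarith), ramp_of_le (show u ≤ 14 / 3 by linarith),
      max_eq_left (show 3 * u - 15 ≤ 0 by linarith), min_eq_left (show 3 ≤ 3 * u by linarith)]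
    norm_num [h', h2]
  right
  rcases lt_or_ge u (10 / 3) with h3 | h3
  · left
    obtain ⟨e1, e2⟩ := hi (a := 8 / 3) (b := 10 / 3) (by norm_num) h2.le h3.le
    rw [e1, e2, ramp_of_ge (by norm_num) h', ramp_of_ge (by norm_num) h2.le,
      ramp_of_mem h2.le h3.le, ramp_of_le h3.le, ramp_of_le (show u ≤ 14 / 3 by linarith),
      max_eq_left (show 3 * u - 15 ≤ 0 by linarith), min_eq_left (show 3 ≤ 3 * u by linarith)]
    norm_num [h3, h2]
    ring
  right
  rcases le_or_gt u (14 / 3) with h4 | h4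
  · left
    obtain ⟨e1, e2⟩ := hi (a := 10 / 3) (b := 14 / 3) (by norm_num) h3 h4
    rw [e1, e2, ramp_of_ge (by norm_num) h', ramp_of_ge (by norm_num) h2.le,
      ramp_of_ge (by norm_num) h3, ramp_of_mem h3 h4, ramp_of_le h4,
      max_eq_left (show 3 * u - 15 ≤ 0 by linarith), min_eq_left (show 3 ≤ 3 * u by linarith)]
    norm_num [h3, h4]
  right
  rcases lt_or_ge u 6 with h5 | h5
  · left
    obtain ⟨e1, e2⟩ := hi (a := 14 / 3) (b := 6) (by norm_num) h4.le h5.le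
    rw [e1, e2, ramp_of_ge (by norm_num) h', ramp_of_ge (by norm_num) h2.le,
      ramp_of_ge (by norm_num) h3, ramp_of_ge (by norm_num) h4.le, ramp_of_mem h4.le h5.le,
      min_eq_left (show 3 ≤ 3 * u by linarith)]
    norm_num [h4, h5]
    ring
  · right
    rw [knotLo, knotHi, ramp_of_ge (by norm_num) h5, ramp_of_ge (by norm_num) h',
      ramp_of_ge (by norm_num) h2.le, ramp_of_ge (by norm_num) h3, ramp_of_ge (by norm_num) h4.le,
      ramp_of_ge (by norm_num) h5]
    norm_num [h5]

/-- The slices that meet the holes. -/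
def HoleSlice (u : ℝ) : Prop := (4 / 3 ≤ u ∧ u ≤ 8 / 3) ∨ (10 / 3 ≤ u ∧ u ≤ 14 / 3)

theorem knots_order (u : ℝ) : knotLo u ≤ knotELo u ∧ knotELo u ≤ knotEHi u ∧ knotEHi u ≤ knotHi u ∧
    (knotLo u = knotELo u ↔ u ≤ 0 ∨ 6 ≤ u) ∧ (knotEHi u = knotHi u ↔ u ≤ 0 ∨ 6 ≤ u) ∧
    (knotELo u = knotEHi u ↔ ¬ ((4 / 3 < u ∧ u < 8 / 3) ∨ (10 / 3 < u ∧ u < 14 / 3))) := by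
  have h := knots_cases u
  rcases h with ⟨h0, e1, e2, e3, e4⟩ | ⟨h0, h0', e1, e2, e3, e4⟩ | ⟨h0, h0', e1, e2, e3, e4⟩ |
    ⟨h0, h0', e1, e2, e3, e4⟩ | ⟨h0, h0', e1, e2, e3, e4⟩ | ⟨h0, h0', e1, e2, e3, e4⟩ |
    ⟨h0, e1, e2, e3, e4⟩ <;> rw [e1, e2, e3, e4] <;> grind (splits := 20)

theorem planarFun_nonpos_iff (p : ℝ × ℝ) {u : ℝ} (hu : u = p.1 + p.2 / 3) : planarFun p ≤ 0 ↔
    (0 ≤ u ∧ u ≤ 6) ∧ (knotLo u ≤ p.2 ∧ p.2 ≤ knotHi u) ∧ ¬ (knotELo u < p.2 ∧ p.2 < knotEHi u) := by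
  have h := knots_cases u
  simp only [planarFun, max_le_iff, min_le_iff]
  obtain ⟨x, y⟩ := p
  simp only at hu ⊢
  obtain rfl : x = u - y / 3 := by linarith
  rcases h with ⟨h0, e1, e2, e3, e4⟩ | ⟨h0, h0', e1, e2, e3, e4⟩ | ⟨h0, h0', e1, e2, e3, e4⟩ |
    ⟨h0, h0', e1, e2, e3, e4⟩ | ⟨h0, h0', e1, e2, e3, e4⟩ | ⟨h0, h0', e1, e2, e3, e4⟩ |
    ⟨h0, e1, e2, e3, e4⟩ <;> rw [e1, e2, e3, e4] <;> grind (splits := 20)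

theorem planarFun_neg_iff (p : ℝ × ℝ) {u : ℝ} (hu : u = p.1 + p.2 / 3) : planarFun p < 0 ↔
    (knotLo u < p.2 ∧ p.2 < knotHi u) ∧
      ¬ (HoleSlice u ∧ knotELo u ≤ p.2 ∧ p.2 ≤ knotEHi u) := by
  have h := knots_cases u
  simp only [planarFun, max_lt_iff, min_lt_iff, HoleSlice]
  obtain ⟨x, y⟩ := p
  simp only at hu ⊢
  obtain rfl : x = u - y / 3 := by linarith
  rcases h with ⟨h0, e1, e2, e3, e4⟩ | ⟨h0, h0', e1, e2, e3, e4⟩ | ⟨h0, h0', e1, e2, e3, e4⟩ |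
    ⟨h0, h0', e1, e2, e3, e4⟩ | ⟨h0, h0', e1, e2, e3, e4⟩ | ⟨h0, h0', e1, e2, e3, e4⟩ |
    ⟨h0, e1, e2, e3, e4⟩ <;> rw [e1, e2, e3, e4] <;> grind (splits := 20)


/-! ### The planar region in normal form -/

/-- The radius of the slices. -/
noncomputable def sliceRadius (t : ℝ) : ℝ := 1 - (t / 16) ^ 2

@[fun_prop]
theorem continuous_sliceRadius : Continuous sliceRadius := by unfold sliceRadius; fun_prop

theorem sliceRadius_nonneg {t : ℝ} : 0 ≤ sliceRadius t ↔ |t| ≤ 16 := by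
  rw [sliceRadius, sub_nonneg, sq_le_one_iff_abs_le_one, abs_div, div_le_one (by norm_num)]
  norm_num

theorem sliceRadius_pos {t : ℝ} : 0 < sliceRadius t ↔ |t| < 16 := by
  rw [sliceRadius, sub_pos, sq_lt_one_iff_abs_lt_one, abs_div, div_lt_one (by norm_num)]
  norm_num

/-- The distances from the centres of the slices to the branch line. -/
structure IsOffset (ρ : ℝ → ℝ) : Prop where
  continuous : Continuous ρ
  nonneg : ∀ t, 0 ≤ ρ t
  lt : ∀ t, ρ t < sliceRadius t ↔ |t| < 3 ∨ (8 < |t| ∧ |t| < 16)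
  eq : ∀ t, ρ t = sliceRadius t ↔ |t| = 3 ∨ |t| = 8 ∨ |t| = 16
  zero : ∀ t, 16 ≤ |t| → ρ t = 0

theorem IsOffset.gt {ρ : ℝ → ℝ} (h : IsOffset ρ) {t : ℝ} :
    sliceRadius t < ρ t ↔ (3 < |t| ∧ |t| < 8) ∨ 16 < |t| := by
  rw [← not_le, le_iff_lt_or_eq, h.lt, h.eq]
  grind

/-- The change of the first coordinate. -/
noncomputable def sliceTime (u : ℝ) : ℝ :=
  6 * (u - 3) + 21 / 4 * ramp (-(1 / 3)) (1 / 3) (u - 3) - 9 / 4 * ramp (-(5 / 3)) (5 / 3) (u - 3)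

theorem continuous_sliceTime : Continuous sliceTime := by
  have := continuous_ramp
  unfold sliceTime; fun_prop

theorem strictMono_sliceTime : StrictMono sliceTime := by
  intro x y h
  have h' : x - 3 ≤ y - 3 := by linarith
  have h1 := ramp_sub_mem (a := -(1 / 3)) (b := 1 / 3) h'
  have h2 := ramp_sub_mem (a := -(5 / 3)) (b := 5 / 3) h'
  unfold sliceTime
  linarith

theorem sliceTime_values : sliceTime 0 = -16 ∧ sliceTime (4 / 3) = -8 ∧ sliceTime (8 / 3) = -3 ∧
    sliceTime (10 / 3) = 3 ∧ sliceTime (14 / 3) = 8 ∧ sliceTime 6 = 16 := by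
  unfold sliceTime ramp
  norm_num

theorem surjective_sliceTime : Function.Surjective sliceTime := by
  have h : Function.Surjective fun u => sliceTime (u + 3) / 6 := by
    refine surjective_of_sub_bounded (C := 2) ?_ fun u => ?_
    · have := continuous_sliceTime; fun_prop
    · have h1 := fun a : ℝ => (⟨le_max_left (-a) (min a u), fun h => max_le h (min_le_left a u)⟩ :
        -a ≤ ramp (-a) a u ∧ (-a ≤ a → ramp (-a) a u ≤ a))
      have h2 := h1 (1 / 3)
      have h3 := h1 (5 / 3)
      norm_num at h2 h3
      simp only [sliceTime, add_sub_cancel_right]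
      rw [abs_le]
      constructor <;> linarith
  intro t
  obtain ⟨u, hu⟩ := h (t / 6)
  exact ⟨u + 3, by simp only at hu; linarith⟩

theorem sliceTime_facts (u : ℝ) : (|sliceTime u| ≤ 16 ↔ 0 ≤ u ∧ u ≤ 6) ∧
    (|sliceTime u| < 16 ↔ 0 < u ∧ u < 6) ∧
    ((3 < |sliceTime u| ∧ |sliceTime u| < 8) ↔
      ((4 / 3 < u ∧ u < 8 / 3) ∨ (10 / 3 < u ∧ u < 14 / 3))) ∧
    ((3 ≤ |sliceTime u| ∧ |sliceTime u| ≤ 8) ↔ HoleSlice u) := by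
  obtain ⟨v1, v2, v3, v4, v5, v6⟩ := sliceTime_values
  have hle := fun a => strictMono_sliceTime.le_iff_le (a := a) (b := u)
  have hlt := fun a => strictMono_sliceTime.lt_iff_lt (a := a) (b := u)
  have hle' := fun b => strictMono_sliceTime.le_iff_le (a := u) (b := b)
  have hlt' := fun b => strictMono_sliceTime.lt_iff_lt (a := u) (b := b)
  refine ⟨?_, ?_, ?_, ?_⟩
  · rw [abs_le, ← v1, ← v6, hle, hle']
  · rw [abs_lt, ← v1, ← v6, hlt, hlt']
  · rw [lt_abs, abs_lt, lt_neg, ← v2, ← v3, ← v4, ← v5, hlt, hlt', hlt, hlt']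
    grind
  · rw [HoleSlice, le_abs, abs_le, le_neg, ← v2, ← v3, ← v4, ← v5, hle, hle', hle, hle']
    grind

/-- The outer radius of the planar region. -/
noncomputable def outerEnd (ρ : ℝ → ℝ) (t : ℝ) : ℝ := √(ρ t + sliceRadius t)

/-- The inner radius of the planar region. -/
noncomputable def innerEnd (ρ : ℝ → ℝ) (t : ℝ) : ℝ :=
  √(min (ρ t - sliceRadius t) (ρ t + sliceRadius t))

theorem IsOffset.ends_of_ge {ρ : ℝ → ℝ} (h : IsOffset ρ) {t : ℝ} (ht : 16 ≤ |t|) :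
    outerEnd ρ t = 0 ∧ innerEnd ρ t = 0 := by
  have h1 : sliceRadius t ≤ 0 := by
    rw [← not_lt, sliceRadius_pos, not_lt]; exact ht
  have h2 := h.zero t ht
  exact ⟨Real.sqrt_eq_zero_of_nonpos (by linarith),
    Real.sqrt_eq_zero_of_nonpos ((min_le_right _ _).trans (by linarith))⟩

theorem IsOffset.innerEnd_lt {ρ : ℝ → ℝ} (h : IsOffset ρ) {t : ℝ} (ht : |t| < 16) :
    innerEnd ρ t < outerEnd ρ t := by
  have h1 := sliceRadius_pos.2 ht
  have h2 := h.nonneg t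
  rw [innerEnd, outerEnd, Real.sqrt_lt_sqrt_iff_of_pos (by linarith)]
  exact (min_le_left _ _).trans_lt (by linarith)

theorem IsOffset.innerEnd_eq_zero {ρ : ℝ → ℝ} (h : IsOffset ρ) {t : ℝ} :
    innerEnd ρ t = 0 ↔ ¬ (3 < |t| ∧ |t| < 8) := by
  by_cases ht : |t| < 16
  · have h1 := sliceRadius_pos.2 ht
    have h2 := h.nonneg t
    rw [innerEnd, min_eq_left (by linarith), Real.sqrt_eq_zero', sub_nonpos, ← not_lt, h.gt]
    grind
  · push Not at ht
    refine iff_of_true (h.ends_of_ge ht).2 fun h => ?_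
    linarith [h.2]

/-- For real `a` the condition is `ρ - R ≤ a² ≤ ρ + R`: an interval symmetric about `0`, with a
symmetric gap when `ρ > R`. The gap is open exactly when the line is outside the octahedron, `3 <
|t| < 8`. -/
theorem IsOffset.le_iff {ρ : ℝ → ℝ} (h : IsOffset ρ) (t a : ℝ) : |a ^ 2 - ρ t| ≤ sliceRadius t ↔
    |t| ≤ 16 ∧ (-outerEnd ρ t ≤ a ∧ a ≤ outerEnd ρ t) ∧
      ¬ (-innerEnd ρ t < a ∧ a < innerEnd ρ t) := by
  by_cases ht : |t| ≤ 16
  · have h1 := sliceRadius_nonneg.2 ht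
    have h2 := h.nonneg t
    rw [← abs_le, ← abs_lt, outerEnd, innerEnd, min_eq_left (by linarith), not_lt,
      Real.sqrt_le_left (abs_nonneg a), sq_abs, Real.le_sqrt (abs_nonneg a) (by linarith), sq_abs, abs_le]
    constructor
    · rintro ⟨h3, h4⟩; exact ⟨ht, by linarith, by linarith⟩
    · rintro ⟨-, h3, h4⟩; constructor <;> linarith
  · refine iff_of_false (fun h' => ht (sliceRadius_nonneg.1 ((abs_nonneg _).trans h'))) fun h' => ht h'.1

theorem IsOffset.lt_iff {ρ : ℝ → ℝ} (h : IsOffset ρ) (t a : ℝ) : |a ^ 2 - ρ t| < sliceRadius t ↔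
    (-outerEnd ρ t < a ∧ a < outerEnd ρ t) ∧
      ¬ ((3 ≤ |t| ∧ |t| ≤ 8) ∧ -innerEnd ρ t ≤ a ∧ a ≤ innerEnd ρ t) := by
  by_cases ht : |t| < 16
  · have h1 := sliceRadius_pos.2 ht
    have h2 := h.nonneg t
    rw [← abs_le, ← abs_lt, outerEnd, innerEnd, min_eq_left (by linarith),
      Real.lt_sqrt (abs_nonneg a), sq_abs, abs_lt]
    by_cases h3 : 3 ≤ |t| ∧ |t| ≤ 8
    · have h4 : sliceRadius t ≤ ρ t := by
        rw [← not_lt, h.lt]; grind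
      simp only [h3, and_self, true_and, not_le]
      rw [Real.sqrt_lt (by linarith) (abs_nonneg a), sq_abs]
      constructor <;> rintro ⟨h5, h6⟩ <;> constructor <;> linarith
    · have h4 : ρ t < sliceRadius t := (h.lt t).2 (by grind)
      have := sq_nonneg a
      simp only [h3, false_and, not_false_eq_true, and_true]
      constructor
      · rintro ⟨h5, h6⟩; linarith
      · intro h5; constructor <;> linarith
  · push Not at ht
    obtain ⟨h1, h2⟩ := h.ends_of_ge ht
    refine iff_of_false (fun h' => absurd (sliceRadius_pos.1 ((abs_nonneg _).trans_lt h')) (not_lt.2 ht)) ?_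
    rw [h1]
    rintro ⟨⟨h3, h4⟩, -⟩
    linarith

/-- Both regions are families of intervals with a middle gap, bounded by four knots. The change of
parameter `sliceTime` makes the ends and gaps occur at the same time, and `exists_fourKnots` matches
the fibres. -/
theorem exists_planarHomeo {ρ : ℝ → ℝ} (h : IsOffset ρ) : ∃ k : ℝ × ℝ ≃ₜ ℝ × ℝ, ∀ p,
    (planarFun p ≤ 0 ↔ |(k p).2 ^ 2 - ρ (k p).1| ≤ sliceRadius (k p).1) ∧
      (planarFun p < 0 ↔ |(k p).2 ^ 2 - ρ (k p).1| < sliceRadius (k p).1) := by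
  have hρ := h.continuous
  have cT := continuous_sliceTime
  obtain ⟨c0, c3, c1, c2⟩ := continuous_knots
  have cA : Continuous fun u => outerEnd ρ (sliceTime u) := by unfold outerEnd; fun_prop
  have cE : Continuous fun u => innerEnd ρ (sliceTime u) := by unfold innerEnd; fun_prop
  have hout : ∀ u, (u ≤ 0 ∨ 6 ≤ u) ↔ innerEnd ρ (sliceTime u) = outerEnd ρ (sliceTime u) := by
    intro u
    have h1 := (sliceTime_facts u).2.1
    by_cases ht : |sliceTime u| < 16
    · refine iff_of_false ?_ (h.innerEnd_lt ht).ne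
      have := h1.1 ht
      push Not; exact this
    · rw [h1] at ht
      refine iff_of_true (by by_contra H; push Not at H; exact ht H) ?_
      obtain ⟨h2, h3⟩ := h.ends_of_ge (not_lt.1 fun h' => ht (h1.1 h'))
      rw [h2, h3]
  have hle : ∀ u, innerEnd ρ (sliceTime u) ≤ outerEnd ρ (sliceTime u) := fun u => by
    by_cases ht : |sliceTime u| < 16
    · exact (h.innerEnd_lt ht).le
    · obtain ⟨h2, h3⟩ := h.ends_of_ge (not_lt.1 ht)
      rw [h2, h3]
  obtain ⟨Φ, f, f0, f1, f2, f3⟩ := exists_fourKnots (l₀ := fun u => -outerEnd ρ (sliceTime u))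
    (l₁ := fun u => -innerEnd ρ (sliceTime u)) (l₂ := fun u => innerEnd ρ (sliceTime u))
    (l₃ := fun u => outerEnd ρ (sliceTime u)) c0 c1 c2 c3 cA.neg cE.neg cE cA
    (fun u => by
      obtain ⟨h1, h2, h3, h4, h5, h6⟩ := knots_order u
      refine ⟨h1, neg_le_neg (hle u), ?_⟩
      rw [h4, hout, neg_inj, eq_comm])
    (fun u => by
      obtain ⟨h1, h2, h3, h4, h5, h6⟩ := knots_order u
      refine ⟨h2, neg_le_self (Real.sqrt_nonneg _), ?_⟩
      rw [h6, neg_eq_self, h.innerEnd_eq_zero, (sliceTime_facts u).2.2.1])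
    (fun u => by
      obtain ⟨h1, h2, h3, h4, h5, h6⟩ := knots_order u
      refine ⟨h3, hle u, ?_⟩
      rw [h5, hout])
  obtain ⟨e, he⟩ := exists_fibreHomeo Φ f.continuous f.strictMono f.surjective
  let shear : ℝ × ℝ ≃ₜ ℝ × ℝ :=
    { toFun := fun p => (p.1 + p.2 / 3, p.2)
      invFun := fun p => (p.1 - p.2 / 3, p.2)
      left_inv := fun p => by simp
      right_inv := fun p => by simp
      continuous_toFun := by fun_prop
      continuous_invFun := by fun_prop }
  let τ : ℝ ≃ₜ ℝ :=
    (strictMono_sliceTime.orderIsoOfSurjective _ surjective_sliceTime).toHomeomorph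
  refine ⟨(shear.trans e).trans (τ.prodCongr (Homeomorph.refl ℝ)), fun p => ?_⟩
  have hval : ((shear.trans e).trans (τ.prodCongr (Homeomorph.refl ℝ))) p =
      (sliceTime (p.1 + p.2 / 3), Φ (p.1 + p.2 / 3) p.2) := by
    change ((τ.prodCongr (Homeomorph.refl ℝ)) (e (p.1 + p.2 / 3, p.2))) = _
    rw [he]; rfl
  rw [hval]
  set u := p.1 + p.2 / 3 with hu
  have m := f.strictMono u
  constructor
  · rw [planarFun_nonpos_iff p hu, h.le_iff, ← f0, ← f1, ← f2, ← f3, m.le_iff_le, m.le_iff_le,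
      m.lt_iff_lt, m.lt_iff_lt, (sliceTime_facts u).1]
  · rw [planarFun_neg_iff p hu, h.lt_iff, ← f0, ← f1, ← f2, ← f3, m.le_iff_le, m.le_iff_le,
      m.lt_iff_lt, m.lt_iff_lt, (sliceTime_facts u).2.2.2]

/-- The thickness of the normal form of the handlebody. -/
noncomputable def thickness (ρ : ℝ → ℝ) (p : ℝ × ℝ) : ℝ :=
  √(√(4 * p.2 ^ 2 * ρ p.1 + max (sliceRadius p.1) 0 ^ 2) - p.2 ^ 2 - ρ p.1) +
    min (√(4 * p.2 ^ 2 * ρ p.1 + max (sliceRadius p.1) 0 ^ 2) - p.2 ^ 2 - ρ p.1) 0 +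
    min (sliceRadius p.1) 0

theorem continuous_thickness {ρ : ℝ → ℝ} (h : Continuous ρ) : Continuous (thickness ρ) := by
  unfold thickness; fun_prop

/-- With `w = a + ib`, one has `|w² - ρ|² = (b² + a² + ρ)² - 4 a² ρ`, so for `R ≥ 0` the condition
bounds `b²` by `√(4 a² ρ + R²) - a² - ρ`. The minima in `thickness` vanish on the region and make
the function negative off it. -/
theorem thickness_facts {ρ : ℝ → ℝ} (h0 : ∀ t, 0 ≤ ρ t) (t a : ℝ) :
    (0 ≤ thickness ρ (t, a) ↔ |a ^ 2 - ρ t| ≤ sliceRadius t) ∧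
    (0 < thickness ρ (t, a) ↔ |a ^ 2 - ρ t| < sliceRadius t) ∧
    ∀ b, |b| ≤ thickness ρ (t, a) ↔ ‖(⟨a, b⟩ : ℂ) ^ 2 - ρ t‖ ≤ sliceRadius t := by
  have hρ := h0 t
  have ha := sq_nonneg a
  set Q := √(4 * a ^ 2 * ρ t + max (sliceRadius t) 0 ^ 2) with hQ
  have hth : thickness ρ (t, a) = √(Q - a ^ 2 - ρ t) + min (Q - a ^ 2 - ρ t) 0 +
    min (sliceRadius t) 0 := rfl
  have hle : 0 ≤ Q - a ^ 2 - ρ t ↔ |a ^ 2 - ρ t| ≤ max (sliceRadius t) 0 := by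
    rw [← abs_of_nonneg (le_max_right (sliceRadius t) 0), ← sq_le_sq, sub_sub, sub_nonneg,
      Real.le_sqrt (by positivity) (by positivity)]
    constructor <;> intro h <;> linarith
  have hlt : 0 < Q - a ^ 2 - ρ t ↔ |a ^ 2 - ρ t| < max (sliceRadius t) 0 := by
    rw [← abs_of_nonneg (le_max_right (sliceRadius t) 0), ← sq_lt_sq, sub_sub, sub_pos,
      Real.lt_sqrt (by positivity)]
    constructor <;> intro h <;> linarith
  rcases lt_or_ge (sliceRadius t) 0 with hR | hR
  · rw [max_eq_right hR.le] at hlt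
    have h1 : Q - a ^ 2 - ρ t ≤ 0 := not_lt.1 fun h => absurd (hlt.1 h) (not_lt.2 (abs_nonneg _))
    have h2 : thickness ρ (t, a) < 0 := by
      rw [hth, Real.sqrt_eq_zero_of_nonpos h1, min_eq_left hR.le]
      have := min_le_right (Q - a ^ 2 - ρ t) 0
      linarith
    refine ⟨iff_of_false (by linarith) ?_, iff_of_false (by linarith) ?_, fun b => iff_of_false ?_ ?_⟩
    · linarith [abs_nonneg (a ^ 2 - ρ t)]
    · linarith [abs_nonneg (a ^ 2 - ρ t)]
    · linarith [abs_nonneg b]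
    · linarith [norm_nonneg ((⟨a, b⟩ : ℂ) ^ 2 - ρ t)]
  · rw [max_eq_left hR] at hle hlt
    rw [min_eq_right hR, add_zero] at hth
    refine ⟨?_, ?_, fun b => ?_⟩
    · rw [← hle, hth]
      rcases lt_or_ge (Q - a ^ 2 - ρ t) 0 with h | h
      · rw [Real.sqrt_eq_zero_of_nonpos h.le, min_eq_left h.le, zero_add]
      · exact iff_of_true (by rw [min_eq_right h, add_zero]; positivity) h
    · rw [← hlt, hth]
      rcases le_or_gt (Q - a ^ 2 - ρ t) 0 with h | h
      · rw [Real.sqrt_eq_zero_of_nonpos h, min_eq_left h, zero_add]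
      · exact iff_of_true (by rw [min_eq_right h.le, add_zero]; positivity) h
    · have hn : ‖(⟨a, b⟩ : ℂ) ^ 2 - ρ t‖ ^ 2 = (b ^ 2 + a ^ 2 + ρ t) ^ 2 - 4 * a ^ 2 * ρ t := by
        rw [Complex.sq_norm, Complex.normSq_apply]
        simp only [sq, Complex.sub_re, Complex.sub_im, Complex.mul_re, Complex.mul_im,
          Complex.ofReal_re, Complex.ofReal_im]
        ring
      have h1 : |b| ≤ thickness ρ (t, a) ↔ b ^ 2 ≤ Q - a ^ 2 - ρ t := by
        rw [hth]
        rcases lt_or_ge (Q - a ^ 2 - ρ t) 0 with h | h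
        · rw [Real.sqrt_eq_zero_of_nonpos h.le, min_eq_left h.le, zero_add]
          exact iff_of_false (by linarith [abs_nonneg b]) (by linarith [sq_nonneg b])
        · rw [min_eq_right h, add_zero, Real.le_sqrt (abs_nonneg b) h, sq_abs]
      have h2 : b ^ 2 ≤ Q - a ^ 2 - ρ t ↔ b ^ 2 + a ^ 2 + ρ t ≤ Q := by
        constructor <;> intro h <;> linarith
      rw [h1, h2, Real.le_sqrt (by positivity) (by positivity), ← sq_le_sq₀ (norm_nonneg _) hR, hn, max_eq_left hR]
      constructor <;> intro h <;> linarith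


/-- The standard handlebody in normal form. -/
theorem exists_handlebody_normalForm {ρ : ℝ → ℝ} (h : IsOffset ρ) :
    ∃ e : EuclideanSpace ℝ (Fin 3) ≃ₜ ℝ × ℂ, ∀ x, x ∈ stdGenusTwoHandlebody ↔
      ‖(e x).2 ^ 2 - ρ (e x).1‖ ≤ sliceRadius (e x).1 := by
  obtain ⟨e₁, h₁⟩ := exists_pancake_handlebody
  obtain ⟨k, hk⟩ := exists_planarHomeo h
  have cβ : Continuous fun p : ℝ × ℝ => min (1 / 2) (-4 * planarFun p) := by fun_prop
  have cβ' : Continuous fun p : ℝ × ℝ => thickness ρ (k p) :=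
    (continuous_thickness h.continuous).comp k.continuous
  obtain ⟨e₂, h₂, h₂'⟩ := exists_pancake cβ cβ'
    (fun p => by
      rw [← Prod.mk.eta (p := k p), (thickness_facts h.nonneg _ _).1, ← (hk p).1, le_min_iff]
      constructor
      · rintro ⟨-, h⟩; linarith
      · intro h; constructor <;> linarith)
    (fun p => by
      rw [← Prod.mk.eta (p := k p), (thickness_facts h.nonneg _ _).2.1, ← (hk p).2, lt_min_iff]
      constructor
      · rintro ⟨-, h⟩; linarith
      · intro h; constructor <;> linarith)
  let e₃ : (ℝ × ℝ) × ℝ ≃ₜ ℝ × ℂ :=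
    (Homeomorph.prodAssoc ℝ ℝ ℝ).trans
      ((Homeomorph.refl ℝ).prodCongr Complex.equivRealProdCLM.symm.toHomeomorph)
  have h₃ : ∀ p, e₃ p = (p.1.1, ⟨p.1.2, p.2⟩) := fun p => by
    refine Prod.ext rfl ?_
    change Complex.equivRealProdCLM.symm (p.1.2, p.2) = _
    apply Complex.ext <;> simp
  refine ⟨(coords.trans e₁).trans (e₂.trans ((k.prodCongr (Homeomorph.refl ℝ)).trans e₃)), fun x => ?_⟩
  have hval : ((coords.trans e₁).trans (e₂.trans ((k.prodCongr (Homeomorph.refl ℝ)).trans e₃))) x =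
      ((k (e₁ (coords x)).1).1, ⟨(k (e₁ (coords x)).1).2, (e₂ (e₁ (coords x))).2⟩) := by
    change e₃ (k (e₂ (e₁ (coords x))).1, (e₂ (e₁ (coords x))).2) = _
    rw [h₃, h₂]
  rw [hval, mem_stdGenusTwoHandlebody, ← h₁, ← h₂', ← Prod.mk.eta (p := k _),
    (thickness_facts h.nonneg _ _).2.2]

/-! ### The octahedron in normal form -/

/-- The sublevel sets of these gauges are the slices of the octahedron. -/
noncomputable def sliceGauge (t : ℝ) (u : ℂ) : ℝ :=
  max ((1 - ramp (-1) 1 (t / 16)) * (|u.re| + |u.im| + (8 * u.re - 3 * u.im) / 16))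
    ((1 + ramp (-1) 1 (t / 16)) * (|u.re| + |u.im| - (8 * u.re - 3 * u.im) / 16))

theorem abs_tilt_le (u : ℂ) : |(8 * u.re - 3 * u.im) / 16| ≤ (|u.re| + |u.im|) / 2 := by
  have h1 := abs_le.1 (le_refl |u.re|)
  have h2 := abs_le.1 (le_refl |u.im|)
  have h3 := abs_nonneg u.im
  rw [abs_le]
  constructor <;> linarith

theorem ramp_one_mem (t : ℝ) : -1 ≤ ramp (-1) 1 t ∧ ramp (-1) 1 t ≤ 1 :=
  ⟨le_max_left _ _, max_le (by norm_num) (min_le_left _ _)⟩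

theorem sliceGauge_lower (t : ℝ) (u : ℂ) : (|u.re| + |u.im|) / 2 ≤ sliceGauge t u := by
  have h := abs_le.1 (abs_tilt_le u)
  have h0 := abs_nonneg u.re
  have h0' := abs_nonneg u.im
  rw [sliceGauge, le_max_iff]
  rcases le_total 0 (ramp (-1) 1 (t / 16)) with h1 | h1
  · right; nlinarith
  · left; nlinarith

theorem isGauge_sliceGauge : IsGauge sliceGauge where
  continuous := by
    have := Complex.continuous_re
    have := Complex.continuous_im
    unfold sliceGauge; fun_prop
  hom t r w hr := by
    rw [sliceGauge, sliceGauge, mul_max_of_nonneg _ _ hr]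
    simp only [Complex.real_smul, Complex.mul_re, Complex.mul_im, Complex.ofReal_re,
      Complex.ofReal_im, zero_mul, sub_zero, add_zero, abs_mul, abs_of_nonneg hr]
    congr 1 <;> ring
  lower := ⟨1 / 2, by norm_num, fun t w => by
    have h1 := sliceGauge_lower t w
    have h2 := Complex.norm_le_abs_re_add_abs_im w
    linarith⟩
  upper := ⟨6, fun t w => by
    have h := abs_le.1 (abs_tilt_le w)
    have h1 := Complex.abs_re_le_norm w
    have h2 := Complex.abs_im_le_norm w
    have h3 := ramp_one_mem (t / 16)
    have h4 := norm_nonneg w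
    rw [sliceGauge]
    refine max_le ?_ ?_ <;> nlinarith⟩

/-- At height `t` the octahedron is `M + s ≤ 1 + t/16` and `M - s ≤ 1 - t/16`, with `M = |X| + |Y|`
and `s` the linear part of `Z`. Multiplying by `1 - t/16` and `1 + t/16` gives both the bound `R(t)
= 1 - (t/16)²`. For `|t| ≥ 16` the factors are truncated, and at most a vertex remains. -/
theorem norm1_iff_sliceGauge (v : ℝ × ℝ × ℝ) :
    (norm1 v ≤ 1 ↔ sliceGauge (height v) ((straighten v).2 + axisC (height v)) ≤
      sliceRadius (height v)) ∧
    (norm1 v < 1 ↔ sliceGauge (height v) ((straighten v).2 + axisC (height v)) <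
      sliceRadius (height v)) := by
  obtain ⟨X, Y, Z⟩ := v
  set t := height (X, Y, Z) with ht
  have hu : (straighten (X, Y, Z)).2 + axisC t = ⟨X, Y⟩ := by
    apply Complex.ext
    · rw [Complex.add_re, straighten_snd_re, axisC_re]; simp [ht]
    · rw [Complex.add_im, straighten_snd_im, axisC_im]; simp [ht]
  have hZ : Z = (8 * X - 3 * Y) / 16 - t / 16 := by rw [ht, height]; ring
  have hT := abs_le.1 (abs_tilt_le ⟨X, Y⟩)
  have hG := sliceGauge_lower t ⟨X, Y⟩
  rw [hu]
  simp only at hT hG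
  have hX := abs_nonneg X
  have hY := abs_nonneg Y
  have hn : norm1 (X, Y, Z) = |X| + |Y| + |Z| := rfl
  rw [hn, hZ]
  clear hu hZ ht hn
  clear_value t
  set s := (8 * X - 3 * Y) / 16 with hs
  set M := |X| + |Y| with hM
  have hG' : sliceGauge t ⟨X, Y⟩ = max ((1 - ramp (-1) 1 (t / 16)) * (M + s))
    ((1 + ramp (-1) 1 (t / 16)) * (M - s)) := rfl
  have hM0 : 0 ≤ M := by positivity
  have hR : sliceRadius t = (1 - t / 16) * (1 + t / 16) := by rw [sliceRadius]; ring
  have hle : M + |s - t / 16| ≤ 1 ↔ M + s ≤ 1 + t / 16 ∧ M - s ≤ 1 - t / 16 := by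
    rw [← le_sub_iff_add_le', abs_le]
    constructor <;> rintro ⟨h1, h2⟩ <;> constructor <;> linarith
  have hlt : M + |s - t / 16| < 1 ↔ M + s < 1 + t / 16 ∧ M - s < 1 - t / 16 := by
    rw [← lt_sub_iff_add_lt', abs_lt]
    constructor <;> rintro ⟨h1, h2⟩ <;> constructor <;> linarith
  rw [hle, hlt]
  rcases lt_or_ge |t| 16 with h16 | h16
  · have h1 := abs_lt.1 h16
    have p1 : 0 < 1 - t / 16 := by linarith
    have p2 : 0 < 1 + t / 16 := by linarith
    rw [hG', ramp_of_mem (by linarith) (by linarith), hR, max_le_iff, max_lt_iff,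
      mul_le_mul_iff_right₀ p1, mul_lt_mul_iff_right₀ p1, mul_comm (1 - t / 16) (1 + t / 16),
      mul_le_mul_iff_right₀ p2, mul_lt_mul_iff_right₀ p2]
    exact ⟨Iff.rfl, Iff.rfl⟩
  · have hR0 : sliceRadius t ≤ 0 := by rw [← not_lt, sliceRadius_pos, not_lt]; exact h16
    have hne : ¬ (M + s < 1 + t / 16 ∧ M - s < 1 - t / 16) := by
      rintro ⟨h1, h2⟩
      rcases le_abs.1 h16 with h | h <;> linarith
    refine ⟨?_, iff_of_false hne (by linarith)⟩
    constructor
    · rintro ⟨h1, h2⟩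
      have hM1 : M = 0 := by rcases le_abs.1 h16 with h | h <;> linarith
      have hs0 : s = 0 := by linarith
      have ht16 : |t| ≤ 16 := abs_le.2 ⟨by linarith, by linarith⟩
      rw [hG', hM1, hs0]
      simpa using sliceRadius_nonneg.2 ht16
    · intro h
      have hM1 : M = 0 := by linarith
      have hs0 : s = 0 := by linarith
      have := abs_le.1 (sliceRadius_nonneg.1 (show 0 ≤ sliceRadius t by linarith))
      constructor <;> linarith

/-- The distance from the branch line to the centres of the slices. -/
noncomputable def offset (t : ℝ) : ℝ := sliceGauge t (axisC t)

theorem axisC_of_ge {t : ℝ} (h : 16 ≤ |t|) : axisC t = 0 := by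
  have : axisX t = 0 ∧ axisY t = 0 := by
    rcases le_abs.1 h with h | h
    · have h1 := axis_piece₀ (t := -t) (by linarith)
      rw [axisX_neg, axisY_neg, neg_eq_zero, neg_eq_zero] at h1
      exact h1
    · exact axis_piece₀ (by linarith)
  exact Complex.ext (by rw [axisC_re, this.1]; rfl) (by rw [axisC_im, this.2]; rfl)

/-- Comparing the gauge of the line with `R(t)` tells whether the line is inside, on or outside the
octahedron, so the conditions are those already computed for `norm1 (axisPt t)`. -/
theorem isOffset_offset : IsOffset offset := by
  have key := fun t => norm1_iff_sliceGauge (axisPt t)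
  have hh : ∀ t, height (axisPt t) = t := fun t => congrArg Prod.fst (straighten_axisPt t)
  have hz : ∀ t, (straighten (axisPt t)).2 = 0 := fun t => congrArg Prod.snd (straighten_axisPt t)
  simp only [hh, hz, zero_add] at key
  refine ⟨isGauge_sliceGauge.continuous.comp (continuous_id.prodMk continuous_axisC), fun t => ?_,
    fun t => ?_, fun t => ?_, fun t ht => ?_⟩
  · exact le_trans (by positivity) (sliceGauge_lower t (axisC t))
  · rw [offset, ← (key t).2, norm1_axisPt_lt_one]
  · rw [offset, eq_iff_le_not_lt, ← (key t).1, ← (key t).2, ← eq_iff_le_not_lt, norm1_axisPt_eq_one]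
  · rw [offset, axisC_of_ge ht, isGauge_sliceGauge.zero]

/-- The gauges of a family of discs that contain the origin. -/
theorem exists_discGauge {X : Type*} [TopologicalSpace X] {c : X → ℂ} {R : X → ℝ}
    (hc : Continuous c) (hR : Continuous R) {m : ℝ} (hm : 0 < m) (hmR : ∀ x, m ≤ R x ^ 2 - ‖c x‖ ^ 2)
    (hR0 : ∀ x, 0 ≤ R x) (hR1 : ∀ x, R x ≤ 1) : ∃ G : X → ℂ → ℝ, IsGauge G ∧
      (∀ x w, G x w ≤ 1 ↔ ‖w - c x‖ ≤ R x) ∧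
      G = fun x w => (√((R x ^ 2 - ‖c x‖ ^ 2) * ‖w‖ ^ 2 + inner ℝ (c x) w ^ 2) - inner ℝ (c x) w) /
        (R x ^ 2 - ‖c x‖ ^ 2) := by
  have hδ : ∀ x, 0 < R x ^ 2 - ‖c x‖ ^ 2 := fun x => hm.trans_le (hmR x)
  have hin : ∀ x w, |inner ℝ (c x) w| ≤ ‖w‖ := fun x w => by
    refine (abs_real_inner_le_norm _ _).trans ?_
    have h1 := hδ x
    have h2 : ‖c x‖ ≤ 1 := by
      have := hR0 x; have := hR1 x
      nlinarith [norm_nonneg (c x)]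
    nlinarith [norm_nonneg w]
  -- The gauge is the nonnegative root `λ` of `‖w - λ c‖ = λ R`, that is of `δ λ² + 2 ⟨c, w⟩ λ =
  -- ‖w‖²` with `δ = R² - ‖c‖²`.
  refine ⟨_, ⟨?_, fun x r w hr => ?_, ⟨1 / 3, by norm_num, fun x w => ?_⟩, ⟨3 / m, fun x w => ?_⟩⟩,
    fun x w => ?_, rfl⟩
  · refine Continuous.div ?_ ?_ fun p => (hδ p.1).ne'
    · fun_prop
    · fun_prop
  · simp only [inner_smul_right, norm_smul, Real.norm_of_nonneg hr]
    rw [show (R x ^ 2 - ‖c x‖ ^ 2) * (r * ‖w‖) ^ 2 + (r * inner ℝ (c x) w) ^ 2 =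
      r ^ 2 * ((R x ^ 2 - ‖c x‖ ^ 2) * ‖w‖ ^ 2 + inner ℝ (c x) w ^ 2) by ring,
      Real.sqrt_mul (sq_nonneg r), Real.sqrt_sq hr]
    ring
  · have h1 := hδ x
    have h2 := hin x w
    have h3 := norm_nonneg w
    have h4 : R x ^ 2 - ‖c x‖ ^ 2 ≤ 1 := by
      have := hR0 x; have := hR1 x; nlinarith [norm_nonneg (c x)]
    set δ := R x ^ 2 - ‖c x‖ ^ 2
    set p := inner ℝ (c x) w
    have h5 := abs_le.1 h2
    rw [le_div_iff₀ h1, le_sub_iff_add_le]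
    refine Real.le_sqrt_of_sq_le ?_
    nlinarith [mul_nonneg h1.le h3, mul_nonneg (sub_nonneg.2 h4) (mul_nonneg h1.le (sq_nonneg ‖w‖)),
      mul_nonneg (mul_nonneg h1.le h3) (sub_nonneg.2 h5.2)]
  · have h1 := hδ x
    have h2 := hin x w
    have h3 := norm_nonneg w
    have h4 : R x ^ 2 - ‖c x‖ ^ 2 ≤ 1 := by
      have := hR0 x; have := hR1 x; nlinarith [norm_nonneg (c x)]
    have h6 := hmR x
    set δ := R x ^ 2 - ‖c x‖ ^ 2
    set p := inner ℝ (c x) w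
    have h5 := abs_le.1 h2
    have h7 : √(δ * ‖w‖ ^ 2 + p ^ 2) ≤ 2 * ‖w‖ := by
      rw [Real.sqrt_le_left (by positivity)]
      nlinarith [sq_nonneg ‖w‖]
    calc (√(δ * ‖w‖ ^ 2 + p ^ 2) - p) / δ ≤ (3 * ‖w‖) / δ := by gcongr; linarith
      _ ≤ (3 * ‖w‖) / m := by gcongr
      _ = 3 / m * ‖w‖ := by ring
  · have h1 := hδ x
    have h8 : ‖w - c x‖ ^ 2 = ‖w‖ ^ 2 - 2 * inner ℝ (c x) w + ‖c x‖ ^ 2 := by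
      rw [norm_sub_sq_real, real_inner_comm]
    rw [div_le_one h1, sub_le_iff_le_add, Real.sqrt_le_iff, ← sq_le_sq₀ (norm_nonneg _) (hR0 x), h8]
    have e : R x ^ 2 - ‖c x‖ ^ 2 + ‖c x‖ ^ 2 = R x ^ 2 := by ring
    rw [← e]
    set δ := R x ^ 2 - ‖c x‖ ^ 2
    set p := inner ℝ (c x) w
    constructor
    · rintro ⟨h2, h3⟩
      have : δ * ‖w‖ ^ 2 ≤ δ * (δ + 2 * p) := by nlinarith
      have := le_of_mul_le_mul_left this h1
      linarith
    · intro h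
      have h9 : ‖w‖ ^ 2 ≤ δ + 2 * p := by linarith
      exact ⟨by nlinarith [sq_nonneg ‖w‖], by nlinarith [mul_le_mul_of_nonneg_left h9 h1.le]⟩


/-! ### The slices become discs centred on the real axis -/

theorem axisC_neg (t : ℝ) : axisC (-t) = - axisC t :=
  Complex.ext (by rw [Complex.neg_re, axisC_re, axisC_re, axisX_neg])
    (by rw [Complex.neg_im, axisC_im, axisC_im, axisY_neg])

theorem axisC_ne_zero {t : ℝ} (h : 3 / 2 ≤ t) (h' : t ≤ 15) : axisC t ≠ 0 := by
  intro h0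
  have h1 : axisX (-t) = 0 := by rw [axisX_neg, ← axisC_re, h0]; simp
  have h2 : axisY (-t) = 0 := by rw [axisY_neg, ← axisC_im, h0]; simp
  rcases le_total (-t) (-(32 / 3)) with h3 | h3
  · have := axis_piece₁ (t := -t) (by linarith) h3
    linarith [this.1]
  rcases le_total (-t) (-8) with h4 | h4
  · have := axis_piece₂ h3 h4
    linarith [this.1]
  rcases le_total (-t) (-6) with h5 | h5
  · have := axis_piece₃ h4 h5
    linarith [this.1]
  rcases le_total (-t) (-3) with h6 | h6
  · have := axis_piece₄ h5 h6
    linarith [this.2]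
  · have := axis_piece₅ h6 (by linarith)
    linarith [this.2]

/-- The rotation that makes the centres of the slices real and nonnegative. -/
noncomputable def turn (t : ℝ) : ℂ :=
  Complex.exp ((-(Real.pi / 3 * ramp (-(3 / 2)) (3 / 2) t) : ℝ) * Complex.I) *
    (-Complex.I * (starRingEnd ℂ) (axisC (ramp (3 / 2) 15 |t|)) / ‖axisC (ramp (3 / 2) 15 |t|)‖)

theorem axisC_ramp_ne_zero (t : ℝ) : axisC (ramp (3 / 2) 15 |t|) ≠ 0 :=
  axisC_ne_zero (le_max_left _ _) (max_le (by norm_num) (min_le_left _ _))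

theorem continuous_turn : Continuous turn := by
  have h := continuous_ramp
  have h1 : Continuous fun t : ℝ => axisC (ramp (3 / 2) 15 |t|) := continuous_axisC.comp (by fun_prop)
  have h2 : Continuous fun t : ℝ => (‖axisC (ramp (3 / 2) 15 |t|)‖ : ℂ) :=
    Complex.continuous_ofReal.comp h1.norm
  refine Continuous.mul ?_ ((continuous_const.mul (Complex.continuous_conj.comp h1)).div h2 fun t => ?_)
  · exact Complex.continuous_exp.comp ((Complex.continuous_ofReal.comp (by fun_prop)).mul continuous_const)
  · simpa using axisC_ramp_ne_zero t

theorem norm_turn (t : ℝ) : ‖turn t‖ = 1 := by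
  have h := norm_ne_zero_iff.2 (axisC_ramp_ne_zero t)
  rw [turn, norm_mul, Complex.norm_exp_ofReal_mul_I, one_mul, norm_div, norm_mul, norm_neg,
    Complex.norm_I, one_mul, RCLike.norm_conj, Complex.norm_real, norm_norm, div_self h]

/-- The conjugate factor removes the phase of the line at `|t|`. The line changes sign with `t`,
which is compensated by the exponential factor turning from `i` to `-i` across `|t| ≤ 3/2`. Beyond
`15` the direction is constant, so freezing it there avoids the zero at `16`. -/
theorem turn_mul_axisC {t : ℝ} (h : 3 / 2 ≤ |t|) : turn t * -axisC t = ‖axisC t‖ := by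
  have hpos : ∀ t : ℝ, 3 / 2 ≤ t → -Complex.I * (starRingEnd ℂ) (axisC (ramp (3 / 2) 15 t)) /
      ‖axisC (ramp (3 / 2) 15 t)‖ * axisC t = -Complex.I * ‖axisC t‖ := by
    intro t ht
    rcases le_total t 15 with h15 | h15
    · rw [ramp_of_mem ht h15]
      have h0 := axisC_ne_zero ht h15
      have h1 : (‖axisC t‖ : ℂ) ≠ 0 := by simpa using h0
      have h2 : (starRingEnd ℂ) (axisC t) * axisC t = (‖axisC t‖ : ℂ) ^ 2 := by
        rw [mul_comm, Complex.mul_conj']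
      field_simp
      linear_combination (-1 : ℂ) * h2
    · rw [ramp_of_ge (by norm_num) h15]
      rcases le_total 16 t with h16 | h16
      · rw [axisC_of_ge (le_abs.2 (Or.inl h16))]; simp
      · have e : ∀ t : ℝ, 15 ≤ t → t ≤ 16 → axisC t = ((1 - t / 16 : ℝ) : ℂ) := by
          intro t h1 h2
          obtain ⟨e1, e2⟩ := axis_piece₁ (t := -t) (by linarith) (by linarith)
          rw [axisX_neg] at e1
          rw [axisY_neg] at e2
          apply Complex.ext
          · rw [axisC_re, Complex.ofReal_re]; linarith
          · rw [axisC_im, Complex.ofReal_im]; linarith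
        rw [e 15 le_rfl (by norm_num), e t h15 h16, Complex.conj_ofReal, Complex.norm_real,
          Complex.norm_real, Real.norm_of_nonneg (by norm_num), Real.norm_of_nonneg (by linarith)]
        have : ((1 - 15 / 16 : ℝ) : ℂ) ≠ 0 := by norm_num
        rw [mul_div_assoc, div_self this, mul_one]
  rcases le_abs.1 h with h | h
  · rw [turn, abs_of_nonneg (by linarith), ramp_of_ge (by norm_num) h]
    have e : Complex.exp ((-(Real.pi / 3 * (3 / 2)) : ℝ) * Complex.I) = -Complex.I := by
      rw [show ((-(Real.pi / 3 * (3 / 2)) : ℝ) : ℂ) * Complex.I = -(Real.pi / 2 * Complex.I) by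
        push_cast; ring, Complex.exp_neg, Complex.exp_pi_div_two_mul_I, Complex.inv_I]
    rw [e, mul_assoc, mul_neg, hpos t h]
    linear_combination (-(‖axisC t‖ : ℂ)) * Complex.I_mul_I
  · rw [turn, abs_of_nonpos (by linarith), ramp_of_le (by linarith)]
    have e : Complex.exp ((-(Real.pi / 3 * -(3 / 2)) : ℝ) * Complex.I) = Complex.I := by
      rw [show ((-(Real.pi / 3 * -(3 / 2)) : ℝ) : ℂ) * Complex.I = (Real.pi / 2 * Complex.I) by
        push_cast; ring, Complex.exp_pi_div_two_mul_I]
    rw [e, mul_assoc, ← axisC_neg, hpos (-t) h, axisC_neg, norm_neg]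
    linear_combination (-(‖axisC t‖ : ℂ)) * Complex.I_mul_I

theorem offset_lt_of_abs_le {t : ℝ} (h : |t| ≤ 3 / 2) :
    1 / 4 ≤ sliceRadius t ^ 2 - offset t ^ 2 ∧ 0 ≤ sliceRadius t ∧ sliceRadius t ≤ 1 := by
  obtain ⟨e1, e2⟩ := axis_piece₅ (t := t) (by linarith [(abs_le.1 h).1]) (by linarith [(abs_le.1 h).2])
  have h1 := abs_le.1 h
  have ht : (t / 16) ^ 2 ≤ 1 / 100 := by nlinarith
  have hR : 99 / 100 ≤ sliceRadius t := by rw [sliceRadius]; linarith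
  refine ⟨?_, by linarith, by rw [sliceRadius]; nlinarith [sq_nonneg (t / 16)]⟩
  have h0 : 0 ≤ offset t := isOffset_offset.nonneg t
  have hO : offset t ≤ 7 / 10 := by
    have ha : |(-t / 3)| ≤ 1 / 2 := by
      rw [abs_div, abs_neg]; norm_num; linarith
    rw [offset, sliceGauge, axisC_re, axisC_im, e1, e2, ramp_of_mem (by linarith) (by linarith),
      abs_zero]
    refine max_le ?_ ?_ <;> nlinarith
  nlinarith

/-- A fibrewise homeomorphism that takes the slices of the octahedron to discs centred on the
nonnegative real axis, and the branch line to itself. -/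
theorem exists_sliceHomeo : ∃ h : ℝ × ℂ ≃ₜ ℝ × ℂ, (∀ p, (h p).1 = p.1) ∧ (∀ t, h (t, 0) = (t, 0)) ∧
    (∀ p, ‖(h p).2 - offset p.1‖ ≤ sliceRadius p.1 ↔
      sliceGauge p.1 (p.2 + axisC p.1) ≤ sliceRadius p.1) ∧
    ∃ ω : ℂ, ω ≠ 0 ∧ ∀ w : ℂ, w ≠ 0 → (h (16, w)).2 / (ω * w) ∈ Complex.slitPlane := by
  have hnorm : IsGauge fun (_ : ℝ) (w : ℂ) => ‖w‖ :=
    ⟨by fun_prop, fun _ r w hr => by rw [norm_smul, Real.norm_of_nonneg hr],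
      ⟨1, one_pos, fun _ w => (one_mul _).le⟩, ⟨1, fun _ w => (one_mul _).ge⟩⟩
  -- The slices become round discs centred at `0`, with the line at `a t`. Moving the line to `0`
  -- and applying `turn` puts the centres at `c t`, which is real and nonnegative for `|t| ≥ 3/2`.
  obtain ⟨e₁, h₁, h₁'⟩ := exists_rescale isGauge_sliceGauge hnorm
  set a : ℝ → ℂ := fun t => (sliceGauge t (axisC t) / ‖axisC t‖) • axisC t with ha
  have hae : ∀ t, e₁ (t, axisC t) = (t, a t) := fun t => h₁ _
  have hac : Continuous a := by
    have : Continuous fun t => (e₁ (t, axisC t)).2 :=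
      continuous_snd.comp (e₁.continuous.comp (continuous_id.prodMk continuous_axisC))
    simpa only [hae] using this
  have han : ∀ t, ‖a t‖ = offset t := fun t => by
    have := h₁' (t, axisC t)
    rwa [hae] at this
  set c : ℝ → ℂ := fun t => turn t * -a t with hcdef
  have hcc : Continuous c := continuous_turn.mul hac.neg
  have hcn : ∀ t, ‖c t‖ = offset t := fun t => by
    rw [hcdef]; simp only [norm_mul, norm_turn, norm_neg, han, one_mul]
  have hcr : ∀ t : ℝ, 3 / 2 ≤ |t| → c t = offset t := fun t ht => by
    rw [hcdef]
    simp only [ha, Complex.real_smul]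
    rw [show turn t * -(((sliceGauge t (axisC t) / ‖axisC t‖ : ℝ) : ℂ) * axisC t) =
      ((sliceGauge t (axisC t) / ‖axisC t‖ : ℝ) : ℂ) * (turn t * -axisC t) by ring,
      turn_mul_axisC ht, ← Complex.ofReal_mul]
    by_cases h0 : axisC t = 0
    · rw [offset, h0, isGauge_sliceGauge.zero]; simp
    · rw [div_mul_cancel₀ _ (norm_ne_zero_iff.2 h0), offset]
  -- For `|t| ≤ 3/2` the origin is well inside the disc, so a radial rescaling between disc gauges
  -- moves the centre to the real axis while fixing `0`. Clamping extends it by the identity, since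
  -- at `±3/2` the two centres agree.
  let clamp : ℝ → ℝ := ramp (-(3 / 2)) (3 / 2)
  have hcl : Continuous clamp := continuous_ramp _ _
  have hcl' : ∀ t, |clamp t| ≤ 3 / 2 := fun t =>
    abs_le.2 ⟨le_max_left _ _, max_le (by norm_num) (min_le_left _ _)⟩
  have cO := isOffset_offset.continuous
  have hO0 := isOffset_offset.nonneg
  obtain ⟨G, hG, hG1, hGe⟩ := exists_discGauge (c := fun t => c (clamp t))
    (R := fun t => sliceRadius (clamp t)) (by fun_prop) (by fun_prop) (by norm_num : (0 : ℝ) < 1 / 4)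
    (fun t => by rw [hcn]; exact (offset_lt_of_abs_le (hcl' t)).1)
    (fun t => (offset_lt_of_abs_le (hcl' t)).2.1) (fun t => (offset_lt_of_abs_le (hcl' t)).2.2)
  have hOn : ∀ t, ‖(offset t : ℂ)‖ = offset t := fun t => by
    rw [Complex.norm_real, Real.norm_of_nonneg (hO0 t)]
  obtain ⟨G', hG', hG1', hGe'⟩ := exists_discGauge (c := fun t => (offset (clamp t) : ℂ))
    (R := fun t => sliceRadius (clamp t)) (by fun_prop) (by fun_prop) (by norm_num : (0 : ℝ) < 1 / 4)
    (fun t => by rw [hOn]; exact (offset_lt_of_abs_le (hcl' t)).1)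
    (fun t => (offset_lt_of_abs_le (hcl' t)).2.1) (fun t => (offset_lt_of_abs_le (hcl' t)).2.2)
  obtain ⟨e₂, h₂, h₂'⟩ := exists_rescale hG hG'
  have hid : ∀ p : ℝ × ℂ, 3 / 2 ≤ |p.1| → e₂ p = p := fun p hp => by
    have hc' : c (clamp p.1) = offset (clamp p.1) := by
      apply hcr
      rcases le_abs.1 hp with h | h
      · rw [show clamp p.1 = 3 / 2 from ramp_of_ge (by norm_num) h]; norm_num
      · rw [show clamp p.1 = -(3 / 2) from ramp_of_le (by linarith)]; norm_num
    have hGG : G p.1 p.2 = G' p.1 p.2 := by simp only [hGe, hGe', hc']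
    rw [h₂]
    refine Prod.ext rfl ?_
    by_cases h0 : p.2 = 0
    · simp [h0]
    · simp only
      rw [hGG, div_self (hG'.pos _ h0).ne', one_smul]
  have hdisc : ∀ p : ℝ × ℂ, ‖(e₂ p).2 - offset p.1‖ ≤ sliceRadius p.1 ↔
      ‖p.2 - c p.1‖ ≤ sliceRadius p.1 := fun p => by
    rcases le_total (3 / 2) |p.1| with h | h
    · rw [hid p h, hcr _ h]
    · have : clamp p.1 = p.1 := ramp_of_mem (abs_le.1 h).1 (abs_le.1 h).2
      have h3 := hG1 p.1 p.2
      have h4 := hG1' p.1 (e₂ p).2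
      simp only [this] at h3 h4
      rw [← h3, ← h4, h₂']
  have hshift : ∀ f : ℝ → ℂ, Continuous f → ∃ e : ℝ × ℂ ≃ₜ ℝ × ℂ, ∀ p, e p = (p.1, p.2 + f p.1) :=
    fun f hf => ⟨{ toFun := fun p => (p.1, p.2 + f p.1)
                   invFun := fun p => (p.1, p.2 - f p.1)
                   left_inv := fun p => by simp
                   right_inv := fun p => by simp
                   continuous_toFun := by fun_prop
                   continuous_invFun := by fun_prop }, fun p => rfl⟩
  have hturn0 : ∀ t, turn t ≠ 0 := fun t => by rw [← norm_ne_zero_iff, norm_turn]; exact one_ne_zero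
  have hrot : ∃ e : ℝ × ℂ ≃ₜ ℝ × ℂ, ∀ p, e p = (p.1, turn p.1 * p.2) := by
    have h1 := continuous_turn
    have h2 : Continuous fun t => (turn t)⁻¹ := h1.inv₀ hturn0
    exact ⟨{ toFun := fun p => (p.1, turn p.1 * p.2)
             invFun := fun p => (p.1, (turn p.1)⁻¹ * p.2)
             left_inv := fun p => by simp [hturn0]
             right_inv := fun p => by simp [hturn0]
             continuous_toFun := by fun_prop
             continuous_invFun :=
              continuous_fst.prodMk ((h2.comp continuous_fst).mul continuous_snd) }, fun p => rfl⟩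
  obtain ⟨s₁, hs₁⟩ := hshift axisC continuous_axisC
  obtain ⟨s₂, hs₂⟩ := hshift (fun t => -a t) hac.neg
  obtain ⟨r, hr⟩ := hrot
  have h₁f : ∀ p, (e₁ p).1 = p.1 := fun p => by rw [h₁]
  have h₂f : ∀ p, (e₂ p).1 = p.1 := fun p => by rw [h₂]
  have hval : ∀ p, ((s₁.trans e₁).trans (s₂.trans (r.trans e₂))) p =
      e₂ (p.1, turn p.1 * ((e₁ (p.1, p.2 + axisC p.1)).2 + -a p.1)) := fun p => by
    change e₂ (r (s₂ (e₁ (s₁ p)))) = _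
    rw [hs₁, hs₂, hr, h₁f]
  refine ⟨(s₁.trans e₁).trans (s₂.trans (r.trans e₂)), fun p => ?_, fun t => ?_, fun p => ?_,
    turn 16, hturn0 _, fun w hw => ?_⟩
  · rw [hval, h₂f]
  · rw [hval]
    simp only [zero_add, hae, add_neg_cancel, mul_zero]
    rw [h₂]; simp
  · rw [hval]
    have h3 := hdisc (p.1, turn p.1 * ((e₁ (p.1, p.2 + axisC p.1)).2 + -a p.1))
    simp only at h3
    rw [h3, hcdef]
    simp only
    rw [← mul_sub, norm_mul, norm_turn, one_mul, add_sub_cancel_right]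
    have h4 := h₁' (p.1, p.2 + axisC p.1)
    simp only at h4
    rw [h4]
  · rw [hval, hid _ (by norm_num)]
    -- At `t = 16` no translation takes place, so up to the rotation `turn 16` the map multiplies
    -- `w` by a positive number: the base slice needed for the logarithm.
    have h16 : axisC 16 = 0 := axisC_of_ge (by norm_num)
    simp only [h16, add_zero, h₁, ha, neg_zero, Complex.real_smul, mul_zero]
    rw [show turn 16 * (((sliceGauge 16 w / ‖w‖ : ℝ) : ℂ) * w) / (turn 16 * w) =
      ((sliceGauge 16 w / ‖w‖ : ℝ) : ℂ) by
        have := hturn0 16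
        field_simp]
    exact Complex.ofReal_mem_slitPlane.2 (div_pos (isGauge_sliceGauge.pos _ hw) (norm_pos_iff.2 hw))

/-! ### The surface is standard -/

theorem frontier_solid : frontier {p : ℝ × ℂ | norm1 (proj p) ≤ 1} = surf := by
  have ho : IsOpenMap proj := straighten.symm.isOpenMap.comp isOpenQuotientMap_dbl.isOpenMap
  have hf : frontier {v : ℝ × ℝ × ℝ | norm1 v ≤ 1} = {v | norm1 v = 1} := by
    refine subset_antisymm (frontier_le_subset_eq continuous_norm1 continuous_const) fun v hv => ?_
    replace hv : norm1 v = 1 := hv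
    rw [frontier_eq_closure_inter_closure]
    refine ⟨subset_closure hv.le, ?_⟩
    have hlim : Filter.Tendsto (fun s : ℝ => s • v) (𝓝[>] 1) (𝓝 v) := by
      have : Continuous fun s : ℝ => s • v := by fun_prop
      simpa using (this.tendsto 1).mono_left (nhdsWithin_le_nhds (s := Set.Ioi 1))
    refine mem_closure_of_tendsto hlim ?_
    filter_upwards [self_mem_nhdsWithin] with s hs
    replace hs : 1 < s := hs
    rw [Set.mem_compl_iff, Set.mem_ofPred_eq, norm1_smul, hv, abs_of_pos (by linarith)]
    linarith
  have := ho.preimage_frontier_eq_frontier_preimage continuous_proj {v : ℝ × ℝ × ℝ | norm1 v ≤ 1}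
  rw [hf] at this
  exact this.symm

/-- The fibrewise homeomorphism to discs preserves the axis and hence lifts to the double cover.
There the solid octahedron becomes `|w² - ρ(t)| ≤ R(t)`, the normal form of the handlebody, and
frontiers correspond. -/
theorem exists_homeomorph_standard :
    ∃ Θ : ℝ × ℂ ≃ₜ EuclideanSpace ℝ (Fin 3), Θ '' surf = stdGenusTwoSurface := by
  obtain ⟨e, he⟩ := exists_handlebody_normalForm isOffset_offset
  obtain ⟨h, h1, h2, h3, ω, hω, h4⟩ := exists_sliceHomeo
  have hax : ∀ p, (h p).2 = 0 ↔ p.2 = 0 := fun p => by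
    constructor
    · intro h0
      have : h p = h (p.1, 0) := by rw [h2]; exact Prod.ext (h1 p) h0
      exact congrArg Prod.snd (h.injective this)
    · intro h0
      rw [show p = (p.1, 0) from Prod.ext rfl h0, h2]
  obtain ⟨k, hk, -⟩ := exists_isLogOf h hax 16 hω h4
  have hL : ∀ p, dbl (hk.lift p) = h (dbl p) := hk.dbl_liftMap
  have key : ∀ p, (hk.lift.trans e.symm) p ∈ stdGenusTwoHandlebody ↔ norm1 (proj p) ≤ 1 := by
    intro p
    rw [he]
    have h5 : e ((hk.lift.trans e.symm) p) = hk.lift p := e.apply_symm_apply _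
    have h6 : (hk.lift p).1 = (dbl p).1 := by rw [← h1 (dbl p), ← hL]; rfl
    have h7 : (hk.lift p).2 ^ 2 = (h (dbl p)).2 := by rw [← hL]; rfl
    have h8 := straighten_proj p
    have h9 : height (proj p) = (dbl p).1 := by rw [← straighten_fst, h8]
    rw [h5, h6, h7, h3, (norm1_iff_sliceGauge _).1, h9, h8]
  refine ⟨hk.lift.trans e.symm, ?_⟩
  rw [← frontier_solid, Homeomorph.image_frontier, stdGenusTwoSurface]
  congr 1
  ext x
  constructor
  · rintro ⟨p, hp, rfl⟩
    exact (key p).2 hp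
  · intro hx
    refine ⟨(hk.lift.trans e.symm).symm x, ?_, Homeomorph.apply_symm_apply _ _⟩
    rw [Set.mem_ofPred_eq, ← key, Homeomorph.apply_symm_apply]
    exact hx


/-! ### The standard surface is compressible -/

open unitInterval in
-- A winding number argument: homotopic loops in `ℂ ∖ 0` have lifts through `exp` with the same
-- endpoint, whereas the lift of a constant loop is constant.
theorem not_homotopic_refl_of_log {X : Type*} [TopologicalSpace X] (L : C(X, {z : ℂ // z ≠ 0}))
    {x : X} (γ : Path x x) (Γ : C(I, ℂ)) (h : ∀ t, (L (γ t) : ℂ) = Complex.exp (Γ t))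
    (hne : Γ 1 ≠ Γ 0) : ¬ γ.Homotopic (Path.refl x) := by
  intro hh
  have hmap := hh.map L
  have cov := Complex.isCoveringMap_exp
  have hL : ∀ t, L (γ t) = ⟨Complex.exp (Γ t), (Γ t).exp_ne_zero⟩ := fun t => Subtype.ext (h t)
  have h0 : L x = ⟨Complex.exp (Γ 0), (Γ 0).exp_ne_zero⟩ := by
    have := hL 0
    rwa [γ.source] at this
  have key := cov.liftPath_apply_one_eq_of_homotopicRel hmap (Γ 0)
    (by simpa using h0) (by simpa using h0)
  have h1 : Γ = cov.liftPath (γ.map L.continuous).toContinuousMap (Γ 0)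
      (by simpa using h0) := by
    rw [cov.eq_liftPath_iff']
    exact ⟨funext fun t => (hL t).symm, rfl⟩
  have h2 : ContinuousMap.const I (Γ 0) =
      cov.liftPath ((Path.refl x).map L.continuous).toContinuousMap (Γ 0)
      (by simpa using h0) := by
    rw [cov.eq_liftPath_iff']
    exact ⟨funext fun t => h0.symm, rfl⟩
  rw [← h1, ← h2] at key
  exact hne key

theorem solidFun_square {u v : ℝ} (hu : |u| ≤ 1 / 2) (hv : |v| ≤ 1 / 2)
    (h : |u| = 1 / 2 ∨ |v| = 1 / 2) : solidFun ((3 / 2 + u, 3 / 2 + v), 1 / 2) = 0 := by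
  rw [abs_le] at hu hv
  have h' : u = 1 / 2 ∨ u = -(1 / 2) ∨ v = 1 / 2 ∨ v = -(1 / 2) := by
    rcases h with h | h <;> rcases eq_or_eq_neg_of_abs_eq h with h | h <;> simp [h]
  obtain ⟨hu1, hu2⟩ := hu
  obtain ⟨hv1, hv2⟩ := hv
  have h1 : max (max (0 - (3 / 2 + u)) (3 / 2 + u - 5)) (max (0 - (3 / 2 + v)) (3 / 2 + v - 3)) < 0 := by
    simp only [max_lt_iff]; refine ⟨⟨?_, ?_⟩, ?_, ?_⟩ <;> linarith
  have h2 : min (min (3 / 2 + u - 3) (4 - (3 / 2 + u))) (min (3 / 2 + v - 1) (2 - (3 / 2 + v))) < 0 :=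
    ((min_le_left _ _).trans (min_le_left _ _)).trans_lt (by linarith)
  have h3 : min (min (3 / 2 + u - 1) (2 - (3 / 2 + u))) (min (3 / 2 + v - 1) (2 - (3 / 2 + v))) = 0 := by
    refine le_antisymm ?_ ?_
    · simp only [min_le_iff]
      rcases h' with h | h | h | h
      · exact Or.inl (Or.inr (by linarith))
      · exact Or.inl (Or.inl (by linarith))
      · exact Or.inr (Or.inr (by linarith))
      · exact Or.inr (Or.inl (by linarith))
    · simp only [le_min_iff]; refine ⟨⟨?_, ?_⟩, ?_, ?_⟩ <;> linarith
  simp only [solidFun, planarFun]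
  rw [h3, max_eq_left h2.le, max_eq_right h1.le, max_eq_left]
  norm_num

theorem solidFun_axis_pos (z : ℝ) : 0 < solidFun ((3 / 2, 3 / 2), z) := by
  refine lt_max_of_lt_left (lt_max_of_lt_right (lt_max_of_lt_left ?_))
  norm_num

/-- The position of a point of the surface relative to the vertical axis through the first hole. -/
noncomputable def holeCoord : C(stdGenusTwoSurface, {z : ℂ // z ≠ 0}) where
  toFun x := ⟨⟨x.1 0 - 3 / 2, x.1 1 - 3 / 2⟩, fun h => by
    have h0 : x.1 0 = 3 / 2 := by have := congrArg Complex.re h; simp at this; linarith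
    have h1 : x.1 1 = 3 / 2 := by have := congrArg Complex.im h; simp at this; linarith
    have := mem_stdGenusTwoSurface.1 x.2
    rw [coords_apply, h0, h1] at this
    exact (solidFun_axis_pos _).ne' this⟩
  continuous_toFun := by
    refine Continuous.subtype_mk ?_ _
    have : (fun x : stdGenusTwoSurface => (⟨x.1 0 - 3 / 2, x.1 1 - 3 / 2⟩ : ℂ)) =
        fun x => ((x.1 0 - 3 / 2 : ℝ) : ℂ) + ((x.1 1 - 3 / 2 : ℝ) : ℂ) * Complex.I := by
      funext x; exact (Complex.mk_eq_add_mul_I _ _)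
    rw [this]
    fun_prop

open unitInterval in
/-- A loop in the surface going around the first hole. -/
theorem exists_hole_loop : ∃ (x : stdGenusTwoSurface) (γ : Path x x) (Γ : C(I, ℂ)),
    (∀ t, (holeCoord (γ t) : ℂ) = Complex.exp (Γ t)) ∧ Γ 1 ≠ Γ 0 := by
  -- The unit circle is projected radially onto the boundary of the square hole at height `1/2`.
  -- Dividing by `2 * m t` only affects the real part of the logarithm, so the winding number is
  -- one.
  set c : ℝ → ℝ := fun t => Real.cos (2 * Real.pi * t) with hc
  set s : ℝ → ℝ := fun t => Real.sin (2 * Real.pi * t) with hs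
  set m : ℝ → ℝ := fun t => max |c t| |s t| with hm
  have hcs : ∀ t, c t ^ 2 + s t ^ 2 = 1 := fun t => by
    simp only [hc, hs]; exact Real.cos_sq_add_sin_sq _
  have hm0 : ∀ t, 0 < m t := fun t => by
    by_contra hle
    have h1 : |c t| ≤ 0 := (le_max_left _ _).trans (not_lt.1 hle)
    have h2 : |s t| ≤ 0 := (le_max_right _ _).trans (not_lt.1 hle)
    have h3 := hcs t
    rw [abs_nonpos_iff.1 h1, abs_nonpos_iff.1 h2] at h3
    norm_num at h3
  have cc : Continuous c := by fun_prop
  have cs : Continuous s := by fun_prop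
  have cm : Continuous m := cc.abs.max cs.abs
  have c2m : ∀ t, 2 * m t ≠ 0 := fun t => by have := hm0 t; positivity
  have hab : ∀ a t, |a / (2 * m t)| = |a| / m t / 2 := fun a t => by
    rw [abs_div, abs_of_pos (by have := hm0 t; positivity : 0 < 2 * m t)]
    have := (hm0 t).ne'
    field_simp
  have hmem : ∀ t, coords.symm ((3 / 2 + c t / (2 * m t), 3 / 2 + s t / (2 * m t)), 1 / 2) ∈
      stdGenusTwoSurface := fun t => by
    rw [mem_stdGenusTwoSurface, coords.apply_symm_apply]
    have h1 : |c t| / m t ≤ 1 := (div_le_one (hm0 t)).2 (le_max_left _ _)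
    have h2 : |s t| / m t ≤ 1 := (div_le_one (hm0 t)).2 (le_max_right _ _)
    refine solidFun_square ?_ ?_ ?_
    · rw [hab]; linarith
    · rw [hab]; linarith
    · rw [hab, hab]
      rcases max_choice |c t| |s t| with h | h
      · left; rw [show |c t| = m t from h.symm, div_self (hm0 t).ne']
      · right; rw [show |s t| = m t from h.symm, div_self (hm0 t).ne']
  set g : ℝ → stdGenusTwoSurface := fun t => ⟨_, hmem t⟩ with hg
  have cg : Continuous g := by
    refine Continuous.subtype_mk (coords.symm.continuous.comp ?_) _
    exact ((continuous_const.add (cc.div (continuous_const.mul cm) c2m)).prodMk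
      (continuous_const.add (cs.div (continuous_const.mul cm) c2m))).prodMk continuous_const
  have hc01 : c 1 = c 0 := by simp [hc]
  have hs01 : s 1 = s 0 := by simp [hs]
  have hg01 : g 1 = g 0 := by
    have hm01 : m 1 = m 0 := by simp only [hm, hc01, hs01]
    apply Subtype.ext
    simp only [hg, hc01, hs01, hm01]
  refine ⟨g 0, ⟨⟨fun t => g t, cg.comp continuous_subtype_val⟩, rfl, hg01⟩,
    ⟨fun t => ((-Real.log (2 * m t) : ℝ) : ℂ) + ((2 * Real.pi * t : ℝ) : ℂ) * Complex.I, ?_⟩,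
    fun t => ?_, fun h => ?_⟩
  · have : Continuous fun t => Real.log (2 * m t) := (continuous_const.mul cm).log c2m
    have : Continuous fun t : I => Real.log (2 * m t) := this.comp continuous_subtype_val
    fun_prop
  · have h2 : ∀ q : (ℝ × ℝ) × ℝ, (coords.symm q) 0 = q.1.1 ∧ (coords.symm q) 1 = q.1.2 := fun q => by
      have := coords.apply_symm_apply q
      rw [coords_apply] at this
      exact ⟨congrArg (fun v => v.1.1) this, congrArg (fun v => v.1.2) this⟩
    change (⟨(g t).1 0 - 3 / 2, (g t).1 1 - 3 / 2⟩ : ℂ) =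
      Complex.exp (((-Real.log (2 * m t) : ℝ) : ℂ) + ((2 * Real.pi * t : ℝ) : ℂ) * Complex.I)
    simp only [hg, (h2 _).1, (h2 _).2]
    rw [Complex.exp_add, Complex.exp_mul_I, ← Complex.ofReal_exp, ← Complex.ofReal_cos,
      ← Complex.ofReal_sin, Real.exp_neg, Real.exp_log (by have := hm0 t; positivity)]
    have h3 : Real.cos (2 * Real.pi * t) = c t := rfl
    have h4 : Real.sin (2 * Real.pi * t) = s t := rfl
    rw [h3, h4]
    apply Complex.ext <;> simp <;> ring
  · have := congrArg Complex.im h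
    simp [Real.pi_ne_zero] at this

/-- The loop around the hole is essential in the surface by its winding number, and null-homotopic
in the image of `ℝ³`, which is simply connected. -/
theorem not_isPiOneInjective_image {M : Type*} [TopologicalSpace M]
    {e : EuclideanSpace ℝ (Fin 3) → M} (he : Topology.IsEmbedding e) :
    ¬ IsPiOneInjective (e '' stdGenusTwoSurface) := by
  obtain ⟨x, γ, Γ, h, hne⟩ := exists_hole_loop
  intro hinj
  set j := he.homeomorphImage stdGenusTwoSurface with hj
  refine not_homotopic_refl_of_log (holeCoord.comp (j.symm : C(_, _))) (γ.map j.continuous) Γ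
    (fun t => ?_) hne ?_
  · rw [← h t]
    exact congrArg (fun y => (holeCoord y : ℂ)) (j.symm_apply_apply (γ t))
  · have h1 : (γ.map continuous_subtype_val).Homotopic (Path.refl (x : EuclideanSpace ℝ (Fin 3))) :=
      SimplyConnectedSpace.paths_homotopic _ _
    have h2 := h1.map ⟨e, he.continuous⟩
    have h3 : FundamentalGroup.map (⟨Subtype.val, continuous_subtype_val⟩ :
        C(e '' stdGenusTwoSurface, M)) (j x)
          (FundamentalGroup.fromPath (Path.Homotopic.Quotient.mk (γ.map j.continuous))) =
        FundamentalGroup.map (⟨Subtype.val, continuous_subtype_val⟩ :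
        C(e '' stdGenusTwoSurface, M)) (j x)
          (FundamentalGroup.fromPath (Path.Homotopic.Quotient.mk (Path.refl (j x)))) :=
      Path.Homotopic.Quotient.eq.2 h2
    exact Path.Homotopic.Quotient.exact (hinj (j x) h3)

/-! ### Transport along open embeddings -/

theorem isTwoSided_image {X M : Type*} [TopologicalSpace X] [TopologicalSpace M] {e : X → M}
    (he : Topology.IsOpenEmbedding e) {Sg : Set X} (h : IsTwoSided Sg) : IsTwoSided (e '' Sg) := by
  obtain ⟨c, hc, hc0⟩ := h
  set j := he.isEmbedding.homeomorphImage Sg with hj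
  refine ⟨fun p => e (c (j.symm p.1, p.2)),
    he.comp (hc.comp (j.symm.prodCongr (Homeomorph.refl ℝ)).isOpenEmbedding), fun x => ?_⟩
  change e (c (j.symm x, 0)) = x
  rw [hc0]
  exact congrArg Subtype.val (j.apply_symm_apply x)

open Classical in
-- The range of `e` and the complement of `e '' K` form an open cover, the second because compact
-- sets in a Hausdorff space are closed. On the first the map is a conjugate of `f`, on the second
-- the identity.
theorem continuous_extendDomain {X M : Type*} [TopologicalSpace X] [TopologicalSpace M] [T2Space M]
    {e : X → M} (he : Topology.IsOpenEmbedding e) {K : Set X} (hK : IsCompact K)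
    (f : Equiv.Perm X) (hf : Continuous f) (hfK : ∀ x ∉ K, f x = x) :
    Continuous (f.extendDomain (Equiv.ofInjective e he.injective)) := by
  set F := f.extendDomain (Equiv.ofInjective e he.injective) with hF
  have h1 : ∀ x, F (e x) = e (f x) := fun x =>
    f.extendDomain_apply_image (Equiv.ofInjective e he.injective) x
  have h2 : ∀ y ∉ e '' K, F y = y := fun y hy => by
    by_cases h : y ∈ Set.range e
    · obtain ⟨x, rfl⟩ := h
      rw [h1, hfK x fun hx => hy ⟨x, hx, rfl⟩]
    · exact f.extendDomain_apply_not_subtype _ h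
  rw [continuous_iff_continuousAt]
  intro y
  by_cases h : y ∈ Set.range e
  · obtain ⟨x, rfl⟩ := h
    rw [← he.continuousAt_iff]
    have : F ∘ e = e ∘ f := funext h1
    rw [this]
    exact (he.continuous.comp hf).continuousAt
  · have ho : IsOpen (e '' K)ᶜ := (hK.image he.continuous).isClosed.isOpen_compl
    have hy : y ∈ (e '' K)ᶜ := fun ⟨x, _, hx⟩ => h ⟨x, hx⟩
    refine continuousAt_id.congr ?_
    filter_upwards [ho.mem_nhds hy] with z hz using (h2 z hz).symm

/-- A homeomorphism with compact support extends along an open embedding by the identity. -/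
theorem exists_homeomorph_extend {X M : Type*} [TopologicalSpace X] [TopologicalSpace M] [T2Space M]
    {e : X → M} (he : Topology.IsOpenEmbedding e) {K : Set X} (hK : IsCompact K)
    (f : X ≃ₜ X) (hfK : ∀ x ∉ K, f x = x) :
    ∃ F : M ≃ₜ M, (∀ x, F (e x) = e (f x)) ∧ ∀ y ∉ e '' K, F y = y := by
  classical
  have h1 : ∀ x, Equiv.Perm.extendDomain f.toEquiv (Equiv.ofInjective e he.injective) (e x) = e (f x) :=
    fun x => Equiv.Perm.extendDomain_apply_image f.toEquiv (Equiv.ofInjective e he.injective) x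
  refine ⟨{ toEquiv := Equiv.Perm.extendDomain f.toEquiv (Equiv.ofInjective e he.injective)
            continuous_toFun := continuous_extendDomain he hK f.toEquiv f.continuous hfK
            continuous_invFun := ?_ }, h1, fun y hy => ?_⟩
  · refine continuous_extendDomain he hK f.symm.toEquiv f.symm.continuous fun x hx => ?_
    exact f.injective ((f.apply_symm_apply x).trans (hfK x hx).symm)
  · by_cases h : y ∈ Set.range e
    · obtain ⟨x, rfl⟩ := h
      exact (h1 x).trans (congrArg e (hfK x fun hx => hy ⟨x, hx, rfl⟩))
    · exact Equiv.Perm.extendDomain_apply_not_subtype _ _ h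


/-! ### The pseudo-Anosov homeomorphism in Euclidean space and its transport -/

theorem exists_homeomorph_stdGenusTwoSurface :
    ∃ (f : EuclideanSpace ℝ (Fin 3) ≃ₜ EuclideanSpace ℝ (Fin 3))
      (ψ : stdGenusTwoSurface ≃ₜ stdGenusTwoSurface) (K : Set (EuclideanSpace ℝ (Fin 3))),
      (∀ x : stdGenusTwoSurface, (ψ x : EuclideanSpace ℝ (Fin 3)) = f x) ∧
      Foliation.IsAffinePseudoAnosov ψ ∧ IsCompact K ∧ stdGenusTwoSurface ⊆ K ∧
      ∀ x ∉ K, f x = x := by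
  obtain ⟨G, ψ, hG, hψ, hid⟩ := exists_homeomorph_surf
  obtain ⟨Θ, hΘ⟩ := exists_homeomorph_standard
  set e : surf ≃ₜ stdGenusTwoSurface := (Θ.image surf).trans (Homeomorph.setCongr hΘ) with he
  have hev : ∀ q, (e q : EuclideanSpace ℝ (Fin 3)) = Θ q := fun q => rfl
  have hcpt : IsCompact stdGenusTwoSurface := by
    have hb : IsCompact (coords ⁻¹' ((Set.Icc 0 5 ×ˢ Set.Icc 0 3) ×ˢ Set.Icc 0 1)) :=
      coords.isCompact_preimage.2 ((isCompact_Icc.prod isCompact_Icc).prod isCompact_Icc)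
    refine hb.of_isClosed_subset isClosed_frontier ?_
    refine frontier_subset_closure.trans (closure_minimal ?_ hb.isClosed)
    intro x hx
    exact ⟨⟨hx.1, hx.2.1⟩, hx.2.2.1⟩
  -- Enlarging the support by the compact surface gives the inclusion of the surface in `K` at no
  -- cost.
  refine ⟨(Θ.symm.trans G).trans Θ, (e.symm.trans ψ).trans e,
    Θ '' Metric.closedBall 0 400 ∪ stdGenusTwoSurface, fun x => ?_, hψ.conj e _ fun x => ?_,
    ((isCompact_closedBall _ _).image Θ.continuous).union hcpt, Set.subset_union_right,
    fun x hx => ?_⟩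
  · obtain ⟨q, rfl⟩ := e.surjective x
    change (e (ψ (e.symm (e q))) : EuclideanSpace ℝ (Fin 3)) = Θ (G (Θ.symm (e q)))
    rw [e.symm_apply_apply, hev, hev, Θ.symm_apply_apply, hG]
  · simp
  · have h1 : Θ.symm x ∉ Metric.closedBall 0 400 := fun h =>
      hx (Or.inl ⟨_, h, Θ.apply_symm_apply x⟩)
    change Θ (G (Θ.symm x)) = x
    rw [hid, Θ.apply_symm_apply]
    -- If `‖dbl p‖ ≤ 400`, then also `‖p‖ ≤ 400`, because `‖z‖² ≤ 400` bounds `‖z‖`.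
    by_contra hle
    rw [not_lt, dbl, Prod.norm_def, max_le_iff, norm_pow] at hle
    refine h1 ?_
    rw [mem_closedBall_zero_iff, Prod.norm_def, max_le_iff]
    exact ⟨hle.1, by nlinarith [hle.2]⟩

theorem exists_compressible_pseudoAnosov {M : Type*} [TopologicalSpace M] [T2Space M]
    {e : EuclideanSpace ℝ (Fin 3) → M} (he : Topology.IsOpenEmbedding e) :
    ∃ (f : M ≃ₜ M) (K : Set (EuclideanSpace ℝ (Fin 3))),
      IsGenusTwoSurface (e '' stdGenusTwoSurface) ∧
      IsCompressiblePseudoAnosovVia f (e '' stdGenusTwoSurface) ∧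
      IsCompact K ∧ stdGenusTwoSurface ⊆ K ∧ ∀ x ∉ e '' K, f x = x := by
  obtain ⟨f₀, ψ, K, hψ, hA, hK, hsub, hid⟩ := exists_homeomorph_stdGenusTwoSurface
  obtain ⟨f, hf, hfK⟩ := exists_homeomorph_extend he hK f₀ hid
  set j := he.isEmbedding.homeomorphImage stdGenusTwoSurface with hj
  have hjv : ∀ x, (j x : M) = e x := fun x => rfl
  have hψ' : ∀ x, (((j.symm.trans ψ).trans j) x : M) = f x := fun x => by
    obtain ⟨q, rfl⟩ := j.surjective x
    change (j (ψ (j.symm (j q))) : M) = f (j q)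
    rw [j.symm_apply_apply, hjv, hjv, hf, hψ]
  refine ⟨f, K, ⟨j.symm⟩, ⟨isTwoSided_image he isTwoSided_stdGenusTwoSurface,
    not_isPiOneInjective_image he.isEmbedding, ?_, (j.symm.trans ψ).trans j, hψ',
    (hA.conj j _ fun x => by simp).isPseudoAnosov⟩, hK, hsub, hfK⟩
  refine Set.Subset.antisymm ?_ fun y hy => ?_
  · rintro _ ⟨y, hy, rfl⟩
    rw [← hψ' ⟨y, hy⟩]
    exact Subtype.property _
  · obtain ⟨x, hx⟩ := ((j.symm.trans ψ).trans j).surjective ⟨y, hy⟩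
    exact ⟨x, x.2, by rw [← hψ', hx]⟩

/-! ### Embeddings of `ℝ³` in `S³` and in manifolds -/

/-- The inverse of the stereographic projection from the pole `(0, 0, 0, 1)`. -/
noncomputable def invStereo (u : EuclideanSpace ℝ (Fin 3)) : ThreeSphere :=
  ⟨!₂[2 * u 0 / (u 0 ^ 2 + u 1 ^ 2 + u 2 ^ 2 + 1), 2 * u 1 / (u 0 ^ 2 + u 1 ^ 2 + u 2 ^ 2 + 1),
    2 * u 2 / (u 0 ^ 2 + u 1 ^ 2 + u 2 ^ 2 + 1),
    (u 0 ^ 2 + u 1 ^ 2 + u 2 ^ 2 - 1) / (u 0 ^ 2 + u 1 ^ 2 + u 2 ^ 2 + 1)], by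
    have h : u 0 ^ 2 + u 1 ^ 2 + u 2 ^ 2 + 1 ≠ 0 := by positivity
    rw [mem_sphere_zero_iff_norm, EuclideanSpace.norm_eq, Real.sqrt_eq_one]
    simp only [Fin.sum_univ_four, Real.norm_eq_abs, sq_abs]
    simp
    field_simp
    ring⟩

theorem sq_sum_of_mem_sphere (p : ThreeSphere) :
    p.1 0 ^ 2 + p.1 1 ^ 2 + p.1 2 ^ 2 + p.1 3 ^ 2 = 1 := by
  have h := p.2
  rw [mem_sphere_zero_iff_norm, EuclideanSpace.norm_eq, Real.sqrt_eq_one] at h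
  simpa only [Fin.sum_univ_four, Real.norm_eq_abs, sq_abs] using h

/-- The inverse stereographic projection as a chart with domain the whole of `ℝ³`. -/
noncomputable def stereoChart : OpenPartialHomeomorph (EuclideanSpace ℝ (Fin 3)) ThreeSphere where
  toFun := invStereo
  invFun p := !₂[p.1 0 / (1 - p.1 3), p.1 1 / (1 - p.1 3), p.1 2 / (1 - p.1 3)]
  source := Set.univ
  target := {p | p.1 3 ≠ 1}
  map_source' u _ := by
    have h : u 0 ^ 2 + u 1 ^ 2 + u 2 ^ 2 + 1 ≠ 0 := by positivity
    simp only [invStereo, Set.mem_ofPred_eq]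
    simp
    rw [div_eq_iff h]
    intro h'
    linarith
  map_target' _ _ := Set.mem_univ _
  left_inv' u _ := by
    have h : u 0 ^ 2 + u 1 ^ 2 + u 2 ^ 2 + 1 ≠ 0 := by positivity
    have h1 : 1 - (u 0 ^ 2 + u 1 ^ 2 + u 2 ^ 2 - 1) / (u 0 ^ 2 + u 1 ^ 2 + u 2 ^ 2 + 1) =
        2 / (u 0 ^ 2 + u 1 ^ 2 + u 2 ^ 2 + 1) := by field_simp; ring
    ext i
    fin_cases i <;> simp [invStereo, h1] <;> field_simp
  right_inv' p hp := by
    have h : 1 - p.1 3 ≠ 0 := fun h => hp (by linarith)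
    have h1 := sq_sum_of_mem_sphere p
    have h2 : (p.1 0 / (1 - p.1 3)) ^ 2 + (p.1 1 / (1 - p.1 3)) ^ 2 + (p.1 2 / (1 - p.1 3)) ^ 2 =
        (1 + p.1 3) / (1 - p.1 3) := by
      field_simp
      linear_combination h1
    have h3 : (1 + p.1 3) / (1 - p.1 3) + 1 = 2 / (1 - p.1 3) := by field_simp; ring
    have h4 : (1 + p.1 3) / (1 - p.1 3) - 1 = 2 * p.1 3 / (1 - p.1 3) := by field_simp; ring
    apply Subtype.ext
    ext i
    fin_cases i <;> simp [invStereo, h2, h3, h4] <;> field_simp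
  open_source := isOpen_univ
  open_target := by
    have : Continuous fun p : ThreeSphere => p.1 3 := by fun_prop
    exact isOpen_ne_fun this continuous_const
  continuousOn_toFun := by
    refine Continuous.continuousOn (Continuous.subtype_mk ?_ _)
    refine (PiLp.continuous_toLp 2 _).comp (continuous_pi fun i => ?_)
    have h : ∀ u : EuclideanSpace ℝ (Fin 3), u 0 ^ 2 + u 1 ^ 2 + u 2 ^ 2 + 1 ≠ 0 :=
      fun u => by positivity
    fin_cases i <;> simp <;> refine Continuous.div (by fun_prop) (by fun_prop) h
  continuousOn_invFun := by
    refine (PiLp.continuous_toLp 2 _).comp_continuousOn (continuousOn_pi.2 fun i => ?_)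
    have h : ∀ p ∈ {p : ThreeSphere | p.1 3 ≠ 1}, 1 - p.1 3 ≠ 0 :=
      fun p hp h => hp (by linarith)
    fin_cases i <;> simp <;>
      refine ContinuousOn.div (Continuous.continuousOn (by fun_prop))
        (Continuous.continuousOn (by fun_prop)) h

theorem stereoChart_image : stereoChart '' stdGenusTwoSurface = stdGenusTwoHeegaardSurface := by
  ext p
  constructor
  · rintro ⟨u, hu, rfl⟩
    refine ⟨stereoChart.map_source (Set.mem_univ u), ?_⟩
    have := stereoChart.left_inv (Set.mem_univ u)
    change stereoChart.symm (stereoChart u) ∈ _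
    rwa [this]
  · rintro ⟨hp, hm⟩
    exact ⟨stereoChart.symm p, hm, stereoChart.right_inv hp⟩

/-- The inverse of a model with corners, on the interior of the model. -/
noncomputable def modelInterior {E H : Type*} [NormedAddCommGroup E] [NormedSpace ℝ E]
    [TopologicalSpace H] (I : ModelWithCorners ℝ E H) : OpenPartialHomeomorph E H where
  toFun := I.symm
  invFun := I
  source := interior (Set.range I)
  target := I ⁻¹' interior (Set.range I)
  map_source' x hx := by rwa [Set.mem_preimage, I.right_inv (interior_subset hx)]
  map_target' _ hx := hx
  left_inv' _ hx := I.right_inv (interior_subset hx)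
  right_inv' x _ := I.left_inv x
  open_source := isOpen_interior
  open_target := isOpen_interior.preimage I.continuous
  continuousOn_toFun := I.continuous_symm.continuousOn
  continuousOn_invFun := I.continuous.continuousOn

/-- A non-empty manifold, possibly with boundary, contains an open Euclidean space. -/
theorem exists_isOpenEmbedding {E H : Type*} [NormedAddCommGroup E] [InnerProductSpace ℝ E]
    [TopologicalSpace H] (I : ModelWithCorners ℝ E H) (M : Type*) [TopologicalSpace M]
    [ChartedSpace H M] [Nonempty M] : ∃ e : E → M, Topology.IsOpenEmbedding e := by
  obtain ⟨x⟩ := ‹Nonempty M›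
  set φ := chartAt H x with hφ
  have hV : IsOpen (I.symm ⁻¹' φ.target) := φ.open_target.preimage I.continuous_symm
  have hx : I (φ x) ∈ I.symm ⁻¹' φ.target := by
    rw [Set.mem_preimage, I.left_inv]
    exact φ.map_source (mem_chart_source H x)
  -- Boundary points of the model are limits of interior ones, so every chart contains an interior
  -- point, and around it a whole ball of `E`.
  obtain ⟨z, hzV, hzI⟩ := mem_closure_iff.1
    (I.range_subset_closure_interior (Set.mem_range_self (φ x))) _ hV hx
  obtain ⟨r, hr, hball⟩ := Metric.isOpen_iff.1 (hV.inter isOpen_interior) z ⟨hzV, hzI⟩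
  set b := OpenPartialHomeomorph.univBall z r with hb
  refine ⟨_, (b.trans ((modelInterior I).trans φ.symm)).isOpenEmbedding ?_⟩
  refine Set.eq_univ_of_forall fun y => ?_
  have hy : b y ∈ Metric.ball z r := by
    rw [← OpenPartialHomeomorph.univBall_target z hr]
    exact b.map_source (by rw [hb, OpenPartialHomeomorph.univBall_source]; trivial)
  rw [OpenPartialHomeomorph.trans_source, OpenPartialHomeomorph.trans_source,
    OpenPartialHomeomorph.univBall_source]
  exact ⟨trivial, (hball hy).2, (hball hy).1⟩

end GenusTwo

/-! ### The main theorem -/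

theorem mainTheorem6 :
    (∃ f : ThreeSphere ≃ₜ ThreeSphere,
      IsGenusTwoSurface stdGenusTwoHeegaardSurface ∧
      IsCompressiblePseudoAnosovVia f stdGenusTwoHeegaardSurface ∧
      ∃ (c : ThreeSphere) (r : ℝ), 0 < r ∧
        Disjoint (Metric.closedBall c r) stdGenusTwoHeegaardSurface ∧
        Set.EqOn f id (Metric.closedBall c r)) ∧
    (∀ (H : Type*) [TopologicalSpace H] (_I : ModelWithCorners ℝ (EuclideanSpace ℝ (Fin 3)) H)
      (M : Type*) [TopologicalSpace M] [ChartedSpace H M] [T2Space M] [Nonempty M],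
      ∃ (Sg : Set M) (f : M ≃ₜ M),
        IsGenusTwoSurface Sg ∧ IsCompressiblePseudoAnosovVia f Sg) := by
  constructor
  · have he : Topology.IsOpenEmbedding GenusTwo.stereoChart := GenusTwo.stereoChart.isOpenEmbedding rfl
    obtain ⟨f, K, hg, hc, hK, hsub, hid⟩ := GenusTwo.exists_compressible_pseudoAnosov he
    rw [GenusTwo.stereoChart_image] at hg hc
    have ho : IsOpen (GenusTwo.stereoChart '' K)ᶜ := (hK.image he.continuous).isClosed.isOpen_compl
    -- The pole of the projection is the one point missed by the chart, so it lies outside the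
    -- compact support, and so does a small ball around it.
    set c : ThreeSphere := ⟨EuclideanSpace.single 3 1, by simp⟩ with hcdef
    have hcK : c ∈ (GenusTwo.stereoChart '' K)ᶜ := by
      rintro ⟨u, -, hu⟩
      have h : (GenusTwo.stereoChart u).1 3 ≠ 1 := GenusTwo.stereoChart.map_source (Set.mem_univ u)
      rw [hu] at h
      simp [hcdef] at h
    obtain ⟨r, hr, hball⟩ := Metric.nhds_basis_closedBall.mem_iff.1 (ho.mem_nhds hcK)
    refine ⟨f, hg, hc, c, r, hr, ?_, fun x hx => hid x (hball hx)⟩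
    rw [← GenusTwo.stereoChart_image]
    exact Set.disjoint_left.2 fun x hx hx' => hball hx (Set.image_mono hsub hx')
  · intro H _ I M _ _ _ _
    obtain ⟨e, he⟩ := GenusTwo.exists_isOpenEmbedding I M
    obtain ⟨f, K, hg, hc, -⟩ := GenusTwo.exists_compressible_pseudoAnosov he
    exact ⟨_, f, hg, hc⟩
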